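/- **Parameters.** Let $N\ge 1$ be an integer, $k=2N$, and let $b\in\mathbb C$ with $|b|=1$, $\mathrm{Re}\,b>0$, $\mathrm{Im}\,b>0$. Put $h=\frac{2\pi i}{k}(1+b^2)$, $\tilde h=\frac{2\pi i}{k}(1+b^{-2})$, $q=e^{h/2}$, $\mathbf q=q^2=e^{h}$, $\tilde q=e^{\tilde h/2}$, $\tilde{\mathbf q}=\tilde q^2=e^{\tilde h}$, $[n]=\frac{\mathbf q^n-\mathbf q^{-n}}{\mathbf q-\mathbf q^{-1}}$, $[n]!=[1]\cdots[n]$, and analogously in the tilded sector. The square root $\sqrt{[n]}$ is the branch that is analytic in $h$ on $\mathrm{Re}\,h<0$ and tends to the positive root of $n$ as $h\to0$; in the tilded sector its complex conjugate is used. **Quantum groups.** $\mathscr U_{\mathbf q}(sl_2)$ is generated by $E,F,K^{\pm1}$ with $KE=\mathbf q^2EK$, $KF=\mathbf q^{-2}FK$, $EF-FE=\frac{K-K^{-1}}{\mathbf q-\mathbf q^{-1}}$, and $\Delta E=E\otimes K+1\otimes E$, $\Delta F=F\otimes1+K^{-1}\otimes F$, $\Delta K=K\otimes K$, $S(E)=-EK^{-1}$,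 $S(F)=-KF$, $S(K)=K^{-1}$, $\varepsilon(E)=\varepsilon(F)=0$, $\varepsilon(K)=1$; $\mathscr U_{\tilde{\mathbf q}}(sl_2)$ is defined in the same way, with tildes. It is embedded in the algebra with generators $\mathcal K^{\pm1},\mathcal X,\mathcal Y$ and coproduct $\Delta\mathcal K=\mathcal K\otimes\mathcal K$, $\Delta\mathcal X=\mathcal X\otimes\mathcal K+\mathcal K^{-1}\otimes\mathcal X$, $\Delta\mathcal Y=\mathcal Y\otimes\mathcal K+\mathcal K^{-1}\otimes\mathcal Y$ by $E=\mathcal X\mathcal K$, $F=\mathcal K^{-1}\mathcal Y$, $K=\mathcal K^2$, and in the tilded sector by $\tilde E=\tilde{\mathcal K}\tilde{\mathcal X}$, $\tilde F=\tilde{\mathcal Y}\tilde{\mathcal K}^{-1}$, $\tilde K=\tilde{\mathcal K}^2$. For $I\in\frac12\mathbb Z_{\ge0}$, the representation $\rho^I$ on $V^I=\mathrm{span}\{e_m\}_{m=I,I-1,\dots,-I}$ is $\mathcal Ke_m=\mathbf q^me_m$, $\mathcal Xe_m=\sqrt{[I-m]}\sqrt{[I+m+1]}\,e_{m+1}$,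 $\mathcal Ye_m=\sqrt{[I+m]}\sqrt{[I-m+1]}\,e_{m-1}$, and the representation $\tilde\rho^I$ on $V^I$ is $\tilde{\mathcal K}e_m=\tilde{\mathbf q}^{-m}e_m$, $\tilde{\mathcal X}e_m=\sqrt{[I+m]}\sqrt{[I-m+1]}\,e_{m-1}$, $\tilde{\mathcal Y}e_m=\sqrt{[I-m]}\sqrt{[I+m+1]}\,e_{m+1}$ (with tilded quantum integers). With $\mathcal K=\mathbf q^{H/2}$, $$R=\mathbf q^{\frac12H\otimes H}\sum_{n\ge0}\frac{\mathbf q^{n(n-1)/2}}{[n]!}(1-\mathbf q^{-2})^n\,(\mathcal K\mathcal X)^n\otimes(\mathcal K^{-1}\mathcal Y)^n ,$$ $R'$ is $R$ with the tensor factors exchanged, and $\tilde R,\tilde R'$ are given by the same formulas with tildes. For any representation $\pi$, $(\rho^I\otimes\pi)(R)$ and $(\rho^I\otimes\pi)(R')$ are finite sums, in which $\mathbf q^{\frac12H\otimes H}$ acts on $e_m\otimes\,\cdot\,$ as $\pi(\mathcal K)^{2m}$ (resp. $\pi(\tilde{\mathcal K})^{-2m}$ in the tilded sector). $R^{IJ}=(\rho^I\otimes\rho^J)(R)$.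 **Graph algebra.** For $m\geq1$, $\mathcal L_{0,m}$ is the complex unital algebra generated by the matrix elements of $\mathbf M_\nu^I\in\mathrm{End}(V^I)\otimes\mathcal L_{0,m}$, $\nu=1,\dots,m$, $I\in\frac12\mathbb Z_{\ge0}$, subject to $\mathbf M^0_\nu=1$ and $$(R^{-1})^{IJ}\overset1{\mathbf M}{}_\nu^IR^{IJ}\overset2{\mathbf M}{}_\nu^J=\sum_K(C_1^{IJ})_K\,\mathbf M_\nu^K\,(C_2^{IJ})^K,\qquad (R^{-1})^{IJ}\overset1{\mathbf M}{}_\nu^IR^{IJ}\overset2{\mathbf M}{}_\mu^J=\overset2{\mathbf M}{}_\mu^J(R^{-1})^{IJ}\overset1{\mathbf M}{}_\nu^IR^{IJ}\quad(\nu<\mu),$$ where $K=|I-J|,\dots,I+J$, and the Clebsch–Gordan maps $(C_1^{IJ})_K:V^K\to V^I\otimes V^J$, $(C_2^{IJ})^K:V^I\otimes V^J\to V^K$ are intertwiners with $(C_2)^K(C_1)_{K'}=\delta^K_{K'}$ and $\sum_K(C_1)_K(C_2)^K=1$. The algebra $\tilde{\mathcal L}_{0,m}$ is defined in the same way, with tildes.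 The extended graph algebra $(\mathcal L_{0,m}\rtimes\mathscr U_{\mathbf q}(sl_2))\otimes(\tilde{\mathcal L}_{0,m}\rtimes\mathscr U_{\tilde{\mathbf q}}(sl_2))$ is the semidirect (smash) product with the rules $\xi\,\mathbf M_\nu^I=\sum\xi^{(1)}(\mathbf M_\nu^I)\,\xi^{(2)}$, where $\xi(\mathbf M_\nu^I)=\sum\rho^I(S(\xi^{(1)}))\,\mathbf M_\nu^I\,\rho^I(\xi^{(2)})$, and likewise with tildes. The $*$-structure is antilinear, antimultiplicative and involutive, exchanges the two sectors, and is given by $\big((\mathbf M_\nu^I)^i{}_j\big)^*=\big((\tilde{\mathbf M}_\nu^I)^{-1}\big)^j{}_i$, $\big((\tilde{\mathbf M}_\nu^I)^i{}_j\big)^*=\big((\mathbf M_\nu^I)^{-1}\big)^j{}_i$, $E^*=\tilde E$, $F^*=\tilde F$, $K^*=\tilde K$. **Hilbert space.** Let $\mathcal H_0=L^2(\mathbb R)\otimes\mathbb C^k$, consisting of functions $f(\mu,s)$ with $s\in\mathbb Z/k$, and let $\mathcal H\simeq L^2(\mathbb R)\otimes\mathbb C^N$ be the subspace of the functions that vanish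 unless $s$ is even. On $\mathcal H_0$, $\mathbf xf(\mu,s)=f(\mu+ib,s-1)$, $\mathbf yf(\mu,s)=e^{\frac{2\pi i}{k}(-ib\mu-s)}f(\mu,s)$, $\tilde{\mathbf x}f(\mu,s)=f(\mu+ib^{-1},s+1)$, $\tilde{\mathbf y}f(\mu,s)=e^{\frac{2\pi i}{k}(-ib^{-1}\mu+s)}f(\mu,s)$. Let $\overline{\mathfrak D}_{0,m}\subset\mathcal H_0^{\otimes m}$ be the space of the functions $f(\mu,s)$, $\mu\in\mathbb R^m$, $s\in(\mathbb Z/k)^m$, that are entire in $\mu$ for each $s$ and for which $\|e^{\alpha\cdot\mu}f(\mu+i\eta,s)\|_{L^2(\mathbb R^m)}$ is finite and locally bounded in $\eta\in\mathbb R^m$, for each $\alpha\in\mathbb R^m$ and $s$. All Laurent monomials of $\mathbf x,\mathbf y,\tilde{\mathbf x},\tilde{\mathbf y}$ in all the tensor factors act on it. Let $\overline{\mathfrak D}_m=\overline{\mathfrak D}_{0,m}\cap\mathcal H^{\otimes m}$. With $\mathbf x_{\alpha,\beta}=q^{-\alpha\beta}\mathbf x^\alpha\mathbf y^\beta$ and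 $\lambda\in\mathbb C^\times$, define $\pi^\lambda$ by $$\mathcal K_\lambda=\mathbf x_{-1,0},\qquad\mathcal X_\lambda=\frac{-i}{\mathbf q-\mathbf q^{-1}}\big[(\lambda+\lambda^{-1})\mathbf x_{1,-1}+\mathbf x_{3,-1}+\mathbf x_{-1,-1}\big],\qquad\mathcal Y_\lambda=\frac{-i}{\mathbf q-\mathbf q^{-1}}\mathbf x_{-1,1},$$ and by the same formulas with tildes and with $\bar\lambda$ in place of $\lambda$. **Claims.** A $*$-representation on $\overline{\mathfrak D}_{0,m}$ is a homomorphism $\mathcal D$ of a $*$-algebra into the linear operators on $\overline{\mathfrak D}_{0,m}$ with $\langle \mathcal D(a)f,g\rangle=\langle f,\mathcal D(a^*)g\rangle$ for all $f,g\in\overline{\mathfrak D}_{0,m}$. The $*$-structures above exist, and: 1. For every $\lambda\in\mathbb C^\times$, $\mathcal D^\lambda(\mathbf M^I)=(\rho^I\otimes\pi^\lambda)(R'R)$, $\mathcal D^\lambda(\tilde{\mathbf M}^I)=(\tilde\rho^I\otimes\pi^\lambda)(\tilde R'\tilde R)$ defines a $*$-representation of $\mathcal L_{0,1}\otimes\tilde{\mathcal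 L}_{0,1}$ on $\overline{\mathfrak D}_{0,1}$ that leaves $\overline{\mathfrak D}_{1}$ invariant. 2. For every $m\ge1$ and $\vec\lambda=(\lambda_1,\dots,\lambda_m)\in(\mathbb C^\times)^m$, let $\iota_\nu=(\pi^{\lambda_1}\otimes\cdots\otimes\pi^{\lambda_{\nu-1}})\circ\Delta^{(\nu-1)}$ ($\iota_1=\varepsilon$), acting on the first $\nu-1$ factors. The space $\overline{\mathfrak D}_m$ is dense in $\mathcal H^{\otimes m}$, and $$\mathcal D^{\vec\lambda}(\mathbf M_\nu^J)=(\rho^J\otimes\iota_\nu)(R')\;\mathcal D_\nu^{\lambda_\nu}(\mathbf M^J)\;(\rho^J\otimes\iota_\nu)(R'^{-1}),$$ where $\mathcal D_\nu^{\lambda_\nu}(\mathbf M^J)$ is $\mathcal D^{\lambda_\nu}(\mathbf M^J)$ acting on the $\nu$-th factor, together with its tilded counterpart, defines a $*$-representation of $\mathcal L_{0,m}\otimes\tilde{\mathcal L}_{0,m}$ on $\overline{\mathfrak D}_{0,m}$ that leaves $\overline{\mathfrak D}_m$ invariant. 3. Together with $\mathcal D^{\vec\lambda}(\xi)=(\pi^{\lambda_1}\otimes\cdots\otimes\pi^{\lambda_m})(\Delta^{(m)}\xi)$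 for $\xi\in\mathscr U_{\mathbf q}(sl_2)\otimes\mathscr U_{\tilde{\mathbf q}}(sl_2)$, it extends to a $*$-representation of the extended graph algebra $(\mathcal L_{0,m}\rtimes\mathscr U_{\mathbf q}(sl_2))\otimes(\tilde{\mathcal L}_{0,m}\rtimes\mathscr U_{\tilde{\mathbf q}}(sl_2))$ on $\overline{\mathfrak D}_{0,m}$ that leaves $\overline{\mathfrak D}_m$ invariant. 4. Let $\Psi$ be a linear functional on a subspace $W$ of $\overline{\mathfrak D}_{0,m}$ that is invariant under the representation in 3 (for instance $W=\overline{\mathfrak D}_m$). If $\Psi$ is gauge invariant, that is, $\Psi[\mathcal D^{\vec\lambda}(\xi)f]=\varepsilon(\xi)\Psi[f]$ for all $\xi\in\mathscr U_{\mathbf q}(sl_2)\otimes\mathscr U_{\tilde{\mathbf q}}(sl_2)$ and $f\in W$, then it satisfies the quantum flatness constraint: with $\mathbf M_0^I=\mathbf M_m^I\mathbf M_{m-1}^I\cdots\mathbf M_1^I$, $$\Psi\big[\mathcal D^{\vec\lambda}\big((\mathbf M_0^I)^i{}_j\big)f\big]=\delta^i_j\,\Psi[f]=\Psi\big[\mathcal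 D^{\vec\lambda}\big((\tilde{\mathbf M}_0^I)^i{}_j\big)f\big]\qquad\text{for all }I,i,j\text{ and }f\in W.$$ -/

import Mathlib

open scoped TensorProduct Kronecker ComplexConjugate NNReal ENNReal

noncomputable section

namespace QLorentz

/-! ### Parameters -/

/-- The level `k = 2N` and the parameter `b` on the open arc of the unit circle. -/
structure Level where
  N : ℕ
  b : ℂ
  N_pos : 0 < N
  norm_b : ‖b‖ = 1
  re_pos : 0 < b.re
  im_pos : 0 < b.im

/-- The holomorphic (untilded) and the anti-holomorphic (tilded) sector. -/
inductive Sector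
  | holo
  | anti

/-- The other sector. -/
def Sector.swap : Sector → Sector
  | .holo => .anti
  | .anti => .holo

/-- `+1` for the untilded and `-1` for the tilded sector. -/
def Sector.sgn : Sector → ℤ
  | .holo => 1
  | .anti => -1

namespace Level

/-- The level `k = 2N`. -/
def k (p : Level) : ℕ := 2 * p.N

instance (p : Level) : NeZero p.k := ⟨by have := p.N_pos; unfold k; omega⟩

/-- `b` in the untilded sector, `b⁻¹` in the tilded sector. -/
def bPar (p : Level) : Sector → ℂ
  | .holo => p.b
  | .anti => p.b⁻¹

/-- `h = (2πi/k)(1+b²)`, resp. `h̃ = (2πi/k)(1+b⁻²)`. -/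
def h (p : Level) (σ : Sector) : ℂ :=
  2 * Real.pi * Complex.I / p.k * (1 + p.bPar σ ^ 2)

/-- The square root `q = e^{h/2}` of the deformation parameter, resp. `q̃ = e^{h̃/2}`. -/
def q (p : Level) (σ : Sector) : ℂ := Complex.exp (p.h σ / 2)

/-- The deformation parameter `𝐪 = e^h = q²`, resp. `𝐪̃ = e^{h̃}`. -/
def Q (p : Level) (σ : Sector) : ℂ := Complex.exp (p.h σ)

/-- The quantum integer `[n]_𝐪`. -/
def qNum (p : Level) (σ : Sector) (n : ℕ) : ℂ :=
  (p.Q σ ^ n - (p.Q σ)⁻¹ ^ n) / (p.Q σ - (p.Q σ)⁻¹)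

/-- The quantum factorial `[n]_𝐪!`. -/
def qFac (p : Level) (σ : Sector) (n : ℕ) : ℂ :=
  ∏ i ∈ Finset.range n, p.qNum σ (i + 1)

/-- The square root of `[n]_𝐪`, as a power series in `h`: the branch, analytic on `Re h < 0`,
that tends to the positive square root of `n` as `h → 0`.
The power series is even in `h` and has real
coefficients, and `h̃ = - conj h`, so that its value in the tilded sector is the conjugate. -/
def sqrtQNum (p : Level) (σ : Sector) (n : ℕ) : ℂ :=
  let r : ℂ := Complex.exp (-((n : ℂ) - 1) * p.h .holo / 2) *
    (1 - Complex.exp (2 * n * p.h .holo)) ^ (1 / 2 : ℂ) /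
      (1 - Complex.exp (2 * p.h .holo)) ^ (1 / 2 : ℂ)
  match σ with
  | .holo => r
  | .anti => conj r

end Level

/-! ### Images of the generators `𝒦, 𝒦⁻¹, 𝒳, 𝒴` -/

/-- The images of the generators `𝒦, 𝒦⁻¹, 𝒳, 𝒴` of one sector of `U_𝐪(sl₂) ⊗ U_𝐪̃(sl₂)`
under an algebra homomorphism into `A`. -/
structure GenImages (A : Type) where
  K : A
  Kinv : A
  X : A
  Y : A

namespace GenImages

variable {A : Type} [Ring A]

/-- The images under the counit. -/
def counit : GenImages A := ⟨1, 1, 0, 0⟩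

/-- The images under `(φ ⊗ ψ) ∘ Δ`, where `S`, `T` are the images under `φ`, `ψ`, and the
ranges of `φ` and `ψ` are commuting subalgebras of `A`:
`Δ𝒦 = 𝒦 ⊗ 𝒦`, `Δ𝒳 = 𝒳 ⊗ 𝒦 + 𝒦⁻¹ ⊗ 𝒳`, `Δ𝒴 = 𝒴 ⊗ 𝒦 + 𝒦⁻¹ ⊗ 𝒴`. -/
def comul (S T : GenImages A) : GenImages A where
  K := S.K * T.K
  Kinv := S.Kinv * T.Kinv
  X := S.X * T.K + S.Kinv * T.X
  Y := S.Y * T.K + S.Kinv * T.Y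

/-- The image of `𝒦ⁿ` for an integer `n`. -/
def kpow (T : GenImages A) (n : ℤ) : A :=
  if 0 ≤ n then T.K ^ n.toNat else T.Kinv ^ (-n).toNat

end GenImages

/-- The generators `E, F, K, K⁻¹` of the quantum group of one sector. -/
inductive UGen
  | E
  | F
  | K
  | Kinv

/-- The images of the generators `E, F, K, K⁻¹`, through the embedding
`E = 𝒳𝒦`, `F = 𝒦⁻¹𝒴`, `K = 𝒦²` and `Ẽ = 𝒦̃𝒳̃`, `F̃ = 𝒴̃𝒦̃⁻¹`, `K̃ = 𝒦̃²`. -/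
def GenImages.u {A : Type} [Ring A] (T : GenImages A) : Sector → UGen → A
  | .holo, .E => T.X * T.K
  | .holo, .F => T.Kinv * T.Y
  | .anti, .E => T.K * T.X
  | .anti, .F => T.Y * T.Kinv
  | _, .K => T.K * T.K
  | _, .Kinv => T.Kinv * T.Kinv

/-! ### Finite-dimensional representations

The spin `I` is encoded by `d = 2I`; the basis vector `e_m` of `V^I` has the index `I - m`. -/

/-- The matrix with `e_m ↦ √([I-m][I+m+1]) e_{m+1}`. -/
def raise (p : Level) (σ : Sector) (d : ℕ) : Matrix (Fin (d + 1)) (Fin (d + 1)) ℂ :=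
  Matrix.of fun i j =>
    if i.val + 1 = j.val then p.sqrtQNum σ j * p.sqrtQNum σ (d + 1 - j) else 0

/-- The matrix with `e_m ↦ √([I+m][I-m+1]) e_{m-1}`. -/
def lower (p : Level) (σ : Sector) (d : ℕ) : Matrix (Fin (d + 1)) (Fin (d + 1)) ℂ :=
  Matrix.of fun i j =>
    if i.val = j.val + 1 then p.sqrtQNum σ (d - j) * p.sqrtQNum σ (j + 1) else 0

/-- `2m` for the basis vector with index `i`. -/
def wt (d : ℕ) (i : Fin (d + 1)) : ℤ := (d : ℤ) - 2 * (i.val : ℤ)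

/-- The spin-`d/2` representations `ρ^{d/2}` and `ρ̃^{d/2}`: `𝒦 e_m = 𝐪^m e_m`, `𝒳` raises and
`𝒴` lowers, whereas `𝒦̃ e_m = 𝐪̃^{-m} e_m`, `𝒳̃` lowers and `𝒴̃` raises. -/
def rho (p : Level) (σ : Sector) (d : ℕ) :
    GenImages (Matrix (Fin (d + 1)) (Fin (d + 1)) ℂ) where
  K := Matrix.diagonal fun i => p.q σ ^ (σ.sgn * wt d i)
  Kinv := Matrix.diagonal fun i => p.q σ ^ (-(σ.sgn * wt d i))
  X := match σ with
    | .holo => raise p σ d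
    | .anti => lower p σ d
  Y := match σ with
    | .holo => lower p σ d
    | .anti => raise p σ d

/-- `(ρ^{d/2} ⊗ ρ^{e/2}) ∘ Δ`. -/
def rhoTensor (p : Level) (σ : Sector) (d e : ℕ) :
    GenImages (Matrix (Fin (d + 1) × Fin (e + 1)) (Fin (d + 1) × Fin (e + 1)) ℂ) :=
  let S := rho p σ d
  let T := rho p σ e
  GenImages.comul
    ⟨S.K ⊗ₖ 1, S.Kinv ⊗ₖ 1, S.X ⊗ₖ 1, S.Y ⊗ₖ 1⟩
    ⟨1 ⊗ₖ T.K, 1 ⊗ₖ T.Kinv, 1 ⊗ₖ T.X, 1 ⊗ₖ T.Y⟩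

/-- Clebsch–Gordan maps for `V^I ⊗ V^J`, with `I = d/2` and `J = e/2`. The index `t` stands for the
spin `K = I + J - t`, so that `K` runs through `|I-J|, …, I+J`. -/
structure CGMaps (p : Level) (σ : Sector) (d e : ℕ) where
  C1 : ∀ t : Fin (min d e + 1),
    Matrix (Fin (d + 1) × Fin (e + 1)) (Fin (d + e - 2 * t + 1)) ℂ
  C2 : ∀ t : Fin (min d e + 1),
    Matrix (Fin (d + e - 2 * t + 1)) (Fin (d + 1) × Fin (e + 1)) ℂ
  C2_C1 : ∀ t, C2 t * C1 t = 1
  C2_C1_ne : ∀ t t', t ≠ t' → C2 t * C1 t' = 0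
  C1_C2 : ∑ t, C1 t * C2 t = 1
  C1_K : ∀ t, C1 t * (rho p σ (d + e - 2 * t)).K = (rhoTensor p σ d e).K * C1 t
  C1_X : ∀ t, C1 t * (rho p σ (d + e - 2 * t)).X = (rhoTensor p σ d e).X * C1 t
  C1_Y : ∀ t, C1 t * (rho p σ (d + e - 2 * t)).Y = (rhoTensor p σ d e).Y * C1 t

/-! ### R-matrices -/

/-- The coefficient of `(𝐪^{H/2}𝒳 ⊗ 𝐪^{-H/2}𝒴)ⁿ` in `ℰ_𝐪`. -/
def expCoef (p : Level) (σ : Sector) (n : ℕ) : ℂ :=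
  p.Q σ ^ (n * (n - 1) / 2) / p.qFac σ n * (1 - (p.Q σ)⁻¹ ^ 2) ^ n

section RMatrix

variable {A : Type} [Ring A] [Algebra ℂ A]

/-- `(ρ ⊗ φ)(𝐪^{(H⊗H)/2})`, with `φ` given by `T`: on `e_m` it is `𝒦^{2m}`, resp. `𝒦̃^{-2m}`. -/
def cartan (σ : Sector) (d : ℕ) (T : GenImages A) : Matrix (Fin (d + 1)) (Fin (d + 1)) A :=
  Matrix.diagonal fun i => T.kpow (σ.sgn * wt d i)

/-- `(ρ^{d/2} ⊗ φ)(R)` for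
`R = 𝐪^{(H⊗H)/2} ℰ_𝐪((1-𝐪⁻²) 𝐪^{H/2}𝒳 ⊗ 𝐪^{-H/2}𝒴)`, with `φ` given by `T`. -/
def RMat (p : Level) (σ : Sector) (d : ℕ) (T : GenImages A) :
    Matrix (Fin (d + 1)) (Fin (d + 1)) A :=
  cartan σ d T * ∑ n ∈ Finset.range (d + 2), Matrix.of fun i j =>
    (expCoef p σ n * (((rho p σ d).K * (rho p σ d).X) ^ n) i j) • (T.Kinv * T.Y) ^ n

/-- `(ρ^{d/2} ⊗ φ)(R')`, where `R'` is `R` with the two tensor factors exchanged. -/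
def RMat' (p : Level) (σ : Sector) (d : ℕ) (T : GenImages A) :
    Matrix (Fin (d + 1)) (Fin (d + 1)) A :=
  cartan σ d T * ∑ n ∈ Finset.range (d + 2), Matrix.of fun i j =>
    (expCoef p σ n * (((rho p σ d).Kinv * (rho p σ d).Y) ^ n) i j) • (T.K * T.X) ^ n

end RMatrix

/-- `R^{IJ} = (ρ^I ⊗ ρ^J)(R)`, with `I = d/2` and `J = e/2`. -/
def RFin (p : Level) (σ : Sector) (d e : ℕ) :
    Matrix (Fin (d + 1) × Fin (e + 1)) (Fin (d + 1) × Fin (e + 1)) ℂ :=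
  Matrix.of fun a c => RMat p σ d (rho p σ e) a.1 c.1 a.2 c.2

/-! ### The graph algebra, the quantum group and the extended graph algebra -/

/-- A complex matrix as a matrix over a complex algebra. -/
def cmat (A : Type) [Ring A] [Algebra ℂ A] {m n : Type} (M : Matrix m n ℂ) : Matrix m n A :=
  M.map (algebraMap ℂ A)

section Relations

variable {A : Type} [Ring A] [Algebra ℂ A]

/-- `(R⁻¹)^{IJ} M₁ R^{IJ} M₂`. -/
def loopProd (p : Level) (σ : Sector) (d e : ℕ)
    (M : Matrix (Fin (d + 1)) (Fin (d + 1)) A) (M' : Matrix (Fin (e + 1)) (Fin (e + 1)) A) :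
    Matrix (Fin (d + 1) × Fin (e + 1)) (Fin (d + 1) × Fin (e + 1)) A :=
  cmat A (RFin p σ d e)⁻¹ * (M ⊗ₖ 1) * cmat A (RFin p σ d e) * (1 ⊗ₖ M')

/-- `M₂ (R⁻¹)^{IJ} M₁ R^{IJ}`. -/
def loopProdExch (p : Level) (σ : Sector) (d e : ℕ)
    (M : Matrix (Fin (d + 1)) (Fin (d + 1)) A) (M' : Matrix (Fin (e + 1)) (Fin (e + 1)) A) :
    Matrix (Fin (d + 1) × Fin (e + 1)) (Fin (d + 1) × Fin (e + 1)) A :=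
  (1 ⊗ₖ M') * cmat A (RFin p σ d e)⁻¹ * (M ⊗ₖ 1) * cmat A (RFin p σ d e)

/-- `∑_K (C₁)_K M^K (C₂)^K`. -/
def cgSum {p : Level} {σ : Sector} {d e : ℕ} (C : CGMaps p σ d e)
    (M : ∀ d : ℕ, Matrix (Fin (d + 1)) (Fin (d + 1)) A) :
    Matrix (Fin (d + 1) × Fin (e + 1)) (Fin (d + 1) × Fin (e + 1)) A :=
  ∑ t, cmat A (C.C1 t) * M (d + e - 2 * t) * cmat A (C.C2 t)

/-- The defining relations of (one sector of) the graph algebra of the `m`-holed sphere, for the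
holonomy matrices `M_ν^{d/2}`. The right-hand side of `product` does not depend on the choice of
the Clebsch–Gordan maps, which are unique up to a scalar for each `K`. -/
inductive GraphRel (p : Level) (σ : Sector) {m : ℕ}
    (M : Fin m → ∀ d : ℕ, Matrix (Fin (d + 1)) (Fin (d + 1)) A) : A → A → Prop
  | one (ν : Fin m) (i j : Fin (0 + 1)) :
      GraphRel p σ M (M ν 0 i j) ((1 : Matrix (Fin (0 + 1)) (Fin (0 + 1)) A) i j)
  | product (ν : Fin m) (d e : ℕ) (C : CGMaps p σ d e) (a c : Fin (d + 1) × Fin (e + 1)) :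
      GraphRel p σ M (loopProd p σ d e (M ν d) (M ν e) a c) (cgSum C (M ν) a c)
  | exchange (ν μ : Fin m) (hνμ : ν < μ) (d e : ℕ) (a c : Fin (d + 1) × Fin (e + 1)) :
      GraphRel p σ M (loopProd p σ d e (M ν d) (M μ e) a c)
        (loopProdExch p σ d e (M ν d) (M μ e) a c)

/-- The defining relations of (one sector of) the quantum group. -/
inductive URel (p : Level) (σ : Sector) (g : UGen → A) : A → A → Prop
  | K_Kinv : URel p σ g (g .K * g .Kinv) 1
  | Kinv_K : URel p σ g (g .Kinv * g .K) 1
  | K_E : URel p σ g (g .K * g .E) (p.Q σ ^ 2 • (g .E * g .K))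
  | K_F : URel p σ g (g .K * g .F) ((p.Q σ)⁻¹ ^ 2 • (g .F * g .K))
  | E_F : URel p σ g (g .E * g .F - g .F * g .E)
      ((p.Q σ - (p.Q σ)⁻¹)⁻¹ • (g .K - g .Kinv))

/-- The gauge transformation `ξ(M^I) = ∑ ρ^I(S(ξ⁽¹⁾)) M^I ρ^I(ξ⁽²⁾)` of a holonomy matrix by a
generator `ξ`, where `ΔE = E ⊗ K + 1 ⊗ E`, `ΔF = F ⊗ 1 + K⁻¹ ⊗ F`, `ΔK = K ⊗ K`,
`S(E) = -EK⁻¹`, `S(F) = -KF` and `S(K) = K⁻¹`. -/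
def gaugeAct (p : Level) (σ : Sector) (d : ℕ)
    (M : Matrix (Fin (d + 1)) (Fin (d + 1)) A) : UGen → Matrix (Fin (d + 1)) (Fin (d + 1)) A :=
  let r := (rho p σ d).u σ
  fun
  | .E => cmat A (-(r .E * r .Kinv)) * M * cmat A (r .K) + M * cmat A (r .E)
  | .F => cmat A (-(r .K * r .F)) * M + cmat A (r .K) * M * cmat A (r .F)
  | .K => cmat A (r .Kinv) * M * cmat A (r .K)
  | .Kinv => cmat A (r .K) * M * cmat A (r .Kinv)

/-- The left multiplication rules `ξ M^I = ∑ ξ⁽¹⁾(M^I) ξ⁽²⁾` of the semidirect product, for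
the generators `ξ` of the quantum group. -/
inductive CrossRel (p : Level) (σ : Sector) {m : ℕ}
    (M : Fin m → ∀ d : ℕ, Matrix (Fin (d + 1)) (Fin (d + 1)) A) (g : UGen → A) : A → A → Prop
  | E (ν : Fin m) (d : ℕ) (i j : Fin (d + 1)) : CrossRel p σ M g (g .E * M ν d i j)
      (gaugeAct p σ d (M ν d) .E i j * g .K + M ν d i j * g .E)
  | F (ν : Fin m) (d : ℕ) (i j : Fin (d + 1)) : CrossRel p σ M g (g .F * M ν d i j)
      (gaugeAct p σ d (M ν d) .F i j + gaugeAct p σ d (M ν d) .Kinv i j * g .F)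
  | K (ν : Fin m) (d : ℕ) (i j : Fin (d + 1)) : CrossRel p σ M g (g .K * M ν d i j)
      (gaugeAct p σ d (M ν d) .K i j * g .K)
  | Kinv (ν : Fin m) (d : ℕ) (i j : Fin (d + 1)) : CrossRel p σ M g (g .Kinv * M ν d i j)
      (gaugeAct p σ d (M ν d) .Kinv i j * g .Kinv)

/-- All the relations of (one sector of) the extended graph algebra. -/
inductive ExtRel (p : Level) (σ : Sector) {m : ℕ}
    (M : Fin m → ∀ d : ℕ, Matrix (Fin (d + 1)) (Fin (d + 1)) A) (g : UGen → A) : A → A → Prop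
  | graph {x y : A} : GraphRel p σ M x y → ExtRel p σ M g x y
  | u {x y : A} : URel p σ g x y → ExtRel p σ M g x y
  | cross {x y : A} : CrossRel p σ M g x y → ExtRel p σ M g x y

end Relations

/-- Names of the matrix elements `(M_ν^{d/2})^i_j`. -/
structure GraphGen (m : ℕ) where
  hole : Fin m
  d : ℕ
  row : Fin (d + 1)
  col : Fin (d + 1)

/-- The free holonomy matrices. -/
def freeM (m : ℕ) (ν : Fin m) (d : ℕ) :
    Matrix (Fin (d + 1)) (Fin (d + 1)) (FreeAlgebra ℂ (GraphGen m)) :=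
  Matrix.of fun i j => FreeAlgebra.ι ℂ ⟨ν, d, i, j⟩

/-- The free holonomy matrices, among the generators of the extended algebra. -/
def freeExtM (m : ℕ) (ν : Fin m) (d : ℕ) :
    Matrix (Fin (d + 1)) (Fin (d + 1)) (FreeAlgebra ℂ (GraphGen m ⊕ UGen)) :=
  Matrix.of fun i j => FreeAlgebra.ι ℂ (Sum.inl ⟨ν, d, i, j⟩)

/-- One sector of the graph algebra: `L_{0,m}`, resp. `L̃_{0,m}`. -/
abbrev Graph (p : Level) (σ : Sector) (m : ℕ) : Type :=
  RingQuot (GraphRel p σ (freeM m))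

/-- One sector of the quantum group: `𝒰_𝐪(sl₂)`, resp. `𝒰_𝐪̃(sl₂)`. -/
abbrev Uq (p : Level) (σ : Sector) : Type :=
  RingQuot (URel p σ (FreeAlgebra.ι ℂ : UGen → FreeAlgebra ℂ UGen))

/-- One sector of the extended graph algebra: the semidirect (smash) product
`L_{0,m} ⋊ 𝒰_𝐪(sl₂)`, presented by the generators and relations of the two factors and the left
multiplication rules; resp. its tilded counterpart. -/
abbrev Ext (p : Level) (σ : Sector) (m : ℕ) : Type :=
  RingQuot (ExtRel p σ (freeExtM m)
    (fun x => FreeAlgebra.ι ℂ (Sum.inr x) : UGen → FreeAlgebra ℂ (GraphGen m ⊕ UGen)))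

/-- The graph algebra `L_{0,m} ⊗ L̃_{0,m}`. -/
abbrev GraphAlg (p : Level) (m : ℕ) : Type := Graph p .holo m ⊗[ℂ] Graph p .anti m

/-- The quantum Lorentz group `𝒰_𝐪(sl₂) ⊗ 𝒰_𝐪̃(sl₂)`. -/
abbrev UAlg (p : Level) : Type := Uq p .holo ⊗[ℂ] Uq p .anti

/-- The extended graph algebra `(L_{0,m} ⋊ 𝒰_𝐪(sl₂)) ⊗ (L̃_{0,m} ⋊ 𝒰_𝐪̃(sl₂))`. -/
abbrev ExtAlg (p : Level) (m : ℕ) : Type := Ext p .holo m ⊗[ℂ] Ext p .anti m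

/-- The quotient map from the free algebra. -/
def Graph.mk (p : Level) (σ : Sector) (m : ℕ) : FreeAlgebra ℂ (GraphGen m) →ₐ[ℂ] Graph p σ m :=
  RingQuot.mkAlgHom ℂ _

/-- The quotient map from the free algebra. -/
def Ext.mk (p : Level) (σ : Sector) (m : ℕ) :
    FreeAlgebra ℂ (GraphGen m ⊕ UGen) →ₐ[ℂ] Ext p σ m :=
  RingQuot.mkAlgHom ℂ _

/-- The holonomy matrices `M_ν^{d/2}`, `M̃_ν^{d/2}` over the graph algebra. -/
def GraphAlg.M (p : Level) (m : ℕ) :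
    ∀ (_ : Sector) (_ : Fin m) (d : ℕ), Matrix (Fin (d + 1)) (Fin (d + 1)) (GraphAlg p m)
  | .holo, ν, d => Matrix.of fun i j =>
      Algebra.TensorProduct.includeLeft (S := ℂ) (Graph.mk p .holo m (freeM m ν d i j))
  | .anti, ν, d => Matrix.of fun i j =>
      Algebra.TensorProduct.includeRight (Graph.mk p .anti m (freeM m ν d i j))

/-- The holonomy matrices `M_ν^{d/2}`, `M̃_ν^{d/2}` over the extended graph algebra. -/
def ExtAlg.M (p : Level) (m : ℕ) :
    ∀ (_ : Sector) (_ : Fin m) (d : ℕ), Matrix (Fin (d + 1)) (Fin (d + 1)) (ExtAlg p m)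
  | .holo, ν, d => Matrix.of fun i j =>
      Algebra.TensorProduct.includeLeft (S := ℂ) (Ext.mk p .holo m (freeExtM m ν d i j))
  | .anti, ν, d => Matrix.of fun i j =>
      Algebra.TensorProduct.includeRight (Ext.mk p .anti m (freeExtM m ν d i j))

/-- The generators `E, F, K, K⁻¹` and `Ẽ, F̃, K̃, K̃⁻¹` in the extended graph algebra. -/
def ExtAlg.g (p : Level) (m : ℕ) : Sector → UGen → ExtAlg p m
  | .holo, x => Algebra.TensorProduct.includeLeft (S := ℂ)
      (Ext.mk p .holo m (FreeAlgebra.ι ℂ (Sum.inr x)))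
  | .anti, x => Algebra.TensorProduct.includeRight
      (Ext.mk p .anti m (FreeAlgebra.ι ℂ (Sum.inr x)))

/-- The holonomy `M_0^I = M_m^I M_{m-1}^I ⋯ M_1^I` around all the holes. -/
def ExtAlg.M0 (p : Level) (m : ℕ) (σ : Sector) (d : ℕ) :
    Matrix (Fin (d + 1)) (Fin (d + 1)) (ExtAlg p m) :=
  (List.ofFn fun ν : Fin m => ExtAlg.M p m σ ν d).reverse.prod

section Naturality

variable {A B : Type} [Ring A] [Algebra ℂ A] [Ring B] [Algebra ℂ B]

lemma map_one_kron (f : A →ₐ[ℂ] B) {l n : Type} [Fintype l] [DecidableEq l] [Fintype n]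
    (M : Matrix n n A) :
    ((1 : Matrix l l A) ⊗ₖ M).map f = (1 : Matrix l l B) ⊗ₖ M.map f := by
  ext ⟨a, b⟩ ⟨c, e⟩
  by_cases h : a = c <;> simp [Matrix.kroneckerMap_apply, h]

lemma map_kron_one (f : A →ₐ[ℂ] B) {l n : Type} [Fintype l] [DecidableEq l] [Fintype n]
    (M : Matrix n n A) :
    (M ⊗ₖ (1 : Matrix l l A)).map f = M.map f ⊗ₖ (1 : Matrix l l B) := by
  ext ⟨a, b⟩ ⟨c, e⟩
  by_cases h : b = e <;> simp [Matrix.kroneckerMap_apply, h]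

lemma map_cmat (f : A →ₐ[ℂ] B) {m n : Type} (M : Matrix m n ℂ) :
    (cmat A M).map f = cmat B M := by
  ext i j
  simp [cmat]

lemma map_loopProd (f : A →ₐ[ℂ] B) (p : Level) (σ : Sector) (d e : ℕ)
    (M : Matrix (Fin (d + 1)) (Fin (d + 1)) A) (M' : Matrix (Fin (e + 1)) (Fin (e + 1)) A) :
    (loopProd p σ d e M M').map f = loopProd p σ d e (M.map f) (M'.map f) := by
  simp only [loopProd, Matrix.map_mul, map_cmat, map_one_kron, map_kron_one]

lemma map_loopProdExch (f : A →ₐ[ℂ] B) (p : Level) (σ : Sector) (d e : ℕ)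
    (M : Matrix (Fin (d + 1)) (Fin (d + 1)) A) (M' : Matrix (Fin (e + 1)) (Fin (e + 1)) A) :
    (loopProdExch p σ d e M M').map f = loopProdExch p σ d e (M.map f) (M'.map f) := by
  simp only [loopProdExch, Matrix.map_mul, map_cmat, map_one_kron, map_kron_one]

lemma map_cgSum (f : A →ₐ[ℂ] B) {p : Level} {σ : Sector} {d e : ℕ} (C : CGMaps p σ d e)
    (M : ∀ d : ℕ, Matrix (Fin (d + 1)) (Fin (d + 1)) A) :
    (cgSum C M).map f = cgSum C fun d => (M d).map f := by
  have h : (cgSum C M).map f =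
      ∑ t, (cmat A (C.C1 t) * M (d + e - 2 * t) * cmat A (C.C2 t)).map f := by
    ext i j
    simp only [cgSum, Matrix.sum_apply, Matrix.map_apply, map_sum]
  rw [h]
  simp only [cgSum, Matrix.map_mul, map_cmat]

lemma GraphRel.map (f : A →ₐ[ℂ] B) {p : Level} {σ : Sector} {m : ℕ}
    {M : Fin m → ∀ d : ℕ, Matrix (Fin (d + 1)) (Fin (d + 1)) A} {x y : A}
    (h : GraphRel p σ M x y) :
    GraphRel p σ (fun ν d => (M ν d).map f) (f x) (f y) := by
  cases h with
  | one ν i j =>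
    have := GraphRel.one (p := p) (σ := σ) (M := fun ν d => (M ν d).map f) ν i j
    have hij : i = j := by
      apply Fin.ext
      have := i.isLt
      have := j.isLt
      omega
    subst hij
    simpa using this
  | product ν d e C a c =>
    have := GraphRel.product (M := fun ν d => (M ν d).map f) ν d e C a c
    rwa [← map_loopProd, ← map_cgSum] at this
  | exchange ν μ hνμ d e a c =>
    have := GraphRel.exchange (p := p) (σ := σ) (M := fun ν d => (M ν d).map f) ν μ hνμ d e a c
    rwa [← map_loopProd, ← map_loopProdExch] at this

lemma URel.map (f : A →ₐ[ℂ] B) {p : Level} {σ : Sector} {g : UGen → A} {x y : A}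
    (h : URel p σ g x y) : URel p σ (fun t => f (g t)) (f x) (f y) := by
  cases h with
  | K_Kinv => simpa using URel.K_Kinv (p := p) (σ := σ) (g := fun t => f (g t))
  | Kinv_K => simpa using URel.Kinv_K (p := p) (σ := σ) (g := fun t => f (g t))
  | K_E => simpa using URel.K_E (p := p) (σ := σ) (g := fun t => f (g t))
  | K_F => simpa using URel.K_F (p := p) (σ := σ) (g := fun t => f (g t))
  | E_F => simpa using URel.E_F (p := p) (σ := σ) (g := fun t => f (g t))

end Naturality

/-- The inclusion of one sector of the graph algebra into its extension. -/
def Graph.toExt (p : Level) (σ : Sector) (m : ℕ) : Graph p σ m →ₐ[ℂ] Ext p σ m :=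
  RingQuot.liftAlgHom ℂ
    ⟨(Ext.mk p σ m).comp (FreeAlgebra.lift ℂ fun x => FreeAlgebra.ι ℂ (Sum.inl x)), by
      intro x y hxy
      have h := GraphRel.map
        (FreeAlgebra.lift ℂ fun x => FreeAlgebra.ι ℂ (Sum.inl x) :
          FreeAlgebra ℂ (GraphGen m) →ₐ[ℂ] FreeAlgebra ℂ (GraphGen m ⊕ UGen)) hxy
      have hM : (fun ν d => (freeM m ν d).map
          (FreeAlgebra.lift ℂ fun x => FreeAlgebra.ι ℂ (Sum.inl x) :
            FreeAlgebra ℂ (GraphGen m) →ₐ[ℂ] FreeAlgebra ℂ (GraphGen m ⊕ UGen)))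
          = freeExtM m := by
        funext ν d
        ext i j
        simp [freeM, freeExtM]
      rw [hM] at h
      exact RingQuot.mkAlgHom_rel ℂ (ExtRel.graph h)⟩

/-- The inclusion of one sector of the quantum group into the extended graph algebra. -/
def Uq.toExt (p : Level) (σ : Sector) (m : ℕ) : Uq p σ →ₐ[ℂ] Ext p σ m :=
  RingQuot.liftAlgHom ℂ
    ⟨(Ext.mk p σ m).comp (FreeAlgebra.lift ℂ fun x => FreeAlgebra.ι ℂ (Sum.inr x)), by
      intro x y hxy
      have h := URel.map
        (FreeAlgebra.lift ℂ fun x => FreeAlgebra.ι ℂ (Sum.inr x) :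
          FreeAlgebra ℂ UGen →ₐ[ℂ] FreeAlgebra ℂ (GraphGen m ⊕ UGen)) hxy
      simp only [FreeAlgebra.lift_ι_apply] at h
      exact RingQuot.mkAlgHom_rel ℂ (ExtRel.u h)⟩

/-- The counit of one sector of the quantum group. -/
def Uq.counit (p : Level) (σ : Sector) : Uq p σ →ₐ[ℂ] ℂ :=
  RingQuot.liftAlgHom ℂ
    ⟨FreeAlgebra.lift ℂ fun
      | .E => 0
      | .F => 0
      | .K => 1
      | .Kinv => 1, by
      intro x y hxy
      cases hxy <;> simp⟩

/-- The inclusion of the graph algebra into the extended graph algebra. -/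
def GraphAlg.toExt (p : Level) (m : ℕ) : GraphAlg p m →ₐ[ℂ] ExtAlg p m :=
  Algebra.TensorProduct.map (Graph.toExt p .holo m) (Graph.toExt p .anti m)

/-- The inclusion of the quantum Lorentz group into the extended graph algebra. -/
def UAlg.toExt (p : Level) (m : ℕ) : UAlg p →ₐ[ℂ] ExtAlg p m :=
  Algebra.TensorProduct.map (Uq.toExt p .holo m) (Uq.toExt p .anti m)

/-- The counit `ε` of the quantum Lorentz group. -/
def UAlg.counit (p : Level) : UAlg p →ₐ[ℂ] ℂ :=
  (Algebra.TensorProduct.lmul' ℂ).comp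
    (Algebra.TensorProduct.map (Uq.counit p .holo) (Uq.counit p .anti))

/-! ### Star structures -/

/-- `s` is a `*`-structure on the complex algebra `A`. -/
structure IsStar {A : Type} [Semiring A] [Algebra ℂ A] (s : A → A) : Prop where
  add : ∀ x y, s (x + y) = s x + s y
  smul : ∀ (c : ℂ) x, s (c • x) = conj c • s x
  mul : ∀ x y, s (x * y) = s y * s x
  invol : ∀ x, s (s x) = x

/-- `(M_ν^I)^i_j{}^* = ((M̃_ν^I)⁻¹)^j_i`, and the same with the two sectors exchanged: the matrix
of the `(M_ν^I)^i_j{}^*`, transposed, is the two-sided inverse of `M̃_ν^I`. -/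
def IsHolonomyStar {A : Type} [Semiring A] {m : ℕ}
    (M : ∀ (_ : Sector) (_ : Fin m) (d : ℕ), Matrix (Fin (d + 1)) (Fin (d + 1)) A)
    (s : A → A) : Prop :=
  ∀ (σ : Sector) (ν : Fin m) (d : ℕ),
    (Matrix.of fun j i => s (M σ ν d i j)) * M σ.swap ν d = 1 ∧
      M σ.swap ν d * (Matrix.of fun j i => s (M σ ν d i j)) = 1

/-! ### The Hilbert space and the common domain

A state in `𝓗₀^{⊗m}`, with `𝓗₀ = L²(ℝ) ⊗ ℂ^k`, is a function of `μ ∈ ℝ^m` and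
`s ∈ (ℤ/k)^m`. The states in the common domain extend to entire functions of `μ`, so that they are
represented by functions on `ℂ^m × (ℤ/k)^m`. -/

/-- Functions on `ℂ^m × (ℤ/k)^m`. -/
abbrev Fun (p : Level) (m : ℕ) : Type := (Fin m → ℂ) → (Fin m → ZMod p.k) → ℂ

/-- `|e^{α·μ} f(μ + iη, s)|`, as a function of `μ ∈ ℝ^m`. -/
def weighted (p : Level) {m : ℕ} (f : Fun p m) (α η : Fin m → ℝ) (s : Fin m → ZMod p.k)
    (μ : Fin m → ℝ) : ℝ≥0∞ :=
  ‖Complex.exp (∑ ν, (α ν : ℂ) * (μ ν : ℂ)) *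
    f (fun ν => (μ ν : ℂ) + (η ν : ℂ) * Complex.I) s‖ₑ

/-- The defining condition of the maximal common domain of all the Laurent monomials of the
(closed, normal) operators `𝐱_ν, 𝐲_ν, 𝐱̃_ν, 𝐲̃_ν` on `𝓗₀^{⊗m}`: for each `s`, the function
`f(·, s)` is entire, and `e^{α·μ} f(μ + iη, s)` is in `L²(ℝ^m)` for all `α` and `η`, with a norm
that is locally bounded in `η`. -/
def IsDom (p : Level) {m : ℕ} (f : Fun p m) : Prop :=
  ∀ s, Differentiable ℂ (fun z => f z s) ∧
    ∀ (α : Fin m → ℝ) (B : ℝ), ∃ C : ℝ≥0, ∀ η : Fin m → ℝ, (∀ ν, |η ν| ≤ B) →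
      ∫⁻ μ, weighted p f α η s μ ^ 2 ≤ C

lemma enorm_add_sq_le (x y : ℂ) : ‖x + y‖ₑ ^ 2 ≤ 2 * ‖x‖ₑ ^ 2 + 2 * ‖y‖ₑ ^ 2 := by
  have h : ‖x + y‖₊ ^ 2 ≤ 2 * ‖x‖₊ ^ 2 + 2 * ‖y‖₊ ^ 2 := by
    rw [← NNReal.coe_le_coe]
    push_cast
    have := norm_add_le x y
    nlinarith [norm_nonneg (x + y), norm_nonneg x, norm_nonneg y, sq_nonneg (‖x‖ - ‖y‖)]
  simp only [enorm_eq_nnnorm]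
  exact_mod_cast h

lemma measurable_weighted {p : Level} {m : ℕ} {f : Fun p m} (s : Fin m → ZMod p.k)
    (hf : Differentiable ℂ (fun z => f z s)) (α η : Fin m → ℝ) :
    Measurable (weighted p f α η s) := by
  have h1 : Continuous fun μ : Fin m → ℝ =>
      f (fun ν => (μ ν : ℂ) + (η ν : ℂ) * Complex.I) s :=
    hf.continuous.comp (by fun_prop)
  have h2 : Continuous fun μ : Fin m → ℝ => Complex.exp (∑ ν, (α ν : ℂ) * (μ ν : ℂ)) := by
    fun_prop
  exact (h2.mul h1).enorm.measurable

lemma IsDom.zero (p : Level) (m : ℕ) : IsDom p (0 : Fun p m) := by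
  intro s
  refine ⟨by simp, fun α B => ⟨0, fun η _ => ?_⟩⟩
  simp [weighted]

lemma IsDom.add {p : Level} {m : ℕ} {f g : Fun p m} (hf : IsDom p f) (hg : IsDom p g) :
    IsDom p (f + g) := by
  intro s
  refine ⟨(hf s).1.add (hg s).1, fun α B => ?_⟩
  obtain ⟨C, hC⟩ := (hf s).2 α B
  obtain ⟨D, hD⟩ := (hg s).2 α B
  refine ⟨2 * C + 2 * D, fun η hη => ?_⟩
  calc ∫⁻ μ, weighted p (f + g) α η s μ ^ 2
      ≤ ∫⁻ μ, (2 * weighted p f α η s μ ^ 2 + 2 * weighted p g α η s μ ^ 2) := by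
        refine MeasureTheory.lintegral_mono fun μ => ?_
        simp only [weighted, Pi.add_apply, mul_add]
        exact enorm_add_sq_le _ _
    _ = 2 * (∫⁻ μ, weighted p f α η s μ ^ 2) + 2 * ∫⁻ μ, weighted p g α η s μ ^ 2 := by
        rw [MeasureTheory.lintegral_add_left, MeasureTheory.lintegral_const_mul,
          MeasureTheory.lintegral_const_mul]
        · exact (measurable_weighted s (hg s).1 α η).pow_const 2
        · exact (measurable_weighted s (hf s).1 α η).pow_const 2
        · exact ((measurable_weighted s (hf s).1 α η).pow_const 2).const_mul 2
    _ ≤ ((2 * C + 2 * D : ℝ≥0) : ℝ≥0∞) := by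
        push_cast
        gcongr
        · exact hC η hη
        · exact hD η hη

/-- Multiplication by a function whose modulus is bounded by `A e^{β·μ}` on each tube. -/
lemma IsDom.mul {p : Level} {m : ℕ} {f : Fun p m} (hf : IsDom p f) (g : Fun p m)
    (hg : ∀ s, Differentiable ℂ (fun z => g z s)) (β : Fin m → ℝ)
    (hb : ∀ s (B : ℝ), ∃ A : ℝ≥0, ∀ η : Fin m → ℝ, (∀ ν, |η ν| ≤ B) → ∀ μ : Fin m → ℝ,
      ‖g (fun ν => (μ ν : ℂ) + (η ν : ℂ) * Complex.I) s‖ ≤ A * Real.exp (∑ ν, β ν * μ ν)) :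
    IsDom p (g * f) := by
  intro s
  refine ⟨(hg s).mul (hf s).1, fun α B => ?_⟩
  obtain ⟨C, hC⟩ := (hf s).2 (α + β) B
  obtain ⟨A, hA⟩ := hb s B
  refine ⟨A ^ 2 * C, fun η hη => ?_⟩
  calc ∫⁻ μ, weighted p (g * f) α η s μ ^ 2
      ≤ ∫⁻ μ, (A : ℝ≥0∞) ^ 2 * weighted p f (α + β) η s μ ^ 2 := by
        refine MeasureTheory.lintegral_mono fun μ => ?_
        rw [← mul_pow]
        gcongr
        simp only [weighted, enorm_eq_nnnorm, Pi.mul_apply, Pi.add_apply]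
        rw [← ENNReal.coe_mul, ENNReal.coe_le_coe, ← NNReal.coe_le_coe]
        push_cast
        simp only [norm_mul, Complex.norm_exp]
        have h1 : (∑ ν, (α ν : ℂ) * (μ ν : ℂ)).re = ∑ ν, α ν * μ ν := by
          simp [Complex.re_sum]
        have h2 : (∑ ν, ((α ν : ℂ) + (β ν : ℂ)) * (μ ν : ℂ)).re
            = ∑ ν, α ν * μ ν + ∑ ν, β ν * μ ν := by
          simp [Complex.re_sum, ← Finset.sum_add_distrib, add_mul]
        rw [h1, h2, Real.exp_add]
        have h3 := mul_le_mul_of_nonneg_right (hA η hη μ)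
          (norm_nonneg (f (fun ν => (μ ν : ℂ) + (η ν : ℂ) * Complex.I) s))
        have h4 := mul_le_mul_of_nonneg_left h3 (Real.exp_pos (∑ ν, α ν * μ ν)).le
        linarith
    _ = (A : ℝ≥0∞) ^ 2 * ∫⁻ μ, weighted p f (α + β) η s μ ^ 2 := by
        rw [MeasureTheory.lintegral_const_mul]
        exact (measurable_weighted s (hf s).1 _ η).pow_const 2
    _ ≤ ((A ^ 2 * C : ℝ≥0) : ℝ≥0∞) := by
        push_cast
        gcongr
        exact hC η hη

/-- Translation by a complex vector. -/
lemma IsDom.shift {p : Level} {m : ℕ} {f : Fun p m} (hf : IsDom p f) (τ : Fin m → ℂ)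
    (n : Fin m → ZMod p.k) : IsDom p (fun z s => f (z + τ) (s + n)) := by
  intro s
  refine ⟨(hf (s + n)).1.comp (by fun_prop), fun α B => ?_⟩
  obtain ⟨C, hC⟩ := (hf (s + n)).2 α (B + ∑ ν, |(τ ν).im|)
  set a : ℝ≥0 := ‖Complex.exp (-∑ ν, (α ν : ℂ) * ((τ ν).re : ℂ))‖₊ with ha
  refine ⟨a ^ 2 * C, fun η hη => ?_⟩
  have key : ∀ μ : Fin m → ℝ, weighted p (fun z s => f (z + τ) (s + n)) α η s μ =
      (a : ℝ≥0∞) * weighted p f α (fun ν => η ν + (τ ν).im) (s + n)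
        (μ + fun ν => (τ ν).re) := by
    intro μ
    have e1 : ((fun ν => (μ ν : ℂ) + (η ν : ℂ) * Complex.I) + τ) =
        (fun ν => (((μ + fun ν => (τ ν).re) ν : ℝ) : ℂ)
          + ((η ν + (τ ν).im : ℝ) : ℂ) * Complex.I) := by
      funext ν
      simp only [Pi.add_apply]
      push_cast
      conv_lhs => rw [← Complex.re_add_im (τ ν)]
      ring
    have e2 : (∑ ν, (α ν : ℂ) * (μ ν : ℂ)) = (-∑ ν, (α ν : ℂ) * ((τ ν).re : ℂ)) +
        ∑ ν, (α ν : ℂ) * (((μ + fun ν => (τ ν).re) ν : ℝ) : ℂ) := by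
      simp only [Pi.add_apply]
      push_cast
      simp only [mul_add, Finset.sum_add_distrib]
      ring
    simp only [weighted]
    rw [e1, e2, Complex.exp_add, mul_assoc, enorm_mul]
    simp [ha, enorm_eq_nnnorm]
  simp only [key, mul_pow]
  rw [MeasureTheory.lintegral_const_mul]
  · rw [MeasureTheory.lintegral_add_right_eq_self
      (fun μ => weighted p f α (fun ν => η ν + (τ ν).im) (s + n) μ ^ 2)]
    push_cast
    gcongr
    apply hC
    intro ν
    calc |η ν + (τ ν).im| ≤ |η ν| + |(τ ν).im| := abs_add_le _ _
      _ ≤ B + ∑ ν, |(τ ν).im| := by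
        gcongr
        · exact hη ν
        · exact Finset.single_le_sum (f := fun ν => |(τ ν).im|) (fun _ _ => abs_nonneg _)
            (Finset.mem_univ ν)
  · exact (((measurable_weighted (s + n) (hf (s + n)).1 _ _).comp
      (measurable_id.add_const _)).pow_const 2)

/-- The common domain in `𝓗₀^{⊗m}`. -/
def Dom (p : Level) (m : ℕ) : Submodule ℂ (Fun p m) where
  carrier := {f | IsDom p f}
  zero_mem' := IsDom.zero p m
  add_mem' := IsDom.add
  smul_mem' c f hf := by
    have := IsDom.mul hf (fun _ _ => c) (fun s => by simp) 0
      (fun s B => ⟨‖c‖₊, fun η _ μ => by simp⟩)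
    exact this

/-- The inner product of `𝓗₀^{⊗m}`, on the common domain. -/
def ip (p : Level) {m : ℕ} (f g : Dom p m) : ℂ :=
  ∑ s : Fin m → ZMod p.k, ∫ μ : Fin m → ℝ,
    conj (f.1 (fun ν => (μ ν : ℂ)) s) * g.1 (fun ν => (μ ν : ℂ)) s

/-- The intersection of the common domain with the subspace `𝓗^{⊗m}` of `𝓗₀^{⊗m}`, where
`𝓗 = 𝓗₊ ≃ L²(ℝ) ⊗ ℂ^N` consists of the `f(μ, s)` that vanish unless `s ∈ ℤ/2N` is even. -/
def EvenDom (p : Level) (m : ℕ) : Submodule ℂ (Dom p m) where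
  carrier := {f | ∀ z s, (∃ ν, ¬ Even (s ν)) → f.1 z s = 0}
  zero_mem' := by intro z s _; rfl
  add_mem' := by
    intro f g hf hg z s hs
    simp [hf z s hs, hg z s hs]
  smul_mem' := by
    intro c f hf z s hs
    simp [hf z s hs]

/-- `EvenDom` is dense in `𝓗^{⊗m}`. -/
def EvenDomDense (p : Level) (m : ℕ) : Prop :=
  ∀ g : (Fin m → ℝ) → (Fin m → ZMod p.k) → ℂ,
    (∀ s, MeasureTheory.MemLp (fun μ => g μ s) 2) →
    (∀ μ s, (∃ ν, ¬ Even (s ν)) → g μ s = 0) →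
    ∀ ε : ℝ≥0∞, 0 < ε → ∃ f ∈ EvenDom p m, ∀ s,
      MeasureTheory.eLpNorm (fun μ : Fin m → ℝ => f.1 (fun ν => (μ ν : ℂ)) s - g μ s) 2 < ε

/-! ### The operators -/

/-- `f(z, s) ↦ f(z + τ e_ν, s + n e_ν)`. -/
def shiftOp (p : Level) {m : ℕ} (ν : Fin m) (τ : ℂ) (n : ZMod p.k) :
    Module.End ℂ (Dom p m) where
  toFun f := ⟨fun z s => f.1 (z + (Pi.single ν τ : Fin m → ℂ))
      (s + (Pi.single ν n : Fin m → ZMod p.k)), by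
    exact IsDom.shift f.2 (Pi.single ν τ) (Pi.single ν n)⟩
  map_add' _ _ := rfl
  map_smul' _ _ := rfl

/-- `f(z, s) ↦ e^{c z_ν + (2πi/k) l s_ν} f(z, s)`, with a real or complex `c`. -/
def multOp (p : Level) {m : ℕ} (ν : Fin m) (c : ℂ) (l : ℤ) : Module.End ℂ (Dom p m) where
  toFun f := ⟨(fun z s => Complex.exp
      (c * z ν + 2 * Real.pi * Complex.I / p.k * l * ((s ν).val : ℂ))) * f.1, by
    refine IsDom.mul f.2 _ (fun s => by fun_prop) (Pi.single ν c.re) fun s B => ?_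
    refine ⟨‖Complex.exp (2 * Real.pi * Complex.I / p.k * l * ((s ν).val : ℂ))‖₊ *
      ⟨Real.exp (|c.im| * B), (Real.exp_pos _).le⟩, fun η hη μ => ?_⟩
    have hsum : ∑ κ, (Pi.single ν c.re : Fin m → ℝ) κ * μ κ = c.re * μ ν := by
      rw [Finset.sum_eq_single ν] <;> simp +contextual
    have him : -(c.im * η ν) ≤ |c.im| * B := by
      calc -(c.im * η ν) ≤ |c.im * η ν| := neg_le_abs _
        _ = |c.im| * |η ν| := abs_mul _ _
        _ ≤ |c.im| * B := by gcongr; exact hη ν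
    rw [hsum, Complex.exp_add, norm_mul]
    push_cast
    rw [Complex.norm_exp (c * _)]
    have hre : (c * ((μ ν : ℂ) + (η ν : ℂ) * Complex.I)).re = c.re * μ ν + -(c.im * η ν) := by
      simp
      ring
    rw [hre, Real.exp_add]
    have hexp := Real.exp_le_exp.mpr him
    have h0 := norm_nonneg (Complex.exp (2 * Real.pi * Complex.I / p.k * l * ((s ν).val : ℂ)))
    have h1 := Real.exp_pos (c.re * μ ν)
    calc Real.exp (c.re * μ ν) * Real.exp (-(c.im * η ν)) *
          ‖Complex.exp (2 * Real.pi * Complex.I / p.k * l * ((s ν).val : ℂ))‖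
        ≤ Real.exp (c.re * μ ν) * Real.exp (|c.im| * B) *
          ‖Complex.exp (2 * Real.pi * Complex.I / p.k * l * ((s ν).val : ℂ))‖ := by gcongr
      _ = _ := by
        change _ = ‖Complex.exp (2 * Real.pi * Complex.I / p.k * l * ((s ν).val : ℂ))‖ *
          Real.exp (|c.im| * B) * Real.exp (c.re * μ ν)
        ring⟩
  map_add' f g := by
    apply Subtype.ext
    funext z s
    simp [mul_add]
  map_smul' a f := by
    apply Subtype.ext
    funext z s
    simp [mul_left_comm]

/-- `𝐱^α` on the `ν`-th factor: `𝐱 f(μ, s) = f(μ + ib, s - 1)`, resp.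
`𝐱̃ f(μ, s) = f(μ + ib⁻¹, s + 1)`. -/
def xPow (p : Level) {m : ℕ} (σ : Sector) (ν : Fin m) (α : ℤ) : Module.End ℂ (Dom p m) :=
  shiftOp p ν (α * (Complex.I * p.bPar σ)) ((-σ.sgn * α : ℤ) : ZMod p.k)

/-- `𝐲^β` on the `ν`-th factor: `𝐲 f(μ, s) = e^{(2πi/k)(-ibμ - s)} f(μ, s)`, resp.
`𝐲̃ f(μ, s) = e^{(2πi/k)(-ib⁻¹μ + s)} f(μ, s)`. -/
def yPow (p : Level) {m : ℕ} (σ : Sector) (ν : Fin m) (β : ℤ) : Module.End ℂ (Dom p m) :=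
  multOp p ν (β * (2 * Real.pi * Complex.I / p.k * (-Complex.I * p.bPar σ))) (-σ.sgn * β)

/-- `𝐱_{α,β} = q^{-αβ} 𝐱^α 𝐲^β` on the `ν`-th factor, resp. the tilded operator. -/
def xOp (p : Level) {m : ℕ} (σ : Sector) (ν : Fin m) (α β : ℤ) : Module.End ℂ (Dom p m) :=
  p.q σ ^ (-(α * β)) • (xPow p σ ν α * yPow p σ ν β)

/-- The operators `𝒦_λ, 𝒦_λ⁻¹, 𝒳_λ, 𝒴_λ` of the representation `π^λ`, resp. the tilded ones, on the
`ν`-th factor. -/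
def siteOps (p : Level) {m : ℕ} (σ : Sector) (ν : Fin m) (lam : ℂ) :
    GenImages (Module.End ℂ (Dom p m)) :=
  let c : ℂ := -Complex.I / (p.Q σ - (p.Q σ)⁻¹)
  let l : ℂ := match σ with
    | .holo => lam
    | .anti => conj lam
  { K := xOp p σ ν (-1) 0
    Kinv := xOp p σ ν 1 0
    X := c • ((l + l⁻¹) • xOp p σ ν 1 (-1) + xOp p σ ν 3 (-1) + xOp p σ ν (-1) (-1))
    Y := c • xOp p σ ν (-1) 1 }

/-- `(π^{λ_1} ⊗ ⋯ ⊗ π^{λ_n}) ∘ Δ^{(n)}` on the first `n` factors; for `n = 0` it is the counit. -/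
def tensorOps (p : Level) {m : ℕ} (σ : Sector) (lam : Fin m → ℂ) (n : ℕ) :
    GenImages (Module.End ℂ (Dom p m)) :=
  ((List.finRange m).take n).foldl (fun T ν => T.comul (siteOps p σ ν (lam ν))) GenImages.counit

/-- `(ρ^{d/2} ⊗ π^{λ_ν})(R'R)` on the `ν`-th factor. -/
def loopOp (p : Level) {m : ℕ} (σ : Sector) (lam : Fin m → ℂ) (ν : Fin m) (d : ℕ) :
    Matrix (Fin (d + 1)) (Fin (d + 1)) (Module.End ℂ (Dom p m)) :=
  RMat' p σ d (siteOps p σ ν (lam ν)) * RMat p σ d (siteOps p σ ν (lam ν))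

/-- The dressed operator `(ρ^{d/2} ⊗ ι_ν)(R') (ρ^{d/2} ⊗ π^{λ_ν})(R'R) (ρ^{d/2} ⊗ ι_ν)(R'⁻¹)`,
where `ι_ν = (π^{λ_1} ⊗ ⋯ ⊗ π^{λ_{ν-1}}) ∘ Δ^{(ν-1)}`. -/
def dressedOp (p : Level) {m : ℕ} (σ : Sector) (lam : Fin m → ℂ) (ν : Fin m) (d : ℕ) :
    Matrix (Fin (d + 1)) (Fin (d + 1)) (Module.End ℂ (Dom p m)) :=
  RMat' p σ d (tensorOps p σ lam ν) * loopOp p σ lam ν d *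
    Ring.inverse (RMat' p σ d (tensorOps p σ lam ν))

/-! ### Representations -/

/-- `D` is a `*`-representation with respect to `s`: on the common domain, `D(a*)` is the
(formal) adjoint of `D(a)`. -/
def IsStarRep (p : Level) {m : ℕ} {A : Type} [Semiring A] [Algebra ℂ A]
    (D : A →ₐ[ℂ] Module.End ℂ (Dom p m)) (s : A → A) : Prop :=
  ∀ (a : A) (f g : Dom p m), ip p (D a f) g = ip p f (D (s a) g)

/-- All the operators `D(a)` leave `𝓗^{⊗m}` invariant. -/
def LeavesEvenInvariant (p : Level) {m : ℕ} {A : Type} [Semiring A] [Algebra ℂ A]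
    (D : A →ₐ[ℂ] Module.End ℂ (Dom p m)) : Prop :=
  ∀ (a : A), ∀ f ∈ EvenDom p m, D a f ∈ EvenDom p m

/-- The assignment `M_ν^I ↦ T_ν^I`, `M̃_ν^I ↦ T̃_ν^I` is given by the `*`-representation `D` of the
graph algebra, which leaves `𝓗^{⊗m}` invariant. The `*`-structure is part of the claim. -/
def IsGraphStarRep (p : Level) {m : ℕ}
    (T : ∀ (_ : Sector) (_ : Fin m) (d : ℕ),
      Matrix (Fin (d + 1)) (Fin (d + 1)) (Module.End ℂ (Dom p m)))
    (D : GraphAlg p m →ₐ[ℂ] Module.End ℂ (Dom p m)) : Prop :=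
  (∀ σ ν d i j, D (GraphAlg.M p m σ ν d i j) = T σ ν d i j) ∧
    LeavesEvenInvariant p D ∧
    ∃ s : GraphAlg p m → GraphAlg p m,
      IsStar s ∧ IsHolonomyStar (GraphAlg.M p m) s ∧ IsStarRep p D s

/-- The representation `D` of the extended graph algebra extends the representation `D₀` of the
graph algebra by `D(ξ) = (π^{λ_1} ⊗ ⋯ ⊗ π^{λ_m})(Δ^{(m)} ξ)`, leaves `𝓗^{⊗m}` invariant and is
a `*`-representation, where `E* = Ẽ`, `F* = F̃`, `K* = K̃`. -/
def IsExtStarRep (p : Level) {m : ℕ} (lam : Fin m → ℂ)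
    (D₀ : GraphAlg p m →ₐ[ℂ] Module.End ℂ (Dom p m))
    (D : ExtAlg p m →ₐ[ℂ] Module.End ℂ (Dom p m)) : Prop :=
  D.comp (GraphAlg.toExt p m) = D₀ ∧
    (∀ σ x, D (ExtAlg.g p m σ x) = (tensorOps p σ lam m).u σ x) ∧
    LeavesEvenInvariant p D ∧
    ∃ s : ExtAlg p m → ExtAlg p m,
      IsStar s ∧ IsHolonomyStar (ExtAlg.M p m) s ∧
        (∀ σ x, s (ExtAlg.g p m σ x) = ExtAlg.g p m σ.swap x) ∧ IsStarRep p D s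

/-- Every gauge-invariant linear functional `Ψ`, on any subspace `W` of the common domain that is
stable under the representation, satisfies the quantum flatness constraint: if
`Ψ[D(ξ)f] = ε(ξ) Ψ[f]` for all `ξ` in the quantum gauge group, then
`Ψ[D((M_0^I)^i_j) f] = δ^i_j Ψ[f]`, and the same for `M̃_0^I`. -/
def GaugeInvariantImpliesFlat (p : Level) {m : ℕ}
    (D : ExtAlg p m →ₐ[ℂ] Module.End ℂ (Dom p m)) : Prop :=
  ∀ (W : Submodule ℂ (Dom p m)) (hW : ∀ (a : ExtAlg p m), ∀ f ∈ W, D a f ∈ W) (Ψ : W →ₗ[ℂ] ℂ),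
    (∀ (ξ : UAlg p) (f : W),
      Ψ ((D (UAlg.toExt p m ξ)).restrict (hW _) f) = UAlg.counit p ξ * Ψ f) →
    ∀ (σ : Sector) (d : ℕ) (i j : Fin (d + 1)) (f : W),
      Ψ ((D (ExtAlg.M0 p m σ d i j)).restrict (hW _) f) =
        (1 : Matrix (Fin (d + 1)) (Fin (d + 1)) ℂ) i j * Ψ f

end QLorentz

end

/-! The algebraic core is the universal R-matrix in the form `θ * qexp (e ⊗ f)`, for two commuting
families of images of the generators with nilpotent `e ⊗ f` and an element `θ` that behaves like
𝐪^{H⊗H/2} (`Pair`, `RUniv`). The quantum exponential is multiplicative on q-commuting nilpotents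
(`qexp_add`), has an explicit inverse (`qexp_mul_qexp_inv`), and intertwines z + a with z + b
(`add_mul_qexp`). These facts give the hexagon identities, invertibility, and R Δ = Δ^op R, hence
Yang–Baxter. The concrete matrices `RMat`, `RMat'` are instances with one leg in matrices and the
other in an arbitrary algebra, so every operator relation is an identity between R-matrices.

The site operators satisfy the quantum group relations for every λ, because the λ-term of 𝒳 commutes
with 𝒴. The fusion relation of the dressed holonomies comes from Yang–Baxter together with the
sliding of Clebsch–Gordan maps through R and R'. The exchange relation comes from gauge covariance:
R'R commutes with the coproduct, dressing by R' transports this to all the previous factors, and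
R₁₂R' is itself the image of R under a coproduct, so that a covariant matrix commutes with it. The
two sectors commute because the continuous phase and the ℤ/k phase of their shifts cancel.

Complex conjugation sends q to the inverse of q̃, and the adjoint of e ⊗ f is 𝐪̃⁻² times its tilded
counterpart. Hence the adjoint of R is the inverse of R̃ (`RUniv_adjoint`), and the adjoint of a
dressed holonomy is the inverse of the tilded one. For the abstract `*`-structure the holonomies
must already be invertible in the algebra. For spin 1/2 this is read off from the singlet component
of the fusion relation; higher spins follow by tensoring with spin 1/2, for which Clebsch–Gordan
maps are written down as complex rotations (`isUnit_holonomy`). The transposed inverses then satisfy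
the relations of the other sector in the conjugate opposite algebra, so the universal property
produces the star. Involutivity and compatibility with the inner product need checking on generators
only, because the elements with either property form a subalgebra.

The analytic input is that a shift by τ is formally adjoint to the shift by -τ̄. This is a contour
shift, valid on the common domain by the locally uniform L² bounds (`integral_add_single`). Density
follows since Gaussians times plane waves belong to the domain, and a function orthogonal to all of
them has, after multiplication by the Gaussian, vanishing Fourier transform. The even subspace is
the common fixed space of the operators (-1)^s, with which all representing operators commute: each
site operator changes sign under its own parity, and signs occur in pairs.

For flatness, the product of the dressed holonomies telescopes to the image of R'R under the full
tensor product representation (`prod_dressedOp`). Its matrix elements contain only even powers of 𝒦,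
so they are images of elements of the quantum group, and their counits are δ^i_j because the counit
sends R'R to 1. Gauge invariance of Ψ then gives the constraint. The statement about a single loop
is the case of one factor, where the dressing is trivial. -/

noncomputable section

namespace QLorentz

open GenImages

/-! ### The quantum exponential -/

/-- The coefficients `(1-t)ⁿ / (n)_t!` of the quantum exponential. -/
def qexpCoef (t : ℂ) (n : ℕ) : ℂ :=
  (1 - t) ^ (2 * n) / ∏ i ∈ Finset.range n, (1 - t ^ (i + 1))

/-- `t` is nonzero and not a root of unity. -/
structure Generic (t : ℂ) : Prop where
  ne_zero : t ≠ 0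
  pow_ne_one : ∀ n : ℕ, t ^ (n + 1) ≠ 1

lemma Generic.one_sub_ne {t : ℂ} (ht : Generic t) (n : ℕ) : 1 - t ^ (n + 1) ≠ 0 :=
  sub_ne_zero.mpr (ht.pow_ne_one n).symm

lemma Generic.one_sub_ne' {t : ℂ} (ht : Generic t) : 1 - t ≠ 0 := by
  simpa using ht.one_sub_ne 0

lemma Generic.inv {t : ℂ} (ht : Generic t) : Generic t⁻¹ :=
  ⟨inv_ne_zero ht.ne_zero, fun n h => ht.pow_ne_one n (by simpa using h)⟩

lemma Generic.sq {t : ℂ} (ht : Generic t) : Generic (t ^ 2) :=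
  ⟨pow_ne_zero _ ht.ne_zero, fun n h => ht.pow_ne_one (2 * n + 1) (by rw [← h]; ring)⟩

@[simp] lemma qexpCoef_zero (t : ℂ) : qexpCoef t 0 = 1 := by simp [qexpCoef]

lemma qexpCoef_ne_zero {t : ℂ} (ht : Generic t) (n : ℕ) : qexpCoef t n ≠ 0 :=
  div_ne_zero (pow_ne_zero _ ht.one_sub_ne')
    (Finset.prod_ne_zero_iff.mpr fun i _ => ht.one_sub_ne i)

lemma qexpCoef_succ {t : ℂ} (ht : Generic t) (n : ℕ) :
    qexpCoef t (n + 1) * (1 - t ^ (n + 1)) = (1 - t) ^ 2 * qexpCoef t n := by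
  have h1 := ht.one_sub_ne n
  have h2 : ∏ i ∈ Finset.range n, (1 - t ^ (i + 1)) ≠ 0 :=
    Finset.prod_ne_zero_iff.mpr fun i _ => ht.one_sub_ne i
  rw [qexpCoef, qexpCoef, Finset.prod_range_succ]
  field_simp
  ring

/-- The coefficients of the inverse of the quantum exponential satisfy the convolution identity. -/
lemma sum_qexpCoef_inv {t : ℂ} (ht : Generic t) (n : ℕ) :
    ∑ ij ∈ Finset.HasAntidiagonal.antidiagonal (n + 1),
      qexpCoef t ij.1 * (t ^ ij.2 * qexpCoef t⁻¹ ij.2) = 0 := by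
  have key : ∀ j, (t ^ (j + 1) * qexpCoef t⁻¹ (j + 1)) * (1 - t ^ (j + 1)) =
      - t ^ j * (1 - t) ^ 2 * (t ^ j * qexpCoef t⁻¹ j) := by
    intro j
    have h := qexpCoef_succ ht.inv j
    have h0 := ht.ne_zero
    have e1 : (1 - t ^ (j + 1)) = - t ^ (j + 1) * (1 - t⁻¹ ^ (j + 1)) := by
      have : t ^ (j + 1) * t⁻¹ ^ (j + 1) = 1 := by rw [← mul_pow, mul_inv_cancel₀ h0, one_pow]
      linear_combination -this
    have e2 : (1 - t) ^ 2 = t ^ 2 * (1 - t⁻¹) ^ 2 := by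
      field_simp
      ring
    rw [e1, e2]
    linear_combination (-(t ^ (j + 1)) ^ 2) * h
  set P : ℕ → ℂ := fun n => ∑ ij ∈ Finset.HasAntidiagonal.antidiagonal n,
      qexpCoef t ij.1 * (t ^ ij.2 * qexpCoef t⁻¹ ij.2) with hP
  -- Split 1 - t^(i+j) = (1 - t^i) + t^i (1 - t^j); the coefficient recursions lower i in the first
  -- piece and j in the second. The two reindexed sums combine to the factor 1 - t^n, which vanishes
  -- at n = 0 and thereby kills P 1, then all later terms.
  have rec_ : ∀ n, (1 - t ^ (n + 1)) * P (n + 1) = (1 - t) ^ 2 * (1 - t ^ n) * P n := by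
    intro n
    have e : (1 - t ^ (n + 1)) * P (n + 1) =
        (∑ ij ∈ Finset.HasAntidiagonal.antidiagonal (n + 1), qexpCoef t ij.1 * (1 - t ^ ij.1) *
            (t ^ ij.2 * qexpCoef t⁻¹ ij.2)) +
        ∑ ij ∈ Finset.HasAntidiagonal.antidiagonal (n + 1), t ^ ij.1 * qexpCoef t ij.1 *
            ((t ^ ij.2 * qexpCoef t⁻¹ ij.2) * (1 - t ^ ij.2)) := by
      rw [hP, Finset.mul_sum, ← Finset.sum_add_distrib]
      refine Finset.sum_congr rfl fun ij hij => ?_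
      have : ij.1 + ij.2 = n + 1 := by simpa using hij
      rw [← this, pow_add]
      ring
    rw [e, Finset.Nat.sum_antidiagonal_succ, Finset.Nat.sum_antidiagonal_succ']
    simp only [pow_zero, sub_self, mul_zero, zero_mul, zero_add, add_zero]
    rw [hP, Finset.mul_sum, ← Finset.sum_add_distrib]
    refine Finset.sum_congr rfl fun ij hij => ?_
    have : ij.1 + ij.2 = n := by simpa using hij
    rw [qexpCoef_succ ht, key, ← this, pow_add]
    ring
  have : ∀ n, P (n + 1) = 0 := by
    intro n
    induction n with
    | zero =>
      have := rec_ 0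
      simp only [pow_zero, sub_self, mul_zero, zero_mul] at this
      exact (mul_eq_zero.mp this).resolve_left (ht.one_sub_ne 0)
    | succ n ih =>
      have := rec_ (n + 1)
      rw [ih, mul_zero] at this
      exact (mul_eq_zero.mp this).resolve_left (ht.one_sub_ne (n + 1))
  exact this n

section Algebra

variable {A B : Type} [Ring A] [Algebra ℂ A] [Ring B] [Algebra ℂ B]

lemma sum_mul_sum_antidiagonal {u v : ℕ → B} {N : ℕ} (hu : ∀ i, N ≤ i → u i = 0)
    (hv : ∀ i, N ≤ i → v i = 0) :
    (∑ i ∈ Finset.range N, u i) * ∑ j ∈ Finset.range N, v j =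
      ∑ n ∈ Finset.range (2 * N), ∑ ij ∈ Finset.HasAntidiagonal.antidiagonal n, u ij.1 * v ij.2 := by
  rw [Finset.sum_mul_sum, ← Finset.sum_product',
    ← Finset.sum_fiberwise_of_maps_to (t := Finset.range (2 * N)) (g := fun x => x.1 + x.2)]
  · refine Finset.sum_congr rfl fun n _ => ?_
    refine Finset.sum_subset ?_ ?_
    · intro x hx
      simp only [Finset.mem_filter] at hx
      simpa using hx.2
    · intro x hx hx'
      simp only [Finset.mem_filter, Finset.mem_product, Finset.mem_range, not_and,
        Finset.mem_antidiagonal] at hx hx'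
      rcases le_or_gt N x.1 with h | h
      · rw [hu _ h, zero_mul]
      · rcases le_or_gt N x.2 with h' | h'
        · rw [hv _ h', mul_zero]
        · exact absurd (by simpa using hx) (hx' ⟨h, h'⟩)
  · intro x hx
    simp only [Finset.mem_product, Finset.mem_range] at hx ⊢
    omega

/-- The quantum exponential of a nilpotent element. -/
def qexp (t : ℂ) (x : B) : B := ∑ᶠ n, qexpCoef t n • x ^ n

/-- Any order of nilpotency serves as the cut-off, so several exponentials can be truncated at a
common order. -/
lemma qexp_eq_sum (t : ℂ) {x : B} {N : ℕ} (h : x ^ N = 0) :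
    qexp t x = ∑ n ∈ Finset.range N, qexpCoef t n • x ^ n := by
  refine finsum_eq_sum_of_support_subset _ fun n hn => ?_
  by_contra hc
  simp only [Finset.coe_range, Set.mem_Iio, not_lt] at hc
  exact hn (by simp [pow_eq_zero_of_le hc h])

lemma semiconjBy_qexp (t : ℂ) {y a b : B} (h : SemiconjBy y a b) (ha : IsNilpotent a)
    (hb : IsNilpotent b) : SemiconjBy y (qexp t a) (qexp t b) := by
  obtain ⟨N, hN⟩ := ha
  obtain ⟨M, hM⟩ := hb
  rw [qexp_eq_sum t (pow_eq_zero_of_le (le_max_left N M) hN),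
    qexp_eq_sum t (pow_eq_zero_of_le (le_max_right N M) hM), SemiconjBy, Finset.mul_sum,
    Finset.sum_mul]
  refine Finset.sum_congr rfl fun n _ => ?_
  rw [mul_smul_comm, smul_mul_assoc, (h.pow_right n).eq]

lemma commute_qexp (t : ℂ) {y a : B} (h : Commute y a) (ha : IsNilpotent a) :
    Commute y (qexp t a) :=
  semiconjBy_qexp t h ha ha

lemma map_qexp (f : A →ₐ[ℂ] B) (t : ℂ) {x : A} (hx : IsNilpotent x) :
    f (qexp t x) = qexp t (f x) := by
  obtain ⟨N, hN⟩ := hx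
  rw [qexp_eq_sum t hN, qexp_eq_sum t (N := N) (by rw [← map_pow, hN, map_zero])]
  simp

/-- The q-binomial theorem in divided powers. In degree n + 1, multiply by 1 - t^(n+1) = (1 - t^i) +
t^i (1 - t^j): the first piece strips an `a` from the left, and in the second the factor t^i is the
cost of moving a `b` past a^i. -/
lemma qexpCoef_smul_add_pow {t : ℂ} (ht : Generic t) {a b : B} (hab : b * a = t • (a * b))
    (n : ℕ) : qexpCoef t n • (a + b) ^ n = ∑ ij ∈ Finset.HasAntidiagonal.antidiagonal n,
      (qexpCoef t ij.1 • a ^ ij.1) * (qexpCoef t ij.2 • b ^ ij.2) := by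
  have hb : ∀ i, b * a ^ i = t ^ i • (a ^ i * b) := by
    intro i
    induction i with
    | zero => simp
    | succ i ih =>
      rw [pow_succ, ← mul_assoc, ih, smul_mul_assoc, mul_assoc, hab, mul_smul_comm, smul_smul,
        ← mul_assoc, ← pow_succ, ← pow_succ]
  induction n with
  | zero => simp
  | succ n ih =>
    have h1 := ht.one_sub_ne n
    have e0 : (1 - t ^ (n + 1)) • (qexpCoef t (n + 1) • (a + b) ^ (n + 1)) =
        (1 - t) ^ 2 • ((a + b) * (qexpCoef t n • (a + b) ^ n)) := by
      rw [smul_smul, mul_comm, qexpCoef_succ ht, mul_smul_comm, ← pow_succ', smul_smul]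
    have e1 : (1 - t ^ (n + 1)) • ∑ ij ∈ Finset.HasAntidiagonal.antidiagonal (n + 1),
        (qexpCoef t ij.1 • a ^ ij.1) * (qexpCoef t ij.2 • b ^ ij.2) =
        (∑ ij ∈ Finset.HasAntidiagonal.antidiagonal (n + 1), (qexpCoef t ij.1 * (1 - t ^ ij.1) *
            qexpCoef t ij.2) • (a ^ ij.1 * b ^ ij.2)) +
        ∑ ij ∈ Finset.HasAntidiagonal.antidiagonal (n + 1), (t ^ ij.1 * qexpCoef t ij.1 *
            (qexpCoef t ij.2 * (1 - t ^ ij.2))) • (a ^ ij.1 * b ^ ij.2) := by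
      rw [Finset.smul_sum, ← Finset.sum_add_distrib]
      refine Finset.sum_congr rfl fun ij hij => ?_
      have : ij.1 + ij.2 = n + 1 := by simpa using hij
      rw [smul_mul_smul_comm, smul_smul, ← add_smul, ← this, pow_add]
      congr 1
      ring
    refine smul_right_injective B h1 ?_
    simp only
    rw [e0, e1, ih, Finset.Nat.sum_antidiagonal_succ, Finset.Nat.sum_antidiagonal_succ',
      Finset.mul_sum, Finset.smul_sum]
    simp only [pow_zero, sub_self, mul_zero, zero_mul, zero_add, add_zero, zero_smul]
    rw [← Finset.sum_add_distrib]
    refine Finset.sum_congr rfl fun ij hij => ?_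
    rw [qexpCoef_succ ht, qexpCoef_succ ht, smul_mul_smul_comm, mul_smul_comm, add_mul,
      ← mul_assoc, ← mul_assoc, ← pow_succ', hb, smul_mul_assoc, mul_assoc _ b, ← pow_succ',
      smul_smul, smul_add, smul_smul]
    congr 2 <;> ring

/-- In degree N + M every term of the q-binomial expansion contains a vanishing power of `a` or of
`b`, and the coefficient of (a + b)^(N+M) is nonzero because t is not a root of unity. -/
lemma isNilpotent_add_of_q_commute {t : ℂ} (ht : Generic t) {a b : B}
    (hab : b * a = t • (a * b)) (ha : IsNilpotent a) (hb : IsNilpotent b) :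
    IsNilpotent (a + b) := by
  obtain ⟨N, hN⟩ := ha
  obtain ⟨M, hM⟩ := hb
  refine ⟨N + M, ?_⟩
  have h := qexpCoef_smul_add_pow ht hab (N + M)
  rw [Finset.sum_eq_zero] at h
  · exact (smul_eq_zero.mp h).resolve_left (qexpCoef_ne_zero ht _)
  · intro ij hij
    have : ij.1 + ij.2 = N + M := by simpa using hij
    rcases le_or_gt N ij.1 with h | h
    · simp [pow_eq_zero_of_le h hN]
    · simp [pow_eq_zero_of_le (show M ≤ ij.2 by omega) hM]

lemma qexp_add {t : ℂ} (ht : Generic t) {a b : B} (hab : b * a = t • (a * b))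
    (ha : IsNilpotent a) (hb : IsNilpotent b) :
    qexp t (a + b) = qexp t a * qexp t b := by
  obtain ⟨N₁, h1⟩ := ha
  obtain ⟨N₂, h2⟩ := hb
  obtain ⟨N₃, h3⟩ := isNilpotent_add_of_q_commute ht hab ⟨N₁, h1⟩ ⟨N₂, h2⟩
  set N := max N₁ (max N₂ N₃)
  have h1' := pow_eq_zero_of_le (show N₁ ≤ N by simp [N]) h1
  have h2' := pow_eq_zero_of_le (show N₂ ≤ N by simp [N]) h2
  have h3' := pow_eq_zero_of_le (show N₃ ≤ 2 * N by omega) h3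
  rw [qexp_eq_sum t h1', qexp_eq_sum t h2', qexp_eq_sum t h3', sum_mul_sum_antidiagonal]
  · exact Finset.sum_congr rfl fun n _ => qexpCoef_smul_add_pow ht hab n
  · intro i hi
    simp [pow_eq_zero_of_le hi h1']
  · intro i hi
    simp [pow_eq_zero_of_le hi h2']

/-- The inverse of the quantum exponential. -/
lemma qexp_mul_qexp_inv {t : ℂ} (ht : Generic t) {x : B} (hx : IsNilpotent x) :
    qexp t x * qexp t⁻¹ (t • x) = 1 := by
  obtain ⟨N, hN⟩ := hx
  have hN' : x ^ (N + 1) = 0 := pow_eq_zero_of_le (by omega) hN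
  have hN'' : (t • x) ^ (N + 1) = 0 := by rw [smul_pow, hN', smul_zero]
  rw [qexp_eq_sum _ hN', qexp_eq_sum _ hN'', sum_mul_sum_antidiagonal]
  · rw [show 2 * (N + 1) = (2 * N + 1) + 1 by ring, Finset.sum_range_succ']
    rw [Finset.sum_eq_zero]
    · simp
    · intro n _
      have : ∀ ij ∈ Finset.HasAntidiagonal.antidiagonal (n + 1), (qexpCoef t ij.1 • x ^ ij.1) *
          (qexpCoef t⁻¹ ij.2 • (t • x) ^ ij.2) =
          (qexpCoef t ij.1 * (t ^ ij.2 * qexpCoef t⁻¹ ij.2)) • x ^ (n + 1) := by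
        intro ij hij
        have : ij.1 + ij.2 = n + 1 := by simpa using hij
        rw [smul_pow, smul_smul, smul_mul_smul_comm, ← pow_add, this]
        congr 1
        ring
      rw [Finset.sum_congr rfl this, ← Finset.sum_smul, sum_qexpCoef_inv ht, zero_smul]
  · intro i hi
    simp [pow_eq_zero_of_le hi hN']
  · intro i hi
    simp [smul_pow, pow_eq_zero_of_le hi hN']

lemma commute_qexp_qexp (s t : ℂ) {x y : B} (hxy : Commute x y) (hx : IsNilpotent x)
    (hy : IsNilpotent y) : Commute (qexp s x) (qexp t y) :=
  commute_qexp t (commute_qexp s hxy.symm hx).symm hy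

/-- The explicit right inverse is also a polynomial in x, so it commutes with the exponential and is
two-sided. -/
lemma isUnit_qexp {t : ℂ} (ht : Generic t) {x : B} (hx : IsNilpotent x) : IsUnit (qexp t x) := by
  have h := qexp_mul_qexp_inv ht hx
  refine ⟨⟨qexp t x, qexp t⁻¹ (t • x), h, ?_⟩, rfl⟩
  rw [← h]
  exact (commute_qexp_qexp _ _ ((Commute.refl x).smul_right t) hx
    (hx.smul t)).eq.symm

/-- The intertwining property of the quantum exponential. -/
lemma add_mul_qexp {t : ℂ} (ht : Generic t) {x z a b : B} (hx : IsNilpotent x)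
    (hz : (1 - t) • (z * x - x * z) = a - b) (ha : a * x = t • (x * a))
    (hb : x * b = t • (b * x)) : (z + b) * qexp t x = qexp t x * (z + a) := by
  have h1 := ht.one_sub_ne'
  have hbn : ∀ n, x ^ n * b = t ^ n • (b * x ^ n) := by
    intro n
    induction n with
    | zero => simp
    | succ n ih =>
      rw [pow_succ', mul_assoc, ih, mul_smul_comm, ← mul_assoc, hb, smul_mul_assoc, smul_smul,
        mul_assoc, ← pow_succ, ← pow_succ']
  -- By the Leibniz rule the commutator with x^(n+1) is a sum of n + 1 copies of a and b moved to
  -- the ends, with powers of t that form a geometric series; its sum 1 - t^(n+1) is the factor in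
  -- the coefficient recursion.
  have hcomm : ∀ n, (1 - t) ^ 2 • (z * x ^ (n + 1) - x ^ (n + 1) * z) =
      (1 - t ^ (n + 1)) • (x ^ n * a - b * x ^ n) := by
    intro n
    induction n with
    | zero => simp [pow_two, mul_smul, hz]
    | succ n ih =>
      have e : z * x ^ (n + 1 + 1) - x ^ (n + 1 + 1) * z =
          (z * x ^ (n + 1) - x ^ (n + 1) * z) * x + x ^ (n + 1) * (z * x - x * z) := by
        rw [pow_succ _ (n + 1)]
        noncomm_ring
      rw [e, smul_add, ← smul_mul_assoc, ih, ← mul_smul_comm, pow_two, mul_smul, hz]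
      rw [smul_mul_assoc, sub_mul, mul_assoc, ha, mul_smul_comm, ← mul_assoc, ← pow_succ,
        mul_assoc b, ← pow_succ, mul_smul_comm, mul_sub, hbn (n + 1)]
      module
  obtain ⟨N, hN⟩ := hx
  have hN1 : x ^ (N + 1) = 0 := pow_eq_zero_of_le (by omega) hN
  have hstep : ∀ n, qexpCoef t (n + 1) • (z * x ^ (n + 1) - x ^ (n + 1) * z) =
      qexpCoef t n • (x ^ n * a - b * x ^ n) := by
    intro n
    refine smul_right_injective B (pow_ne_zero 2 h1) ?_
    simp only
    rw [smul_comm, hcomm, smul_smul, qexpCoef_succ ht, smul_smul]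
  -- The recursion lowers the degree by one, so the left side is truncated at N + 1 and the right
  -- side at N; the degree-zero term on the left is the commutator with 1.
  have hsub : z * qexp t x - qexp t x * z = qexp t x * a - b * qexp t x := by
    rw [qexp_eq_sum t hN1]
    nth_rewrite 3 [← qexp_eq_sum t hN1]
    nth_rewrite 3 [← qexp_eq_sum t hN1]
    rw [qexp_eq_sum t hN]
    simp only [Finset.mul_sum, Finset.sum_mul, ← Finset.sum_sub_distrib, mul_smul_comm,
      smul_mul_assoc, ← smul_sub]
    rw [Finset.sum_range_succ']
    simp only [hstep]
    simp
  rw [add_mul, mul_add]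
  have := sub_eq_sub_iff_add_eq_add.mp hsub
  rw [this]
  abel

end Algebra

/-! ### Universal R-matrix identities -/

namespace GenImages

variable {A B : Type}

/-- All four images satisfy `P`. -/
def All (P : A → Prop) (T : GenImages A) : Prop := P T.K ∧ P T.Kinv ∧ P T.X ∧ P T.Y

/-- The transport along a map. -/
def map (f : A → B) (T : GenImages A) : GenImages B := ⟨f T.K, f T.Kinv, f T.X, f T.Y⟩

/-- The images under the Chevalley involution. -/
def flip (T : GenImages A) : GenImages A := ⟨T.Kinv, T.K, T.Y, T.X⟩

lemma All.imp {P P' : A → Prop} (h : ∀ a, P a → P' a) {T : GenImages A} (hT : T.All P) :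
    T.All P' :=
  ⟨h _ hT.1, h _ hT.2.1, h _ hT.2.2.1, h _ hT.2.2.2⟩

lemma All.flip {P : A → Prop} {T : GenImages A} (hT : T.All P) : T.flip.All P :=
  ⟨hT.2.1, hT.1, hT.2.2.2, hT.2.2.1⟩

lemma All.of_forall {P : A → Prop} (h : ∀ a, P a) (T : GenImages A) : T.All P :=
  ⟨h _, h _, h _, h _⟩

lemma All.map {P : B → Prop} {f : A → B} {T : GenImages A} (h : T.All fun a => P (f a)) :
    (T.map f).All P := h

variable [Ring A] [Algebra ℂ A] [Ring B] [Algebra ℂ B]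

/-- `𝒦𝒳`. -/
def e (T : GenImages A) : A := T.K * T.X

/-- `𝒦⁻¹𝒴`. -/
def f (T : GenImages A) : A := T.Kinv * T.Y

/-- The images in two commuting factors. -/
def Comm (S T : GenImages A) : Prop := S.All fun a => T.All fun b => Commute a b

lemma Comm.symm {S T : GenImages A} (h : S.Comm T) : T.Comm S := by
  obtain ⟨⟨h1, h2, h3, h4⟩, ⟨h5, h6, h7, h8⟩, ⟨h9, h10, h11, h12⟩, ⟨h13, h14, h15, h16⟩⟩ := h
  exact ⟨⟨h1.symm, h5.symm, h9.symm, h13.symm⟩, ⟨h2.symm, h6.symm, h10.symm, h14.symm⟩,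
    ⟨h3.symm, h7.symm, h11.symm, h15.symm⟩, ⟨h4.symm, h8.symm, h12.symm, h16.symm⟩⟩

lemma Comm.flip {S T : GenImages A} (h : S.Comm T) : S.flip.Comm T.flip :=
  All.flip (h.imp fun _ ha => ha.flip)

lemma Comm.map (φ : A →ₐ[ℂ] B) {S T : GenImages A} (h : S.Comm T) :
    (S.map φ).Comm (T.map φ) :=
  All.map (h.imp fun _ ha => All.map (ha.imp fun _ hab => hab.map φ))

lemma All.comul {P : A → Prop} (hadd : ∀ a b, P a → P b → P (a + b))
    (hmul : ∀ a b, P a → P b → P (a * b)) {S T : GenImages A} (hS : S.All P) (hT : T.All P) :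
    (S.comul T).All P :=
  ⟨hmul _ _ hS.1 hT.1, hmul _ _ hS.2.1 hT.2.1,
    hadd _ _ (hmul _ _ hS.2.2.1 hT.1) (hmul _ _ hS.2.1 hT.2.2.1),
    hadd _ _ (hmul _ _ hS.2.2.2 hT.1) (hmul _ _ hS.2.1 hT.2.2.2)⟩

lemma All.commute_comul {a : A} {S T : GenImages A} (hS : S.All (Commute a))
    (hT : T.All (Commute a)) : (S.comul T).All (Commute a) :=
  All.comul (fun _ _ h h' => h.add_right h') (fun _ _ h h' => h.mul_right h') hS hT

lemma Comm.comul_left {S T U : GenImages A} (hS : S.Comm U) (hT : T.Comm U) :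
    (S.comul T).Comm U :=
  Comm.symm <| All.imp (fun _ h => All.commute_comul h.1 h.2)
    (show U.All fun a => S.All (Commute a) ∧ T.All (Commute a) from
      let h := hS.symm; let h' := hT.symm
      ⟨⟨h.1, h'.1⟩, ⟨h.2.1, h'.2.1⟩, ⟨h.2.2.1, h'.2.2.1⟩, ⟨h.2.2.2, h'.2.2.2⟩⟩)

lemma map_comul (φ : A →ₐ[ℂ] B) (S T : GenImages A) :
    (S.comul T).map φ = (S.map φ).comul (T.map φ) := by
  simp [map, comul]

lemma comul_assoc (S T U : GenImages A) :
    (S.comul T).comul U = S.comul (T.comul U) := by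
  simp only [comul, mul_assoc, add_mul, mul_add, add_assoc]

/-- The Chevalley involution reverses the coproduct. This lets each identity for 𝒳, or for Δ ⊗ id,
be reused for 𝒴, or for id ⊗ Δ. -/
lemma flip_comul {S T : GenImages A} (h : S.Comm T) :
    (S.comul T).flip = T.flip.comul S.flip := by
  obtain ⟨⟨h1, h2, h3, h4⟩, ⟨h5, h6, h7, h8⟩, ⟨h9, h10, h11, h12⟩, ⟨h13, h14, h15, h16⟩⟩ := h
  simp only [flip, comul, h1.eq, h6.eq, h7.eq, h8.eq, h9.eq, h13.eq, add_comm]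

end GenImages


section Universal

variable {A B : Type} [Ring A] [Algebra ℂ A] [Ring B] [Algebra ℂ B] {Q : ℂ}

/-- The relations between the images of `𝒦, 𝒦⁻¹, 𝒳, 𝒴`. -/
structure Rels (Q : ℂ) (T : GenImages B) : Prop where
  K_Kinv : T.K * T.Kinv = 1
  Kinv_K : T.Kinv * T.K = 1
  K_X : T.K * T.X = Q • (T.X * T.K)
  K_Y : T.K * T.Y = Q⁻¹ • (T.Y * T.K)
  X_Y : (Q - Q⁻¹) • (T.X * T.Y - T.Y * T.X) = T.K * T.K - T.Kinv * T.Kinv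

namespace Rels

lemma inv_comm {T : GenImages B} (h : Rels Q T) {c : ℂ} (hc : c ≠ 0) {x : B}
    (hx : T.K * x = c • (x * T.K)) : T.Kinv * x = c⁻¹ • (x * T.Kinv) := by
  have : x * T.Kinv = c • (T.Kinv * x) := by
    calc x * T.Kinv = T.Kinv * (T.K * x) * T.Kinv := by
          rw [← mul_assoc, h.Kinv_K, one_mul]
      _ = c • (T.Kinv * x * (T.K * T.Kinv)) := by
          rw [hx]; simp only [mul_smul_comm, smul_mul_assoc, mul_assoc]
      _ = _ := by rw [h.K_Kinv, mul_one]
  rw [this, smul_smul, inv_mul_cancel₀ hc, one_smul]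

lemma Kinv_X {T : GenImages B} (hQ : Generic Q) (h : Rels Q T) :
    T.Kinv * T.X = Q⁻¹ • (T.X * T.Kinv) :=
  h.inv_comm hQ.ne_zero h.K_X

lemma Kinv_Y {T : GenImages B} (hQ : Generic Q) (h : Rels Q T) :
    T.Kinv * T.Y = Q • (T.Y * T.Kinv) := by
  simpa using h.inv_comm (inv_ne_zero hQ.ne_zero) h.K_Y

lemma flip {T : GenImages B} (hQ : Generic Q) (h : Rels Q T) : Rels Q T.flip where
  K_Kinv := h.Kinv_K
  Kinv_K := h.K_Kinv
  K_X := h.Kinv_Y hQ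
  K_Y := h.Kinv_X hQ
  X_Y := by
    have := congrArg Neg.neg h.X_Y
    rw [← smul_neg, neg_sub, neg_sub] at this
    exact this

lemma map (φ : A →ₐ[ℂ] B) {T : GenImages A} (h : Rels Q T) : Rels Q (T.map φ) where
  K_Kinv := by simpa [GenImages.map] using congrArg φ h.K_Kinv
  Kinv_K := by simpa [GenImages.map] using congrArg φ h.Kinv_K
  K_X := by simpa [GenImages.map] using congrArg φ h.K_X
  K_Y := by simpa [GenImages.map] using congrArg φ h.K_Y
  X_Y := by simpa [GenImages.map] using congrArg φ h.X_Y

lemma counit : Rels Q (GenImages.counit : GenImages B) := by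
  constructor <;> simp [GenImages.counit]

lemma comul (hQ : Generic Q) {S T : GenImages B} (hS : Rels Q S) (hT : Rels Q T)
    (h : S.Comm T) : Rels Q (S.comul T) := by
  have hST := h
  obtain ⟨⟨h1, h2, h3, h4⟩, ⟨h5, h6, h7, h8⟩, ⟨h9, h10, h11, h12⟩, ⟨h13, h14, h15, h16⟩⟩ := h
  constructor
  · change S.K * T.K * (S.Kinv * T.Kinv) = 1
    rw [h5.symm.mul_mul_mul_comm, hS.K_Kinv, hT.K_Kinv, one_mul]
  · change S.Kinv * T.Kinv * (S.K * T.K) = 1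
    rw [h2.symm.mul_mul_mul_comm, hS.Kinv_K, hT.Kinv_K, one_mul]
  · change S.K * T.K * (S.X * T.K + S.Kinv * T.X) = Q • ((S.X * T.K + S.Kinv * T.X) * (S.K * T.K))
    rw [mul_add, add_mul, h9.symm.mul_mul_mul_comm, h5.symm.mul_mul_mul_comm,
      h1.symm.mul_mul_mul_comm, h3.symm.mul_mul_mul_comm, hS.K_X, hT.K_X, hS.K_Kinv, hS.Kinv_K,
      smul_add, smul_mul_assoc, mul_smul_comm]
  · change S.K * T.K * (S.Y * T.K + S.Kinv * T.Y) =
      Q⁻¹ • ((S.Y * T.K + S.Kinv * T.Y) * (S.K * T.K))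
    rw [mul_add, add_mul, h13.symm.mul_mul_mul_comm, h5.symm.mul_mul_mul_comm,
      h1.symm.mul_mul_mul_comm, h4.symm.mul_mul_mul_comm, hS.K_Y, hT.K_Y, hS.K_Kinv, hS.Kinv_K,
      smul_add, smul_mul_assoc, mul_smul_comm]
  · change (Q - Q⁻¹) • ((S.X * T.K + S.Kinv * T.X) * (S.Y * T.K + S.Kinv * T.Y) -
      (S.Y * T.K + S.Kinv * T.Y) * (S.X * T.K + S.Kinv * T.X)) =
      S.K * T.K * (S.K * T.K) - S.Kinv * T.Kinv * (S.Kinv * T.Kinv)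
    -- The mixed terms commute, as both legs contribute the same power of Q. What remains is [X,Y] ⊗
    -- K² + K⁻² ⊗ [X,Y], which telescopes.
    have e1 : S.X * T.K * (S.Kinv * T.Y) = S.Kinv * T.Y * (S.X * T.K) := by
      rw [h5.symm.mul_mul_mul_comm, h12.symm.mul_mul_mul_comm, hS.Kinv_X hQ, hT.K_Y]
      simp only [smul_mul_assoc, mul_smul_comm]
    have e2 : S.Kinv * T.X * (S.Y * T.K) = S.Y * T.K * (S.Kinv * T.X) := by
      rw [h15.symm.mul_mul_mul_comm, h5.symm.mul_mul_mul_comm, hS.Kinv_Y hQ, hT.K_X]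
      simp only [smul_mul_assoc, mul_smul_comm]
    have e3 : (S.X * T.K + S.Kinv * T.X) * (S.Y * T.K + S.Kinv * T.Y) -
        (S.Y * T.K + S.Kinv * T.Y) * (S.X * T.K + S.Kinv * T.X) =
        (S.X * S.Y - S.Y * S.X) * (T.K * T.K) +
        (S.Kinv * S.Kinv) * (T.X * T.Y - T.Y * T.X) := by
      rw [add_mul, mul_add, mul_add, add_mul, mul_add, mul_add, e1, e2,
        h13.symm.mul_mul_mul_comm, h9.symm.mul_mul_mul_comm, h7.symm.mul_mul_mul_comm,
        h8.symm.mul_mul_mul_comm]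
      noncomm_ring
    rw [e3, smul_add, ← smul_mul_assoc, ← mul_smul_comm, hS.X_Y, hT.X_Y,
      h1.symm.mul_mul_mul_comm, h6.symm.mul_mul_mul_comm]
    noncomm_ring

end Rels

/-! ### The Cartan element and the intertwining property of R -/

/-- The commutation relations of `θ = 𝐪^{(H⊗H)/2}`. -/
structure IsCartan (S T : GenImages B) (θ : B) : Prop where
  SK : Commute θ S.K
  SKinv : Commute θ S.Kinv
  TK : Commute θ T.K
  TKinv : Commute θ T.Kinv
  SX : θ * S.X = S.X * (T.K * T.K) * θ
  SY : θ * S.Y = S.Y * (T.Kinv * T.Kinv) * θ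
  TX : θ * T.X = T.X * (S.K * S.K) * θ
  TY : θ * T.Y = T.Y * (S.Kinv * S.Kinv) * θ

lemma IsCartan.symm {S T : GenImages B} {θ : B} (h : IsCartan S T θ) : IsCartan T S θ :=
  ⟨h.TK, h.TKinv, h.SK, h.SKinv, h.TX, h.TY, h.SX, h.SY⟩

lemma IsCartan.flip {S T : GenImages B} {θ : B} (h : IsCartan S T θ) :
    IsCartan S.flip T.flip θ :=
  ⟨h.SKinv, h.SK, h.TKinv, h.TK, h.SY, h.SX, h.TY, h.TX⟩

lemma IsCartan.map (φ : A →ₐ[ℂ] B) {S T : GenImages A} {θ : A} (h : IsCartan S T θ) :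
    IsCartan (S.map φ) (T.map φ) (φ θ) where
  SK := h.SK.map φ
  SKinv := h.SKinv.map φ
  TK := h.TK.map φ
  TKinv := h.TKinv.map φ
  SX := by simpa [GenImages.map] using congrArg φ h.SX
  SY := by simpa [GenImages.map] using congrArg φ h.SY
  TX := by simpa [GenImages.map] using congrArg φ h.TX
  TY := by simpa [GenImages.map] using congrArg φ h.TY

/-- Two commuting sets of images, between which the universal R-matrix is defined. -/
structure Pair (Q : ℂ) (S T : GenImages B) (θ : B) : Prop where
  relS : Rels Q S
  relT : Rels Q T
  comm : S.Comm T
  cartan : IsCartan S T θ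
  unit : IsUnit θ
  nilST : IsNilpotent (S.e * T.f)
  nilTS : IsNilpotent (T.e * S.f)

/-- The image of the universal R-matrix. -/
def RUniv (Q : ℂ) (S T : GenImages B) (θ : B) : B := θ * qexp (Q⁻¹ ^ 2) (S.e * T.f)

lemma Generic.inv_sq (hQ : Generic Q) : Generic (Q⁻¹ ^ 2) := hQ.inv.sq

lemma GenImages.Comm.e_f {S T : GenImages B} (h : S.Comm T) : Commute S.e T.f :=
  .mul_left (.mul_right h.1.2.1 h.1.2.2.2) (.mul_right h.2.2.1.2.1 h.2.2.1.2.2.2)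

namespace Pair

variable {S T : GenImages B} {θ : B}

lemma symm (h : Pair Q S T θ) : Pair Q T S θ :=
  ⟨h.relT, h.relS, h.comm.symm, h.cartan.symm, h.unit, h.nilTS, h.nilST⟩

lemma flip (hQ : Generic Q) (h : Pair Q S T θ) : Pair Q T.flip S.flip θ where
  relS := h.relT.flip hQ
  relT := h.relS.flip hQ
  comm := h.comm.flip.symm
  cartan := h.cartan.flip.symm
  unit := h.unit
  nilST := by
    rw [show T.flip.e * S.flip.f = S.e * T.f from h.comm.e_f.eq.symm]
    exact h.nilST
  nilTS := by
    rw [show S.flip.e * T.flip.f = T.e * S.f from h.comm.symm.e_f.eq.symm]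
    exact h.nilTS

/-- Flipping both legs and exchanging them turns e ⊗ f into itself. -/
lemma RUniv_flip (h : Pair Q S T θ) : RUniv Q T.flip S.flip θ = RUniv Q S T θ := by
  rw [RUniv, RUniv, show T.flip.e * S.flip.f = S.e * T.f from h.comm.e_f.eq.symm]

lemma map (φ : A →ₐ[ℂ] B) {S T : GenImages A} {θ : A} (h : Pair Q S T θ) :
    Pair Q (S.map φ) (T.map φ) (φ θ) where
  relS := h.relS.map φ
  relT := h.relT.map φ
  comm := h.comm.map φ
  cartan := h.cartan.map φ
  unit := h.unit.map φ
  nilST := by simpa [GenImages.e, GenImages.f, GenImages.map] using h.nilST.map φ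
  nilTS := by simpa [GenImages.e, GenImages.f, GenImages.map] using h.nilTS.map φ

lemma map_RUniv (φ : A →ₐ[ℂ] B) {S T : GenImages A} {θ : A} (h : Pair Q S T θ) :
    φ (RUniv Q S T θ) = RUniv Q (S.map φ) (T.map φ) (φ θ) := by
  rw [RUniv, map_mul, map_qexp φ _ h.nilST]
  simp [RUniv, GenImages.e, GenImages.f, GenImages.map]

lemma isUnit_RUniv (hQ : Generic Q) (h : Pair Q S T θ) : IsUnit (RUniv Q S T θ) :=
  h.unit.mul (isUnit_qexp hQ.inv_sq h.nilST)

/-- Conjugation by θ turns Δ^op(𝒳) into 𝒦⁻¹ ⊗ 𝒳 + 𝒳 ⊗ 𝒦⁻³, and the quantum exponential exchanges the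
last summand for 𝒳 ⊗ 𝒦, which restores Δ(𝒳). -/
lemma RUniv_X (hQ : Generic Q) (h : Pair Q S T θ) :
    RUniv Q S T θ * (S.comul T).X = (T.comul S).X * RUniv Q S T θ := by
  obtain ⟨⟨h1, h2, h3, h4⟩, ⟨h5, h6, h7, h8⟩, ⟨h9, h10, h11, h12⟩, ⟨h13, h14, h15, h16⟩⟩ := h.comm
  have hS := h.relS
  have hT := h.relT
  have hQ0 := hQ.ne_zero
  -- The roles in `add_mul_qexp`: z + a is the coproduct of 𝒳, and z + b is its opposite coproduct
  -- conjugated by the inverse of θ.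
  set a := S.X * T.K with ha
  set z := S.Kinv * T.X with hz
  set b := S.X * (T.Kinv * (T.Kinv * T.Kinv)) with hb
  set x := S.e * T.f with hx
  have hθ : (T.comul S).X * θ = θ * (z + b) := by
    change (T.X * S.K + T.Kinv * S.X) * θ = _
    have e1 : θ * z = T.X * S.K * θ := by
      rw [hz, ← mul_assoc, h.cartan.SKinv.eq, mul_assoc, h.cartan.TX, ← mul_assoc, ← mul_assoc,
        h7.eq, mul_assoc T.X, ← mul_assoc S.Kinv, hS.Kinv_K, one_mul]
    have e2 : θ * b = T.Kinv * S.X * θ := by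
      rw [hb, ← mul_assoc, h.cartan.SX, mul_assoc _ θ,
        (h.cartan.TKinv.mul_right (h.cartan.TKinv.mul_right h.cartan.TKinv)).eq, ← mul_assoc,
        ← h10.eq, mul_assoc S.X]
      congr 2
      rw [mul_assoc, ← mul_assoc T.K T.Kinv, hT.K_Kinv, one_mul, ← mul_assoc, hT.K_Kinv, one_mul]
    rw [mul_add, e1, e2, add_mul]
  have hXe : S.Kinv * S.e = S.X := by rw [GenImages.e, ← mul_assoc, hS.Kinv_K, one_mul]
  have heX : S.e * S.Kinv = Q • S.X := by
    have := hS.Kinv_X hQ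
    have e : S.X * S.Kinv = Q • (S.Kinv * S.X) := by
      rw [this, smul_smul, mul_inv_cancel₀ hQ0, one_smul]
    rw [GenImages.e, mul_assoc, e, mul_smul_comm, ← mul_assoc, hS.K_Kinv, one_mul]
  have hXf : T.X * T.f = Q • (T.Kinv * (T.X * T.Y)) := by
    have := hT.Kinv_X hQ
    have e : T.X * T.Kinv = Q • (T.Kinv * T.X) := by
      rw [this, smul_smul, mul_inv_cancel₀ hQ0, one_smul]
    rw [GenImages.f, ← mul_assoc, e, smul_mul_assoc, mul_assoc]
  have cf (y : B) (hy1 : Commute y T.Kinv) (hy2 : Commute y T.Y) : Commute y T.f :=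
    hy1.mul_right hy2
  have ce (y : B) (hy1 : Commute y S.K) (hy2 : Commute y S.X) : Commute y S.e :=
    hy1.mul_right hy2
  have hSXe : S.X * S.e = Q⁻¹ • (S.e * S.X) := by
    rw [GenImages.e, hS.K_X, smul_mul_assoc, smul_smul, inv_mul_cancel₀ hQ0, one_smul, mul_assoc,
      hS.K_X, mul_smul_comm]
  have hKf : T.K * T.f = Q⁻¹ • (T.f * T.K) := by
    rw [GenImages.f, ← mul_assoc, hT.K_Kinv, one_mul, mul_assoc]
    have : T.Y * T.K = Q • (T.K * T.Y) := by
      rw [hT.K_Y, smul_smul, mul_inv_cancel₀ hQ0, one_smul]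
    rw [this, mul_smul_comm, smul_smul, inv_mul_cancel₀ hQ0, one_smul, ← mul_assoc, hT.Kinv_K,
      one_mul]
  have hKf' : T.Kinv * T.f = Q • (T.f * T.Kinv) := by
    simpa using hT.inv_comm (inv_ne_zero hQ0) hKf
  have key : (z + b) * qexp (Q⁻¹ ^ 2) x = qexp (Q⁻¹ ^ 2) x * (z + a) := by
    refine add_mul_qexp hQ.inv_sq h.nilST ?_ ?_ ?_
    · have e1 : z * x = S.X * (Q • (T.Kinv * (T.X * T.Y))) := by
        rw [hz, hx, (ce T.X h3.symm h11.symm).mul_mul_mul_comm, hXe, hXf]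
      have e2 : x * z = S.X * (Q • (T.Kinv * (T.Y * T.X))) := by
        rw [hz, hx, (cf S.Kinv h6 h8).symm.mul_mul_mul_comm, heX, GenImages.f, smul_mul_assoc,
          mul_smul_comm, mul_assoc]
      rw [e1, e2, ← mul_sub, ← smul_sub, ← mul_sub, ← mul_smul_comm, smul_smul, ← mul_smul_comm,
        show (1 - Q⁻¹ ^ 2) * Q = Q - Q⁻¹ by field_simp, hT.X_Y, ha, hb, mul_sub, mul_sub,
        ← mul_assoc T.Kinv T.K, hT.Kinv_K, one_mul]
    · rw [ha, hx, (ce T.K h1.symm h9.symm).mul_mul_mul_comm, (cf S.X h10 h12).symm.mul_mul_mul_comm,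
        hSXe, hKf, smul_mul_assoc, mul_smul_comm, smul_smul, pow_two]
    · rw [hb, hx]
      have c1 : Commute (T.Kinv * (T.Kinv * T.Kinv)) S.e :=
        (ce T.Kinv h2.symm h10.symm).mul_left
          ((ce T.Kinv h2.symm h10.symm).mul_left (ce T.Kinv h2.symm h10.symm))
      have e3 : T.Kinv * (T.Kinv * T.Kinv) * T.f =
          Q ^ 3 • (T.f * (T.Kinv * (T.Kinv * T.Kinv))) := by
        rw [mul_assoc, mul_assoc, hKf', mul_smul_comm, ← mul_assoc T.Kinv T.f, hKf',
          smul_mul_assoc, mul_smul_comm, mul_smul_comm, mul_assoc, ← mul_assoc T.Kinv T.f, hKf',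
          smul_mul_assoc, smul_smul, smul_smul, mul_assoc]
        congr 1
        · ring
        · simp only [mul_assoc]
      have e4 : S.e * S.X = Q • (S.X * S.e) := by
        rw [hSXe, smul_smul, mul_inv_cancel₀ hQ0, one_smul]
      rw [c1.mul_mul_mul_comm, (cf S.X h10 h12).symm.mul_mul_mul_comm, e3, e4, smul_mul_assoc,
        mul_smul_comm, smul_smul]
      congr 1
      field_simp
  rw [RUniv, ← mul_assoc, hθ, mul_assoc, mul_assoc, key]
  change _ = θ * (_ * (z + a))
  rw [add_comm z a]
  rfl

lemma RUniv_Y (hQ : Generic Q) (h : Pair Q S T θ) :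
    RUniv Q S T θ * (S.comul T).Y = (T.comul S).Y * RUniv Q S T θ := by
  -- The Chevalley involution exchanges 𝒳 and 𝒴 and fixes R.
  have := (h.flip hQ).RUniv_X hQ
  rw [h.RUniv_flip, ← flip_comul h.comm, ← flip_comul h.comm.symm] at this
  exact this

lemma commute_nil_K (h : Pair Q S T θ) : Commute (S.K * T.K) (S.e * T.f) := by
  obtain ⟨⟨h1, h2, h3, h4⟩, ⟨h5, h6, h7, h8⟩, ⟨h9, h10, h11, h12⟩, ⟨h13, h14, h15, h16⟩⟩ := h.comm
  -- Genericity is not assumed here; for Q = 0 the relation K X = Q X K makes `e` vanish. Otherwise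
  -- the weights Q of `e` and Q⁻¹ of `f` cancel.
  by_cases hQ0 : Q = 0
  · have e1 : S.K * S.X = 0 := by rw [h.relS.K_X, hQ0, zero_smul]
    simp [GenImages.e, e1]
  have c1 : Commute T.K S.e := h1.symm.mul_right h9.symm
  have c2 : Commute S.K T.f := h2.mul_right h4
  rw [commute_iff_eq, c1.mul_mul_mul_comm,
    c2.symm.mul_mul_mul_comm]
  have e1 : S.K * S.e = Q • (S.e * S.K) := by
    simp only [GenImages.e, mul_assoc]
    nth_rewrite 1 [h.relS.K_X]
    rw [mul_smul_comm]
  have e2 : T.K * T.f = Q⁻¹ • (T.f * T.K) := by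
    simp only [GenImages.f, mul_assoc]
    have : T.Y * T.K = Q • (T.K * T.Y) := by
      rw [h.relT.K_Y, smul_smul, mul_inv_cancel₀ hQ0, one_smul]
    rw [this, mul_smul_comm, smul_smul, inv_mul_cancel₀ hQ0, one_smul, ← mul_assoc, ← mul_assoc,
      h.relT.K_Kinv, h.relT.Kinv_K]
  rw [e1, e2, smul_mul_assoc, mul_smul_comm, smul_smul, mul_inv_cancel₀ hQ0, one_smul]

lemma RUniv_K (h : Pair Q S T θ) :
    RUniv Q S T θ * (S.comul T).K = (T.comul S).K * RUniv Q S T θ := by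
  change _ * (S.K * T.K) = (T.K * S.K) * _
  rw [← h.comm.1.1.eq]
  exact ((h.cartan.SK.mul_right h.cartan.TK).mul_left
    (commute_qexp _ h.commute_nil_K h.nilST).symm).eq

lemma RUniv_Kinv (h : Pair Q S T θ) :
    RUniv Q S T θ * (S.comul T).Kinv = (T.comul S).Kinv * RUniv Q S T θ := by
  change _ * (S.Kinv * T.Kinv) = (T.Kinv * S.Kinv) * _
  have hK : RUniv Q S T θ * (S.K * T.K) = (T.K * S.K) * RUniv Q S T θ := h.RUniv_K
  have e1 : T.Kinv * S.Kinv * (T.K * S.K) = 1 := by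
    rw [(h.comm.2.1.1 : Commute S.Kinv T.K).mul_mul_mul_comm, h.relS.Kinv_K, h.relT.Kinv_K,
      one_mul]
  have e2 : S.K * T.K * (S.Kinv * T.Kinv) = 1 := by
    rw [(h.comm.2.1.1 : Commute S.Kinv T.K).symm.mul_mul_mul_comm, h.relS.K_Kinv, h.relT.K_Kinv,
      one_mul]
  calc RUniv Q S T θ * (S.Kinv * T.Kinv)
      = T.Kinv * S.Kinv * (T.K * S.K) * RUniv Q S T θ * (S.Kinv * T.Kinv) := by rw [e1, one_mul]
    _ = T.Kinv * S.Kinv * RUniv Q S T θ * (S.K * T.K * (S.Kinv * T.Kinv)) := by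
        rw [mul_assoc _ _ (RUniv Q S T θ), ← hK]
        simp only [mul_assoc]
    _ = _ := by rw [e2, mul_one]

end Pair

lemma GenImages.comul_e {S T : GenImages B} (hS : Rels Q S) (h : S.Comm T) :
    (S.comul T).e = S.e * (T.K * T.K) + T.e := by
  change S.K * T.K * (S.X * T.K + S.Kinv * T.X) = _
  rw [mul_add, (h.2.2.1.1 : Commute S.X T.K).symm.mul_mul_mul_comm,
    (h.2.1.1 : Commute S.Kinv T.K).symm.mul_mul_mul_comm, hS.K_Kinv, one_mul]
  rfl

lemma e_mul_K_K (hQ : Generic Q) {S : GenImages B} (hS : Rels Q S) :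
    S.e * (S.K * S.K) = Q⁻¹ ^ 2 • ((S.K * S.K) * S.e) := by
  have e1 : S.e * S.K = Q⁻¹ • (S.K * S.e) := by
    simp only [GenImages.e, mul_assoc]
    rw [← mul_smul_comm, hS.K_X, smul_smul, inv_mul_cancel₀ hQ.ne_zero, one_smul]
  rw [← mul_assoc, e1, smul_mul_assoc, mul_assoc, e1, mul_smul_comm, smul_smul, pow_two, mul_assoc]

/-! ### The hexagon identities -/

section Comul

variable {S₁ S₂ T : GenImages B} {θ₁ θ₂ : B}

/-- The coproduct of `e` is e ⊗ K² + 1 ⊗ e, and its two summands q-commute with t = Q⁻²: exactly the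
situation of `qexp_add`. -/
lemma comul_nil_aux (hQ : Generic Q) (h₁ : Pair Q S₁ T θ₁) (h₂ : Pair Q S₂ T θ₂)
    (h : S₁.Comm S₂) :
    (S₁.comul S₂).e * T.f = S₁.e * T.f * (S₂.K * S₂.K) + S₂.e * T.f ∧
    IsNilpotent (S₁.e * T.f * (S₂.K * S₂.K)) ∧
    (S₂.e * T.f) * (S₁.e * T.f * (S₂.K * S₂.K)) =
      Q⁻¹ ^ 2 • ((S₁.e * T.f * (S₂.K * S₂.K)) * (S₂.e * T.f)) := by
  have cK : Commute T.f (S₂.K * S₂.K) := by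
    have : Commute T.f S₂.K := (h₂.comm.1.2.1.mul_right h₂.comm.1.2.2.2).symm
    exact this.mul_right this
  have c1K : Commute S₁.e (S₂.K * S₂.K) := by
    have : Commute S₁.e S₂.K := h.1.1.mul_left h.2.2.1.1
    exact this.mul_right this
  have cee : Commute S₁.e S₂.e :=
    (h.1.1.mul_right h.1.2.2.1).mul_left (h.2.2.1.1.mul_right h.2.2.1.2.2.1)
  have c1f := h₁.comm.e_f
  have c2f := h₂.comm.e_f
  refine ⟨?_, ?_, ?_⟩
  · rw [GenImages.comul_e h₁.relS h, add_mul, mul_assoc S₁.e, mul_assoc S₁.e, cK.eq]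
  · exact (Commute.isNilpotent_mul_right (c1K.mul_left cK) h₁.nilST)
  · have e1 : S₂.e * T.f * (S₁.e * T.f * (S₂.K * S₂.K)) =
        S₁.e * T.f * (S₂.e * (S₂.K * S₂.K)) * T.f := by
      calc S₂.e * T.f * (S₁.e * T.f * (S₂.K * S₂.K))
          = S₂.e * (T.f * S₁.e) * (T.f * (S₂.K * S₂.K)) := by simp only [mul_assoc]
        _ = (S₂.e * S₁.e) * (T.f * (S₂.K * S₂.K)) * T.f := by
            rw [← c1f.eq, cK.eq]
            simp only [mul_assoc]
            rw [← mul_assoc T.f (S₂.K), ← mul_assoc (T.f * S₂.K), mul_assoc T.f, cK.eq]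
            simp only [mul_assoc]
        _ = S₁.e * S₂.e * (S₂.K * S₂.K) * T.f * T.f := by
            rw [← cee.eq, cK.eq]
            simp only [mul_assoc]
        _ = S₁.e * (S₂.e * (S₂.K * S₂.K) * T.f) * T.f := by simp only [mul_assoc]
        _ = _ := by
            rw [((c2f.mul_left cK.symm) : Commute (S₂.e * (S₂.K * S₂.K)) T.f).eq]
            simp only [mul_assoc]
    rw [e1, e_mul_K_K hQ h₂.relS, mul_smul_comm, smul_mul_assoc]
    simp only [mul_assoc]

lemma comul_nil (hQ : Generic Q) (h₁ : Pair Q S₁ T θ₁) (h₂ : Pair Q S₂ T θ₂)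
    (h : S₁.Comm S₂) : IsNilpotent ((S₁.comul S₂).e * T.f) := by
  obtain ⟨e, n, q⟩ := comul_nil_aux hQ h₁ h₂ h
  rw [e]
  exact isNilpotent_add_of_q_commute hQ.inv_sq q n h₂.nilST

/-- `(Δ ⊗ id)(R) = R₁₃ R₂₃`. -/
lemma RUniv_comul_left (hQ : Generic Q) (h₁ : Pair Q S₁ T θ₁) (h₂ : Pair Q S₂ T θ₂)
    (h : S₁.Comm S₂) (hθ : S₁.All (Commute θ₂)) :
    RUniv Q (S₁.comul S₂) T (θ₁ * θ₂) = RUniv Q S₁ T θ₁ * RUniv Q S₂ T θ₂ := by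
  obtain ⟨e, n, q⟩ := comul_nil_aux hQ h₁ h₂ h
  -- Moving θ₂ past `f` produces K⁻² in the second leg, which removes the K² left over from the
  -- coproduct of `e`.
  have hs : SemiconjBy θ₂ (S₁.e * T.f * (S₂.K * S₂.K)) (S₁.e * T.f) := by
    have ce : Commute θ₂ S₁.e := hθ.1.mul_right hθ.2.2.1
    have cf : θ₂ * T.f = T.f * (S₂.Kinv * S₂.Kinv) * θ₂ := by
      rw [GenImages.f, ← mul_assoc, h₂.cartan.TKinv.eq, mul_assoc, h₂.cartan.TY]
      simp only [mul_assoc]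
    have cK : Commute θ₂ (S₂.K * S₂.K) := h₂.cartan.SK.mul_right h₂.cartan.SK
    have c1 : S₂.Kinv * S₂.Kinv * (S₂.K * S₂.K) = 1 := by
      rw [mul_assoc, ← mul_assoc _ S₂.K, h₂.relS.Kinv_K, one_mul, h₂.relS.Kinv_K]
    calc θ₂ * (S₁.e * T.f * (S₂.K * S₂.K)) = (θ₂ * S₁.e) * T.f * (S₂.K * S₂.K) := by
          simp only [mul_assoc]
      _ = S₁.e * (θ₂ * T.f) * (S₂.K * S₂.K) := by rw [ce.eq]; simp only [mul_assoc]
      _ = S₁.e * T.f * (S₂.Kinv * S₂.Kinv) * (θ₂ * (S₂.K * S₂.K)) := by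
          rw [cf]; simp only [mul_assoc]
      _ = S₁.e * T.f * (S₂.Kinv * S₂.Kinv * (S₂.K * S₂.K)) * θ₂ := by
          rw [cK.eq]; simp only [mul_assoc]
      _ = _ := by rw [c1, mul_one]
  rw [RUniv, e, qexp_add hQ.inv_sq q n h₂.nilST, RUniv, RUniv]
  have := (semiconjBy_qexp (Q⁻¹ ^ 2) hs n h₁.nilST).eq
  calc _ = θ₁ * (θ₂ * qexp (Q⁻¹ ^ 2) (S₁.e * T.f * (S₂.K * S₂.K))) *
        qexp (Q⁻¹ ^ 2) (S₂.e * T.f) := by simp only [mul_assoc]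
    _ = _ := by rw [this]; simp only [mul_assoc]

/-- `(id ⊗ Δ)(R) = R₁₃ R₁₂`. -/
lemma RUniv_comul_right (hQ : Generic Q) (h₁ : Pair Q T S₁ θ₁) (h₂ : Pair Q T S₂ θ₂)
    (h : S₁.Comm S₂) (hθ : S₂.All (Commute θ₁)) :
    RUniv Q T (S₁.comul S₂) (θ₂ * θ₁) = RUniv Q T S₂ θ₂ * RUniv Q T S₁ θ₁ := by
  -- The other hexagon identity is the Chevalley flip of the first.
  have := RUniv_comul_left hQ (h₂.flip hQ) (h₁.flip hQ) h.flip.symm hθ.flip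
  rw [h₁.RUniv_flip, h₂.RUniv_flip, ← flip_comul h] at this
  rw [← this, RUniv, RUniv]
  congr 2
  exact (h₁.comm.symm.comul_left h₂.comm.symm).symm.e_f.eq

end Comul

/-! ### Yang–Baxter and the fusion of loops -/

/-- Three commuting sets of images. -/
structure Triple (Q : ℂ) (S₁ S₂ S₃ : GenImages B) (θ₁₂ θ₁₃ θ₂₃ : B) : Prop where
  h₁₂ : Pair Q S₁ S₂ θ₁₂
  h₁₃ : Pair Q S₁ S₃ θ₁₃
  h₂₃ : Pair Q S₂ S₃ θ₂₃
  c₃ : S₃.All (Commute θ₁₂)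
  c₂ : S₂.All (Commute θ₁₃)
  c₁ : S₁.All (Commute θ₂₃)
  t₁₂₁₃ : Commute θ₁₂ θ₁₃
  t₁₂₂₃ : Commute θ₁₂ θ₂₃
  t₁₃₂₃ : Commute θ₁₃ θ₂₃

namespace Triple

variable {S₁ S₂ S₃ : GenImages B} {θ₁₂ θ₁₃ θ₂₃ : B}

lemma swap₁₂ (h : Triple Q S₁ S₂ S₃ θ₁₂ θ₁₃ θ₂₃) : Triple Q S₂ S₁ S₃ θ₁₂ θ₂₃ θ₁₃ :=
  ⟨h.h₁₂.symm, h.h₂₃, h.h₁₃, h.c₃, h.c₁, h.c₂, h.t₁₂₂₃, h.t₁₂₁₃, h.t₁₃₂₃.symm⟩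

lemma swap₂₃ (h : Triple Q S₁ S₂ S₃ θ₁₂ θ₁₃ θ₂₃) : Triple Q S₁ S₃ S₂ θ₁₃ θ₁₂ θ₂₃ :=
  ⟨h.h₁₃, h.h₁₂, h.h₂₃.symm, h.c₂, h.c₃, h.c₁, h.t₁₂₁₃.symm, h.t₁₃₂₃, h.t₁₂₂₃⟩

/-- The Yang–Baxter equation. -/
lemma yangBaxter (hQ : Generic Q) (h : Triple Q S₁ S₂ S₃ θ₁₂ θ₁₃ θ₂₃) :
    RUniv Q S₁ S₂ θ₁₂ * RUniv Q S₁ S₃ θ₁₃ * RUniv Q S₂ S₃ θ₂₃ =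
      RUniv Q S₂ S₃ θ₂₃ * RUniv Q S₁ S₃ θ₁₃ * RUniv Q S₁ S₂ θ₁₂ := by
  have e1 := RUniv_comul_left hQ h.h₁₃ h.h₂₃ h.h₁₂.comm h.c₁
  have e2 := RUniv_comul_left hQ h.h₂₃ h.h₁₃ h.h₁₂.comm.symm h.c₂
  have n1 := comul_nil hQ h.h₁₃ h.h₂₃ h.h₁₂.comm
  have n2 := comul_nil hQ h.h₂₃ h.h₁₃ h.h₁₂.comm.symm
  have hR : ∀ (S T : GenImages B) (θ : B), RUniv Q S T θ = θ * qexp (Q⁻¹ ^ 2) (S.e * T.f) := fun _ _ _ => rfl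
  rw [mul_assoc, ← e1, ← e2, hR (S₁.comul S₂), hR (S₂.comul S₁), ← h.t₁₃₂₃.eq]
  -- By the hexagon identity R₁₃R₂₃ is the coproduct in legs 1 and 2, with Cartan part θ₁₃θ₂₃. That
  -- part commutes with e ⊗ f in legs 1 and 2: the first leg contributes K² and the second K⁻² in
  -- leg 3.
  have cθ : Commute (RUniv Q S₁ S₂ θ₁₂) (θ₁₃ * θ₂₃) := by
    refine Commute.mul_left (h.t₁₂₁₃.mul_right h.t₁₂₂₃) (commute_qexp _ ?_ h.h₁₂.nilST).symm
    have c1 : θ₁₃ * S₁.e = S₁.e * (S₃.K * S₃.K) * θ₁₃ := by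
      rw [GenImages.e, ← mul_assoc, h.h₁₃.cartan.SK.eq, mul_assoc, h.h₁₃.cartan.SX]
      simp only [mul_assoc]
    have c2 : θ₂₃ * S₂.f = S₂.f * (S₃.Kinv * S₃.Kinv) * θ₂₃ := by
      rw [GenImages.f, ← mul_assoc, h.h₂₃.cartan.SKinv.eq, mul_assoc, h.h₂₃.cartan.SY]
      simp only [mul_assoc]
    have c3 : Commute θ₂₃ S₁.e := h.c₁.1.mul_right h.c₁.2.2.1
    have c4 : Commute θ₁₃ S₂.f := h.c₂.2.1.mul_right h.c₂.2.2.2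
    have c5 : Commute θ₁₃ (S₃.Kinv * S₃.Kinv) :=
      h.h₁₃.cartan.TKinv.mul_right h.h₁₃.cartan.TKinv
    have c6 : Commute (S₃.K * S₃.K) S₂.f := by
      have : Commute S₃.K S₂.f :=
        (h.h₂₃.comm.2.1.1.symm).mul_right (h.h₂₃.comm.2.2.2.1.symm)
      exact this.mul_left this
    have c7 : S₃.K * S₃.K * (S₃.Kinv * S₃.Kinv) = 1 := by
      rw [mul_assoc, ← mul_assoc _ S₃.Kinv, h.h₂₃.relT.K_Kinv, one_mul, h.h₂₃.relT.K_Kinv]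
    calc θ₁₃ * θ₂₃ * (S₁.e * S₂.f) = θ₁₃ * (θ₂₃ * S₁.e) * S₂.f := by simp only [mul_assoc]
      _ = θ₁₃ * S₁.e * (θ₂₃ * S₂.f) := by rw [c3.eq]; simp only [mul_assoc]
      _ = S₁.e * (S₃.K * S₃.K) * (θ₁₃ * S₂.f) * (S₃.Kinv * S₃.Kinv) * θ₂₃ := by
          rw [c1, c2]; simp only [mul_assoc]
      _ = S₁.e * (S₃.K * S₃.K * S₂.f) * (θ₁₃ * (S₃.Kinv * S₃.Kinv)) * θ₂₃ := by
          rw [c4.eq]; simp only [mul_assoc]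
      _ = S₁.e * S₂.f * (S₃.K * S₃.K * (S₃.Kinv * S₃.Kinv)) * (θ₁₃ * θ₂₃) := by
          rw [c5.eq, c6.eq]; simp only [mul_assoc]
      _ = _ := by rw [c7, mul_one]
  -- R₁₂ carries the coproduct of `e` into the opposite one, and hence the exponential in R₁₃R₂₃
  -- into that in R₂₃R₁₃.
  have cs : SemiconjBy (RUniv Q S₁ S₂ θ₁₂) ((S₁.comul S₂).e * S₃.f) ((S₂.comul S₁).e * S₃.f) := by
    refine SemiconjBy.mul_right ?_ ?_
    · exact SemiconjBy.mul_right h.h₁₂.RUniv_K (h.h₁₂.RUniv_X hQ)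
    · refine Commute.mul_left (h.c₃.2.1.mul_right h.c₃.2.2.2) (commute_qexp _ ?_ h.h₁₂.nilST).symm
      refine Commute.mul_right ?_ ?_
      · exact h.h₁₃.comm.e_f.symm
      · exact Commute.mul_left
          ((h.h₂₃.comm.2.1.2.1.mul_left h.h₂₃.comm.2.2.2.2.1).symm)
          ((h.h₂₃.comm.2.1.2.2.2.mul_left h.h₂₃.comm.2.2.2.2.2.2).symm)
  rw [← mul_assoc, cθ.eq, mul_assoc, (semiconjBy_qexp _ cs n1 n2).eq]
  simp only [mul_assoc]

/-- The fusion of two loops. -/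
lemma loop_product (hQ : Generic Q) (h : Triple Q S₁ S₂ S₃ θ₁₂ θ₁₃ θ₂₃) {V : B}
    (hV : V * RUniv Q S₁ S₂ θ₁₂ = 1) :
    V * (RUniv Q S₃ S₁ θ₁₃ * RUniv Q S₁ S₃ θ₁₃) * RUniv Q S₁ S₂ θ₁₂ *
      (RUniv Q S₃ S₂ θ₂₃ * RUniv Q S₂ S₃ θ₂₃) =
    RUniv Q S₃ S₂ θ₂₃ * RUniv Q S₃ S₁ θ₁₃ * (RUniv Q S₁ S₃ θ₁₃ * RUniv Q S₂ S₃ θ₂₃) := by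
  -- Yang–Baxter in the leg orders 1,3,2 and 3,1,2: these carry R₁₃, then R₃₁, through the factors
  -- R₁₂ and R₃₂, until R₁₂ meets its inverse.
  have y1 := h.swap₂₃.yangBaxter hQ
  have y2 := h.swap₂₃.swap₁₂.yangBaxter hQ
  set a := RUniv Q S₁ S₂ θ₁₂
  calc _ = V * RUniv Q S₃ S₁ θ₁₃ * (RUniv Q S₁ S₃ θ₁₃ * a * RUniv Q S₃ S₂ θ₂₃) *
        RUniv Q S₂ S₃ θ₂₃ := by simp only [mul_assoc]
    _ = V * (RUniv Q S₃ S₁ θ₁₃ * RUniv Q S₃ S₂ θ₂₃ * a) * RUniv Q S₁ S₃ θ₁₃ *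
        RUniv Q S₂ S₃ θ₂₃ := by rw [y1]; simp only [mul_assoc]
    _ = (V * a) * RUniv Q S₃ S₂ θ₂₃ * RUniv Q S₃ S₁ θ₁₃ * RUniv Q S₁ S₃ θ₁₃ *
        RUniv Q S₂ S₃ θ₂₃ := by rw [y2]; simp only [mul_assoc]
    _ = _ := by rw [hV, one_mul]; simp only [mul_assoc]

/-- The fusion of two dressed operators. -/
lemma dressed_product (hQ : Generic Q) (h : Triple Q S₁ S₂ S₃ θ₁₂ θ₁₃ θ₂₃) {V W₁ W₂ L₁ L₂ : B}
    (hV : V * RUniv Q S₁ S₂ θ₁₂ = 1) (hV' : RUniv Q S₁ S₂ θ₁₂ * V = 1)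
    (hW₁ : W₁ * RUniv Q S₃ S₁ θ₁₃ = 1) (hW₁' : RUniv Q S₃ S₁ θ₁₃ * W₁ = 1)
    (hL₁ : Commute L₁ (RUniv Q S₃ S₂ θ₂₃)) (hL₂ : Commute W₁ L₂) :
    V * (RUniv Q S₃ S₁ θ₁₃ * L₁ * W₁) * RUniv Q S₁ S₂ θ₁₂ * (RUniv Q S₃ S₂ θ₂₃ * L₂ * W₂) =
    RUniv Q S₃ S₂ θ₂₃ * RUniv Q S₃ S₁ θ₁₃ * (V * L₁ * RUniv Q S₁ S₂ θ₁₂ * L₂) * (W₁ * W₂) := by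
  have y := h.swap₂₃.swap₁₂.yangBaxter hQ
  set a := RUniv Q S₁ S₂ θ₁₂
  set r := RUniv Q S₃ S₁ θ₁₃
  set u := RUniv Q S₃ S₂ θ₂₃
  -- `y1` and `y2` are the same Yang–Baxter equation, multiplied on both sides by the inverse of
  -- R₃₁, respectively of R₁₂.
  have y1 : W₁ * (a * u) = u * a * W₁ := by
    calc W₁ * (a * u) = W₁ * (a * u) * (r * W₁) := by rw [hW₁', mul_one]
      _ = W₁ * (a * u * r) * W₁ := by simp only [mul_assoc]
      _ = (W₁ * r) * (u * a) * W₁ := by rw [← y]; simp only [mul_assoc]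
      _ = _ := by rw [hW₁, one_mul]
  have y2 : V * (r * u) = u * r * V := by
    calc V * (r * u) = V * (r * u) * (a * V) := by rw [hV', mul_one]
      _ = V * (r * u * a) * V := by simp only [mul_assoc]
      _ = (V * a) * (u * r) * V := by rw [y]; simp only [mul_assoc]
      _ = _ := by rw [hV, one_mul]
  calc _ = V * r * L₁ * (W₁ * (a * u)) * L₂ * W₂ := by simp only [mul_assoc]
    _ = V * r * (L₁ * u) * a * (W₁ * L₂) * W₂ := by rw [y1]; simp only [mul_assoc]
    _ = (V * (r * u)) * L₁ * a * L₂ * W₁ * W₂ := by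
        rw [hL₁.eq, hL₂.eq]; simp only [mul_assoc]
    _ = _ := by rw [y2]; simp only [mul_assoc]

end Triple

end Universal

/-! ### Parameters -/

namespace Level

variable (p : Level)

lemma conj_b : conj p.b = p.b⁻¹ := by
  rw [Complex.inv_def, Complex.normSq_eq_norm_sq, p.norm_b]
  simp

lemma conj_bPar (σ : Sector) : conj (p.bPar σ) = p.bPar σ.swap := by
  cases σ
  · exact p.conj_b
  · simp [bPar, Sector.swap, p.conj_b]

/-- Since |b| = 1, conjugation exchanges b and b⁻¹, and the prefactor i supplies the sign. All
adjointness between the two sectors originates here. -/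
lemma h_swap (σ : Sector) : p.h σ.swap = -conj (p.h σ) := by
  simp only [h, ← p.conj_bPar σ, map_mul, map_div₀, map_add, map_one, map_pow, Complex.conj_I,
    Complex.conj_ofReal, map_natCast, map_ofNat]
  ring

lemma h_holo_re_neg : (p.h .holo).re < 0 := by
  have e : p.h .holo = ((2 * Real.pi / p.k : ℝ) : ℂ) * (Complex.I * (1 + p.b ^ 2)) := by
    simp only [h, bPar]
    push_cast
    ring
  have hk : (0 : ℝ) < p.k := Nat.cast_pos.mpr (NeZero.pos p.k)
  have h1 := p.re_pos
  have h2 := p.im_pos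
  rw [e, Complex.re_ofReal_mul]
  have : (Complex.I * (1 + p.b ^ 2)).re = -(2 * p.b.re * p.b.im) := by
    simp [pow_two]
    ring
  rw [this]
  have : 0 < 2 * Real.pi / p.k * (2 * p.b.re * p.b.im) := by positivity
  linarith

lemma h_re_ne_zero (σ : Sector) : (p.h σ).re ≠ 0 := by
  cases σ
  · exact p.h_holo_re_neg.ne
  · have := p.h_swap .holo
    simp only [Sector.swap] at this
    rw [this]
    simpa using p.h_holo_re_neg.ne

/-- Re h ≠ 0, as b² is not real, so |𝐪| ≠ 1 and 𝐪 is not a root of unity. -/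
lemma generic (σ : Sector) : Generic (p.Q σ) := by
  refine ⟨Complex.exp_ne_zero _, fun n hn => p.h_re_ne_zero σ ?_⟩
  have h1 : ‖p.Q σ‖ = 1 := Complex.norm_eq_one_of_pow_eq_one hn (by omega)
  rw [Q, Complex.norm_exp, Real.exp_eq_one_iff] at h1
  exact h1

lemma q_ne_zero (σ : Sector) : p.q σ ≠ 0 := Complex.exp_ne_zero _

lemma Q_ne_zero (σ : Sector) : p.Q σ ≠ 0 := Complex.exp_ne_zero _

lemma q_sq (σ : Sector) : p.q σ ^ 2 = p.Q σ := by
  rw [q, Q, ← Complex.exp_nat_mul]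
  congr 1
  push_cast
  ring

lemma conj_q (σ : Sector) : conj (p.q σ) = (p.q σ.swap)⁻¹ := by
  rw [q, q, ← Complex.exp_conj, ← Complex.exp_neg, p.h_swap]
  congr 1
  simp only [map_div₀, map_ofNat]
  ring

lemma conj_Q (σ : Sector) : conj (p.Q σ) = (p.Q σ.swap)⁻¹ := by
  rw [← q_sq, ← q_sq, map_pow, conj_q, inv_pow]

lemma Q_sub_inv_ne_zero (σ : Sector) : p.Q σ - (p.Q σ)⁻¹ ≠ 0 := by
  have h := (p.generic σ).pow_ne_one 1
  intro h'
  apply h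
  have h0 := p.Q_ne_zero σ
  field_simp at h'
  linear_combination h'

lemma qNum_ne_zero (σ : Sector) (n : ℕ) : p.qNum σ (n + 1) ≠ 0 := by
  refine div_ne_zero ?_ (p.Q_sub_inv_ne_zero σ)
  have h := (p.generic σ).pow_ne_one (2 * n + 1)
  intro h'
  apply h
  have h0 := p.Q_ne_zero σ
  have : p.Q σ ^ (n + 1) * (p.Q σ)⁻¹ ^ (n + 1) = 1 := by
    rw [← mul_pow, mul_inv_cancel₀ h0, one_pow]
  linear_combination p.Q σ ^ (n + 1) * h' + this

lemma conj_qNum (σ : Sector) (n : ℕ) : conj (p.qNum σ n) = p.qNum σ.swap n := by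
  have h := p.Q_sub_inv_ne_zero σ.swap
  simp only [qNum, map_div₀, map_sub, map_pow, map_inv₀, conj_Q, inv_inv]
  rw [← neg_sub (p.Q σ.swap), ← neg_sub (p.Q σ.swap ^ n), neg_div_neg_eq]

lemma conj_sqrtQNum (σ : Sector) (n : ℕ) : conj (p.sqrtQNum σ n) = p.sqrtQNum σ.swap n := by
  cases σ <;> simp [sqrtQNum, Sector.swap]

/-- Squaring a power with exponent 1/2 undoes it for every branch. Apart from conjugation between
sectors, this is the only property of the square roots that enters the proof. -/
lemma sqrtQNum_sq (σ : Sector) (n : ℕ) : p.sqrtQNum σ n ^ 2 = p.qNum σ n := by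
  have key : p.sqrtQNum .holo n ^ 2 = p.qNum .holo n := by
    have hs : ∀ z : ℂ, (z ^ (1 / 2 : ℂ)) ^ 2 = z := by
      intro z
      rw [← Complex.cpow_nat_mul]
      norm_num
    have hq : p.Q .holo ^ 2 ≠ 1 := (p.generic .holo).pow_ne_one 1
    have h0 := p.Q_ne_zero .holo
    have e1 : Complex.exp (2 * p.h .holo) = p.Q .holo ^ 2 := by
      rw [Q, ← Complex.exp_nat_mul]
      norm_num
    have e2 : Complex.exp (2 * n * p.h .holo) = p.Q .holo ^ (2 * n) := by
      rw [Q, ← Complex.exp_nat_mul]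
      norm_num
    have e3 : Complex.exp (-((n : ℂ) - 1) * p.h .holo / 2) ^ 2 = p.Q .holo / p.Q .holo ^ n := by
      rw [Q, ← Complex.exp_nat_mul, ← Complex.exp_nat_mul, ← Complex.exp_sub]
      congr 1
      push_cast
      ring
    simp only [sqrtQNum]
    rw [div_pow, mul_pow, hs, hs, e1, e2, e3, qNum, pow_mul', inv_pow]
    have h1 : 1 - p.Q .holo ^ 2 ≠ 0 := sub_ne_zero.mpr hq.symm
    have h2 : p.Q .holo ^ 2 - 1 ≠ 0 := sub_ne_zero.mpr hq
    have h3 := pow_ne_zero n h0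
    field_simp
    ring
  cases σ
  · exact key
  · have := congrArg conj key
    rwa [map_pow, conj_sqrtQNum, conj_qNum] at this

@[simp] lemma sqrtQNum_zero (σ : Sector) : p.sqrtQNum σ 0 = 0 := by
  have := p.sqrtQNum_sq σ 0
  simpa [qNum] using this

lemma sqrtQNum_ne_zero (σ : Sector) (n : ℕ) : p.sqrtQNum σ (n + 1) ≠ 0 := by
  intro h
  have := p.sqrtQNum_sq σ (n + 1)
  rw [h] at this
  exact p.qNum_ne_zero σ n (by simpa using this.symm)

end Level

lemma Sector.sgn_swap (σ : Sector) : σ.swap.sgn = -σ.sgn := by cases σ <;> rfl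

@[simp] lemma Sector.swap_swap (σ : Sector) : σ.swap.swap = σ := by cases σ <;> rfl

/-- The coefficients of R are those of the quantum exponential at t = 𝐪⁻²: both start at 1, and the
ratios of consecutive ones agree because [n+1](1 - 𝐪⁻²) = 𝐪ⁿ(1 - 𝐪^(-2(n+1))). -/
lemma expCoef_eq (p : Level) (σ : Sector) (n : ℕ) :
    expCoef p σ n = qexpCoef ((p.Q σ)⁻¹ ^ 2) n := by
  have hQ := p.generic σ
  have h0 := p.Q_ne_zero σ
  have hsub := p.Q_sub_inv_ne_zero σ
  induction n with
  | zero => simp [expCoef, Level.qFac]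
  | succ n ih =>
    have h1 := hQ.inv_sq.one_sub_ne n
    have hn := p.qNum_ne_zero σ n
    have rec_ := qexpCoef_succ hQ.inv_sq n
    have e : (n + 1) * (n + 1 - 1) / 2 = n * (n - 1) / 2 + n := by
      rcases n with _ | n
      · simp
      · simp only [Nat.add_sub_cancel]
        rw [show (n + 1 + 1) * (n + 1) = (n + 1) * n + (n + 1) * 2 by ring,
          Nat.add_mul_div_right _ _ (by norm_num)]
    have hfac : p.qFac σ (n + 1) = p.qFac σ n * p.qNum σ (n + 1) := by
      rw [Level.qFac, Level.qFac, Finset.prod_range_succ]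
    have hf : p.qFac σ n ≠ 0 :=
      Finset.prod_ne_zero_iff.mpr fun i _ => p.qNum_ne_zero σ i
    have step : expCoef p σ (n + 1) =
        expCoef p σ n * (p.Q σ ^ n * (1 - (p.Q σ)⁻¹ ^ 2) / p.qNum σ (n + 1)) := by
      rw [expCoef, expCoef, e, hfac, pow_add, pow_succ (1 - (p.Q σ)⁻¹ ^ 2)]
      field_simp
    refine mul_right_cancel₀ h1 ?_
    rw [rec_, ← ih, step]
    have hnum : p.qNum σ (n + 1) * (1 - (p.Q σ)⁻¹ ^ 2) =
        p.Q σ ^ n * (1 - ((p.Q σ)⁻¹ ^ 2) ^ (n + 1)) := by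
      rw [Level.qNum, div_mul_eq_mul_div, div_eq_iff hsub]
      have hQn : p.Q σ ^ n * (p.Q σ)⁻¹ ^ n = 1 := by
        rw [← mul_pow, mul_inv_cancel₀ h0, one_pow]
      have hQ1 : p.Q σ * (p.Q σ)⁻¹ = 1 := mul_inv_cancel₀ h0
      generalize p.Q σ = x at *
      generalize x⁻¹ = y at *
      rw [show (y ^ 2) ^ (n + 1) = y ^ n * y ^ n * y ^ 2 by ring, pow_succ, pow_succ y n]
      generalize x ^ n = u at *
      generalize y ^ n = v at *
      linear_combination (u * v ^ 2 * y - u * y) * hQ1 + (v * y - v * y ^ 3) * hQn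
    rw [← mul_div_assoc, div_mul_eq_mul_div, div_eq_iff hn]
    linear_combination (-(expCoef p σ n * (1 - (p.Q σ)⁻¹ ^ 2))) * hnum

/-! ### The weights of the finite-dimensional representations -/

section Matrices

variable {d : ℕ}

lemma raise_apply (p : Level) (σ : Sector) (i j : Fin (d + 1)) :
    raise p σ d i j =
      if i.val + 1 = j.val then p.sqrtQNum σ (i + 1) * p.sqrtQNum σ (d - i) else 0 := by
  simp only [raise, Matrix.of_apply]
  split_ifs with h
  · rw [← h, Nat.add_sub_add_right]
  · rfl

lemma lower_apply (p : Level) (σ : Sector) (i j : Fin (d + 1)) :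
    lower p σ d i j =
      if j.val + 1 = i.val then p.sqrtQNum σ (j + 1) * p.sqrtQNum σ (d - j) else 0 := by
  simp only [lower, Matrix.of_apply]
  simp only [eq_comm (a := i.val), mul_comm]

lemma raise_transpose (p : Level) (σ : Sector) (d : ℕ) :
    (raise p σ d).transpose = lower p σ d := by
  ext i j
  rw [Matrix.transpose_apply, raise_apply, lower_apply]

/-- A matrix that is supported next to the diagonal is nilpotent. -/
lemma pow_eq_zero_of_raising {M : Matrix (Fin (d + 1)) (Fin (d + 1)) ℂ}
    (h : ∀ i j, M i j ≠ 0 → i.val + 1 = j.val) : M ^ (d + 1) = 0 := by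
  have key : ∀ n i j, (M ^ n) i j ≠ 0 → i.val + n = j.val := by
    intro n
    induction n with
    | zero =>
      intro i j hij
      by_contra hne
      exact hij (by rw [pow_zero, Matrix.one_apply_ne (fun h => hne (by simp [h]))])
    | succ n ih =>
      intro i j hij
      rw [pow_succ, Matrix.mul_apply] at hij
      obtain ⟨l, _, hl⟩ := Finset.exists_ne_zero_of_sum_ne_zero hij
      have h1 := ih i l (left_ne_zero_of_mul hl)
      have h2 := h l j (right_ne_zero_of_mul hl)
      omega
  ext i j
  by_contra hne
  have := key _ i j hne
  omega

lemma pow_eq_zero_of_lowering {M : Matrix (Fin (d + 1)) (Fin (d + 1)) ℂ}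
    (h : ∀ i j, M i j ≠ 0 → j.val + 1 = i.val) : M ^ (d + 1) = 0 := by
  rw [← Matrix.transpose_eq_zero, Matrix.transpose_pow]
  exact pow_eq_zero_of_raising fun i j hij => h j i hij

lemma pow_eq_zero_of_adjacent (σ : Sector) {M : Matrix (Fin (d + 1)) (Fin (d + 1)) ℂ}
    (h : ∀ i j, M i j ≠ 0 → σ.sgn * wt d i = σ.sgn * wt d j + 2) : M ^ (d + 1) = 0 := by
  cases σ
  · refine pow_eq_zero_of_raising fun i j hij => ?_
    have := h i j hij
    simp only [Sector.sgn, wt] at this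
    omega
  · refine pow_eq_zero_of_lowering fun i j hij => ?_
    have := h i j hij
    simp only [Sector.sgn, wt] at this
    omega

lemma pow_eq_zero_of_adjacent' (σ : Sector) {M : Matrix (Fin (d + 1)) (Fin (d + 1)) ℂ}
    (h : ∀ i j, M i j ≠ 0 → σ.sgn * wt d i = σ.sgn * wt d j - 2) : M ^ (d + 1) = 0 := by
  rw [← Matrix.transpose_eq_zero, Matrix.transpose_pow]
  refine pow_eq_zero_of_adjacent σ fun i j hij => ?_
  have := h j i hij
  omega

variable (p : Level) (σ : Sector)

/-- In the tilded sector both the sign of the weights and the direction of 𝒳 are reversed. With the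
signed weight, 𝒳 raises by 2 in either sector, so later arguments need no case distinction. -/
lemma rho_X_weight (i j : Fin (d + 1)) (h : (rho p σ d).X i j ≠ 0) :
    σ.sgn * wt d i = σ.sgn * wt d j + 2 := by
  cases σ
  · change raise p _ d i j ≠ 0 at h
    rw [raise_apply] at h
    have := (ite_ne_right_iff.mp h).1
    simp only [Sector.sgn, wt]
    omega
  · change lower p _ d i j ≠ 0 at h
    rw [lower_apply] at h
    have := (ite_ne_right_iff.mp h).1
    simp only [Sector.sgn, wt]
    omega

lemma rho_X_transpose (d : ℕ) : (rho p σ d).X.transpose = (rho p σ d).Y := by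
  cases σ
  · exact raise_transpose p _ d
  · change (lower p _ d).transpose = raise p _ d
    rw [← raise_transpose, Matrix.transpose_transpose]

lemma rho_K_transpose (d : ℕ) : (rho p σ d).K.transpose = (rho p σ d).K :=
  Matrix.diagonal_transpose _

lemma rho_Kinv_transpose (d : ℕ) : (rho p σ d).Kinv.transpose = (rho p σ d).Kinv :=
  Matrix.diagonal_transpose _

lemma rho_Y_weight (i j : Fin (d + 1)) (h : (rho p σ d).Y i j ≠ 0) :
    σ.sgn * wt d i = σ.sgn * wt d j - 2 := by
  rw [← rho_X_transpose] at h
  have := rho_X_weight p σ j i h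
  omega

lemma rho_K (d : ℕ) :
    (rho p σ d).K = Matrix.diagonal fun i => p.q σ ^ (σ.sgn * wt d i) := rfl

lemma rho_Kinv (d : ℕ) :
    (rho p σ d).Kinv = Matrix.diagonal fun i => p.q σ ^ (-(σ.sgn * wt d i)) := rfl

lemma rho_e_pow (d : ℕ) : (rho p σ d).e ^ (d + 1) = 0 := by
  refine pow_eq_zero_of_adjacent σ fun i j hij => rho_X_weight p σ i j ?_
  rw [GenImages.e, rho_K, Matrix.diagonal_mul] at hij
  exact right_ne_zero_of_mul hij

lemma rho_f_pow (d : ℕ) : (rho p σ d).f ^ (d + 1) = 0 := by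
  refine pow_eq_zero_of_adjacent' σ fun i j hij => rho_Y_weight p σ i j ?_
  rw [GenImages.f, rho_Kinv, Matrix.diagonal_mul] at hij
  exact right_ne_zero_of_mul hij

lemma raise_mul_lower (d : ℕ) : raise p σ d * lower p σ d =
    Matrix.diagonal fun i : Fin (d + 1) => p.qNum σ (i + 1) * p.qNum σ (d - i) := by
  ext i l
  rw [Matrix.mul_apply]
  simp only [raise_apply, lower_apply]
  rw [Matrix.diagonal_apply, ← p.sqrtQNum_sq, ← p.sqrtQNum_sq]
  split_ifs with hil
  · subst hil
    rcases Nat.lt_or_ge i d with hi | hi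
    · rw [Finset.sum_eq_single ⟨i + 1, by omega⟩]
      · simp only [if_true]
        ring
      · intro j _ hj
        rw [if_neg, zero_mul]
        exact fun h => hj (Fin.ext h.symm)
      · simp
    -- At the last basis vector there is no neighbour to sum over, in agreement with [0] = 0.
    · rw [Nat.sub_eq_zero_of_le hi]
      simp
  · refine Finset.sum_eq_zero fun j _ => ?_
    by_cases h1 : i.val + 1 = j.val
    · rw [if_neg (c := l.val + 1 = j.val), mul_zero]
      exact fun h => hil (Fin.ext (by omega))
    · rw [if_neg h1, zero_mul]

lemma lower_mul_raise (d : ℕ) : lower p σ d * raise p σ d =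
    Matrix.diagonal fun i : Fin (d + 1) => p.qNum σ i * p.qNum σ (d + 1 - i) := by
  ext i l
  rw [Matrix.mul_apply]
  simp only [raise_apply, lower_apply]
  rw [Matrix.diagonal_apply, ← p.sqrtQNum_sq, ← p.sqrtQNum_sq]
  split_ifs with hil
  · subst hil
    rcases Nat.eq_zero_or_pos i with hi | hi
    · rw [hi]
      simp
    · rw [Finset.sum_eq_single ⟨i - 1, by omega⟩]
      · simp only [Nat.sub_add_cancel hi, if_true]
        rw [show d - (i - 1) = d + 1 - i by omega]
        ring
      · intro j _ hj
        rw [if_neg, zero_mul]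
        exact fun h => hj (Fin.ext (by simp; omega))
      · simp
  · refine Finset.sum_eq_zero fun j _ => ?_
    by_cases h1 : j.val + 1 = i.val
    · rw [if_neg (c := j.val + 1 = l.val), mul_zero]
      exact fun h => hil (Fin.ext (by omega))
    · rw [if_neg h1, zero_mul]

lemma qNum_comm_identity {d i : ℕ} (hi : i ≤ d) :
    (p.Q σ - (p.Q σ)⁻¹) * (p.qNum σ (i + 1) * p.qNum σ (d - i) -
      p.qNum σ i * p.qNum σ (d + 1 - i)) =
    p.Q σ ^ ((d : ℤ) - 2 * i) - p.Q σ ^ (-((d : ℤ) - 2 * i)) := by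
  obtain ⟨n, rfl⟩ := Nat.exists_eq_add_of_le hi
  have h := p.Q_sub_inv_ne_zero σ
  have h0 := p.Q_ne_zero σ
  rw [show i + n - i = n by omega, show i + n + 1 - i = n + 1 by omega,
    show ((i + n : ℕ) : ℤ) - 2 * i = n - i by push_cast; ring, neg_sub, zpow_sub₀ h0, zpow_sub₀ h0]
  simp only [Level.qNum, zpow_natCast, inv_pow, pow_succ]
  have h2 : p.Q σ ^ 2 - 1 ≠ 0 := by
    intro h'
    apply h
    field_simp
    simpa using h'
  have h3 := pow_ne_zero i h0
  have h4 := pow_ne_zero n h0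
  generalize p.Q σ ^ i = u at *
  generalize p.Q σ ^ n = v at *
  generalize p.Q σ = x at *
  field_simp
  ring

lemma rho_rels (d : ℕ) : Rels (p.Q σ) (rho p σ d) where
  K_Kinv := by
    simp only [rho, Matrix.diagonal_mul_diagonal, ← zpow_add₀ (p.q_ne_zero σ), add_neg_cancel,
      neg_add_cancel, zpow_zero, Matrix.diagonal_one]
  Kinv_K := by
    simp only [rho, Matrix.diagonal_mul_diagonal, ← zpow_add₀ (p.q_ne_zero σ), add_neg_cancel,
      neg_add_cancel, zpow_zero, Matrix.diagonal_one]
  K_X := by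
    ext i j
    rw [Matrix.smul_apply, rho_K, Matrix.diagonal_mul, Matrix.mul_diagonal]
    by_cases h : (rho p σ d).X i j = 0
    · simp [h]
    · rw [rho_X_weight p σ i j h, zpow_add₀ (p.q_ne_zero σ), ← p.q_sq, smul_eq_mul]
      norm_cast
      ring
  K_Y := by
    ext i j
    rw [Matrix.smul_apply, rho_K, Matrix.diagonal_mul, Matrix.mul_diagonal]
    by_cases h : (rho p σ d).Y i j = 0
    · simp [h]
    · rw [rho_Y_weight p σ i j h, sub_eq_add_neg, zpow_add₀ (p.q_ne_zero σ), ← p.q_sq, smul_eq_mul,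
        zpow_neg]
      norm_cast
      ring
  X_Y := by
    have key : (p.Q σ - (p.Q σ)⁻¹) • (raise p σ d * lower p σ d - lower p σ d * raise p σ d) =
        Matrix.diagonal fun i => p.Q σ ^ (wt d i) - p.Q σ ^ (-wt d i) := by
      rw [raise_mul_lower, lower_mul_raise, Matrix.diagonal_sub, ← Matrix.diagonal_smul]
      congr 1
      funext i
      exact qNum_comm_identity p σ (Nat.lt_succ_iff.mp i.isLt)
    have hz : ∀ n : ℤ, p.q σ ^ n * p.q σ ^ n = p.Q σ ^ n := by
      intro n
      rw [← mul_zpow, ← pow_two, p.q_sq]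
    cases σ
    · change (p.Q _ - (p.Q _)⁻¹) • (raise p _ d * lower p _ d - lower p _ d * raise p _ d) = _
      rw [key]
      simp only [rho, Matrix.diagonal_mul_diagonal, Matrix.diagonal_sub, Sector.sgn, one_mul, hz]
    · change (p.Q _ - (p.Q _)⁻¹) • (lower p _ d * raise p _ d - raise p _ d * lower p _ d) = _
      rw [← neg_sub (raise p _ d * lower p _ d), smul_neg, key, Matrix.diagonal_neg]
      simp only [rho, Matrix.diagonal_mul_diagonal, Matrix.diagonal_sub, Sector.sgn, neg_mul,
        one_mul, hz, neg_neg]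
      congr 1
      funext i
      simp

end Matrices

/-! ### Matrices over an algebra -/

section Embeddings

variable {A A' : Type} [Ring A] [Algebra ℂ A] [Ring A'] [Algebra ℂ A']
  {n n' l : Type} [Fintype n] [DecidableEq n] [Fintype n'] [DecidableEq n'] [Fintype l]
  [DecidableEq l]

variable (A n) in
/-- Complex matrices as matrices over `A`. -/
def cmatHom : Matrix n n ℂ →ₐ[ℂ] Matrix n n A := (Algebra.ofId ℂ A).mapMatrix

variable (A n) in
/-- Elements of `A` as scalar matrices. -/
def scalarHom : A →ₐ[ℂ] Matrix n n A := Matrix.scalarAlgHom n ℂ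

variable (A n n') in
/-- The embedding `M ↦ M ⊗ 1`. -/
def kronLeft : Matrix n n A →ₐ[ℂ] Matrix (n × n') (n × n') A :=
  (Matrix.compAlgEquiv n n' A ℂ).toAlgHom.comp (scalarHom A n').mapMatrix

variable (A n n') in
/-- The embedding `M ↦ 1 ⊗ M`. -/
def kronRight : Matrix n' n' A →ₐ[ℂ] Matrix (n × n') (n × n') A :=
  (Matrix.compAlgEquiv n n' A ℂ).toAlgHom.comp (scalarHom (Matrix n' n' A) n)

lemma cmatHom_apply (M : Matrix n n ℂ) : cmatHom A n M = cmat A M := rfl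

lemma cmat_mul {n₁ n₂ n₃ : Type} [Fintype n₂] (M : Matrix n₁ n₂ ℂ) (M' : Matrix n₂ n₃ ℂ) :
    cmat A (M * M') = cmat A M * cmat A M' :=
  Matrix.map_mul

@[simp] lemma cmat_one : cmat A (1 : Matrix n n ℂ) = 1 := map_one (cmatHom A n)

@[simp] lemma cmat_zero {n₁ n₂ : Type} : cmat A (0 : Matrix n₁ n₂ ℂ) = 0 := by
  ext
  simp [cmat]

lemma scalarHom_apply (a : A) : scalarHom A n a = Matrix.diagonal fun _ => a := rfl

lemma kronLeft_apply (M : Matrix n n A) : kronLeft A n n' M = M ⊗ₖ 1 := by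
  ext ⟨a, b⟩ ⟨c, e⟩
  change (Matrix.diagonal fun _ => M a c : Matrix n' n' A) b e = M a c * (1 : Matrix n' n' A) b e
  rw [Matrix.diagonal_apply, Matrix.one_apply]
  split_ifs <;> simp

lemma kronRight_apply (M : Matrix n' n' A) : kronRight A n n' M = 1 ⊗ₖ M := by
  ext ⟨a, b⟩ ⟨c, e⟩
  change (Matrix.diagonal fun _ => M : Matrix n n (Matrix n' n' A)) a c b e =
    (1 : Matrix n n A) a c * M b e
  rw [Matrix.diagonal_apply, Matrix.one_apply]
  split_ifs <;> simp

lemma kronLeft_mul_kronRight_apply (M : Matrix n n A) (M' : Matrix n' n' A) (x y : n × n') :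
    (kronLeft A n n' M * kronRight A n n' M') x y = M x.1 y.1 * M' x.2 y.2 := by
  rw [kronLeft_apply, kronRight_apply, Matrix.mul_apply, Finset.sum_eq_single (y.1, x.2)]
  · simp [Matrix.kroneckerMap_apply]
  · rintro ⟨c, e⟩ _ h
    simp only [Matrix.kroneckerMap_apply, Matrix.one_apply]
    split_ifs with h1 h2
    · exact absurd (Prod.ext h2 h1.symm) h
    all_goals simp
  · simp

lemma kronRight_mul_kronLeft_apply (M : Matrix n n A) (M' : Matrix n' n' A) (x y : n × n') :
    (kronRight A n n' M' * kronLeft A n n' M) x y = M' x.2 y.2 * M x.1 y.1 := by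
  rw [kronLeft_apply, kronRight_apply, Matrix.mul_apply, Finset.sum_eq_single (x.1, y.2)]
  · simp [Matrix.kroneckerMap_apply]
  · rintro ⟨c, e⟩ _ h
    simp only [Matrix.kroneckerMap_apply, Matrix.one_apply]
    split_ifs with h1 h2
    · exact absurd (Prod.ext h1.symm h2) h
    all_goals simp
  · simp

/-- Over a noncommutative algebra M ⊗ 1 and 1 ⊗ M' need not commute; the commutation of the entries
has to be supplied. -/
lemma commute_kronLeft_kronRight {M : Matrix n n A} {M' : Matrix n' n' A}
    (h : ∀ i j k l, Commute (M i j) (M' k l)) :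
    Commute (kronLeft A n n' M) (kronRight A n n' M') := by
  ext x y
  rw [kronLeft_mul_kronRight_apply, kronRight_mul_kronLeft_apply, (h _ _ _ _).eq]

lemma commute_cmat_apply (M : Matrix n n' ℂ) (a : A) (i : n) (j : n') :
    Commute (cmat A M i j) a :=
  Algebra.commutes _ _

lemma cmat_mul_diagonal_apply {n₁ n₂ : Type} [Fintype n₂] [DecidableEq n₂]
    (M : Matrix n₁ n₂ ℂ) (v : n₂ → A) (i : n₁) (j : n₂) :
    (cmat A M * Matrix.diagonal v) i j = M i j • v j := by
  rw [Matrix.mul_diagonal, cmat, Matrix.map_apply, ← Algebra.smul_def]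

lemma diagonal_mul_cmat_apply {n₁ n₂ : Type} [Fintype n₁] [DecidableEq n₁]
    (M : Matrix n₁ n₂ ℂ) (v : n₁ → A) (i : n₁) (j : n₂) :
    (Matrix.diagonal v * cmat A M) i j = M i j • v i := by
  rw [Matrix.diagonal_mul, cmat, Matrix.map_apply, ← Algebra.commutes, ← Algebra.smul_def]

lemma scalarHom_mul_cmat (M : Matrix n n' ℂ) (a : A) :
    scalarHom A n a * cmat A M = cmat A M * scalarHom A n' a := by
  ext i j
  rw [scalarHom_apply, scalarHom_apply, cmat_mul_diagonal_apply, diagonal_mul_cmat_apply]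

lemma commute_scalarHom_cmatHom (M : Matrix n n ℂ) (a : A) :
    Commute (scalarHom A n a) (cmatHom A n M) :=
  scalarHom_mul_cmat M a

lemma commute_scalarHom {a : A} {M : Matrix n n A} (h : ∀ i j, Commute a (M i j)) :
    Commute (scalarHom A n a) M := by
  ext i j
  rw [scalarHom_apply, Matrix.diagonal_mul, Matrix.mul_diagonal, (h i j).eq]

lemma commute_apply_of_commute_scalarHom {a : A} {M : Matrix n n A}
    (h : Commute (scalarHom A n a) M) (i j : n) : Commute a (M i j) := by
  have := congrFun (congrFun h.eq i) j
  rwa [scalarHom_apply, Matrix.diagonal_mul, Matrix.mul_diagonal] at this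

lemma kronLeft_scalarHom (a : A) :
    kronLeft A n n' (scalarHom A n a) = scalarHom A (n × n') a := by
  ext ⟨i, j⟩ ⟨k, l⟩
  simp only [kronLeft_apply, scalarHom_apply, Matrix.kroneckerMap_apply, Matrix.diagonal_apply,
    Matrix.one_apply, Prod.mk.injEq]
  split_ifs <;> simp_all

lemma kronRight_scalarHom (a : A) :
    kronRight A n n' (scalarHom A n' a) = scalarHom A (n × n') a := by
  ext ⟨i, j⟩ ⟨k, l⟩
  simp only [kronRight_apply, scalarHom_apply, Matrix.kroneckerMap_apply, Matrix.diagonal_apply,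
    Matrix.one_apply, Prod.mk.injEq]
  split_ifs <;> simp_all

lemma kronLeft_cmatHom (M : Matrix n n ℂ) :
    kronLeft A n n' (cmatHom A n M) = cmatHom A (n × n') (kronLeft ℂ n n' M) := by
  rw [kronLeft_apply, kronLeft_apply]
  exact (map_kron_one (Algebra.ofId ℂ A) M).symm

lemma kronRight_cmatHom (M : Matrix n' n' ℂ) :
    kronRight A n n' (cmatHom A n' M) = cmatHom A (n × n') (kronRight ℂ n n' M) := by
  rw [kronRight_apply, kronRight_apply]
  exact (map_one_kron (Algebra.ofId ℂ A) M).symm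

/-- The analogue of `semiconjBy_qexp` for a rectangular intertwiner, as needed for Clebsch–Gordan
maps. -/
lemma mul_qexp_of_intertwine {n₁ n₂ : Type} [Fintype n₁] [DecidableEq n₁] [Fintype n₂]
    [DecidableEq n₂] (t : ℂ) {x : Matrix n₁ n₁ A} {y : Matrix n₂ n₂ A} {C : Matrix n₁ n₂ A}
    (h : x * C = C * y) (hx : IsNilpotent x) (hy : IsNilpotent y) :
    qexp t x * C = C * qexp t y := by
  obtain ⟨N, hN⟩ := hx
  obtain ⟨M, hM⟩ := hy
  rw [qexp_eq_sum t (pow_eq_zero_of_le (le_max_left N M) hN),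
    qexp_eq_sum t (pow_eq_zero_of_le (le_max_right N M) hM), Matrix.sum_mul, Matrix.mul_sum]
  have hpow : ∀ r, x ^ r * C = C * y ^ r := by
    intro r
    induction r with
    | zero => simp
    | succ r ih => rw [pow_succ, Matrix.mul_assoc, h, ← Matrix.mul_assoc, ih, Matrix.mul_assoc,
        ← pow_succ]
  refine Finset.sum_congr rfl fun r _ => ?_
  rw [Matrix.smul_mul, Matrix.mul_smul, hpow]

end Embeddings

/-! ### The R-matrix in a finite-dimensional representation -/

section Kpow

variable {A B : Type} [Ring A] [Algebra ℂ A] [Ring B] [Algebra ℂ B] {Q : ℂ} {T : GenImages A}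

/-- The unit `𝒦`. -/
def Rels.unitK (h : Rels Q T) : Aˣ := ⟨T.K, T.Kinv, h.K_Kinv, h.Kinv_K⟩

lemma Rels.kpow_eq (h : Rels Q T) (n : ℤ) : T.kpow n = ((h.unitK ^ n : Aˣ) : A) := by
  rw [GenImages.kpow]
  split_ifs with hn
  · obtain ⟨m, rfl⟩ := Int.eq_ofNat_of_zero_le hn
    rw [zpow_natCast, Units.val_pow_eq_pow_val]
    rfl
  · obtain ⟨m, hm⟩ := Int.eq_ofNat_of_zero_le (show 0 ≤ -n by omega)
    rw [show n = -(m : ℤ) by omega, zpow_neg, zpow_natCast, ← inv_pow, Units.val_pow_eq_pow_val]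
    rw [neg_neg]
    rfl

lemma Rels.kpow_add (h : Rels Q T) (m n : ℤ) : T.kpow (m + n) = T.kpow m * T.kpow n := by
  rw [h.kpow_eq, h.kpow_eq, h.kpow_eq, zpow_add, Units.val_mul]

@[simp] lemma kpow_zero (T : GenImages A) : T.kpow 0 = 1 := by simp [GenImages.kpow]

@[simp] lemma kpow_one (T : GenImages A) : T.kpow 1 = T.K := by simp [GenImages.kpow]

@[simp] lemma kpow_neg_one (T : GenImages A) : T.kpow (-1) = T.Kinv := by simp [GenImages.kpow]

lemma Rels.kpow_two (h : Rels Q T) : T.kpow 2 = T.K * T.K := by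
  rw [show (2 : ℤ) = 1 + 1 by norm_num, h.kpow_add, kpow_one]

lemma Rels.kpow_neg_two (h : Rels Q T) : T.kpow (-2) = T.Kinv * T.Kinv := by
  rw [show (-2 : ℤ) = -1 + -1 by norm_num, h.kpow_add, kpow_neg_one]

lemma Rels.commute_kpow (h : Rels Q T) (m n : ℤ) : Commute (T.kpow m) (T.kpow n) := by
  rw [commute_iff_eq, ← h.kpow_add, ← h.kpow_add, add_comm]

lemma GenImages.All.kpow {a : A} (h : Commute a T.K) (h' : Commute a T.Kinv) (n : ℤ) :
    Commute a (T.kpow n) := by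
  rw [GenImages.kpow]
  split_ifs
  · exact h.pow_right _
  · exact h'.pow_right _

lemma map_kpow (φ : A →ₐ[ℂ] B) (T : GenImages A) (n : ℤ) :
    φ (T.kpow n) = (T.map φ).kpow n := by
  simp only [GenImages.kpow, GenImages.map]
  split_ifs <;> simp

lemma Rels.kpow_mul (h : Rels Q T) {c : ℂ} (hc : c ≠ 0) {x : A} (hx : T.K * x = c • (x * T.K))
    (n : ℤ) : T.kpow n * x = c ^ n • (x * T.kpow n) := by
  have hpow : ∀ (u : A) (c : ℂ) (m : ℕ), u * x = c • (x * u) →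
      u ^ m * x = c ^ m • (x * u ^ m) := by
    intro u c m hu
    induction m with
    | zero => simp
    | succ m ih =>
      rw [pow_succ u, mul_assoc, hu, mul_smul_comm, ← mul_assoc, ih, smul_mul_assoc, smul_smul,
        mul_assoc, ← pow_succ']
  rw [GenImages.kpow]
  split_ifs with hn
  · obtain ⟨m, rfl⟩ := Int.eq_ofNat_of_zero_le hn
    rw [zpow_natCast]
    exact hpow _ _ _ hx
  · obtain ⟨m, hm⟩ := Int.eq_ofNat_of_zero_le (show 0 ≤ -n by omega)
    rw [show n = -(m : ℤ) by omega, zpow_neg, zpow_natCast, ← inv_pow, neg_neg]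
    exact hpow _ _ _ (h.inv_comm hc hx)

end Kpow

section RMatrix

variable {A : Type} [Ring A] [Algebra ℂ A] (p : Level) (σ : Sector) (d e : ℕ)
  {T : GenImages A}

lemma q_zpow_mul_self (n : ℤ) : p.q σ ^ n * p.q σ ^ n = p.Q σ ^ n := by
  rw [← mul_zpow, ← pow_two, p.q_sq]

/-- The representation `ρ^{d/2}` in matrices over `A`. -/
def rhoLeg (A : Type) [Ring A] [Algebra ℂ A] : GenImages (Matrix (Fin (d + 1)) (Fin (d + 1)) A) :=
  (rho p σ d).map (cmatHom A (Fin (d + 1)))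

/-- Images in `A`, acting as scalar matrices. -/
def scalarLeg (n : Type) [Fintype n] [DecidableEq n] (T : GenImages A) :
    GenImages (Matrix n n A) :=
  T.map (scalarHom A n)

lemma cmatHom_diagonal {n : Type} [Fintype n] [DecidableEq n] (v : n → ℂ) :
    cmatHom A n (Matrix.diagonal v) = Matrix.diagonal fun i => algebraMap ℂ A (v i) := by
  rw [cmatHom_apply, cmat, Matrix.diagonal_map (map_zero _)]

lemma commute_cartan_scalarHom {a : A} (h : Commute a T.K) (h' : Commute a T.Kinv) :
    Commute (cartan σ d T) (scalarHom A _ a) := by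
  refine (commute_scalarHom fun i j => ?_).symm
  rw [cartan, Matrix.diagonal_apply]
  split_ifs
  · exact GenImages.All.kpow h h' _
  · exact Commute.zero_right _

lemma isCartan_cartan (hT : Rels (p.Q σ) T) :
    IsCartan (rhoLeg p σ d A) (scalarLeg (Fin (d + 1)) T) (cartan σ d T) where
  SK := by
    change Commute (cartan σ d T) (cmatHom A _ (rho p σ d).K)
    rw [rho_K, cmatHom_diagonal, cartan, commute_iff_eq, Matrix.diagonal_mul_diagonal,
      Matrix.diagonal_mul_diagonal]
    simp only [Algebra.commutes]
  SKinv := by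
    change Commute (cartan σ d T) (cmatHom A _ (rho p σ d).Kinv)
    rw [rho_Kinv, cmatHom_diagonal, cartan, commute_iff_eq, Matrix.diagonal_mul_diagonal,
      Matrix.diagonal_mul_diagonal]
    simp only [Algebra.commutes]
  TK := commute_cartan_scalarHom σ d (Commute.refl _) (hT.K_Kinv.trans hT.Kinv_K.symm)
  TKinv := commute_cartan_scalarHom σ d (hT.Kinv_K.trans hT.K_Kinv.symm) (Commute.refl _)
  SX := by
    change cartan σ d T * cmat A (rho p σ d).X =
      cmat A (rho p σ d).X * (scalarHom A _ T.K * scalarHom A _ T.K) * cartan σ d T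
    ext i j
    rw [← map_mul, scalarHom_apply, cartan, Matrix.mul_assoc, Matrix.diagonal_mul_diagonal,
      cmat_mul_diagonal_apply, diagonal_mul_cmat_apply]
    by_cases h : (rho p σ d).X i j = 0
    · simp [h]
    · rw [rho_X_weight p σ i j h, add_comm _ (2 : ℤ), hT.kpow_add, hT.kpow_two]
  SY := by
    change cartan σ d T * cmat A (rho p σ d).Y =
      cmat A (rho p σ d).Y * (scalarHom A _ T.Kinv * scalarHom A _ T.Kinv) * cartan σ d T
    ext i j
    rw [← map_mul, scalarHom_apply, cartan, Matrix.mul_assoc, Matrix.diagonal_mul_diagonal,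
      cmat_mul_diagonal_apply, diagonal_mul_cmat_apply]
    by_cases h : (rho p σ d).Y i j = 0
    · simp [h]
    · rw [rho_Y_weight p σ i j h, sub_eq_add_neg, add_comm _ (-2 : ℤ), hT.kpow_add, hT.kpow_neg_two]
  TX := by
    change cartan σ d T * scalarHom A _ T.X =
      scalarHom A _ T.X * (cmatHom A _ (rho p σ d).K * cmatHom A _ (rho p σ d).K) * cartan σ d T
    rw [rho_K, cmatHom_diagonal, cartan, scalarHom_apply]
    simp only [Matrix.diagonal_mul_diagonal, ← map_mul, q_zpow_mul_self]
    congr 1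
    funext i
    rw [hT.kpow_mul (p.Q_ne_zero σ) hT.K_X, ← Algebra.commutes, mul_assoc, Algebra.smul_def]
  TY := by
    change cartan σ d T * scalarHom A _ T.Y =
      scalarHom A _ T.Y * (cmatHom A _ (rho p σ d).Kinv * cmatHom A _ (rho p σ d).Kinv) *
        cartan σ d T
    rw [rho_Kinv, cmatHom_diagonal, cartan, scalarHom_apply]
    simp only [Matrix.diagonal_mul_diagonal, ← map_mul, q_zpow_mul_self]
    congr 1
    funext i
    rw [hT.kpow_mul (inv_ne_zero (p.Q_ne_zero σ)) hT.K_Y, ← Algebra.commutes, mul_assoc,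
      Algebra.smul_def, inv_zpow']

lemma rhoLeg_comm_scalarLeg (T : GenImages A) :
    (rhoLeg p σ d A).Comm (scalarLeg (Fin (d + 1)) T) :=
  All.map <| All.of_forall (fun _ => All.map <| All.of_forall
    (fun _ => (commute_scalarHom_cmatHom _ _).symm) _) _

lemma isUnit_cartan (hT : Rels (p.Q σ) T) : IsUnit (cartan σ d T) := by
  refine ⟨⟨cartan σ d T, Matrix.diagonal fun i => T.kpow (-(σ.sgn * wt d i)), ?_, ?_⟩, rfl⟩
  · simp only [cartan, Matrix.diagonal_mul_diagonal, ← hT.kpow_add, add_neg_cancel, kpow_zero,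
      Matrix.diagonal_one]
  · simp only [cartan, Matrix.diagonal_mul_diagonal, ← hT.kpow_add, neg_add_cancel, kpow_zero,
      Matrix.diagonal_one]

lemma rhoLeg_e_pow : (rhoLeg p σ d A).e ^ (d + 1) = 0 := by
  rw [show (rhoLeg p σ d A).e = cmatHom A _ (rho p σ d).e from (map_mul _ _ _).symm, ← map_pow,
    rho_e_pow, map_zero]

lemma rhoLeg_f_pow : (rhoLeg p σ d A).f ^ (d + 1) = 0 := by
  rw [show (rhoLeg p σ d A).f = cmatHom A _ (rho p σ d).f from (map_mul _ _ _).symm, ← map_pow,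
    rho_f_pow, map_zero]

lemma rhoLeg_scalarLeg_pow (T : GenImages A) :
    ((rhoLeg p σ d A).e * (scalarLeg (Fin (d + 1)) T).f) ^ (d + 1) = 0 := by
  rw [(rhoLeg_comm_scalarLeg p σ d T).e_f.mul_pow, rhoLeg_e_pow, zero_mul]

lemma scalarLeg_rhoLeg_pow (T : GenImages A) :
    ((scalarLeg (Fin (d + 1)) T).e * (rhoLeg p σ d A).f) ^ (d + 1) = 0 := by
  rw [(rhoLeg_comm_scalarLeg p σ d T).symm.e_f.mul_pow, rhoLeg_f_pow, mul_zero]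

lemma pair_cartan (hT : Rels (p.Q σ) T) :
    Pair (p.Q σ) (rhoLeg p σ d A) (scalarLeg (Fin (d + 1)) T) (cartan σ d T) where
  relS := (rho_rels p σ d).map _
  relT := hT.map _
  comm := rhoLeg_comm_scalarLeg p σ d T
  cartan := isCartan_cartan p σ d hT
  unit := isUnit_cartan p σ d hT
  nilST := ⟨_, rhoLeg_scalarLeg_pow p σ d T⟩
  nilTS := ⟨_, scalarLeg_rhoLeg_pow p σ d T⟩

/-- This identification makes all the universal identities available. The cut-off d + 2 is harmless,
as the matrix leg is nilpotent of order d + 1. -/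
lemma RMat_eq (T : GenImages A) : RMat p σ d T =
    RUniv (p.Q σ) (rhoLeg p σ d A) (scalarLeg (Fin (d + 1)) T) (cartan σ d T) := by
  rw [RMat, RUniv, qexp_eq_sum _ (pow_eq_zero_of_le (show d + 1 ≤ d + 2 by omega)
    (rhoLeg_scalarLeg_pow p σ d T))]
  congr 1
  refine Finset.sum_congr rfl fun n _ => ?_
  rw [(rhoLeg_comm_scalarLeg p σ d T).e_f.mul_pow, expCoef_eq,
    show (rhoLeg p σ d A).e = cmatHom A _ (rho p σ d).e from (map_mul _ _ _).symm,
    show (scalarLeg (Fin (d + 1)) T).f = scalarHom A _ T.f from (map_mul _ _ _).symm,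
    ← map_pow, ← map_pow]
  ext i j
  rw [Matrix.smul_apply, scalarHom_apply, cmatHom_apply, cmat_mul_diagonal_apply, smul_smul]
  rfl

lemma RMat'_eq (T : GenImages A) : RMat' p σ d T =
    RUniv (p.Q σ) (scalarLeg (Fin (d + 1)) T) (rhoLeg p σ d A) (cartan σ d T) := by
  rw [RMat', RUniv, qexp_eq_sum _ (pow_eq_zero_of_le (show d + 1 ≤ d + 2 by omega)
    (scalarLeg_rhoLeg_pow p σ d T))]
  congr 1
  refine Finset.sum_congr rfl fun n _ => ?_
  rw [(rhoLeg_comm_scalarLeg p σ d T).symm.e_f.mul_pow, expCoef_eq,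
    show (rhoLeg p σ d A).f = cmatHom A _ (rho p σ d).f from (map_mul _ _ _).symm,
    show (scalarLeg (Fin (d + 1)) T).e = scalarHom A _ T.e from (map_mul _ _ _).symm,
    ← map_pow, ← map_pow]
  ext i j
  rw [Matrix.smul_apply, scalarHom_apply, cmatHom_apply, diagonal_mul_cmat_apply, smul_smul]
  rfl

lemma isUnit_RMat (hT : Rels (p.Q σ) T) : IsUnit (RMat p σ d T) := by
  rw [RMat_eq]
  exact (pair_cartan p σ d hT).isUnit_RUniv (p.generic σ)

lemma isUnit_RMat' (hT : Rels (p.Q σ) T) : IsUnit (RMat' p σ d T) := by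
  rw [RMat'_eq]
  exact (pair_cartan p σ d hT).symm.isUnit_RUniv (p.generic σ)

/-! ### Two finite-dimensional representations -/

lemma rhoTensor_eq : rhoTensor p σ d e = ((rho p σ d).map (kronLeft ℂ _ (Fin (e + 1)))).comul
    ((rho p σ e).map (kronRight ℂ (Fin (d + 1)) _)) := by
  simp only [rhoTensor, GenImages.map, kronLeft_apply, kronRight_apply]

/-- The first representation in `V ⊗ V'`. -/
def leftLeg (A : Type) [Ring A] [Algebra ℂ A] :
    GenImages (Matrix (Fin (d + 1) × Fin (e + 1)) (Fin (d + 1) × Fin (e + 1)) A) :=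
  (rhoLeg p σ d A).map (kronLeft A _ (Fin (e + 1)))

/-- The second representation in `V ⊗ V'`. -/
def rightLeg (A : Type) [Ring A] [Algebra ℂ A] :
    GenImages (Matrix (Fin (d + 1) × Fin (e + 1)) (Fin (d + 1) × Fin (e + 1)) A) :=
  (rhoLeg p σ e A).map (kronRight A (Fin (d + 1)) _)

/-- The element `𝐪^{(H⊗H)/2}` in `V ⊗ V'`. -/
def cartanFin (A : Type) [Ring A] [Algebra ℂ A] :
    Matrix (Fin (d + 1) × Fin (e + 1)) (Fin (d + 1) × Fin (e + 1)) A :=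
  cmatHom A _ (Matrix.compAlgEquiv _ _ ℂ ℂ (cartan σ d (rho p σ e)))

lemma map_congr {A₁ A₂ : Type} {f g : A₁ → A₂} (h : ∀ a, f a = g a) (T : GenImages A₁) :
    T.map f = T.map g := by rw [funext h]

lemma leftLeg_eq : leftLeg p σ d e A =
    (rhoLeg p σ d (Matrix (Fin (e + 1)) (Fin (e + 1)) ℂ)).map
      ((cmatHom A _).comp (Matrix.compAlgEquiv _ _ ℂ ℂ).toAlgHom) := by
  exact map_congr (f := fun M => kronLeft A _ (Fin (e + 1)) (cmatHom A _ M))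
    (g := fun M => cmatHom A _ (Matrix.compAlgEquiv _ _ ℂ ℂ (cmatHom _ _ M)))
    (fun M => kronLeft_cmatHom M) (rho p σ d)

lemma rightLeg_eq : rightLeg p σ d e A =
    (scalarLeg (Fin (d + 1)) (rho p σ e)).map
      ((cmatHom A _).comp (Matrix.compAlgEquiv _ _ ℂ ℂ).toAlgHom) := by
  exact map_congr (f := fun M => kronRight A (Fin (d + 1)) _ (cmatHom A _ M))
    (g := fun M => cmatHom A _ (Matrix.compAlgEquiv _ _ ℂ ℂ (scalarHom _ _ M)))
    (fun M => kronRight_cmatHom M) (rho p σ e)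

lemma scalarLeg_eq_left (T : GenImages A) : scalarLeg (Fin (d + 1) × Fin (e + 1)) T =
    (scalarLeg (Fin (d + 1)) T).map (kronLeft A _ (Fin (e + 1))) :=
  map_congr (fun _ => (kronLeft_scalarHom _).symm) T

lemma scalarLeg_eq_right (T : GenImages A) : scalarLeg (Fin (d + 1) × Fin (e + 1)) T =
    (scalarLeg (Fin (e + 1)) T).map (kronRight A (Fin (d + 1)) _) :=
  map_congr (fun _ => (kronRight_scalarHom _).symm) T

lemma pair_cartanFin : Pair (p.Q σ) (leftLeg p σ d e A) (rightLeg p σ d e A)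
    (cartanFin p σ d e A) := by
  rw [leftLeg_eq, rightLeg_eq]
  exact (pair_cartan p σ d (rho_rels p σ e)).map _

lemma cmat_RFin : cmat A (RFin p σ d e) =
    RUniv (p.Q σ) (leftLeg p σ d e A) (rightLeg p σ d e A) (cartanFin p σ d e A) := by
  rw [leftLeg_eq, rightLeg_eq]
  refine Eq.trans ?_ ((pair_cartan p σ d (rho_rels p σ e)).map_RUniv _)
  rw [← RMat_eq]
  rfl

lemma isUnit_RFin : IsUnit (RFin p σ d e) := by
  have h := (pair_cartanFin p σ d e (A := ℂ)).isUnit_RUniv (p.generic σ)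
  rw [← cmat_RFin] at h
  exact h

lemma cmat_RFin_inv_mul : cmat A (RFin p σ d e)⁻¹ * cmat A (RFin p σ d e) = 1 := by
  rw [← cmat_mul, Matrix.nonsing_inv_mul _ ((Matrix.isUnit_iff_isUnit_det _).mp
    (isUnit_RFin p σ d e)), cmat_one]

lemma cmat_RFin_mul_inv : cmat A (RFin p σ d e) * cmat A (RFin p σ d e)⁻¹ = 1 := by
  rw [← cmat_mul, Matrix.mul_nonsing_inv _ ((Matrix.isUnit_iff_isUnit_det _).mp
    (isUnit_RFin p σ d e)), cmat_one]

lemma kronLeft_RMat (hT : Rels (p.Q σ) T) : kronLeft A _ (Fin (e + 1)) (RMat p σ d T) =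
    RUniv (p.Q σ) (leftLeg p σ d e A) (scalarLeg _ T) (kronLeft A _ _ (cartan σ d T)) := by
  rw [RMat_eq, (pair_cartan p σ d hT).map_RUniv, scalarLeg_eq_left]
  rfl

lemma kronLeft_RMat' (hT : Rels (p.Q σ) T) : kronLeft A _ (Fin (e + 1)) (RMat' p σ d T) =
    RUniv (p.Q σ) (scalarLeg _ T) (leftLeg p σ d e A) (kronLeft A _ _ (cartan σ d T)) := by
  rw [RMat'_eq, (pair_cartan p σ d hT).symm.map_RUniv, scalarLeg_eq_left]
  rfl

lemma kronRight_RMat (hT : Rels (p.Q σ) T) : kronRight A (Fin (d + 1)) _ (RMat p σ e T) =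
    RUniv (p.Q σ) (rightLeg p σ d e A) (scalarLeg _ T) (kronRight A _ _ (cartan σ e T)) := by
  rw [RMat_eq, (pair_cartan p σ e hT).map_RUniv, scalarLeg_eq_right]
  rfl

lemma kronRight_RMat' (hT : Rels (p.Q σ) T) : kronRight A (Fin (d + 1)) _ (RMat' p σ e T) =
    RUniv (p.Q σ) (scalarLeg _ T) (rightLeg p σ d e A) (kronRight A _ _ (cartan σ e T)) := by
  rw [RMat'_eq, (pair_cartan p σ e hT).symm.map_RUniv, scalarLeg_eq_right]
  rfl

lemma commute_kpow_kpow_cartan (hT : Rels (p.Q σ) T) (d e : ℕ) (i j : Fin (d + 1))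
    (k l : Fin (e + 1)) : Commute (cartan σ d T i j) (cartan σ e T k l) := by
  simp only [cartan, Matrix.diagonal_apply]
  split_ifs
  · exact hT.commute_kpow _ _
  all_goals simp

/-- The explicit diagonal form shows that this element commutes with the other two Cartan elements:
its entries are scalars. -/
lemma cartanFin_eq : cartanFin p σ d e A = Matrix.diagonal fun x =>
    algebraMap ℂ A (p.q σ ^ ((σ.sgn * wt d x.1) * (σ.sgn * wt e x.2))) := by
  have h : cartan σ d (rho p σ e) = Matrix.diagonal fun i => Matrix.diagonal fun j =>
      p.q σ ^ ((σ.sgn * wt d i) * (σ.sgn * wt e j)) := by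
    rw [cartan]
    congr 1
    funext i
    rw [GenImages.kpow, rho_K, rho_Kinv]
    split_ifs with hn
    · obtain ⟨m, hm⟩ := Int.eq_ofNat_of_zero_le hn
      rw [Matrix.diagonal_pow, hm]
      congr 1
      funext j
      rw [Int.toNat_natCast, Pi.pow_apply, ← zpow_natCast, ← zpow_mul, mul_comm]
    · obtain ⟨m, hm⟩ := Int.eq_ofNat_of_zero_le (show 0 ≤ -(σ.sgn * wt d i) by omega)
      rw [Matrix.diagonal_pow, show σ.sgn * wt d i = -m by omega, neg_neg]
      congr 1
      funext j
      rw [Int.toNat_natCast, Pi.pow_apply, ← zpow_natCast, ← zpow_mul]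
      congr 1
      ring
  rw [cartanFin, h, Matrix.compAlgEquiv_apply, Matrix.comp_diagonal_diagonal, cmatHom_diagonal]

/-- The three legs V, V' and A all act in matrices over A indexed by V ⊗ V'. Each Cartan element
involves only two legs and commutes with the third. -/
lemma triple_cartan (hT : Rels (p.Q σ) T) :
    Triple (p.Q σ) (leftLeg p σ d e A) (rightLeg p σ d e A) (scalarLeg _ T)
      (cartanFin p σ d e A) (kronLeft A _ _ (cartan σ d T)) (kronRight A _ _ (cartan σ e T)) where
  h₁₂ := pair_cartanFin p σ d e
  h₁₃ := by
    rw [scalarLeg_eq_left]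
    exact (pair_cartan p σ d hT).map _
  h₂₃ := by
    rw [scalarLeg_eq_right]
    exact (pair_cartan p σ e hT).map _
  c₃ := All.map <| All.of_forall (fun a => (commute_scalarHom_cmatHom
    (Matrix.compAlgEquiv _ _ ℂ ℂ (cartan σ d (rho p σ e))) a).symm) T
  c₂ := All.map <| All.map <| All.of_forall (fun M => commute_kronLeft_kronRight
    (M := cartan σ d T) (M' := cmatHom A _ M) fun i j k l =>
      (commute_cmat_apply M (cartan σ d T i j) k l).symm) (rho p σ e)
  c₁ := All.map <| All.map <| All.of_forall (fun M => (commute_kronLeft_kronRight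
    (M := cmatHom A _ M) (M' := cartan σ e T) fun i j k l =>
      (commute_cmat_apply M (cartan σ e T k l) i j)).symm) (rho p σ d)
  t₁₂₁₃ := by
    rw [cartanFin_eq, kronLeft_apply, cartan, ← Matrix.diagonal_one,
      Matrix.diagonal_kronecker_diagonal, commute_iff_eq, Matrix.diagonal_mul_diagonal,
      Matrix.diagonal_mul_diagonal]
    simp only [Algebra.commutes]
  t₁₂₂₃ := by
    rw [cartanFin_eq, kronRight_apply, cartan, ← Matrix.diagonal_one,
      Matrix.diagonal_kronecker_diagonal, commute_iff_eq, Matrix.diagonal_mul_diagonal,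
      Matrix.diagonal_mul_diagonal]
    simp only [Algebra.commutes]
  t₁₃₂₃ := commute_kronLeft_kronRight (commute_kpow_kpow_cartan p σ hT d e)

end RMatrix

/-! ### Fusion -/

section Fusion

variable {A : Type} [Ring A] [Algebra ℂ A] {p : Level} {σ : Sector} {d e l : ℕ}
  {S T : GenImages A}

/-- Distinct weights have distinct 𝒦-eigenvalues, so commutation with 𝒦 becomes a selection rule on
weights. -/
lemma q_zpow_injective (p : Level) (σ : Sector) : Function.Injective fun n : ℤ => p.q σ ^ n := by
  have key : ∀ n : ℕ, p.q σ ^ (n + 1) ≠ 1 := by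
    intro n hn
    apply (p.generic σ).pow_ne_one n
    rw [← p.q_sq, ← pow_mul, mul_comm, pow_mul, hn, one_pow]
  have key' : ∀ n : ℤ, p.q σ ^ n = 1 → n = 0 := by
    intro n hn
    by_contra h0
    rcases lt_or_gt_of_ne h0 with h | h
    · obtain ⟨m, hm⟩ := Int.eq_ofNat_of_zero_le (show 0 ≤ -n - 1 by omega)
      apply key m
      rw [show n = -((m + 1 : ℕ) : ℤ) by push_cast; omega, zpow_neg, inv_eq_one,
        zpow_natCast] at hn
      exact hn
    · obtain ⟨m, hm⟩ := Int.eq_ofNat_of_zero_le (show 0 ≤ n - 1 by omega)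
      apply key m
      rw [show n = ((m + 1 : ℕ) : ℤ) by push_cast; omega, zpow_natCast] at hn
      exact hn
  intro m n h
  have := key' (m - n) <| by
    rw [zpow_sub₀ (p.q_ne_zero σ), div_eq_one_iff_eq (zpow_ne_zero _ (p.q_ne_zero σ))]
    exact h
  omega

/-- An intertwiner from a representation to a tensor product. -/
structure IsIntertwiner (p : Level) (σ : Sector) (d e l : ℕ)
    (C : Matrix (Fin (d + 1) × Fin (e + 1)) (Fin (l + 1)) ℂ) : Prop where
  K : C * (rho p σ l).K = (rhoTensor p σ d e).K * C
  X : C * (rho p σ l).X = (rhoTensor p σ d e).X * C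
  Y : C * (rho p σ l).Y = (rhoTensor p σ d e).Y * C

lemma rhoTensor_rels (p : Level) (σ : Sector) (d e : ℕ) :
    Rels (p.Q σ) (rhoTensor p σ d e) := by
  rw [rhoTensor_eq]
  refine Rels.comul (p.generic σ) ((rho_rels p σ d).map _) ((rho_rels p σ e).map _) ?_
  have key : ∀ (M : Matrix (Fin (d + 1)) (Fin (d + 1)) ℂ) (M' : Matrix (Fin (e + 1)) (Fin (e + 1)) ℂ),
      Commute (kronLeft ℂ _ (Fin (e + 1)) M) (kronRight ℂ (Fin (d + 1)) _ M') :=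
    fun M M' => commute_kronLeft_kronRight fun _ _ _ _ => Commute.all _ _
  have h1 : ∀ M, ((rho p σ e).map (kronRight ℂ (Fin (d + 1)) _)).All
      (Commute (kronLeft ℂ _ (Fin (e + 1)) M)) := fun M =>
    All.map (All.of_forall (fun M' => key M M') _)
  exact All.map (All.of_forall (fun M => h1 M) _)

lemma rhoTensor_K (p : Level) (σ : Sector) (d e : ℕ) : (rhoTensor p σ d e).K =
    Matrix.diagonal fun x => p.q σ ^ (σ.sgn * wt d x.1 + σ.sgn * wt e x.2) := by
  change (rho p σ d).K ⊗ₖ 1 * 1 ⊗ₖ (rho p σ e).K = _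
  rw [rho_K, rho_K, ← Matrix.diagonal_one, ← Matrix.diagonal_one,
    Matrix.diagonal_kronecker_diagonal, Matrix.diagonal_kronecker_diagonal,
    Matrix.diagonal_mul_diagonal]
  simp only [mul_one, one_mul, zpow_add₀ (p.q_ne_zero σ)]

lemma rhoTensor_map (p : Level) (σ : Sector) (d e : ℕ) :
    (rhoTensor p σ d e).map (cmatHom A _) = (leftLeg p σ d e A).comul (rightLeg p σ d e A) := by
  rw [rhoTensor_eq, map_comul]
  congr 1
  · exact map_congr (fun M => (kronLeft_cmatHom M).symm) (rho p σ d)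
  · exact map_congr (fun M => (kronRight_cmatHom M).symm) (rho p σ e)

namespace IsIntertwiner

variable {C : Matrix (Fin (d + 1) × Fin (e + 1)) (Fin (l + 1)) ℂ}

lemma Kinv (h : IsIntertwiner p σ d e l C) :
    C * (rho p σ l).Kinv = (rhoTensor p σ d e).Kinv * C := by
  calc C * (rho p σ l).Kinv
      = (rhoTensor p σ d e).Kinv * ((rhoTensor p σ d e).K * C) * (rho p σ l).Kinv := by
        rw [← Matrix.mul_assoc (rhoTensor p σ d e).Kinv, (rhoTensor_rels p σ d e).Kinv_K,
          Matrix.one_mul]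
    _ = (rhoTensor p σ d e).Kinv * C * ((rho p σ l).K * (rho p σ l).Kinv) := by
        rw [← h.K]
        simp only [Matrix.mul_assoc]
    _ = _ := by rw [(rho_rels p σ l).K_Kinv, Matrix.mul_one]

lemma map_e (h : IsIntertwiner p σ d e l C) :
    (rhoTensor p σ d e).e * C = C * (rho p σ l).e := by
  rw [GenImages.e, GenImages.e, Matrix.mul_assoc, ← h.X, ← Matrix.mul_assoc, ← h.K,
    Matrix.mul_assoc]

lemma map_f (h : IsIntertwiner p σ d e l C) :
    (rhoTensor p σ d e).f * C = C * (rho p σ l).f := by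
  rw [GenImages.f, GenImages.f, Matrix.mul_assoc, ← h.Y, ← Matrix.mul_assoc, ← h.Kinv,
    Matrix.mul_assoc]

/-- Compare the 𝒦-eigenvalues on the two sides of a nonzero matrix element. -/
lemma weight (h : IsIntertwiner p σ d e l C) (x : Fin (d + 1) × Fin (e + 1)) (i : Fin (l + 1))
    (hx : C x i ≠ 0) : σ.sgn * wt d x.1 + σ.sgn * wt e x.2 = σ.sgn * wt l i := by
  have := congrFun (congrFun h.K x) i
  rw [rho_K, rhoTensor_K, Matrix.mul_diagonal, Matrix.diagonal_mul, mul_comm] at this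
  exact (q_zpow_injective p σ (mul_right_cancel₀ hx this)).symm

lemma cartan_mul (h : IsIntertwiner p σ d e l C) (hT : Rels (p.Q σ) T) :
    kronLeft A _ _ (cartan σ d T) * kronRight A _ _ (cartan σ e T) * cmat A C =
      cmat A C * cartan σ l T := by
  rw [kronLeft_apply, kronRight_apply, cartan, cartan, ← Matrix.diagonal_one,
    ← Matrix.diagonal_one, Matrix.diagonal_kronecker_diagonal, Matrix.diagonal_kronecker_diagonal,
    Matrix.diagonal_mul_diagonal, cartan]
  ext x i
  rw [diagonal_mul_cmat_apply, cmat_mul_diagonal_apply]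
  by_cases hx : C x i = 0
  · simp [hx]
  · rw [mul_one, one_mul, ← hT.kpow_add, h.weight x i hx]

/-- Fusion of `R'`. -/
lemma RMat'_mul (h : IsIntertwiner p σ d e l C) (hT : Rels (p.Q σ) T) :
    kronRight A _ _ (RMat' p σ e T) * kronLeft A _ _ (RMat' p σ d T) * cmat A C =
      cmat A C * RMat' p σ l T := by
  have ht := triple_cartan p σ d e hT
  have hn := comul_nil (p.generic σ) (ht.h₁₃.flip (p.generic σ)).symm
    (ht.h₂₃.flip (p.generic σ)).symm ht.h₁₂.comm.flip
  rw [kronLeft_RMat' p σ d e hT, kronRight_RMat' p σ d e hT,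
    ← RUniv_comul_right (p.generic σ) ht.h₁₃.symm ht.h₂₃.symm ht.h₁₂.comm ht.c₂, RMat'_eq,
    RUniv, RUniv, ← ht.t₁₃₂₃.eq]
  have hx : (scalarLeg (Fin (d + 1) × Fin (e + 1)) T).e *
      ((leftLeg p σ d e A).comul (rightLeg p σ d e A)).f * cmat A C =
      cmat A C * ((scalarLeg (Fin (l + 1)) T).e * (rhoLeg p σ l A).f) := by
    rw [← rhoTensor_map]
    have e1 : ((rhoTensor p σ d e).map (cmatHom A _)).f = cmat A (rhoTensor p σ d e).f :=
      (map_mul (cmatHom A _) _ _).symm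
    have e2 : (scalarLeg (Fin (d + 1) × Fin (e + 1)) T).e = scalarHom A _ T.e :=
      (map_mul (scalarHom A _) _ _).symm
    have e3 : (scalarLeg (Fin (l + 1)) T).e = scalarHom A _ T.e :=
      (map_mul (scalarHom A _) _ _).symm
    have e4 : (rhoLeg p σ l A).f = cmat A (rho p σ l).f :=
      (map_mul (cmatHom A _) _ _).symm
    rw [e1, e2, e3, e4, Matrix.mul_assoc, ← cmat_mul, h.map_f, cmat_mul, ← Matrix.mul_assoc,
      scalarHom_mul_cmat, Matrix.mul_assoc]
  -- Here the coproduct sits on the `f`-side, so nilpotency comes from the flipped statement.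
  have hnil : IsNilpotent ((scalarLeg (Fin (d + 1) × Fin (e + 1)) T).e *
      ((leftLeg p σ d e A).comul (rightLeg p σ d e A)).f) := by
    have h' := comul_nil (p.generic σ) (ht.h₂₃.symm.flip (p.generic σ))
      (ht.h₁₃.symm.flip (p.generic σ)) ht.h₁₂.comm.symm.flip
    rw [← flip_comul ht.h₁₂.comm] at h'
    have hc := (ht.h₁₃.comm.comul_left ht.h₂₃.comm).symm.e_f
    rw [hc.eq]
    exact h'
  rw [Matrix.mul_assoc, mul_qexp_of_intertwine _ hx hnil ⟨_, scalarLeg_rhoLeg_pow p σ l T⟩,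
    ← Matrix.mul_assoc, h.cartan_mul hT, Matrix.mul_assoc]

/-- Fusion of `R`. -/
lemma RMat_mul (h : IsIntertwiner p σ d e l C) (hT : Rels (p.Q σ) T) :
    kronLeft A _ _ (RMat p σ d T) * kronRight A _ _ (RMat p σ e T) * cmat A C =
      cmat A C * RMat p σ l T := by
  have ht := triple_cartan p σ d e hT
  rw [kronLeft_RMat p σ d e hT, kronRight_RMat p σ d e hT,
    ← RUniv_comul_left (p.generic σ) ht.h₁₃ ht.h₂₃ ht.h₁₂.comm ht.c₁, RMat_eq, RUniv, RUniv]
  have hx : ((leftLeg p σ d e A).comul (rightLeg p σ d e A)).e *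
      (scalarLeg (Fin (d + 1) × Fin (e + 1)) T).f * cmat A C =
      cmat A C * ((rhoLeg p σ l A).e * (scalarLeg (Fin (l + 1)) T).f) := by
    rw [← rhoTensor_map]
    have e1 : ((rhoTensor p σ d e).map (cmatHom A _)).e = cmat A (rhoTensor p σ d e).e :=
      (map_mul (cmatHom A _) _ _).symm
    have e2 : (scalarLeg (Fin (d + 1) × Fin (e + 1)) T).f = scalarHom A _ T.f :=
      (map_mul (scalarHom A _) _ _).symm
    have e3 : (scalarLeg (Fin (l + 1)) T).f = scalarHom A _ T.f :=
      (map_mul (scalarHom A _) _ _).symm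
    have e4 : (rhoLeg p σ l A).e = cmat A (rho p σ l).e :=
      (map_mul (cmatHom A _) _ _).symm
    rw [e1, e2, e3, e4, Matrix.mul_assoc, scalarHom_mul_cmat, ← Matrix.mul_assoc, ← cmat_mul,
      h.map_e, cmat_mul, Matrix.mul_assoc]
  have hnil := comul_nil (p.generic σ) ht.h₁₃ ht.h₂₃ ht.h₁₂.comm
  rw [Matrix.mul_assoc, mul_qexp_of_intertwine _ hx hnil ⟨_, rhoLeg_scalarLeg_pow p σ l T⟩,
    ← Matrix.mul_assoc, h.cartan_mul hT, Matrix.mul_assoc]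

end IsIntertwiner

lemma CGMaps.isIntertwiner (C : CGMaps p σ d e) (t : Fin (min d e + 1)) :
    IsIntertwiner p σ d e (d + e - 2 * t) (C.C1 t) :=
  ⟨C.C1_K t, C.C1_X t, C.C1_Y t⟩

/-! ### Coproducts of the site representations -/

lemma scalarLeg_comul (n : Type) [Fintype n] [DecidableEq n] (S T : GenImages A) :
    scalarLeg n (S.comul T) = (scalarLeg n S).comul (scalarLeg n T) :=
  map_comul _ _ _

lemma scalarLeg_comm (n : Type) [Fintype n] [DecidableEq n] (h : S.Comm T) :
    (scalarLeg n S).Comm (scalarLeg n T) :=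
  h.map _

lemma kpow_comul (hS : Rels (p.Q σ) S) (hT : Rels (p.Q σ) T) (h : S.Comm T) (n : ℤ) :
    (S.comul T).kpow n = S.kpow n * T.kpow n := by
  rw [GenImages.kpow, GenImages.kpow, GenImages.kpow]
  split_ifs
  · exact (h.1.1 : Commute S.K T.K).mul_pow _
  · exact (h.2.1.2.1 : Commute S.Kinv T.Kinv).mul_pow _

lemma cartan_comul (hS : Rels (p.Q σ) S) (hT : Rels (p.Q σ) T) (h : S.Comm T) :
    cartan σ d (S.comul T) = cartan σ d S * cartan σ d T := by
  rw [cartan, cartan, cartan, Matrix.diagonal_mul_diagonal]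
  simp only [kpow_comul hS hT h]

lemma commute_cartan_scalarLeg (h : S.Comm T) :
    (scalarLeg (Fin (d + 1)) T).All (Commute (cartan σ d S)) :=
  All.map <| (All.imp fun _ ha => commute_cartan_scalarHom σ d ha.1 ha.2.1) h.symm

lemma commute_cartan_cartan (h : S.Comm T) : Commute (cartan σ d S) (cartan σ d T) := by
  rw [cartan, cartan, commute_iff_eq, Matrix.diagonal_mul_diagonal, Matrix.diagonal_mul_diagonal]
  congr 1
  funext i
  exact GenImages.All.kpow (GenImages.All.kpow h.1.1.symm h.2.1.1.symm _).symm
    (GenImages.All.kpow h.1.2.1.symm h.2.1.2.1.symm _).symm _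

/-- R reverses the order of the two factors, whereas R' keeps it. This nesting is what makes the
products of dressed holonomies telescope. -/
lemma RMat_comul (hS : Rels (p.Q σ) S) (hT : Rels (p.Q σ) T) (h : S.Comm T) (d : ℕ) :
    RMat p σ d (S.comul T) = RMat p σ d T * RMat p σ d S := by
  rw [RMat_eq, RMat_eq, RMat_eq, scalarLeg_comul, cartan_comul hS hT h,
    (commute_cartan_cartan h).eq]
  exact RUniv_comul_right (p.generic σ) (pair_cartan p σ d hS) (pair_cartan p σ d hT)
    (scalarLeg_comm _ h) (commute_cartan_scalarLeg h)

lemma RMat'_comul (hS : Rels (p.Q σ) S) (hT : Rels (p.Q σ) T) (h : S.Comm T) (d : ℕ) :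
    RMat' p σ d (S.comul T) = RMat' p σ d S * RMat' p σ d T := by
  rw [RMat'_eq, RMat'_eq, RMat'_eq, scalarLeg_comul, cartan_comul hS hT h]
  exact RUniv_comul_left (p.generic σ) (pair_cartan p σ d hS).symm (pair_cartan p σ d hT).symm
    (scalarLeg_comm _ h) (commute_cartan_scalarLeg h.symm)

lemma RMat_counit (d : ℕ) : RMat p σ d (GenImages.counit : GenImages A) = 1 := by
  have h1 : cartan σ d (GenImages.counit : GenImages A) = 1 := by
    rw [cartan, ← Matrix.diagonal_one]
    congr 1
    funext i
    simp [GenImages.kpow, GenImages.counit]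
  rw [RMat_eq, RUniv, h1, one_mul,
    show (scalarLeg (Fin (d + 1)) (GenImages.counit : GenImages A)).f = 0 by
      change scalarHom A _ 1 * scalarHom A _ 0 = 0
      rw [map_zero, mul_zero], mul_zero, qexp_eq_sum _ (pow_one 0)]
  simp

lemma RMat'_counit (d : ℕ) : RMat' p σ d (GenImages.counit : GenImages A) = 1 := by
  have h1 : cartan σ d (GenImages.counit : GenImages A) = 1 := by
    rw [cartan, ← Matrix.diagonal_one]
    congr 1
    funext i
    simp [GenImages.kpow, GenImages.counit]
  rw [RMat'_eq, RUniv, h1, one_mul,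
    show (scalarLeg (Fin (d + 1)) (GenImages.counit : GenImages A)).e = 0 by
      change scalarHom A _ 1 * scalarHom A _ 0 = 0
      rw [map_zero, mul_zero], zero_mul, qexp_eq_sum _ (pow_one 0)]
  simp

/-! ### Dressed holonomies -/

/-- `(ρ ⊗ π)(R'R)`. -/
def loopMat (p : Level) (σ : Sector) (d : ℕ) (T : GenImages A) :
    Matrix (Fin (d + 1)) (Fin (d + 1)) A :=
  RMat' p σ d T * RMat p σ d T

/-- The dressed holonomy `(ρ ⊗ ι)(R') (ρ ⊗ π)(R'R) (ρ ⊗ ι)(R'⁻¹)`. -/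
def dressedMat (p : Level) (σ : Sector) (d : ℕ) (S T : GenImages A) :
    Matrix (Fin (d + 1)) (Fin (d + 1)) A :=
  RMat' p σ d S * loopMat p σ d T * Ring.inverse (RMat' p σ d S)

/-- The telescoping of the product of the dressed holonomies. -/
lemma dressedMat_mul_loopMat (hS : Rels (p.Q σ) S) (hT : Rels (p.Q σ) T) (h : S.Comm T) (d : ℕ) :
    dressedMat p σ d S T * loopMat p σ d S = loopMat p σ d (S.comul T) := by
  rw [dressedMat, loopMat, loopMat, loopMat, RMat_comul hS hT h, RMat'_comul hS hT h]
  calc _ = RMat' p σ d S * (RMat' p σ d T * RMat p σ d T) *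
        (Ring.inverse (RMat' p σ d S) * RMat' p σ d S) * RMat p σ d S := by
        simp only [mul_assoc]
    _ = _ := by rw [Ring.inverse_mul_cancel _ (isUnit_RMat' p σ d hS), mul_one]
                simp only [mul_assoc]

lemma loopMat_counit (d : ℕ) : loopMat p σ d (GenImages.counit : GenImages A) = 1 := by
  rw [loopMat, RMat_counit, RMat'_counit, one_mul]

lemma dressedMat_counit (T : GenImages A) (d : ℕ) :
    dressedMat p σ d GenImages.counit T = loopMat p σ d T := by
  rw [dressedMat, RMat'_counit, Ring.inverse_one, one_mul, mul_one]

lemma rhoLeg_zero (p : Level) (σ : Sector) : (rhoLeg p σ 0 A).e = 0 ∧ (rhoLeg p σ 0 A).f = 0 := by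
  have h1 := rhoLeg_e_pow p σ 0 (A := A)
  have h2 := rhoLeg_f_pow p σ 0 (A := A)
  exact ⟨by simpa using h1, by simpa using h2⟩

lemma cartan_zero (T : GenImages A) : cartan σ 0 T = 1 := by
  rw [cartan, ← Matrix.diagonal_one]
  congr 1
  funext i
  have : wt 0 i = 0 := by simp [wt]
  rw [this, mul_zero, kpow_zero]

lemma dressedMat_zero (S T : GenImages A) : dressedMat p σ 0 S T = 1 := by
  have h1 : ∀ T : GenImages A, RMat p σ 0 T = 1 := by
    intro T
    rw [RMat_eq, RUniv, (rhoLeg_zero p σ).1, cartan_zero, zero_mul, qexp_eq_sum _ (pow_one 0)]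
    simp
  have h2 : ∀ T : GenImages A, RMat' p σ 0 T = 1 := by
    intro T
    rw [RMat'_eq, RUniv, (rhoLeg_zero p σ).2, cartan_zero, mul_zero, qexp_eq_sum _ (pow_one 0)]
    simp
  rw [dressedMat, loopMat, h1, h2, h2, Ring.inverse_one, one_mul, one_mul, one_mul]

/-- Gauge covariance. -/
lemma commute_of_semiconj {R : Type} [Ring R] {r r' x y : R} (h : r * x = y * r)
    (h' : r' * y = x * r') : Commute (r' * r) x := by
  rw [commute_iff_eq, mul_assoc, h, ← mul_assoc, h', mul_assoc]

/-- R carries the coproduct into the opposite one and R' carries it back. -/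
lemma loopMat_gauge (hT : Rels (p.Q σ) T) (d : ℕ) :
    ((rhoLeg p σ d A).comul (scalarLeg _ T)).All (Commute (loopMat p σ d T)) := by
  have h := pair_cartan p σ d hT
  rw [loopMat, RMat_eq, RMat'_eq]
  exact ⟨commute_of_semiconj h.RUniv_K h.symm.RUniv_K,
    commute_of_semiconj h.RUniv_Kinv h.symm.RUniv_Kinv,
    commute_of_semiconj (h.RUniv_X (p.generic σ)) (h.symm.RUniv_X (p.generic σ)),
    commute_of_semiconj (h.RUniv_Y (p.generic σ)) (h.symm.RUniv_Y (p.generic σ))⟩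

/-- Locality: the entries of the R-matrix are polynomials in the images of the generators. -/
lemma commute_RMat'_scalarHom {a : A} (h : T.All (Commute a)) :
    Commute (scalarHom A _ a) (RMat' p σ d T) := by
  rw [RMat'_eq]
  refine Commute.mul_right (commute_cartan_scalarHom σ d h.1 h.2.1).symm
    (commute_qexp _ ?_ ⟨_, scalarLeg_rhoLeg_pow p σ d T⟩)
  refine Commute.mul_right ?_ ?_
  · rw [show (scalarLeg (Fin (d + 1)) T).e = scalarHom A _ T.e from (map_mul _ _ _).symm]
    exact (h.1.mul_right h.2.2.1 : Commute a T.e).map (scalarHom A _)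
  · exact (commute_scalarHom_cmatHom _ _).mul_right (commute_scalarHom_cmatHom _ _)

end Fusion

/-! ### The relations of the dressed holonomies -/

section Dressed

variable {A : Type} [Ring A] [Algebra ℂ A] {p : Level} {σ : Sector} {d e : ℕ}
  {S T : GenImages A}

lemma commute_RMat_scalarHom {a : A} (h : T.All (Commute a)) :
    Commute (scalarHom A _ a) (RMat p σ d T) := by
  rw [RMat_eq]
  refine Commute.mul_right (commute_cartan_scalarHom σ d h.1 h.2.1).symm
    (commute_qexp _ ?_ ⟨_, rhoLeg_scalarLeg_pow p σ d T⟩)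
  refine Commute.mul_right ?_ ?_
  · exact (commute_scalarHom_cmatHom _ _).mul_right (commute_scalarHom_cmatHom _ _)
  · rw [show (scalarLeg (Fin (d + 1)) T).f = scalarHom A _ T.f from (map_mul _ _ _).symm]
    exact (h.2.1.mul_right h.2.2.2 : Commute a T.f).map (scalarHom A _)

lemma commute_loopMat_scalarHom {a : A} (h : T.All (Commute a)) :
    Commute (scalarHom A _ a) (loopMat p σ d T) :=
  (commute_RMat'_scalarHom h).mul_right (commute_RMat_scalarHom h)

lemma Commute.ringInverse_right {R : Type} [Ring R] {a b : R} (h : Commute a b) :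
    Commute a (Ring.inverse b) := by
  by_cases hb : IsUnit b
  · obtain ⟨u, rfl⟩ := hb
    rw [Ring.inverse_unit]
    exact h.units_inv_right
  · rw [Ring.inverse_non_unit _ hb]
    exact Commute.zero_right a

lemma commute_dressedMat_scalarHom {a : A} (hS : S.All (Commute a)) (hT : T.All (Commute a)) :
    Commute (scalarHom A _ a) (dressedMat p σ d S T) :=
  ((commute_RMat'_scalarHom hS).mul_right (commute_loopMat_scalarHom hT)).mul_right
    (Commute.ringInverse_right (commute_RMat'_scalarHom hS))

lemma commute_scalarLeg_of_comm {M : Matrix (Fin (d + 1)) (Fin (d + 1)) A}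
    (h : S.Comm T) (hM : ∀ a, S.All (Commute a) → Commute (scalarHom A _ a) M) :
    (scalarLeg _ T).All (Commute M) :=
  All.map <| (All.imp fun a ha => (hM a ha).symm) h.symm

/-- The dressed holonomies are gauge covariant. -/
lemma dressedMat_gauge (hS : Rels (p.Q σ) S) (hT : Rels (p.Q σ) T) (h : S.Comm T) (d : ℕ) :
    ((rhoLeg p σ d A).comul (scalarLeg _ (S.comul T))).All (Commute (dressedMat p σ d S T)) := by
  rw [scalarLeg_comul, ← comul_assoc]
  have hU := (pair_cartan p σ d hS).symm
  have hUT : (scalarLeg _ T).All (Commute (RMat' p σ d S)) :=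
    commute_scalarLeg_of_comm h fun _ ha => commute_RMat'_scalarHom ha
  have hLS : (scalarLeg _ S).All (Commute (loopMat p σ d T)) :=
    commute_scalarLeg_of_comm h.symm fun _ ha => commute_loopMat_scalarHom ha
  -- The loop of T ignores S and is covariant under ρ and T together. Coassociativity makes it
  -- covariant under the order S, ρ, T.
  have hL : (((scalarLeg _ S).comul (rhoLeg p σ d A)).comul (scalarLeg _ T)).All
      (Commute (loopMat p σ d T)) := by
    rw [comul_assoc]
    exact All.commute_comul hLS (loopMat_gauge hT d)
  -- Conjugation by R' transports covariance: R' exchanges the order S, ρ in the coproduct for the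
  -- order ρ, S.
  have key : ∀ x y, RMat' p σ d S * x = y * RMat' p σ d S → Commute (loopMat p σ d T) x →
      Commute (dressedMat p σ d S T) y := by
    intro x y hxy hx
    have hu := isUnit_RMat' p σ d hS
    have e1 : Ring.inverse (RMat' p σ d S) * y = x * Ring.inverse (RMat' p σ d S) := by
      calc _ = Ring.inverse (RMat' p σ d S) * (y * RMat' p σ d S) *
            Ring.inverse (RMat' p σ d S) := by
            rw [mul_assoc, mul_assoc, Ring.mul_inverse_cancel _ hu, mul_one]
        _ = _ := by rw [← hxy, ← mul_assoc, Ring.inverse_mul_cancel _ hu, one_mul]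
    rw [commute_iff_eq, dressedMat, mul_assoc, e1, ← mul_assoc, mul_assoc _ _ x, hx.eq,
      ← mul_assoc, hxy]
    simp only [mul_assoc]
  have hK := hU.RUniv_K
  have hKi := hU.RUniv_Kinv
  have hX := hU.RUniv_X (p.generic σ)
  have hY := hU.RUniv_Y (p.generic σ)
  rw [← RMat'_eq] at hK hKi hX hY
  refine ⟨key _ _ ?_ hL.1, key _ _ ?_ hL.2.1, key _ _ ?_ hL.2.2.1, key _ _ ?_ hL.2.2.2⟩
  · change _ * (_ * _) = _ * _ * _
    rw [← mul_assoc, hK, mul_assoc, hUT.1.eq, mul_assoc]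
  · change _ * (_ * _) = _ * _ * _
    rw [← mul_assoc, hKi, mul_assoc, hUT.2.1.eq, mul_assoc]
  · change _ * (_ * _ + _ * _) = (_ * _ + _ * _) * _
    rw [mul_add, add_mul, ← mul_assoc, hX, mul_assoc, hUT.1.eq, mul_assoc,
      ← mul_assoc _ (GenImages.Kinv _), hKi, mul_assoc _ (RMat' p σ d S), hUT.2.2.1.eq, mul_assoc]
  · change _ * (_ * _ + _ * _) = (_ * _ + _ * _) * _
    rw [mul_add, add_mul, ← mul_assoc, hY, mul_assoc, hUT.1.eq, mul_assoc,
      ← mul_assoc _ (GenImages.Kinv _), hKi, mul_assoc _ (RMat' p σ d S), hUT.2.2.2.eq, mul_assoc]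

/-- Covariance is inherited by larger tensor products. -/
lemma gauge_comul {M : Matrix (Fin (d + 1)) (Fin (d + 1)) A}
    (hM : ((rhoLeg p σ d A).comul (scalarLeg _ S)).All (Commute M))
    (hT : T.All fun a => Commute (scalarHom A _ a) M) :
    ((rhoLeg p σ d A).comul (scalarLeg _ (S.comul T))).All (Commute M) := by
  rw [scalarLeg_comul, ← comul_assoc]
  exact All.commute_comul hM (All.map <| (All.imp fun a ha => ha.symm) hT)

lemma rho_kpow (p : Level) (σ : Sector) (d : ℕ) (n : ℤ) : (rho p σ d).kpow n =
    Matrix.diagonal fun i => p.q σ ^ (σ.sgn * wt d i * n) := by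
  rw [GenImages.kpow]
  split_ifs with hn
  · obtain ⟨m, rfl⟩ := Int.eq_ofNat_of_zero_le hn
    rw [rho_K, Matrix.diagonal_pow]
    congr 1
    funext i
    simp [zpow_mul]
  · obtain ⟨m, hm⟩ := Int.eq_ofNat_of_zero_le (show 0 ≤ -n by omega)
    obtain rfl : n = -m := by omega
    rw [rho_Kinv, Matrix.diagonal_pow]
    congr 1
    funext i
    simp [zpow_mul]

lemma rhoLeg_kpow (n : ℤ) : (rhoLeg p σ d A).kpow n =
    Matrix.diagonal fun i => algebraMap ℂ A (p.q σ ^ (σ.sgn * wt d i * n)) := by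
  rw [rhoLeg, ← map_kpow, rho_kpow, cmatHom_diagonal]

/-- On each basis vector of the second space the combined Cartan element is a power of the coproduct
of 𝒦, so covariance under 𝒦 suffices. -/
lemma commute_kronLeft_cartan (hS : Rels (p.Q σ) S) {M : Matrix (Fin (d + 1)) (Fin (d + 1)) A}
    (hM : ((rhoLeg p σ d A).comul (scalarLeg _ S)).All (Commute M)) (e : ℕ) :
    Commute (kronLeft A _ (Fin (e + 1)) M)
      (cartanFin p σ d e A * kronRight A _ _ (cartan σ e S)) := by
  have h1 : ∀ n : ℤ, Commute M ((rhoLeg p σ d A).kpow n * (scalarLeg _ S).kpow n) := by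
    intro n
    have hk := kpow_comul (p := p) (σ := σ) (S := rhoLeg p σ d A) (T := scalarLeg _ S)
      ((rho_rels p σ d).map _) (hS.map _) (rhoLeg_comm_scalarLeg p σ d S) n
    rw [← hk]
    exact GenImages.All.kpow hM.1 hM.2.1 n
  have h2 : ∀ (n : ℤ) i j, M i j * (algebraMap ℂ A (p.q σ ^ (σ.sgn * wt d j * n)) * S.kpow n) =
      algebraMap ℂ A (p.q σ ^ (σ.sgn * wt d i * n)) * S.kpow n * M i j := by
    intro n i j
    have := congrFun (congrFun (h1 n).eq i) j
    rw [rhoLeg_kpow, scalarLeg, ← map_kpow, scalarHom_apply, Matrix.diagonal_mul_diagonal,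
      Matrix.mul_diagonal, Matrix.diagonal_mul] at this
    exact this
  rw [commute_iff_eq, cartanFin_eq, kronRight_apply, cartan, ← Matrix.diagonal_one,
    Matrix.diagonal_kronecker_diagonal, Matrix.diagonal_mul_diagonal]
  ext ⟨a, b⟩ ⟨c, k⟩
  rw [Matrix.mul_diagonal, Matrix.diagonal_mul, kronLeft_apply, Matrix.kroneckerMap_apply]
  simp only [Matrix.one_apply, one_mul]
  split_ifs with hbk
  · subst hbk
    rw [mul_one]
    exact h2 _ a c
  · simp

/-- The exchange relation. -/
lemma loopProd_dressedMat (hS : Rels (p.Q σ) S) {M : Matrix (Fin (d + 1)) (Fin (d + 1)) A}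
    (hM : ((rhoLeg p σ d A).comul (scalarLeg _ S)).All (Commute M))
    (hMT : ∀ i j, T.All (Commute (M i j))) (e : ℕ) :
    loopProd p σ d e M (dressedMat p σ e S T) =
      loopProdExch p σ d e M (dressedMat p σ e S T) := by
  have ht := triple_cartan p σ d e hS
  have hr := isUnit_RMat' p σ e hS
  have hM' : ((leftLeg p σ d e A).comul (scalarLeg _ S)).All
      (Commute (kronLeft A _ (Fin (e + 1)) M)) := by
    rw [scalarLeg_eq_left, leftLeg, ← map_comul]
    exact All.map <| (All.imp fun a ha => Commute.map ha (kronLeft A _ (Fin (e + 1)))) hM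
  have hMf : Commute (kronLeft A _ (Fin (e + 1)) M) (rightLeg p σ d e A).f := by
    have h1 : ∀ N, Commute (kronLeft A _ (Fin (e + 1)) M)
        (kronRight A (Fin (d + 1)) _ (cmatHom A _ N)) := fun N =>
      commute_kronLeft_kronRight fun _ _ _ _ => (commute_cmat_apply _ _ _ _).symm
    exact (h1 _).mul_right (h1 _)
  -- R₁₂R' is the image of R under a coproduct in its first leg (ρ together with S). A matrix M that
  -- is covariant under this coproduct therefore commutes with it, although not with the individual
  -- factors.
  have hMR : Commute (kronLeft A _ (Fin (e + 1)) M)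
      (cmat A (RFin p σ d e) * kronRight A _ _ (RMat' p σ e S)) := by
    rw [cmat_RFin, kronRight_RMat' p σ d e hS,
      ← RUniv_comul_left (p.generic σ) ht.h₁₂ ht.h₂₃.symm ht.h₁₃.comm ht.c₁]
    refine (commute_kronLeft_cartan hS hM e).mul_right (commute_qexp _ ?_
      (comul_nil (p.generic σ) ht.h₁₂ ht.h₂₃.symm ht.h₁₃.comm))
    exact (hM'.1.mul_right hM'.2.2.1).mul_right hMf
  have hML : Commute (kronLeft A _ (Fin (e + 1)) M) (kronRight A _ _ (loopMat p σ e T)) :=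
    commute_kronLeft_kronRight fun _ _ _ _ =>
      commute_apply_of_commute_scalarHom (commute_loopMat_scalarHom (hMT _ _)) _ _
  rw [loopProd, loopProdExch, ← kronLeft_apply, ← kronRight_apply, dressedMat, map_mul, map_mul]
  have i1 : kronRight A (Fin (d + 1)) _ (RMat' p σ e S) *
      kronRight A _ _ (Ring.inverse (RMat' p σ e S)) = 1 := by
    rw [← map_mul, Ring.mul_inverse_cancel _ hr, map_one]
  have i2 : kronRight A (Fin (d + 1)) _ (Ring.inverse (RMat' p σ e S)) *
      kronRight A _ _ (RMat' p σ e S) = 1 := by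
    rw [← map_mul, Ring.inverse_mul_cancel _ hr, map_one]
  have j1 := cmat_RFin_mul_inv p σ d e (A := A)
  have j2 := cmat_RFin_inv_mul p σ d e (A := A)
  generalize kronRight A (Fin (d + 1)) _ (RMat' p σ e S) = u at *
  generalize kronRight A (Fin (d + 1)) _ (Ring.inverse (RMat' p σ e S)) = u' at *
  generalize kronRight A (Fin (d + 1)) _ (loopMat p σ e T) = L at *
  generalize kronLeft A _ (Fin (e + 1)) M = m at *
  generalize cmat A (RFin p σ d e) = r at *
  generalize cmat A (RFin p σ d e)⁻¹ = r' at *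
  have e1 : u' * r' * m = m * (u' * r') := by
    calc u' * r' * m = u' * r' * m * (r * (u * u') * r') := by rw [i1, mul_one, j1, mul_one]
      _ = u' * r' * (m * (r * u)) * u' * r' := by simp only [mul_assoc]
      _ = u' * (r' * r) * u * m * u' * r' := by rw [hMR.eq]; simp only [mul_assoc]
      _ = _ := by rw [j2, mul_one, i2, one_mul, mul_assoc]
  calc r' * m * r * (u * L * u') = r' * (m * (r * u)) * L * u' := by simp only [mul_assoc]
    _ = (r' * r) * u * (m * L) * u' := by rw [hMR.eq]; simp only [mul_assoc]
    _ = u * L * (m * (u' * (r' * r))) := by rw [hML.eq, j2, one_mul, mul_one]; simp only [mul_assoc]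
    _ = u * L * (m * (u' * r')) * r := by simp only [mul_assoc]
    _ = u * L * u' * r' * m * r := by rw [← e1]; simp only [mul_assoc]

/-- The intertwiner C slides through the dressing, the loop and, by inverting the first relation,
through the inverse dressing. -/
lemma fusion_aux {n l : Type} [Fintype n] [DecidableEq n] [Fintype l] [DecidableEq l]
    {U₁ U₂ V₁ V₂ R₁ R₂ W₁ W₂ : Matrix n n A} {C : Matrix n l A} {u v r w : Matrix l l A}
    (h1 : U₂ * U₁ * C = C * u) (h2 : V₂ * V₁ * C = C * v) (h3 : R₁ * R₂ * C = C * r)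
    (h4 : W₁ * U₁ = 1) (h5 : W₂ * U₂ = 1) (h6 : u * w = 1) :
    U₂ * U₁ * (V₂ * V₁ * (R₁ * R₂)) * (W₁ * W₂) * C = C * (u * (v * r) * w) := by
  have h7 : W₁ * W₂ * C = C * w := by
    calc W₁ * W₂ * C = W₁ * W₂ * (C * u * w) := by rw [Matrix.mul_assoc C, h6, Matrix.mul_one]
      _ = W₁ * (W₂ * U₂) * U₁ * C * w := by rw [← h1]; simp only [Matrix.mul_assoc]
      _ = C * w := by rw [h5, Matrix.mul_one, h4, Matrix.one_mul]
  calc _ = U₂ * U₁ * (V₂ * V₁ * (R₁ * R₂)) * (W₁ * W₂ * C) := by simp only [Matrix.mul_assoc]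
    _ = U₂ * U₁ * (V₂ * V₁ * (R₁ * R₂ * C)) * w := by rw [h7]; simp only [Matrix.mul_assoc]
    _ = U₂ * U₁ * (V₂ * V₁ * C) * r * w := by rw [h3]; simp only [Matrix.mul_assoc]
    _ = U₂ * U₁ * C * v * r * w := by rw [h2]; simp only [Matrix.mul_assoc]
    _ = _ := by rw [h1]; simp only [Matrix.mul_assoc]

/-- The fusion relation. -/
lemma loopProd_dressedMat_self (hS : Rels (p.Q σ) S) (hT : Rels (p.Q σ) T) (h : S.Comm T)
    (C : CGMaps p σ d e) :
    loopProd p σ d e (dressedMat p σ d S T) (dressedMat p σ e S T) =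
      cgSum C fun d => dressedMat p σ d S T := by
  have hSt := triple_cartan p σ d e hS
  have hTt := triple_cartan p σ d e hT
  have hSLT : ∀ (d e : ℕ) (i j : Fin (d + 1)) (k l : Fin (e + 1)),
      Commute (loopMat p σ d T i j) (RMat' p σ e S k l) := by
    intro d e i j k l
    have hS' : S.All (Commute (loopMat p σ d T i j)) :=
      (All.imp fun a ha => (commute_apply_of_commute_scalarHom
        (commute_loopMat_scalarHom ha) i j).symm) h
    exact commute_apply_of_commute_scalarHom (commute_RMat'_scalarHom hS') k l
  have hd := isUnit_RMat' p σ d hS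
  have he := isUnit_RMat' p σ e hS
  have q1 : kronLeft A _ (Fin (e + 1)) (Ring.inverse (RMat' p σ d S)) *
      kronLeft A _ _ (RMat' p σ d S) = 1 := by
    rw [← map_mul, Ring.inverse_mul_cancel _ hd, map_one]
  have q2 : kronLeft A _ (Fin (e + 1)) (RMat' p σ d S) *
      kronLeft A _ _ (Ring.inverse (RMat' p σ d S)) = 1 := by
    rw [← map_mul, Ring.mul_inverse_cancel _ hd, map_one]
  have q3 : kronRight A (Fin (d + 1)) _ (Ring.inverse (RMat' p σ e S)) *
      kronRight A _ _ (RMat' p σ e S) = 1 := by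
    rw [← map_mul, Ring.inverse_mul_cancel _ he, map_one]
  have hc1 : Commute (kronLeft A _ (Fin (e + 1)) (loopMat p σ d T))
      (kronRight A _ _ (RMat' p σ e S)) := commute_kronLeft_kronRight fun _ _ _ _ => hSLT _ _ _ _ _ _
  have hc2 : Commute (kronLeft A _ (Fin (e + 1)) (Ring.inverse (RMat' p σ d S)))
      (kronRight A _ _ (loopMat p σ e T)) := by
    have : Commute (kronLeft A _ (Fin (e + 1)) (RMat' p σ d S))
      (kronRight A _ _ (loopMat p σ e T)) :=
      commute_kronLeft_kronRight fun _ _ _ _ => (hSLT _ _ _ _ _ _).symm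
    rw [commute_iff_eq]
    calc _ = kronLeft A _ (Fin (e + 1)) (Ring.inverse (RMat' p σ d S)) *
          (kronRight A _ _ (loopMat p σ e T) * kronLeft A _ (Fin (e + 1)) (RMat' p σ d S)) *
          kronLeft A _ (Fin (e + 1)) (Ring.inverse (RMat' p σ d S)) := by
          rw [mul_assoc, mul_assoc, q2, mul_one]
      _ = _ := by rw [← this.eq, ← mul_assoc, q1, one_mul]
  -- The dressings are collected outside, leaving an undressed fusion product of loops of T in the
  -- middle, to which `loop_product` applies.
  have hdp := hSt.dressed_product (p.generic σ) (V := cmat A (RFin p σ d e)⁻¹)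
    (W₁ := kronLeft A _ (Fin (e + 1)) (Ring.inverse (RMat' p σ d S)))
    (W₂ := kronRight A (Fin (d + 1)) _ (Ring.inverse (RMat' p σ e S)))
    (L₁ := kronLeft A _ (Fin (e + 1)) (loopMat p σ d T))
    (L₂ := kronRight A (Fin (d + 1)) _ (loopMat p σ e T))
    (by rw [← cmat_RFin, cmat_RFin_inv_mul]) (by rw [← cmat_RFin, cmat_RFin_mul_inv])
    (by rw [← kronLeft_RMat' p σ d e hS, q1]) (by rw [← kronLeft_RMat' p σ d e hS, q2])
    (by rw [← kronRight_RMat' p σ d e hS]; exact hc1) hc2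
  have hlp := hTt.loop_product (p.generic σ) (V := cmat A (RFin p σ d e)⁻¹)
    (by rw [← cmat_RFin, cmat_RFin_inv_mul])
  rw [← cmat_RFin, ← kronLeft_RMat' p σ d e hS, ← kronRight_RMat' p σ d e hS] at hdp
  rw [← cmat_RFin, ← kronLeft_RMat' p σ d e hT, ← kronRight_RMat' p σ d e hT,
    ← kronLeft_RMat p σ d e hT, ← kronRight_RMat p σ d e hT, ← map_mul, ← map_mul] at hlp
  rw [loopMat, loopMat, hlp] at hdp
  rw [loopProd, ← kronLeft_apply, ← kronRight_apply]
  simp only [dressedMat, map_mul, loopMat] at hdp ⊢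
  rw [hdp]
  have hone : ∑ t, cmat A (C.C1 t) * cmat A (C.C2 t) = 1 := by
    have := congrArg (cmatHom A _) C.C1_C2
    rw [map_sum, map_one] at this
    rw [← this]
    exact Finset.sum_congr rfl fun t _ => (cmat_mul _ _).symm
  -- Inserting the completeness relation of the Clebsch–Gordan maps decomposes the product into
  -- spins; each C1 then slides to the left.
  rw [← mul_one (_ * _), ← hone, Finset.mul_sum, cgSum]
  refine Finset.sum_congr rfl fun t _ => ?_
  have hi := C.isIntertwiner t
  have f1 := hi.RMat'_mul hS (A := A)
  have f2 := hi.RMat'_mul hT (A := A)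
  have f3 := hi.RMat_mul hT (A := A)
  have hl := isUnit_RMat' p σ (d + e - 2 * t) hS
  have q4 := Ring.mul_inverse_cancel _ hl
  have := fusion_aux f1 f2 f3 q1 q3 q4
  rw [← Matrix.mul_assoc, this]

end Dressed

/-! ### Shift and multiplication operators -/

section Operators

variable (p : Level) {m : ℕ}

/-- A representative in ℤ/k may be replaced by any integer, since a multiple of k changes the
exponent by a multiple of 2πi. -/
lemma exp_val (l a : ℤ) :
    Complex.exp (2 * Real.pi * Complex.I / p.k * l * ((((a : ℤ) : ZMod p.k)).val : ℂ)) =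
      Complex.exp (2 * Real.pi * Complex.I / p.k * l * a) := by
  have hk : (p.k : ℂ) ≠ 0 := by exact_mod_cast NeZero.ne p.k
  have h1 : ((((a : ℤ) : ZMod p.k)).val : ℤ) = a - p.k * (a / p.k) := by
    rw [ZMod.val_intCast, Int.emod_def]
  have h2 : ((((a : ℤ) : ZMod p.k)).val : ℂ) = (a : ℂ) - p.k * ((a / p.k : ℤ) : ℂ) := by
    exact_mod_cast congrArg (Int.cast : ℤ → ℂ) h1
  rw [h2, Complex.exp_eq_exp_iff_exists_int]
  refine ⟨-(l * (a / p.k)), ?_⟩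
  push_cast
  field_simp
  ring

lemma exp_val_add (l : ℤ) (s t : ZMod p.k) :
    Complex.exp (2 * Real.pi * Complex.I / p.k * l * ((s + t).val : ℂ)) =
      Complex.exp (2 * Real.pi * Complex.I / p.k * l * (s.val : ℂ)) *
        Complex.exp (2 * Real.pi * Complex.I / p.k * l * (t.val : ℂ)) := by
  have h : s + t = (((s.val + t.val : ℕ) : ℤ) : ZMod p.k) := by simp
  rw [← Complex.exp_add, ← mul_add]
  conv_lhs => rw [h]
  rw [exp_val]
  push_cast
  rfl

lemma shiftOp_apply (ν : Fin m) (τ : ℂ) (n : ZMod p.k) (f : Dom p m) (z s) :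
    (shiftOp p ν τ n f).1 z s = f.1 (z + Pi.single ν τ) (s + Pi.single ν n) := rfl

lemma multOp_apply (ν : Fin m) (c : ℂ) (l : ℤ) (f : Dom p m) (z s) :
    (multOp p ν c l f).1 z s = Complex.exp
      (c * z ν + 2 * Real.pi * Complex.I / p.k * l * ((s ν).val : ℂ)) * f.1 z s := rfl

lemma Dom.end_ext {P P' : Module.End ℂ (Dom p m)}
    (h : ∀ f z s, (P f).1 z s = (P' f).1 z s) : P = P' := by
  ext f z s
  exact h f z s

lemma shiftOp_mul_shiftOp (ν : Fin m) (τ τ' : ℂ) (n n' : ZMod p.k) :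
    shiftOp p ν τ n * shiftOp p ν τ' n' = shiftOp p ν (τ + τ') (n + n') := by
  refine Dom.end_ext p fun f z s => ?_
  rw [Module.End.mul_apply, shiftOp_apply, shiftOp_apply, shiftOp_apply, Pi.single_add,
    Pi.single_add, add_assoc, add_assoc]

lemma shiftOp_zero (ν : Fin m) : shiftOp p ν 0 0 = 1 := by
  refine Dom.end_ext p fun f z s => ?_
  rw [shiftOp_apply, Pi.single_zero, Pi.single_zero, add_zero, add_zero, Module.End.one_apply]

lemma commute_shiftOp (ν ν' : Fin m) (τ τ' : ℂ) (n n' : ZMod p.k) :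
    Commute (shiftOp p ν τ n) (shiftOp p ν' τ' n') := by
  refine Dom.end_ext p fun f z s => ?_
  rw [Module.End.mul_apply, Module.End.mul_apply, shiftOp_apply, shiftOp_apply, shiftOp_apply,
    shiftOp_apply, add_right_comm, add_right_comm s]

lemma multOp_mul_multOp (ν : Fin m) (c c' : ℂ) (l l' : ℤ) :
    multOp p ν c l * multOp p ν c' l' = multOp p ν (c + c') (l + l') := by
  refine Dom.end_ext p fun f z s => ?_
  rw [Module.End.mul_apply, multOp_apply, multOp_apply, multOp_apply, ← mul_assoc,
    ← Complex.exp_add]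
  congr 2
  push_cast
  ring

lemma multOp_zero (ν : Fin m) : multOp p ν 0 0 = 1 := by
  refine Dom.end_ext p fun f z s => ?_
  rw [multOp_apply, Module.End.one_apply]
  simp

lemma commute_multOp (ν ν' : Fin m) (c c' : ℂ) (l l' : ℤ) :
    Commute (multOp p ν c l) (multOp p ν' c' l') := by
  refine Dom.end_ext p fun f z s => ?_
  rw [Module.End.mul_apply, Module.End.mul_apply, multOp_apply, multOp_apply, multOp_apply,
    multOp_apply, mul_left_comm]

lemma shiftOp_mul_multOp (ν : Fin m) (τ c : ℂ) (a l : ℤ) :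
    shiftOp p ν τ (a : ZMod p.k) * multOp p ν c l =
      Complex.exp (c * τ + 2 * Real.pi * Complex.I / p.k * l * a) •
        (multOp p ν c l * shiftOp p ν τ (a : ZMod p.k)) := by
  refine Dom.end_ext p fun f z s => ?_
  rw [Module.End.mul_apply, LinearMap.smul_apply, Module.End.mul_apply, shiftOp_apply,
    multOp_apply]
  change _ = _ * (multOp p ν c l (shiftOp p ν τ (a : ZMod p.k) f)).1 z s
  rw [multOp_apply, shiftOp_apply, Pi.add_apply, Pi.add_apply, Pi.single_eq_same,
    Pi.single_eq_same, Complex.exp_add, exp_val_add, exp_val, mul_add, Complex.exp_add,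
    Complex.exp_add, Complex.exp_add]
  ring

lemma commute_shiftOp_multOp {ν ν' : Fin m} (h : ν ≠ ν') (τ c : ℂ) (n : ZMod p.k) (l : ℤ) :
    Commute (shiftOp p ν τ n) (multOp p ν' c l) := by
  refine Dom.end_ext p fun f z s => ?_
  rw [Module.End.mul_apply, Module.End.mul_apply, shiftOp_apply, multOp_apply, multOp_apply,
    shiftOp_apply, Pi.add_apply, Pi.add_apply, Pi.single_eq_of_ne h.symm,
    Pi.single_eq_of_ne h.symm, add_zero, add_zero]

/-! ### The quantum torus -/

lemma sgn_mul_sgn (σ : Sector) : (σ.sgn : ℂ) * σ.sgn = 1 := by cases σ <;> simp [Sector.sgn]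

/-- The ℤ/k shift supplies the summand 1 of 1 + b² in h, the imaginary shift of μ the summand b². -/
lemma xPow_mul_yPow (σ : Sector) (ν : Fin m) (α β : ℤ) :
    xPow p σ ν α * yPow p σ ν β = p.q σ ^ (2 * (α * β)) • (yPow p σ ν β * xPow p σ ν α) := by
  rw [xPow, yPow, shiftOp_mul_multOp, Level.q, ← Complex.exp_int_mul, Level.h]
  congr 2
  push_cast
  linear_combination (2 * Real.pi * Complex.I / p.k * (α * β)) * sgn_mul_sgn σ
    - (2 * Real.pi * Complex.I / p.k * (α * β) * p.bPar σ ^ 2) * Complex.I_mul_I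

/-- On the same site but in opposite sectors the continuous phase involves b · b⁻¹ = 1 and is
cancelled by the ℤ/k phase, whose sign is opposite. -/
lemma commute_xPow_yPow {σ σ' : Sector} {ν ν' : Fin m} (h : ν ≠ ν' ∨ σ ≠ σ') (α β : ℤ) :
    Commute (xPow p σ ν α) (yPow p σ' ν' β) := by
  by_cases hν : ν = ν'
  · subst hν
    have hb : p.bPar σ * p.bPar σ' = 1 := by
      have hb0 : p.b ≠ 0 := fun h => by have := p.re_pos; simp [h] at this
      cases σ <;> cases σ' <;> simp_all [Level.bPar]
    have hs : (σ.sgn : ℂ) * σ'.sgn = -1 := by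
      cases σ <;> cases σ' <;> simp_all [Sector.sgn]
    rw [xPow, yPow, commute_iff_eq, shiftOp_mul_multOp]
    refine Eq.trans (congrArg (· • _) ?_) (one_smul ℂ _)
    rw [Complex.exp_eq_one_iff]
    refine ⟨0, ?_⟩
    push_cast
    linear_combination (2 * Real.pi * Complex.I / p.k * (α * β)) * hs
      - (2 * Real.pi * Complex.I / p.k * (α * β) * p.bPar σ * p.bPar σ') * Complex.I_mul_I
      + (2 * Real.pi * Complex.I / p.k * (α * β)) * hb
  · exact commute_shiftOp_multOp p hν _ _ _ _

lemma xPow_mul_xPow (σ : Sector) (ν : Fin m) (α β : ℤ) :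
    xPow p σ ν α * xPow p σ ν β = xPow p σ ν (α + β) := by
  rw [xPow, xPow, xPow, shiftOp_mul_shiftOp]
  congr 1
  · push_cast; ring
  · push_cast; ring

lemma yPow_mul_yPow (σ : Sector) (ν : Fin m) (α β : ℤ) :
    yPow p σ ν α * yPow p σ ν β = yPow p σ ν (α + β) := by
  rw [yPow, yPow, yPow, multOp_mul_multOp]
  congr 1
  · push_cast; ring
  · ring

/-- The Weyl relations. -/
lemma xOp_mul_xOp (σ : Sector) (ν : Fin m) (α β γ δ : ℤ) :
    xOp p σ ν α β * xOp p σ ν γ δ =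
      p.q σ ^ (α * δ - β * γ) • xOp p σ ν (α + γ) (β + δ) := by
  have h : yPow p σ ν β * xPow p σ ν γ =
      p.q σ ^ (-(2 * (γ * β))) • (xPow p σ ν γ * yPow p σ ν β) := by
    rw [xPow_mul_yPow, smul_smul, ← zpow_add₀ (p.q_ne_zero σ), neg_add_cancel, zpow_zero, one_smul]
  rw [xOp, xOp, xOp, smul_mul_smul_comm, mul_assoc, ← mul_assoc (yPow p σ ν β), h,
    smul_mul_assoc, mul_smul_comm, mul_assoc (xPow p σ ν γ), yPow_mul_yPow,
    ← mul_assoc (xPow p σ ν α), xPow_mul_xPow, smul_smul, smul_smul, ← zpow_add₀ (p.q_ne_zero σ), ← zpow_add₀ (p.q_ne_zero σ),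
    ← zpow_add₀ (p.q_ne_zero σ)]
  congr 2
  ring

lemma xOp_zero (σ : Sector) (ν : Fin m) : xOp p σ ν 0 0 = 1 := by
  rw [xOp, xPow, yPow]
  simp [shiftOp_zero, multOp_zero]

lemma commute_xOp {σ σ' : Sector} {ν ν' : Fin m} (h : ν ≠ ν' ∨ σ ≠ σ') (α β γ δ : ℤ) :
    Commute (xOp p σ ν α β) (xOp p σ' ν' γ δ) := by
  refine Commute.smul_left (Commute.smul_right ?_ _) _
  refine Commute.mul_left (Commute.mul_right ?_ ?_) (Commute.mul_right ?_ ?_)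
  · exact commute_shiftOp _ _ _ _ _ _ _
  · exact commute_xPow_yPow p h _ _
  · exact (commute_xPow_yPow p (h.imp Ne.symm Ne.symm) _ _).symm
  · exact commute_multOp _ _ _ _ _ _ _

/-! ### The site representations -/

/-- In [𝒳, 𝒴] the λ-term drops out because 𝐱_{1,-1} and 𝐱_{-1,1} commute; the other two monomials
give the two summands of 𝒦² - 𝒦⁻². Hence λ is free. -/
lemma siteOps_rels (σ : Sector) (ν : Fin m) (lam : ℂ) :
    Rels (p.Q σ) (siteOps p σ ν lam) := by
  have hq0 := p.q_ne_zero σ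
  have hQ : p.Q σ = p.q σ ^ 2 := (p.q_sq σ).symm
  have hQ0 : p.Q σ ≠ 0 := p.Q_ne_zero σ
  have hD := p.Q_sub_inv_ne_zero σ
  have e1 : p.q σ ^ (1 : ℤ) = p.Q σ * p.q σ ^ (-1 : ℤ) := by
    rw [hQ, zpow_neg, zpow_one]; field_simp
  have e2 : p.q σ ^ (-1 : ℤ) = (p.Q σ)⁻¹ * p.q σ ^ (1 : ℤ) := by
    rw [hQ, zpow_neg, zpow_one]; field_simp
  have e3 : p.q σ ^ (2 : ℤ) = p.Q σ := by rw [hQ]; rfl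
  have e4 : p.q σ ^ (-2 : ℤ) = (p.Q σ)⁻¹ := by rw [zpow_neg, e3]
  constructor
  · simp only [siteOps]
    rw [xOp_mul_xOp]
    norm_num [xOp_zero]
  · simp only [siteOps]
    rw [xOp_mul_xOp]
    norm_num [xOp_zero]
  · simp only [siteOps, mul_add, add_mul, mul_smul_comm, smul_mul_assoc, xOp_mul_xOp, smul_add]
    norm_num only
    simp only [smul_smul]
    rw [e1]
    congr 1
    · congr 1
      · congr 1; ring
      · congr 1; ring
    · congr 1; ring
  · simp only [siteOps, mul_add, add_mul, mul_smul_comm, smul_mul_assoc, xOp_mul_xOp, smul_add]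
    norm_num only
    simp only [smul_smul]
    rw [e2]
    congr 1; ring
  · simp only [siteOps, mul_add, add_mul, mul_smul_comm, smul_mul_assoc, xOp_mul_xOp, smul_add]
    norm_num only
    rw [e3, e4]
    simp only [zpow_zero, one_smul]
    set D := p.Q σ - (p.Q σ)⁻¹
    have hI : -Complex.I / D * (-Complex.I / D) = -(D⁻¹ * D⁻¹) := by
      rw [div_mul_div_comm, neg_mul_neg, Complex.I_mul_I]
      field_simp
    have hc : D * (-Complex.I / D * (-Complex.I / D) * D) = -1 := by
      rw [hI]; field_simp
    have : D • ((-Complex.I / D) • (-Complex.I / D) • D • (xOp p σ ν 2 0 - xOp p σ ν (-2) 0)) =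
      xOp p σ ν (-2) 0 - xOp p σ ν 2 0 := by
      rw [smul_smul, smul_smul, smul_smul]
      rw [show D * (-Complex.I / D) * (-Complex.I / D) * D = -1 by rw [← hc]; ring]
      module
    rw [← this]
    module

/-- An induction principle for the site representations. -/
lemma siteOps_all {P : Module.End ℂ (Dom p m) → Prop} (hadd : ∀ a b, P a → P b → P (a + b))
    (hsmul : ∀ (c : ℂ) a, P a → P (c • a)) (σ : Sector) (ν : Fin m) (lam : ℂ)
    (h : ∀ α β, Odd α → P (xOp p σ ν α β)) : (siteOps p σ ν lam).All P := by
  have h3 : Odd (3 : ℤ) := by decide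
  have h1 : Odd (1 : ℤ) := by decide
  have h1' : Odd (-1 : ℤ) := by decide
  exact ⟨h _ _ h1', h _ _ h1, hsmul _ _ (hadd _ _ (hadd _ _ (hsmul _ _ (h _ _ h1)) (h _ _ h3))
    (h _ _ h1')), hsmul _ _ (h _ _ h1')⟩

lemma siteOps_comm {σ σ' : Sector} {ν ν' : Fin m} (h : ν ≠ ν' ∨ σ ≠ σ') (lam lam' : ℂ) :
    (siteOps p σ ν lam).Comm (siteOps p σ' ν' lam') := by
  refine siteOps_all p (P := fun a => (siteOps p σ' ν' lam').All fun b => Commute a b)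
    (fun a b ha hb => ⟨ha.1.add_left hb.1, ha.2.1.add_left hb.2.1, ha.2.2.1.add_left hb.2.2.1,
      ha.2.2.2.add_left hb.2.2.2⟩)
    (fun c a ha => ⟨ha.1.smul_left _, ha.2.1.smul_left _, ha.2.2.1.smul_left _,
      ha.2.2.2.smul_left _⟩) _ _ _ fun α β _ => ?_
  exact siteOps_all p (P := fun b => Commute (xOp p σ ν α β) b)
    (fun a b ha hb => ha.add_right hb) (fun c a ha => ha.smul_right c) _ _ _
    fun γ δ _ => commute_xOp p h _ _ _ _

lemma tensorOps_zero (σ : Sector) (lam : Fin m → ℂ) : tensorOps p σ lam 0 = GenImages.counit := by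
  simp [tensorOps]

lemma tensorOps_succ (σ : Sector) (lam : Fin m → ℂ) (n : ℕ) (hn : n < m) :
    tensorOps p σ lam (n + 1) =
      (tensorOps p σ lam n).comul (siteOps p σ ⟨n, hn⟩ (lam ⟨n, hn⟩)) := by
  rw [tensorOps, List.take_add_one, List.foldl_append]
  simp [tensorOps, hn]

lemma All_counit {A : Type} [Ring A] {P : A → Prop} (h1 : P 1) (h0 : P 0) :
    (GenImages.counit : GenImages A).All P := ⟨h1, h1, h0, h0⟩

lemma tensorOps_all {P : Module.End ℂ (Dom p m) → Prop} (h1 : P 1) (h0 : P 0)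
    (hadd : ∀ a b, P a → P b → P (a + b)) (hmul : ∀ a b, P a → P b → P (a * b))
    (σ : Sector) (lam : Fin m → ℂ) (n : ℕ) (hn : n ≤ m)
    (h : ∀ ν : Fin m, ν.val < n → (siteOps p σ ν (lam ν)).All P) :
    (tensorOps p σ lam n).All P := by
  induction n with
  | zero =>
    rw [tensorOps_zero]
    exact All_counit h1 h0
  | succ n ih =>
    rw [tensorOps_succ p σ lam n (by omega)]
    exact All.comul hadd hmul (ih (by omega) fun ν hν => h ν (by omega)) (h _ (by simp))

lemma tensorOps_commute (σ : Sector) (lam : Fin m → ℂ) (n : ℕ) (hn : n ≤ m)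
    {a : Module.End ℂ (Dom p m)}
    (h : ∀ ν : Fin m, ν.val < n → (siteOps p σ ν (lam ν)).All (Commute a)) :
    (tensorOps p σ lam n).All (Commute a) :=
  tensorOps_all p (Commute.one_right _) (Commute.zero_right _)
    (fun _ _ h h' => h.add_right h') (fun _ _ h h' => h.mul_right h') σ lam n hn h

lemma tensorOps_comm_siteOps (σ σ' : Sector) (lam : Fin m → ℂ) (n : ℕ) (hn : n ≤ m) (ν : Fin m)
    (c : ℂ) (h : n ≤ ν.val ∨ σ ≠ σ') : (tensorOps p σ lam n).Comm (siteOps p σ' ν c) := by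
  refine Comm.symm ?_
  have key : ∀ ν' : Fin m, ν'.val < n → (siteOps p σ' ν c).Comm (siteOps p σ ν' (lam ν')) := by
    intro ν' hν'
    refine siteOps_comm p (h.imp (fun h h' => ?_) Ne.symm) _ _
    subst h'
    omega
  exact ⟨tensorOps_commute p σ lam n hn fun ν' hν' => (key ν' hν').1,
    tensorOps_commute p σ lam n hn fun ν' hν' => (key ν' hν').2.1,
    tensorOps_commute p σ lam n hn fun ν' hν' => (key ν' hν').2.2.1,
    tensorOps_commute p σ lam n hn fun ν' hν' => (key ν' hν').2.2.2⟩

lemma tensorOps_rels (σ : Sector) (lam : Fin m → ℂ) (n : ℕ) (hn : n ≤ m) :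
    Rels (p.Q σ) (tensorOps p σ lam n) := by
  induction n with
  | zero =>
    rw [tensorOps_zero]
    exact Rels.counit
  | succ n ih =>
    rw [tensorOps_succ p σ lam n (by omega)]
    exact Rels.comul (p.generic σ) (ih (by omega)) (siteOps_rels p σ _ _)
      (tensorOps_comm_siteOps p σ σ lam n (by omega) _ _ (Or.inl le_rfl))

lemma tensorOps_comm_tensorOps {σ σ' : Sector} (h : σ ≠ σ') (lam : Fin m → ℂ) (n n' : ℕ)
    (hn : n ≤ m) (hn' : n' ≤ m) : (tensorOps p σ lam n).Comm (tensorOps p σ' lam n') := by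
  have key : ∀ ν' : Fin m, ν'.val < n' → (tensorOps p σ lam n).Comm
      (siteOps p σ' ν' (lam ν')) := fun ν' _ =>
    tensorOps_comm_siteOps p σ σ' lam n hn _ _ (Or.inr h)
  exact ⟨tensorOps_commute p σ' lam n' hn' fun ν' hν' => (key ν' hν').1,
    tensorOps_commute p σ' lam n' hn' fun ν' hν' => (key ν' hν').2.1,
    tensorOps_commute p σ' lam n' hn' fun ν' hν' => (key ν' hν').2.2.1,
    tensorOps_commute p σ' lam n' hn' fun ν' hν' => (key ν' hν').2.2.2⟩

lemma dressedOp_eq (σ : Sector) (lam : Fin m → ℂ) (ν : Fin m) (d : ℕ) :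
    dressedOp p σ lam ν d =
      dressedMat p σ d (tensorOps p σ lam ν) (siteOps p σ ν (lam ν)) := rfl

lemma loopOp_eq (σ : Sector) (lam : Fin m → ℂ) (ν : Fin m) (d : ℕ) :
    loopOp p σ lam ν d = loopMat p σ d (siteOps p σ ν (lam ν)) := rfl

/-- `M_ν` is covariant under the quantum group acting on the first `n > ν` factors. -/
lemma dressedOp_gauge (σ : Sector) (lam : Fin m → ℂ) (ν : Fin m) (d n : ℕ) (hν : ν.val < n)
    (hn : n ≤ m) : ((rhoLeg p σ d _).comul (scalarLeg _ (tensorOps p σ lam n))).All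
      (Commute (dressedOp p σ lam ν d)) := by
  induction n with
  | zero => omega
  | succ n ih =>
    have hnm : n < m := by omega
    have hS := tensorOps_rels p σ lam n (by omega)
    have hT := siteOps_rels p σ ⟨n, hnm⟩ (lam ⟨n, hnm⟩)
    have hST := tensorOps_comm_siteOps p σ σ lam n (by omega) ⟨n, hnm⟩ (lam ⟨n, hnm⟩)
      (Or.inl le_rfl)
    rw [tensorOps_succ p σ lam n (by omega)]
    -- Either site n is that of the holonomy, and the dressing gives covariance, or it lies beyond
    -- the holonomy, which then commutes with the new factor.
    by_cases h : ν.val = n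
    · subst h
      exact dressedMat_gauge hS hT hST d
    · refine gauge_comul (ih (by omega) (by omega)) ?_
      have h1 : (tensorOps p σ lam ν).Comm (siteOps p σ ⟨n, hnm⟩ (lam ⟨n, hnm⟩)) :=
        tensorOps_comm_siteOps p σ σ lam ν ν.isLt.le _ _ (Or.inl (Nat.lt_succ_iff.mp hν))
      have h2 : (siteOps p σ ν (lam ν)).Comm (siteOps p σ ⟨n, hnm⟩ (lam ⟨n, hnm⟩)) :=
        siteOps_comm p (Or.inl fun hn => h (congrArg Fin.val hn)) _ _
      have h1' := h1.symm
      have h2' := h2.symm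
      rw [dressedOp_eq]
      exact ⟨commute_dressedMat_scalarHom h1'.1 h2'.1,
        commute_dressedMat_scalarHom h1'.2.1 h2'.2.1,
        commute_dressedMat_scalarHom h1'.2.2.1 h2'.2.2.1,
        commute_dressedMat_scalarHom h1'.2.2.2 h2'.2.2.2⟩

lemma dressedOp_apply_commute (σ : Sector) (lam : Fin m → ℂ) (ν : Fin m) (d : ℕ) (i j)
    {a : Module.End ℂ (Dom p m)}
    (h : ∀ κ : Fin m, κ ≤ ν → (siteOps p σ κ (lam κ)).All (Commute a)) :
    Commute a (dressedOp p σ lam ν d i j) := by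
  rw [dressedOp_eq]
  refine commute_apply_of_commute_scalarHom (commute_dressedMat_scalarHom ?_ (h ν le_rfl)) i j
  exact tensorOps_commute p σ lam ν ν.isLt.le fun κ hκ => h κ (Fin.le_def.mpr hκ.le)

lemma siteOps_comm_dressedOp {σ σ' : Sector} (lam : Fin m → ℂ) (μ ν : Fin m) (c : ℂ) (d : ℕ) (i j)
    (h : ν < μ ∨ σ ≠ σ') :
    (siteOps p σ' μ c).All (Commute (dressedOp p σ lam ν d i j)) := by
  have key : ∀ κ : Fin m, κ ≤ ν → (siteOps p σ' μ c).Comm (siteOps p σ κ (lam κ)) := by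
    intro κ hκ
    refine siteOps_comm p (h.imp (fun h h' => ?_) Ne.symm) _ _
    subst h'
    exact absurd hκ (not_le.mpr h)
  exact ⟨(dressedOp_apply_commute p σ lam ν d i j fun κ hκ => (key κ hκ).1).symm,
    (dressedOp_apply_commute p σ lam ν d i j fun κ hκ => (key κ hκ).2.1).symm,
    (dressedOp_apply_commute p σ lam ν d i j fun κ hκ => (key κ hκ).2.2.1).symm,
    (dressedOp_apply_commute p σ lam ν d i j fun κ hκ => (key κ hκ).2.2.2).symm⟩

lemma commute_dressedOp_dressedOp {σ σ' : Sector} (h : σ ≠ σ') (lam : Fin m → ℂ) (μ ν : Fin m)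
    (d e : ℕ) (i j k l) : Commute (dressedOp p σ lam ν d i j) (dressedOp p σ' lam μ e k l) :=
  dressedOp_apply_commute p σ' lam μ e k l fun κ _ =>
    siteOps_comm_dressedOp p lam κ ν _ d i j (Or.inr h)

/-- The relations of the graph algebra. -/
lemma graphRel_dressedOp (σ : Sector) (lam : Fin m → ℂ) {x y : Module.End ℂ (Dom p m)}
    (h : GraphRel p σ (dressedOp p σ lam) x y) : x = y := by
  cases h with
  | one ν i j => rw [dressedOp_eq, dressedMat_zero]
  | product ν d e C a c =>
    exact congrFun (congrFun (loopProd_dressedMat_self (tensorOps_rels p σ lam ν ν.isLt.le)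
      (siteOps_rels p σ ν (lam ν))
      (tensorOps_comm_siteOps p σ σ lam ν ν.isLt.le ν _ (Or.inl le_rfl)) C) a) c
  | exchange ν μ hνμ d e a c =>
    exact congrFun (congrFun (loopProd_dressedMat (tensorOps_rels p σ lam μ μ.isLt.le)
      (dressedOp_gauge p σ lam ν d μ hνμ μ.isLt.le)
      (fun i j => siteOps_comm_dressedOp p lam μ ν (lam μ) d i j (Or.inl hνμ)) e) a) c

end Operators

/-! ### Clebsch–Gordan maps for the tensor product with the fundamental representation -/

section ClebschGordan

variable (p : Level) (σ : Sector) (d : ℕ)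

/-- The q-deformed addition rule carries the whole Clebsch–Gordan computation: both the
normalisation and the intertwining property are instances of it. -/
lemma qNum_add (n w : ℕ) :
    p.Q σ ^ (-(σ.sgn * w)) * p.qNum σ n + p.Q σ ^ (σ.sgn * n) * p.qNum σ w =
      p.qNum σ (n + w) := by
  have h := p.Q_sub_inv_ne_zero σ
  have h0 := p.Q_ne_zero σ
  cases σ <;>
  · simp only [Level.qNum, Sector.sgn, one_mul, neg_mul, neg_neg, zpow_neg, zpow_natCast, pow_add,
      inv_pow]
    field_simp
    ring

/-- The cosine of the Clebsch–Gordan rotation at level `w`. -/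
def cgCos (w : ℕ) : ℂ :=
  p.q σ ^ (-(σ.sgn * w)) * p.sqrtQNum σ (d + 1 - w) / p.sqrtQNum σ (d + 1)

/-- The sine of the Clebsch–Gordan rotation at level `w`. -/
def cgSin (w : ℕ) : ℂ :=
  p.q σ ^ (σ.sgn * ((d : ℤ) + 1 - w)) * p.sqrtQNum σ w / p.sqrtQNum σ (d + 1)

/-- This is `qNum_add` for d + 1 = (d + 1 - w) + w, divided by [d+1]. The rotations are complex
orthogonal, so transposes rather than adjoints invert them. -/
lemma cgCos_sq_add {w : ℕ} (hw : w ≤ d + 1) :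
    cgCos p σ d w * cgCos p σ d w + cgSin p σ d w * cgSin p σ d w = 1 := by
  obtain ⟨n, hn⟩ := Nat.exists_eq_add_of_le' hw
  have h := qNum_add p σ n w
  have hs := p.sqrtQNum_ne_zero σ d
  have e1 : d + 1 - w = n := by omega
  have e2 : (d : ℤ) + 1 - w = n := by omega
  rw [cgCos, cgSin, e1, e2]
  have a1 : ∀ m : ℤ, p.q σ ^ m * p.q σ ^ m = p.Q σ ^ m := fun m => q_zpow_mul_self p σ m
  have a2 := p.sqrtQNum_sq σ n
  have a3 := p.sqrtQNum_sq σ w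
  have a4 := p.sqrtQNum_sq σ (d + 1)
  rw [hn, ← h, ← hn, ← a1, ← a1] at a4
  rw [div_mul_div_comm, div_mul_div_comm, ← add_div, div_eq_one_iff_eq (mul_ne_zero hs hs), ← pow_two
    (p.sqrtQNum σ (d + 1)), a4, ← a2, ← a3]
  ring

lemma cgSin_zero : cgSin p σ d 0 = 0 := by simp [cgSin, p.sqrtQNum_zero]

lemma cgCos_top : cgCos p σ d (d + 1) = 0 := by simp [cgCos, p.sqrtQNum_zero]

/-- The entries of the Clebsch–Gordan rotation at level `w`. -/
def cgEntry (t a w : ℕ) : ℂ :=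
  if t = a then cgCos p σ d w else if t < a then cgSin p σ d w else -cgSin p σ d w

/-- The Clebsch–Gordan map into the tensor product with the fundamental representation. -/
def cgMat (t : ℕ) : Matrix (Fin (1 + 1) × Fin (d + 1)) (Fin (1 + d - 2 * t + 1)) ℂ :=
  Matrix.of fun x l =>
    if l.val + t = x.1.val + x.2.val then cgEntry p σ d t x.1 (x.1 + x.2) else 0

lemma cgMat_apply (t : ℕ) (x l) : cgMat p σ d t x l =
    if l.val + t = x.1.val + x.2.val then cgEntry p σ d t x.1 (x.1 + x.2) else 0 := rfl

variable {d}

lemma sum_fin_ite {n : ℕ} (f : ℕ → ℂ) (k : ℕ) (hk : n ≤ k → f k = 0) :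
    ∑ j : Fin n, (if j.val = k then f k else 0) = f k := by
  by_cases h : k < n
  · rw [Finset.sum_eq_single ⟨k, h⟩]
    · simp
    · intro j _ hj
      rw [if_neg fun h' => hj (Fin.ext h')]
    · simp
  · rw [hk (by omega)]
    simp

lemma cgEntry_orthogonal {w : ℕ} (hw : w ≤ d + 1) {t t' : ℕ} (ht : t ≤ 1) (ht' : t' ≤ 1) :
    cgEntry p σ d t 0 w * cgEntry p σ d t' 0 w + cgEntry p σ d t 1 w * cgEntry p σ d t' 1 w =
      if t = t' then 1 else 0 := by
  have hcs := cgCos_sq_add p σ d hw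
  interval_cases t <;> interval_cases t' <;> simp [cgEntry] <;>
    first | ring1 | linear_combination hcs

/-- At a fixed total level w only two basis vectors of the tensor product occur, and the claim is
the orthogonality of a 2 × 2 rotation. At the two extreme levels one vector is missing, but its
coefficient vanishes. -/
lemma cgMat_transpose_mul_cgMat (hd : 1 ≤ d) {t t' : ℕ} (ht : t ≤ 1) (ht' : t' ≤ 1)
    (l : Fin (1 + d - 2 * t + 1)) (l' : Fin (1 + d - 2 * t' + 1)) :
    ((cgMat p σ d t).transpose * cgMat p σ d t') l l' =
      if l.val + t = l'.val + t' then (if t = t' then 1 else 0) else 0 := by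
  rw [Matrix.mul_apply]
  have hl := l.isLt
  have hl' := l'.isLt
  set w := l.val + t with hw
  have hwd : w ≤ d + 1 := by omega
  rw [Fintype.sum_prod_type, Fin.sum_univ_two]
  simp only [Matrix.transpose_apply, cgMat_apply, ← hw]
  by_cases h : w = l'.val + t'
  · simp only [← h, if_true]
    have e0 : ∑ x : Fin (d + 1), (if w = (0 : Fin (1 + 1)).val + x.val then
          cgEntry p σ d t (0 : Fin (1 + 1)).val ((0 : Fin (1 + 1)).val + x.val) else 0) *
        (if w = (0 : Fin (1 + 1)).val + x.val then
          cgEntry p σ d t' (0 : Fin (1 + 1)).val ((0 : Fin (1 + 1)).val + x.val) else 0) =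
        cgEntry p σ d t 0 w * cgEntry p σ d t' 0 w := by
      rw [← sum_fin_ite (n := d + 1) (fun _ => cgEntry p σ d t 0 w * cgEntry p σ d t' 0 w) w]
      · refine Finset.sum_congr rfl fun x _ => ?_
        by_cases hx : x.val = w
        · simp [← hx]
        · have hx' : ¬ w = x.val := fun h => hx h.symm
          simp [hx, hx']
      · intro hw'
        -- The lowest level meets only the larger spin t = 0, whose missing coefficient is the
        -- vanishing cosine.
        have hw1 : w = d + 1 := by omega
        have t0 : t = 0 := by omega
        have t0' : t' = 0 := by omega
        rw [t0, t0', hw1]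
        simp [cgEntry, cgCos_top]
    have e1 : ∑ x : Fin (d + 1), (if w = (1 : Fin (1 + 1)).val + x.val then
          cgEntry p σ d t (1 : Fin (1 + 1)).val ((1 : Fin (1 + 1)).val + x.val) else 0) *
        (if w = (1 : Fin (1 + 1)).val + x.val then
          cgEntry p σ d t' (1 : Fin (1 + 1)).val ((1 : Fin (1 + 1)).val + x.val) else 0) =
        cgEntry p σ d t 1 w * cgEntry p σ d t' 1 w := by
      by_cases hw0 : w = 0
      · have t0 : t = 0 := by omega
        have t0' : t' = 0 := by omega
        rw [hw0, t0, t0']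
        simp only [cgEntry, cgSin_zero]
        refine Eq.trans (Finset.sum_eq_zero fun x _ => ?_) (by simp)
        rw [if_neg (by simp; omega), zero_mul]
      · obtain ⟨v, hv⟩ := Nat.exists_eq_succ_of_ne_zero hw0
        rw [← sum_fin_ite (n := d + 1) (fun _ => cgEntry p σ d t 1 w * cgEntry p σ d t' 1 w) v]
        · refine Finset.sum_congr rfl fun x _ => ?_
          by_cases hx : x.val = v
          · have : w = 1 + x.val := by omega
            simp [hx, this]
          · have hx' : ¬ w = 1 + x.val := by omega
            simp [hx, hx']
        · intro hv'
          omega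
    rw [e0, e1]
    exact cgEntry_orthogonal p σ hwd ht ht'
  · rw [if_neg h]
    refine Eq.trans (congrArg₂ (· + ·) (Finset.sum_eq_zero fun x _ => ?_)
      (Finset.sum_eq_zero fun x _ => ?_)) (add_zero 0)
    all_goals
      split_ifs with h1 h2
      · omega
      all_goals simp

lemma cgMat_mul_transpose (hd : 1 ≤ d) {t : ℕ} (ht : t ≤ 1) (x y) :
    (cgMat p σ d t * (cgMat p σ d t).transpose) x y =
      if x.1.val + x.2.val = y.1.val + y.2.val then
        cgEntry p σ d t x.1 (x.1 + x.2) * cgEntry p σ d t y.1 (x.1 + x.2) else 0 := by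
  rw [Matrix.mul_apply]
  simp only [Matrix.transpose_apply, cgMat_apply]
  obtain ⟨a, j⟩ := x
  obtain ⟨a', j'⟩ := y
  have ha := a.isLt
  have ha' := a'.isLt
  have hj := j.isLt
  have hj' := j'.isLt
  simp only
  set w := a.val + j.val with hw
  by_cases h : w = a'.val + j'.val
  · rw [if_pos h]
    by_cases hwt : w < t
    -- The smaller spin t = 1 has no vector at level 0; the product of entries is a vanishing sine.
    · have w0 : w = 0 := by omega
      have t1 : t = 1 := by omega
      have a0 : a.val = 0 := by omega
      rw [a0, w0, t1]
      simp [cgEntry, cgSin_zero]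
    · obtain ⟨v, hv⟩ := Nat.exists_eq_add_of_le' (not_lt.mp hwt)
      rw [← sum_fin_ite (n := 1 + d - 2 * t + 1)
        (fun _ => cgEntry p σ d t a.val w * cgEntry p σ d t a'.val w) v]
      · refine Finset.sum_congr rfl fun l _ => ?_
        rw [← h]
        by_cases hl : l.val = v
        · rw [if_pos hl, if_pos (by omega), if_pos (by omega)]
        · rw [if_neg hl, if_neg (by omega), zero_mul]
      · intro hv'
        -- Nor has it a vector at level d + 1, where the cosine vanishes.
        have t1 : t = 1 := by omega
        have a1 : a.val = 1 := by omega
        have w1 : w = d + 1 := by omega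
        rw [a1, w1, t1]
        simp [cgEntry, cgCos_top]
  · rw [if_neg h]
    refine Finset.sum_eq_zero fun l _ => ?_
    split_ifs with h1 h2
    · omega
    all_goals simp

lemma sum_cgMat_mul_transpose (hd : 1 ≤ d) :
    ∑ t : Fin (min 1 d + 1), cgMat p σ d t * (cgMat p σ d t).transpose = 1 := by
  have hsum : ∀ (k : ℕ) (f : ℕ → ℂ), k = 2 → ∑ t : Fin k, f t = f 0 + f 1 := by
    rintro k f rfl
    simp
  ext x y
  rw [Matrix.sum_apply]
  have e : ∀ t : Fin (min 1 d + 1), (cgMat p σ d t * (cgMat p σ d t).transpose) x y =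
      (fun t : ℕ => if x.1.val + x.2.val = y.1.val + y.2.val then
        cgEntry p σ d t x.1 (x.1 + x.2) * cgEntry p σ d t y.1 (x.1 + x.2) else 0) t.val := by
    intro t
    have := t.isLt
    exact cgMat_mul_transpose p σ hd (by omega) x y
  refine (Finset.sum_congr rfl fun t _ => e t).trans ((hsum (min 1 d + 1)
    (fun t : ℕ => if x.1.val + x.2.val = y.1.val + y.2.val then
        cgEntry p σ d t x.1 (x.1 + x.2) * cgEntry p σ d t y.1 (x.1 + x.2) else 0)
    (by omega)).trans ?_)
  obtain ⟨a, j⟩ := x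
  obtain ⟨a', j'⟩ := y
  have hj := j.isLt
  have hj' := j'.isLt
  have hcs := cgCos_sq_add p σ d (w := a.val + j.val) (by have := a.isLt; omega)
  by_cases h : a.val + j.val = a'.val + j'.val
  · simp only [h, if_true]
    rw [h] at hcs
    rw [Matrix.one_apply]
    by_cases haa : a = a'
    · have hjj : j = j' := Fin.ext (by subst haa; omega)
      rw [if_pos (by rw [haa, hjj]), haa]
      fin_cases a' <;> simp [cgEntry] at hcs ⊢ <;> linear_combination hcs
    · rw [if_neg fun h => haa (congrArg Prod.fst h)]
      fin_cases a <;> fin_cases a' <;> simp [cgEntry] at haa ⊢ <;> ring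
  · simp only [h, if_false]
    rw [Matrix.one_apply_ne fun h' => h (by rw [Prod.mk.injEq] at h'; rw [h'.1, h'.2]), add_zero]

lemma mul_raise_apply {n : Type} {L : ℕ} (M : Matrix n (Fin (L + 1)) ℂ) (x : n)
    (f : ℕ → ℂ) (hf : ∀ k, M x k = f k) (l : Fin (L + 1)) :
    (M * raise p σ L) x l =
      if l.val = 0 then 0 else f (l - 1) * (p.sqrtQNum σ l * p.sqrtQNum σ (L + 1 - l)) := by
  rw [Matrix.mul_apply]
  simp only [raise_apply, hf]
  have hl := l.isLt
  split_ifs with h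
  · exact Finset.sum_eq_zero fun k _ => by rw [if_neg (by omega), mul_zero]
  · rw [Finset.sum_eq_single ⟨l.val - 1, by omega⟩]
    · rw [if_pos (by simp; omega)]
      congr 3
      · simp; omega
      · simp; omega
    · intro k _ hk
      rw [if_neg fun h' => hk (Fin.ext (by simp; omega)), mul_zero]
    · simp

lemma raise_mul_apply {n : Type} {L : ℕ} (M : Matrix (Fin (L + 1)) n ℂ) (x : n)
    (f : ℕ → ℂ) (hf : ∀ k, M k x = f k) (j : Fin (L + 1)) :
    (raise p σ L * M) j x = p.sqrtQNum σ (j + 1) * p.sqrtQNum σ (L - j) * f (j + 1) := by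
  rw [Matrix.mul_apply]
  simp only [raise_apply, hf]
  have hj := j.isLt
  by_cases h : j.val = L
  · rw [h, Nat.sub_self, p.sqrtQNum_zero, mul_zero, zero_mul]
    exact Finset.sum_eq_zero fun k _ => by rw [if_neg (by have := k.isLt; omega), zero_mul]
  · rw [Finset.sum_eq_single ⟨j.val + 1, by omega⟩]
    · simp
    · intro k _ hk
      rw [if_neg fun h' => hk (Fin.ext (by simp; omega)), zero_mul]
    · simp

lemma qNum_one : p.qNum σ 1 = 1 := by
  rw [Level.qNum, pow_one, pow_one, div_self (p.Q_sub_inv_ne_zero σ)]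

variable (d) in
/-- The scalar form of the intertwining property of `cgMat`. -/
lemma cgEntry_raise {t a j l : ℕ} (hd : 1 ≤ d) (ht : t ≤ 1) (ha : a ≤ 1) (hj : j ≤ d) (h : l + t = a + j + 1)
    (hl : l ≤ 1 + d - 2 * t) :
    (if l = 0 then 0 else
      cgEntry p σ d t a (a + j) * (p.sqrtQNum σ l * p.sqrtQNum σ (1 + d - 2 * t + 1 - l))) =
    p.q σ ^ (σ.sgn * ((d : ℤ) - 2 * j)) *
      (p.sqrtQNum σ (a + 1) * p.sqrtQNum σ (1 - a) * cgEntry p σ d t (a + 1) (a + 1 + j)) +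
    p.q σ ^ (-(σ.sgn * (1 - 2 * (a : ℤ)))) *
      (p.sqrtQNum σ (j + 1) * p.sqrtQNum σ (d - j) * cgEntry p σ d t a (a + (j + 1))) := by
  have hs := p.sqrtQNum_ne_zero σ d
  have h11 : p.sqrtQNum σ 1 * p.sqrtQNum σ 1 = 1 := by
    rw [← pow_two, p.sqrtQNum_sq, qNum_one]
  -- With this variable the scalar identity has the same form in both sectors.
  set v := p.q σ ^ σ.sgn with hv
  have hv0 : v ≠ 0 := zpow_ne_zero _ (p.q_ne_zero σ)
  have hz : ∀ n : ℤ, p.q σ ^ (σ.sgn * n) = v ^ n := fun n => zpow_mul _ _ _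
  have hz' : ∀ n : ℤ, p.q σ ^ (-(σ.sgn * n)) = v ^ (-n) := fun n => by
    rw [← mul_neg, hz]
  have hq : ∀ n : ℤ, p.Q σ ^ (σ.sgn * n) = v ^ n * v ^ n := fun n => by
    rw [← q_zpow_mul_self, hz]
  have hq' : ∀ n : ℤ, p.Q σ ^ (-(σ.sgn * n)) = v ^ (-n) * v ^ (-n) := fun n => by
    rw [← q_zpow_mul_self, hz']
  obtain ⟨n, rfl⟩ := Nat.exists_eq_add_of_le' hj
  -- With n = d - j, the four cases (t, a) reduce as follows: (0,0) is [n] + 1 in deformed form,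
  -- (1,0) is 1 + [j], and the two cases with a = 1 are identities of monomials since [0] = 0
  -- removes one term.
  have key1 := qNum_add p σ n 1
  have key2 := qNum_add p σ 1 j
  rw [qNum_one, hq, hq', ← p.sqrtQNum_sq, ← p.sqrtQNum_sq, mul_one] at key1
  rw [qNum_one, hq, hq', ← p.sqrtQNum_sq, ← p.sqrtQNum_sq, mul_one, add_comm 1 j] at key2
  rcases (by omega : t = 0 ∨ t = 1) with rfl | rfl <;>
    rcases (by omega : a = 0 ∨ a = 1) with rfl | rfl
  · obtain rfl : l = j + 1 := by omega
    simp only [cgEntry, cgCos, cgSin, hz, hz']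
    rw [if_neg (by omega)]
    simp only [zero_add, Nat.sub_zero, h11, one_mul, add_comm 1 j]
    rw [show n + j + 1 - j = n + 1 by omega, show 1 + (n + j) - 2 * 0 + 1 - (j + 1) = n + 1 by omega,
      show n + j - j = n by omega, show n + j + 1 - (j + 1) = n by omega]
    norm_num only [if_true, if_false]
    push_cast
    rw [show ((n : ℤ) + j - 2 * j) = n + -j by ring, show ((n : ℤ) + j + 1 - (j + 1)) = n by ring,
      show (-((j : ℤ) + 1)) = -j + -1 by ring, zpow_add₀ hv0, zpow_add₀ hv0]
    simp only [div_eq_mul_inv]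
    push_cast at key1
    linear_combination (-(v ^ (-(j : ℤ)) * p.sqrtQNum σ (j + 1) *
      (p.sqrtQNum σ (n + j + 1))⁻¹)) * key1
  · obtain rfl : l = j + 2 := by omega
    simp only [cgEntry, cgCos, cgSin, hz, hz', p.sqrtQNum_zero]
    rw [if_neg (by omega)]
    simp only [Nat.sub_self, p.sqrtQNum_zero, add_comm 1 j, add_comm 1 (j + 1)]
    rw [show 1 + (n + j) - 2 * 0 + 1 - (j + 2) = n by omega,
      show n + j - j = n by omega, show j + 1 + 1 = j + 2 by omega]
    norm_num only [if_true, if_false]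
    push_cast
    rw [show ((n : ℤ) + j + 1 - (j + 1)) = (n - 1) + 1 by ring,
      show ((n : ℤ) + j + 1 - (j + 2)) = n - 1 by ring, zpow_add₀ hv0]
    simp only [div_eq_mul_inv]
    ring
  · obtain rfl : l = j := by omega
    simp only [cgEntry, cgCos, cgSin, hz, hz']
    simp only [zero_add, Nat.sub_zero, h11, one_mul, add_comm 1 l]
    rw [show 1 + (n + l) - 2 * 1 + 1 - l = n by omega,
      show n + l - l = n by omega, show n + l + 1 - (l + 1) = n by omega]
    norm_num only [if_true, if_false]
    have e0 : (if l = 0 then (0 : ℂ) else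
        -(v ^ (((n + l : ℕ) : ℤ) + 1 - l) * p.sqrtQNum σ l / p.sqrtQNum σ (n + l + 1)) *
          (p.sqrtQNum σ l * p.sqrtQNum σ n)) =
        -(v ^ (((n + l : ℕ) : ℤ) + 1 - l) * p.sqrtQNum σ l / p.sqrtQNum σ (n + l + 1)) *
          (p.sqrtQNum σ l * p.sqrtQNum σ n) := by
      split_ifs with h0
      · rw [h0, p.sqrtQNum_zero]; ring
      · rfl
    rw [e0]
    push_cast at key2 ⊢
    rw [show ((n : ℤ) + l - 2 * l) = (n - 1) + 1 + -l by ring,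
      show ((n : ℤ) + l + 1 - (l + 1)) = (n - 1) + 1 by ring,
      show ((n : ℤ) + l + 1 - l) = (n - 1) + 1 + 1 by ring,
      show (-((l : ℤ) + 1)) = -l + -1 by ring]
    simp only [zpow_add₀ hv0]
    simp only [div_eq_mul_inv]
    have hvv : v ^ (1 : ℤ) * v ^ (-1 : ℤ) = 1 := by rw [← zpow_add₀ hv0]; simp
    generalize v ^ (1 : ℤ) = v1 at *
    generalize v ^ (-1 : ℤ) = v2 at *
    generalize v ^ ((n : ℤ) - 1) = x at *
    generalize v ^ (-(l : ℤ)) = w at *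
    generalize (p.sqrtQNum σ (n + l + 1))⁻¹ = i at *
    linear_combination (-(x * i * p.sqrtQNum σ n)) * key2 +
      (x * i * p.sqrtQNum σ n * (p.sqrtQNum σ (l + 1) ^ 2 - w * w)) * hvv
  · obtain rfl : l = j + 1 := by omega
    simp only [cgEntry, cgCos, cgSin, hz, hz']
    rw [if_neg (by omega)]
    simp only [Nat.sub_self, p.sqrtQNum_zero, add_comm 1 j, add_comm 1 (j + 1)]
    have hn1 : 1 ≤ n := by omega
    obtain ⟨n, rfl⟩ := Nat.exists_eq_add_of_le' hn1
    rw [show 1 + (n + 1 + j) - 2 * 1 + 1 - (j + 1) = n by omega,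
      show n + 1 + j - j = n + 1 by omega, show n + 1 + j + 1 - (j + 1) = n + 1 by omega,
      show n + 1 + j + 1 - (j + 1 + 1) = n by omega]
    norm_num only [if_true, if_false]
    push_cast
    rw [show (-((j : ℤ) + 1)) = 1 + -(j + 1 + 1) by ring, zpow_add₀ hv0]
    simp only [div_eq_mul_inv]
    ring

lemma cgMat_mul_raise {t : ℕ} (hd : 1 ≤ d) (ht : t ≤ 1) :
    cgMat p σ d t * raise p σ (1 + d - 2 * t) =
      (raise p σ 1 ⊗ₖ (rho p σ d).K + (rho p σ 1).Kinv ⊗ₖ raise p σ d) * cgMat p σ d t := by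
  ext ⟨a, j⟩ l
  have ha := a.isLt
  have hj := j.isLt
  have hl := l.isLt
  rw [mul_raise_apply p σ _ _ (fun k => if k + t = a.val + j.val then
    cgEntry p σ d t a (a + j) else 0) (fun k => rfl), Matrix.add_mul, Matrix.add_apply]
  have e1 : (raise p σ 1 ⊗ₖ (rho p σ d).K * cgMat p σ d t) (a, j) l =
      p.q σ ^ (σ.sgn * wt d j) * (p.sqrtQNum σ (a + 1) * p.sqrtQNum σ (1 - a) *
        if l.val + t = a.val + 1 + j.val then cgEntry p σ d t (a + 1) (a + 1 + j) else 0) := by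
    rw [← raise_mul_apply p σ (Matrix.of fun (b : Fin (1 + 1)) (_ : Unit) => cgMat p σ d t (b, j) l)
      () (fun b => if l.val + t = b + j.val then cgEntry p σ d t b (b + j) else 0) (fun b => rfl),
      Matrix.mul_apply, Matrix.mul_apply, Fintype.sum_prod_type, Finset.mul_sum]
    refine Finset.sum_congr rfl fun b _ => ?_
    rw [Finset.sum_eq_single j]
    · rw [Matrix.kroneckerMap_apply, rho_K, Matrix.diagonal_apply_eq]
      simp only [Matrix.of_apply]
      ring
    · intro k _ hk
      rw [Matrix.kroneckerMap_apply, rho_K, Matrix.diagonal_apply_ne _ hk.symm, mul_zero, zero_mul]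
    · simp
  have e2 : ((rho p σ 1).Kinv ⊗ₖ raise p σ d * cgMat p σ d t) (a, j) l =
      p.q σ ^ (-(σ.sgn * wt 1 a)) * (p.sqrtQNum σ (j + 1) * p.sqrtQNum σ (d - j) *
        if l.val + t = a.val + (j.val + 1) then cgEntry p σ d t a (a + (j + 1)) else 0) := by
    rw [← raise_mul_apply p σ (Matrix.of fun (k : Fin (d + 1)) (_ : Unit) => cgMat p σ d t (a, k) l)
      () (fun k => if l.val + t = a.val + k then cgEntry p σ d t a (a + k) else 0) (fun b => rfl),
      Matrix.mul_apply, Matrix.mul_apply, Fintype.sum_prod_type, Finset.sum_eq_single a]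
    · rw [Finset.mul_sum]
      refine Finset.sum_congr rfl fun k _ => ?_
      rw [Matrix.kroneckerMap_apply, rho_Kinv, Matrix.diagonal_apply_eq]
      simp only [Matrix.of_apply]
      ring
    · intro k _ hk
      refine Finset.sum_eq_zero fun k' _ => ?_
      rw [Matrix.kroneckerMap_apply, rho_Kinv, Matrix.diagonal_apply_ne _ hk.symm, zero_mul, zero_mul]
    · simp
  rw [e1, e2]
  by_cases h : l.val + t = a.val + j.val + 1
  · rw [if_pos (by omega : l.val + t = a.val + 1 + j.val),
      if_pos (by omega : l.val + t = a.val + (j.val + 1))]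
    have := cgEntry_raise p σ d (a := a) (j := j) (l := l) hd ht (by omega) (by omega) h (by omega)
    rw [wt, wt, Nat.cast_one, ← this]
    by_cases h0 : l.val = 0
    · rw [if_pos h0, if_pos h0]
    · rw [if_neg h0, if_neg h0, if_pos (by omega)]
  · rw [if_neg (by omega : ¬ l.val + t = a.val + 1 + j.val),
      if_neg (by omega : ¬ l.val + t = a.val + (j.val + 1))]
    split_ifs
    · simp
    · omega
    · simp

lemma cgMat_transpose_mul_self (hd : 1 ≤ d) {t : ℕ} (ht : t ≤ 1) :
    (cgMat p σ d t).transpose * cgMat p σ d t = 1 := by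
  ext l l'
  rw [cgMat_transpose_mul_cgMat p σ hd ht ht, Matrix.one_apply]
  simp [Fin.ext_iff]

lemma cgMat_transpose_mul_ne (hd : 1 ≤ d) {t t' : ℕ} (ht : t ≤ 1) (ht' : t' ≤ 1) (h : t ≠ t') :
    (cgMat p σ d t).transpose * cgMat p σ d t' = 0 := by
  ext l l'
  rw [cgMat_transpose_mul_cgMat p σ hd ht ht', if_neg h]
  simp

lemma cgMat_mul_K {t : ℕ} (hd : 1 ≤ d) (ht : t ≤ 1) :
    cgMat p σ d t * (rho p σ (1 + d - 2 * t)).K = (rhoTensor p σ 1 d).K * cgMat p σ d t := by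
  ext x l
  have hl := l.isLt
  rw [rho_K, rhoTensor_K, Matrix.mul_diagonal, Matrix.diagonal_mul, mul_comm, cgMat_apply]
  split_ifs with h
  · congr 2
    rw [← mul_add]
    congr 1
    simp only [wt]
    omega
  · simp

/-- A Clebsch–Gordan decomposition intertwining one of two mutually transposed operators
intertwines both. -/
lemma intertwine_transpose {ι : Type} [Fintype ι] [DecidableEq ι] {n : Type} [Fintype n]
    [DecidableEq n] {l : ι → Type} [∀ t, Fintype (l t)] [∀ t, DecidableEq (l t)]
    {C : ∀ t, Matrix n (l t) ℂ} (h1 : ∀ t, (C t).transpose * C t = 1)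
    (h2 : ∀ t t', t ≠ t' → (C t).transpose * C t' = 0) (h3 : ∑ t, C t * (C t).transpose = 1)
    {x : Matrix n n ℂ} {y : ∀ t, Matrix (l t) (l t) ℂ} (h : ∀ t, C t * y t = x * C t) (t : ι) :
    C t * (y t).transpose = x.transpose * C t := by
  have key : y t * (C t).transpose = (C t).transpose * x := by
    have e : (C t).transpose * x = ∑ s, (C t).transpose * (C s * y s * (C s).transpose) := by
      rw [← Matrix.mul_sum]
      simp only [h, Matrix.mul_assoc]
      rw [← Matrix.mul_sum, h3, Matrix.mul_one]
    rw [e, Finset.sum_eq_single t]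
    · rw [← Matrix.mul_assoc, ← Matrix.mul_assoc, h1, Matrix.one_mul]
    · intro s _ hs
      rw [← Matrix.mul_assoc, ← Matrix.mul_assoc, h2 t s hs.symm, Matrix.zero_mul, Matrix.zero_mul]
    · simp
  have := congrArg Matrix.transpose key
  rwa [Matrix.transpose_mul, Matrix.transpose_mul, Matrix.transpose_transpose] at this

lemma rhoTensor_X (d e : ℕ) : (rhoTensor p σ d e).X =
    (rho p σ d).X ⊗ₖ (rho p σ e).K + (rho p σ d).Kinv ⊗ₖ (rho p σ e).X := by
  change (rho p σ d).X ⊗ₖ 1 * 1 ⊗ₖ (rho p σ e).K + (rho p σ d).Kinv ⊗ₖ 1 * 1 ⊗ₖ (rho p σ e).X = _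
  rw [← Matrix.mul_kronecker_mul, ← Matrix.mul_kronecker_mul, Matrix.one_mul, Matrix.one_mul,
    Matrix.mul_one, Matrix.mul_one]

lemma rhoTensor_Y (d e : ℕ) : (rhoTensor p σ d e).Y =
    (rho p σ d).Y ⊗ₖ (rho p σ e).K + (rho p σ d).Kinv ⊗ₖ (rho p σ e).Y := by
  change (rho p σ d).Y ⊗ₖ 1 * 1 ⊗ₖ (rho p σ e).K + (rho p σ d).Kinv ⊗ₖ 1 * 1 ⊗ₖ (rho p σ e).Y = _
  rw [← Matrix.mul_kronecker_mul, ← Matrix.mul_kronecker_mul, Matrix.one_mul, Matrix.one_mul,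
    Matrix.mul_one, Matrix.mul_one]

lemma rho_Y_transpose (d : ℕ) : (rho p σ d).Y.transpose = (rho p σ d).X := by
  rw [← rho_X_transpose, Matrix.transpose_transpose]

lemma rhoTensor_X_transpose (d e : ℕ) :
    (rhoTensor p σ d e).X.transpose = (rhoTensor p σ d e).Y := by
  rw [rhoTensor_X, rhoTensor_Y, Matrix.transpose_add, ← Matrix.kroneckerMap_transpose,
    ← Matrix.kroneckerMap_transpose, rho_X_transpose, rho_X_transpose, rho_K_transpose,
    rho_Kinv_transpose]

variable (d) in
/-- The Clebsch–Gordan maps for the tensor product with the fundamental representation. -/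
def cgFundamental (hd : 1 ≤ d) : CGMaps p σ 1 d := by
  have ht : ∀ t : Fin (min 1 d + 1), t.val ≤ 1 := fun t => by have := t.isLt; omega
  have h1 : ∀ t : Fin (min 1 d + 1), (cgMat p σ d t).transpose * cgMat p σ d t = 1 :=
    fun t => cgMat_transpose_mul_self p σ hd (ht t)
  have h2 : ∀ t t' : Fin (min 1 d + 1), t ≠ t' → (cgMat p σ d t).transpose * cgMat p σ d t' = 0 :=
    fun t t' h => cgMat_transpose_mul_ne p σ hd (ht t) (ht t') fun h' => h (Fin.ext h')
  have h3 := sum_cgMat_mul_transpose p σ hd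
  have hXY : (∀ t : Fin (min 1 d + 1), cgMat p σ d t * (rho p σ (1 + d - 2 * t)).X =
      (rhoTensor p σ 1 d).X * cgMat p σ d t) ∧
      (∀ t : Fin (min 1 d + 1), cgMat p σ d t * (rho p σ (1 + d - 2 * t)).Y =
        (rhoTensor p σ 1 d).Y * cgMat p σ d t) := by
    -- The raising matrix represents 𝒳 in the untilded and 𝒴 in the tilded sector, and both
    -- coproducts have the same shape. The remaining lowering generator follows by transposition.
    cases σ with
    | holo =>
      have hX : ∀ t : Fin (min 1 d + 1), cgMat p .holo d t * (rho p .holo (1 + d - 2 * t)).X =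
          (rhoTensor p .holo 1 d).X * cgMat p .holo d t := fun t => by
        rw [rhoTensor_X]
        exact cgMat_mul_raise p .holo hd (ht t)
      refine ⟨hX, fun t => ?_⟩
      have := intertwine_transpose h1 h2 h3 hX t
      rwa [rho_X_transpose, rhoTensor_X_transpose] at this
    | anti =>
      have hY : ∀ t : Fin (min 1 d + 1), cgMat p .anti d t * (rho p .anti (1 + d - 2 * t)).Y =
          (rhoTensor p .anti 1 d).Y * cgMat p .anti d t := fun t => by
        rw [rhoTensor_Y]
        exact cgMat_mul_raise p .anti hd (ht t)
      refine ⟨fun t => ?_, hY⟩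
      have := intertwine_transpose h1 h2 h3 hY t
      rwa [rho_Y_transpose, ← rhoTensor_X_transpose, Matrix.transpose_transpose] at this
  exact
    { C1 := fun t => cgMat p σ d t
      C2 := fun t => (cgMat p σ d t).transpose
      C2_C1 := h1
      C2_C1_ne := h2
      C1_C2 := h3
      C1_K := fun t => cgMat_mul_K p σ hd (ht t)
      C1_X := hXY.1
      C1_Y := hXY.2 }

end ClebschGordan

/-! ### Invertibility of the holonomies -/

section Units

variable {A : Type} [Ring A] [Algebra ℂ A] {p : Level} {σ : Sector} {d e : ℕ}

/-- The fused product is block diagonal, so the projection to one spin isolates its block. -/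
lemma CGMaps.C2_mul_cgSum (C : CGMaps p σ d e)
    (M : ∀ d : ℕ, Matrix (Fin (d + 1)) (Fin (d + 1)) A) (t) :
    cmat A (C.C2 t) * cgSum C M = M (d + e - 2 * t) * cmat A (C.C2 t) := by
  rw [cgSum, Matrix.mul_sum, Finset.sum_eq_single t]
  · rw [← Matrix.mul_assoc, ← Matrix.mul_assoc, ← cmat_mul, C.C2_C1, cmat_one, Matrix.one_mul]
  · intro s _ hs
    rw [← Matrix.mul_assoc, ← Matrix.mul_assoc, ← cmat_mul, C.C2_C1_ne t s hs.symm, cmat_zero,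
      Matrix.zero_mul, Matrix.zero_mul]
  · simp

lemma CGMaps.cgSum_mul_C1 (C : CGMaps p σ d e)
    (M : ∀ d : ℕ, Matrix (Fin (d + 1)) (Fin (d + 1)) A) (t) :
    cgSum C M * cmat A (C.C1 t) = cmat A (C.C1 t) * M (d + e - 2 * t) := by
  rw [cgSum, Matrix.sum_mul, Finset.sum_eq_single t]
  · rw [Matrix.mul_assoc, ← cmat_mul, C.C2_C1, cmat_one, Matrix.mul_one]
  · intro s _ hs
    rw [Matrix.mul_assoc, ← cmat_mul, C.C2_C1_ne s t hs, cmat_zero, Matrix.mul_zero]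
  · simp

lemma cmat_complex {n n' : Type} (M : Matrix n n' ℂ) : cmat ℂ M = M := by
  ext i j
  rfl

lemma RFin_comul (p : Level) (σ : Sector) (d e : ℕ) :
    RFin p σ d e * (rhoTensor p σ d e).X =
      ((rho p σ d).K ⊗ₖ (rho p σ e).X + (rho p σ d).X ⊗ₖ (rho p σ e).Kinv) * RFin p σ d e ∧
    RFin p σ d e * (rhoTensor p σ d e).K = (rhoTensor p σ d e).K * RFin p σ d e := by
  have h := pair_cartanFin p σ d e (A := ℂ)
  have hX := h.RUniv_X (p.generic σ)
  have hK := h.RUniv_K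
  rw [← rhoTensor_map, ← cmat_RFin, cmat_complex] at hX hK
  have eL : ∀ M, kronLeft ℂ (Fin (d + 1)) (Fin (e + 1)) (cmatHom ℂ _ M) = M ⊗ₖ 1 := fun M => by
    rw [kronLeft_apply]; rfl
  have eR : ∀ M, kronRight ℂ (Fin (d + 1)) (Fin (e + 1)) (cmatHom ℂ _ M) = 1 ⊗ₖ M := fun M => by
    rw [kronRight_apply]; rfl
  constructor
  · refine hX.trans (congrArg (· * _) ?_)
    change kronRight ℂ _ _ (cmatHom ℂ _ (rho p σ e).X) * kronLeft ℂ _ _ (cmatHom ℂ _ (rho p σ d).K) +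
      kronRight ℂ _ _ (cmatHom ℂ _ (rho p σ e).Kinv) *
        kronLeft ℂ _ _ (cmatHom ℂ _ (rho p σ d).X) = _
    rw [eL, eL, eR, eR, ← Matrix.mul_kronecker_mul, ← Matrix.mul_kronecker_mul, Matrix.one_mul,
      Matrix.one_mul, Matrix.mul_one, Matrix.mul_one]
  · refine hK.trans (congrArg (· * _) ?_)
    change kronRight ℂ _ _ (cmatHom ℂ _ (rho p σ e).K) * kronLeft ℂ _ _ (cmatHom ℂ _ (rho p σ d).K) =
      (rho p σ d).K ⊗ₖ 1 * 1 ⊗ₖ (rho p σ e).K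
    rw [eL, eR, ← Matrix.mul_kronecker_mul, ← Matrix.mul_kronecker_mul, Matrix.one_mul,
      Matrix.one_mul, Matrix.mul_one, Matrix.mul_one]

lemma isUnit_antidiagonal {w : Matrix (Fin (1 + 1)) (Fin (1 + 1)) ℂ} (h0 : w 0 0 = 0)
    (h01 : w 0 1 ≠ 0) (h10 : w 1 0 ≠ 0) : IsUnit w := by
  rw [Matrix.isUnit_iff_isUnit_det, isUnit_iff_ne_zero]
  have : w.det = w 0 0 * w 1 1 - w 0 1 * w 1 0 := Matrix.det_fin_two w
  rw [this, h0, zero_mul, zero_sub, neg_ne_zero]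
  exact mul_ne_zero h01 h10

lemma rho_zero_X (p : Level) (σ : Sector) : (rho p σ 0).X = 0 := by
  ext i j
  by_contra h
  have := rho_X_weight p σ i j h
  rw [Subsingleton.elim (α := Fin 1) i j] at this
  omega

lemma rho_zero_K (p : Level) (σ : Sector) : (rho p σ 0).K = 1 := by
  rw [rho_K, ← Matrix.diagonal_one]
  congr 1
  funext i
  simp [wt]

/-- The image of an invariant vector under the R-matrix is nondegenerate. -/
lemma RFin_invariant (p : Level) (σ : Sector)
    {C : Matrix (Fin (1 + 1) × Fin (1 + 1)) (Fin (0 + 1)) ℂ} (hC : IsIntertwiner p σ 1 1 0 C)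
    (h0 : C ≠ 0) :
    IsUnit (Matrix.of fun i j => (RFin p σ 1 1 * C) (i, j) 0 : Matrix (Fin (1 + 1)) _ ℂ) := by
  set w := RFin p σ 1 1 * C with hw
  -- The invariant vector is killed by the coproduct of 𝒳, so its image under R is killed by the
  -- opposite coproduct.
  have hX : ((rho p σ 1).K ⊗ₖ (rho p σ 1).X + (rho p σ 1).X ⊗ₖ (rho p σ 1).Kinv) * w = 0 := by
    rw [hw, ← Matrix.mul_assoc, ← (RFin_comul p σ 1 1).1, Matrix.mul_assoc, ← hC.X, rho_zero_X,
      Matrix.mul_zero, Matrix.mul_zero]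
  have hK : (rhoTensor p σ 1 1).K * w = w := by
    rw [hw, ← Matrix.mul_assoc, ← (RFin_comul p σ 1 1).2, Matrix.mul_assoc, ← hC.K, rho_zero_K,
      Matrix.mul_one]
  -- Invariance under 𝒦 leaves only components of total weight zero, an antidiagonal 2 × 2 matrix.
  have hw0 : ∀ x : Fin (1 + 1) × Fin (1 + 1), σ.sgn * wt 1 x.1 + σ.sgn * wt 1 x.2 ≠ 0 →
      w x 0 = 0 := by
    intro x hx
    by_contra hwx
    have := congrFun (congrFun hK x) 0
    rw [rhoTensor_K, Matrix.diagonal_mul] at this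
    have h1 : p.q σ ^ (σ.sgn * wt 1 x.1 + σ.sgn * wt 1 x.2) = p.q σ ^ (0 : ℤ) := by
      rw [zpow_zero]
      exact mul_right_cancel₀ hwx (this.trans (one_mul _).symm)
    exact hx (q_zpow_injective p σ h1)
  have hsg : σ.sgn ≠ 0 := by cases σ <;> decide
  have w00 : w (0, 0) 0 = 0 := hw0 _ (by simp [wt]; exact hsg)
  have w11 : w (1, 1) 0 = 0 := hw0 _ (by simp [wt]; exact hsg)
  have hs := p.sqrtQNum_ne_zero σ 0
  have hq := p.q_ne_zero σ
  -- The extreme row reached by 𝒳 relates the two remaining components with nonzero coefficients.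
  -- They therefore vanish together, and both vanishing would make the vector zero.
  obtain ⟨α, β, hα, hβ, hαβ⟩ : ∃ α β : ℂ, α ≠ 0 ∧ β ≠ 0 ∧
      α * w (0, 1) 0 + β * w (1, 0) 0 = 0 := by
    cases σ with
    | holo =>
      have := congrFun (congrFun hX (0, 0)) 0
      rw [Matrix.mul_apply, Fintype.sum_prod_type, Fin.sum_univ_two, Fin.sum_univ_two,
        Fin.sum_univ_two] at this
      simp only [Matrix.add_apply, Matrix.kroneckerMap_apply, rho_K, rho_Kinv, rho, raise_apply,
        Matrix.diagonal_apply] at this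
      simp at this
      refine ⟨_, _, ?_, ?_, this⟩
      · exact mul_ne_zero (zpow_ne_zero _ hq) (mul_ne_zero hs hs)
      · exact mul_ne_zero (mul_ne_zero hs hs) (inv_ne_zero (zpow_ne_zero _ hq))
    | anti =>
      have := congrFun (congrFun hX (1, 1)) 0
      rw [Matrix.mul_apply, Fintype.sum_prod_type, Fin.sum_univ_two, Fin.sum_univ_two,
        Fin.sum_univ_two] at this
      simp only [Matrix.add_apply, Matrix.kroneckerMap_apply, rho_K, rho_Kinv, rho, lower_apply,
        Matrix.diagonal_apply] at this
      simp at this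
      refine ⟨_, _, ?_, ?_, this⟩
      · exact mul_ne_zero (mul_ne_zero hs hs) (inv_ne_zero (zpow_ne_zero _ hq))
      · exact mul_ne_zero (zpow_ne_zero _ hq) (mul_ne_zero hs hs)
  have hne : ¬ (w (0, 1) 0 = 0 ∧ w (1, 0) 0 = 0) := by
    rintro ⟨w01, w10⟩
    apply h0
    have : w = 0 := by
      ext ⟨i, j⟩ l
      obtain rfl : l = 0 := Subsingleton.elim (α := Fin 1) _ _
      fin_cases i <;> fin_cases j
      · exact w00
      · exact w01
      · exact w10
      · exact w11
    have hu := (Matrix.isUnit_iff_isUnit_det _).mp (isUnit_RFin p σ 1 1)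
    rw [← Matrix.one_mul C, ← Matrix.nonsing_inv_mul _ hu, Matrix.mul_assoc, ← hw, this,
      Matrix.mul_zero]
  refine isUnit_antidiagonal w00 ?_ ?_
  · intro h01
    change w (0, 1) 0 = 0 at h01
    rw [h01, mul_zero, zero_add] at hαβ
    exact hne ⟨h01, (mul_eq_zero.mp hαβ).resolve_left hβ⟩
  · intro h10
    change w (1, 0) 0 = 0 at h10
    rw [h10, mul_zero, add_zero] at hαβ
    exact hne ⟨(mul_eq_zero.mp hαβ).resolve_left hα, h10⟩

lemma isUnit_of_left_right {R : Type} [Ring R] {a b c : R} (h1 : b * a = 1) (h2 : a * c = 1) :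
    IsUnit a :=
  ⟨⟨a, b, by rw [left_inv_eq_right_inv h1 h2, h2], h1⟩, rfl⟩

variable {M : ∀ d : ℕ, Matrix (Fin (d + 1)) (Fin (d + 1)) A}

/-- On the singlet in V ⊗ V the fused matrix is M⁰ = 1. Applying the singlet map from either side
leaves M¹ times a known matrix equal to an invertible constant, on the left and on the right
respectively. -/
lemma isUnit_holonomy_one (h0 : M 0 = 1)
    (hprod : ∀ d e (C : CGMaps p σ d e), loopProd p σ d e (M d) (M e) = cgSum C M) :
    IsUnit (M 1) := by
  set C := cgFundamental p σ 1 le_rfl with hC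
  -- The singlet channel, 1 + 1 - 2·1 = 0.
  let t : Fin (min 1 1 + 1) := ⟨1, by decide⟩
  let C₁ : Matrix (Fin (1 + 1) × Fin (1 + 1)) (Fin (0 + 1)) ℂ := C.C1 t
  let C₂ : Matrix (Fin (0 + 1)) (Fin (1 + 1) × Fin (1 + 1)) ℂ := C.C2 t
  have hP := hprod 1 1 C
  have hl : cmat A C₂ * loopProd p σ 1 1 (M 1) (M 1) = M 0 * cmat A C₂ := by
    rw [hP]
    exact C.C2_mul_cgSum M t
  have hr : loopProd p σ 1 1 (M 1) (M 1) * cmat A C₁ = cmat A C₁ * M 0 := by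
    rw [hP]
    exact C.cgSum_mul_C1 M t
  rw [h0, Matrix.one_mul] at hl
  rw [h0, Matrix.mul_one] at hr
  have hs := p.sqrtQNum_ne_zero σ 0
  have hs1 := p.sqrtQNum_ne_zero σ 1
  have hq := p.q_ne_zero σ
  have hcos : cgCos p σ 1 1 ≠ 0 :=
    div_ne_zero (mul_ne_zero (zpow_ne_zero _ hq) hs) hs1
  have hsin : cgSin p σ 1 1 ≠ 0 :=
    div_ne_zero (mul_ne_zero (zpow_ne_zero _ hq) hs) hs1
  have u₁ : IsUnit (Matrix.of fun a j => C₂ 0 (a, j) : Matrix (Fin (1 + 1)) (Fin (1 + 1)) ℂ) := by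
    have e : ∀ a j, C₂ 0 (a, j) = if 0 + 1 = a.val + j.val then cgEntry p σ 1 1 a (a + j) else 0 :=
      fun a j => rfl
    refine isUnit_antidiagonal ?_ ?_ ?_
    · simp [e]
    · simp [e, cgEntry, hsin]
    · simp [e, cgEntry, hcos]
  have u₂ : IsUnit (Matrix.of fun i j => (RFin p σ 1 1 * C₁) (i, j) 0 :
      Matrix (Fin (1 + 1)) (Fin (1 + 1)) ℂ) := by
    refine RFin_invariant p σ (C.isIntertwiner t) fun h => ?_
    have := C.C2_C1 t
    rw [show C.C1 t = 0 from h, Matrix.mul_zero] at this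
    exact one_ne_zero (congrFun (congrFun this.symm (0 : Fin (0 + 1))) (0 : Fin (0 + 1)))
  -- After the singlet projection from the left, the entries of the second M are multiplied by a row
  -- vector whose constant right-hand side is C₂; its matrix has entries sine and cosine on the
  -- antidiagonal.
  have key₁ : ∃ b, b * M 1 = 1 := by
    set Z := cmat A C₂ * (cmat A (RFin p σ 1 1)⁻¹ * (M 1 ⊗ₖ 1) * cmat A (RFin p σ 1 1)) with hZ
    rw [loopProd, ← Matrix.mul_assoc, ← hZ] at hl
    set u : Matrix (Fin (1 + 1)) (Fin (1 + 1)) ℂ := Matrix.of fun a j => C₂ 0 (a, j) with hu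
    refine ⟨cmat A u⁻¹ * Matrix.of fun a j => Z 0 (a, j), ?_⟩
    have : (Matrix.of fun a j => Z 0 (a, j)) * M 1 = cmat A u := by
      ext a j'
      have := congrFun (congrFun hl 0) (a, j')
      rw [Matrix.mul_apply, Fintype.sum_prod_type, Finset.sum_eq_single a] at this
      · rw [Matrix.mul_apply, show cmat A u a j' = cmat A C₂ 0 (a, j') from rfl]
        simpa [Matrix.kroneckerMap_apply] using this
      · intro b _ hb
        simp [Matrix.kroneckerMap_apply, Matrix.one_apply, hb]
      · simp
    rw [mul_assoc, this]
    erw [← cmat_mul]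
    rw [Matrix.nonsing_inv_mul _ ((Matrix.isUnit_iff_isUnit_det _).mp u₁), cmat_one]
  -- From the right the first M is isolated by moving R⁻¹ across, which is why the singlet must be
  -- nondegenerate after application of R.
  have key₂ : ∃ b, M 1 * b = 1 := by
    set W := cmat A (RFin p σ 1 1) * ((1 : Matrix (Fin (1 + 1)) (Fin (1 + 1)) A) ⊗ₖ M 1) * cmat A C₁ with hW
    have hr' : (M 1 ⊗ₖ (1 : Matrix (Fin (1 + 1)) (Fin (1 + 1)) A)) * W =
        cmat A (RFin p σ 1 1 * C₁) := by
      rw [cmat_mul, ← hr, loopProd, hW]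
      simp only [← Matrix.mul_assoc]
      rw [cmat_RFin_mul_inv, Matrix.one_mul]
    set u : Matrix (Fin (1 + 1)) (Fin (1 + 1)) ℂ :=
      Matrix.of fun i j => (RFin p σ 1 1 * C₁) (i, j) 0 with hu
    refine ⟨(Matrix.of fun i j => W (i, j) 0) * cmat A u⁻¹, ?_⟩
    have : M 1 * (Matrix.of fun i j => W (i, j) 0) = cmat A u := by
      ext i j
      have := (Matrix.mul_apply (M := M 1 ⊗ₖ 1) (N := W) (i := (i, j)) (k := 0)).symm.trans
        (congrFun (congrFun hr' (i, j)) 0)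
      rw [Fintype.sum_prod_type] at this
      rw [Matrix.mul_apply]
      refine Eq.trans (Finset.sum_congr rfl fun k _ => ?_) this
      rw [Finset.sum_eq_single j]
      · simp [Matrix.kroneckerMap_apply]
      · intro b _ hb
        simp [Matrix.kroneckerMap_apply, Matrix.one_apply, hb.symm]
      · simp
    rw [← mul_assoc, this]
    erw [← cmat_mul]
    rw [Matrix.mul_nonsing_inv _ ((Matrix.isUnit_iff_isUnit_det _).mp u₂), cmat_one]
  obtain ⟨b, hb⟩ := key₁
  obtain ⟨c, hc⟩ := key₂
  exact isUnit_of_left_right hb hc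

/-- The holonomy matrices of the graph algebra are invertible. -/
lemma isUnit_holonomy (h0 : M 0 = 1)
    (hprod : ∀ d e (C : CGMaps p σ d e), loopProd p σ d e (M d) (M e) = cgSum C M) (d : ℕ) :
    IsUnit (M d) := by
  induction d with
  | zero => rw [h0]; exact isUnit_one
  | succ d ih =>
    by_cases hd : d = 0
    · subst hd
      exact isUnit_holonomy_one h0 hprod
    · have h1 := isUnit_holonomy_one h0 hprod
      set C := cgFundamental p σ d (Nat.one_le_iff_ne_zero.mpr hd)
      -- The top component of the product of spins 1/2 and d/2. A unit that commutes with the spin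
      -- projections restricts to a unit on each block.
      let t : Fin (min 1 d + 1) := 0
      have hP := hprod 1 d C
      have hu : IsUnit (loopProd p σ 1 d (M 1) (M d)) := by
        rw [loopProd, ← kronLeft_apply, ← kronRight_apply]
        have hR : IsUnit (cmat A (RFin p σ 1 d)) := (isUnit_RFin p σ 1 d).map (cmatHom A _)
        have hR' : IsUnit (cmat A (RFin p σ 1 d)⁻¹) :=
          ⟨⟨_, _, cmat_RFin_inv_mul p σ 1 d, cmat_RFin_mul_inv p σ 1 d⟩, rfl⟩
        exact ((hR'.mul (h1.map (kronLeft A _ _))).mul hR).mul (ih.map (kronRight A _ _))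
      obtain ⟨⟨P, P', hPP', hP'P⟩, hPe⟩ := hu
      change P = _ at hPe
      have key : ∀ l, l = d + 1 → l = 1 + d - 2 * t.val → IsUnit (M l) := by
        intro l _ hl
        subst hl
        have e1 := C.C2_mul_cgSum M t
        have e2 := C.cgSum_mul_C1 M t
        rw [← hP, ← hPe] at e1 e2
        have e0 : cmat A (C.C2 t) * cmat A (C.C1 t) = 1 := by rw [← cmat_mul, C.C2_C1, cmat_one]
        refine ⟨⟨M _, cmat A (C.C2 t) * P' * cmat A (C.C1 t), ?_, ?_⟩, rfl⟩
        · calc M (1 + d - 2 * t.val) * (cmat A (C.C2 t) * P' * cmat A (C.C1 t))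
              = (M (1 + d - 2 * t.val) * cmat A (C.C2 t)) * P' * cmat A (C.C1 t) := by simp only [Matrix.mul_assoc]
            _ = cmat A (C.C2 t) * (P * P') * cmat A (C.C1 t) := by
              rw [← e1]; simp only [Matrix.mul_assoc]
            _ = 1 := by rw [hPP', Matrix.mul_one, e0]
        · calc cmat A (C.C2 t) * P' * cmat A (C.C1 t) * M (1 + d - 2 * t.val)
              = cmat A (C.C2 t) * P' * (cmat A (C.C1 t) * M (1 + d - 2 * t.val)) := by simp only [Matrix.mul_assoc]
            _ = cmat A (C.C2 t) * (P' * P) * cmat A (C.C1 t) := by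
              rw [← e2]; simp only [Matrix.mul_assoc]
            _ = 1 := by rw [hP'P, Matrix.mul_one, e0]
      exact key (d + 1) rfl (by simp [t]; omega)

end Units

/-! ### Adjoint relations -/

/-- A relation with the properties of `b = a*`. -/
structure StarRel {A : Type} [Ring A] [Algebra ℂ A] (r : A → A → Prop) : Prop where
  zero : r 0 0
  one : r 1 1
  add : ∀ {a a' b b'}, r a a' → r b b' → r (a + b) (a' + b')
  smul : ∀ (c : ℂ) {a a'}, r a a' → r (c • a) (conj c • a')
  mul : ∀ {a a' b b'}, r a a' → r b b' → r (a * b) (b' * a')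

/-- The induced relation for matrices. -/
def matRel {A : Type} (r : A → A → Prop) {n n' : Type} (P : Matrix n n' A) (P' : Matrix n' n A) :
    Prop :=
  ∀ i j, r (P i j) (P' j i)

/-- The induced relation for images of the generators. -/
def genRel {A : Type} (r : A → A → Prop) (T T' : GenImages A) : Prop :=
  r T.K T'.K ∧ r T.Kinv T'.Kinv ∧ r T.X T'.X ∧ r T.Y T'.Y

namespace StarRel

variable {A : Type} [Ring A] [Algebra ℂ A] {r : A → A → Prop} {p : Level} {σ : Sector} {d : ℕ}
  {S S' T T' : GenImages A}

lemma sum (h : StarRel r) {ι : Type} (s : Finset ι) {f f' : ι → A} (hf : ∀ i, r (f i) (f' i)) :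
    r (∑ i ∈ s, f i) (∑ i ∈ s, f' i) := by
  classical
  induction s using Finset.induction_on with
  | empty => simpa using h.zero
  | insert i s hi ih => rw [Finset.sum_insert hi, Finset.sum_insert hi]; exact h.add (hf i) ih

lemma pow (h : StarRel r) {a a' : A} (ha : r a a') (n : ℕ) : r (a ^ n) (a' ^ n) := by
  induction n with
  | zero => simpa using h.one
  | succ n ih => rw [pow_succ, pow_succ']; exact h.mul ih ha

/-- The notion is symmetric, so adjoint statements can be read from either sector; existence or
uniqueness of adjoints is never needed. -/
lemma flip (h : StarRel r) : StarRel (fun a b => r b a) where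
  zero := h.zero
  one := h.one
  add := h.add
  smul c a a' ha := by simpa using h.smul (conj c) ha
  mul ha hb := h.mul hb ha

lemma matrix (h : StarRel r) (n : Type) [Fintype n] [DecidableEq n] :
    StarRel (matRel r : Matrix n n A → Matrix n n A → Prop) where
  zero _ _ := h.zero
  one i j := by
    by_cases hij : i = j
    · subst hij; simpa using h.one
    · simpa [Matrix.one_apply, hij, Ne.symm hij] using h.zero
  add ha hb i j := h.add (ha i j) (hb i j)
  smul c _ _ ha i j := h.smul c (ha i j)
  mul {a a' b b'} ha hb i j := by
    rw [Matrix.mul_apply, Matrix.mul_apply]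
    exact h.sum _ fun k => h.mul (ha i k) (hb k j)

lemma cmat (h : StarRel r) {n n' : Type} (M : Matrix n n' ℂ) :
    matRel r (cmat A M) (QLorentz.cmat A M.conjTranspose) := by
  intro i j
  simp only [QLorentz.cmat, Matrix.map_apply, Matrix.conjTranspose_apply,
    Algebra.algebraMap_eq_smul_one]
  exact h.smul _ h.one

lemma scalar (h : StarRel r) {n : Type} [Fintype n] [DecidableEq n] {a a' : A} (ha : r a a') :
    matRel r (scalarHom A n a) (scalarHom A n a') := by
  intro i j
  rw [scalarHom_apply, scalarHom_apply]
  by_cases hij : i = j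
  · subst hij; simpa using ha
  · simpa [Matrix.diagonal_apply, hij, Ne.symm hij] using h.zero

lemma conj_qexpCoef (t : ℂ) (n : ℕ) : conj (qexpCoef t n) = qexpCoef (conj t) n := by
  simp [qexpCoef, map_div₀, map_prod]

lemma qexp (h : StarRel r) (t : ℂ) {a a' : A} (ha : r a a') (hn : IsNilpotent a)
    (hn' : IsNilpotent a') : r (qexp t a) (QLorentz.qexp (conj t) a') := by
  obtain ⟨N, hN⟩ := hn
  obtain ⟨N', hN'⟩ := hn'
  rw [qexp_eq_sum t (pow_eq_zero_of_le (le_max_left N N') hN),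
    qexp_eq_sum (conj t) (pow_eq_zero_of_le (le_max_right N N') hN')]
  refine h.sum _ fun n => ?_
  rw [← conj_qexpCoef]
  exact h.smul _ (h.pow ha n)

lemma kpow (h : StarRel r) (hT : genRel r T T') (n : ℤ) : r (T.kpow n) (T'.kpow n) := by
  rw [GenImages.kpow, GenImages.kpow]
  split_ifs
  · exact h.pow hT.1 _
  · exact h.pow hT.2.1 _

lemma comul (h : StarRel r) (hS : genRel r S S') (hT : genRel r T T') (hc : S'.Comm T') :
    genRel r (S.comul T) (S'.comul T') := by
  obtain ⟨⟨h1, h2, h3, h4⟩, ⟨h5, h6, h7, h8⟩, ⟨h9, h10, h11, h12⟩, ⟨h13, h14, h15, h16⟩⟩ := hc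
  refine ⟨?_, ?_, ?_, ?_⟩
  · change r (_ * _) (_ * _)
    rw [h1.eq]
    exact h.mul hS.1 hT.1
  · change r (_ * _) (_ * _)
    rw [h6.eq]
    exact h.mul hS.2.1 hT.2.1
  · change r (_ * _ + _ * _) (_ * _ + _ * _)
    rw [h9.eq, h7.eq]
    exact h.add (h.mul hS.2.2.1 hT.1) (h.mul hS.2.1 hT.2.2.1)
  · change r (_ * _ + _ * _) (_ * _ + _ * _)
    rw [h13.eq, h8.eq]
    exact h.add (h.mul hS.2.2.2 hT.1) (h.mul hS.2.1 hT.2.2.2)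

lemma counit (h : StarRel r) : genRel r GenImages.counit GenImages.counit :=
  ⟨h.one, h.one, h.zero, h.zero⟩

lemma u (h : StarRel r) (hT : genRel r T T') (x : UGen) : r (T.u σ x) (T'.u σ.swap x) := by
  obtain ⟨h1, h2, h3, h4⟩ := hT
  cases σ <;> cases x
  · exact h.mul h3 h1
  · exact h.mul h2 h4
  · exact h.mul h1 h1
  · exact h.mul h2 h2
  · exact h.mul h1 h3
  · exact h.mul h4 h2
  · exact h.mul h1 h1
  · exact h.mul h2 h2

end StarRel

lemma raise_conjTranspose (p : Level) (σ : Sector) (d : ℕ) :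
    (raise p σ d).conjTranspose = lower p σ.swap d := by
  ext i j
  rw [Matrix.conjTranspose_apply, raise_apply, lower_apply]
  split_ifs
  · simp [p.conj_sqrtQNum]
  · simp

lemma conjTranspose_starRel (n : Type) [Fintype n] [DecidableEq n] :
    StarRel (fun M M' : Matrix n n ℂ => M' = M.conjTranspose) where
  zero := by simp
  one := by simp
  add := by rintro _ _ _ _ rfl rfl; simp
  smul := by rintro _ _ _ rfl; simp
  mul := by rintro _ _ _ _ rfl rfl; simp

/-- Passing to the other sector inverts the conjugate of q and also reverses the signed weights,
while the square roots are conjugated. -/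
lemma rho_adjoint (p : Level) (σ : Sector) (d : ℕ) :
    genRel (fun M M' => M' = M.conjTranspose) (rho p σ d) (rho p σ.swap d) := by
  have hq : ∀ n : ℤ, p.q σ.swap ^ (σ.swap.sgn * n) = conj (p.q σ ^ (σ.sgn * n)) := by
    intro n
    rw [map_zpow₀, p.conj_q, inv_zpow', Sector.sgn_swap, neg_mul]
  refine ⟨?_, ?_, ?_, ?_⟩
  · change (rho p σ.swap d).K = (rho p σ d).K.conjTranspose
    rw [rho_K, rho_K, Matrix.diagonal_conjTranspose]
    congr 1
    funext i
    exact hq _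
  · change (rho p σ.swap d).Kinv = (rho p σ d).Kinv.conjTranspose
    rw [rho_Kinv, rho_Kinv, Matrix.diagonal_conjTranspose]
    congr 1
    funext i
    simp only [← mul_neg]
    exact hq _
  · cases σ
    · exact (raise_conjTranspose p _ d).symm
    · change raise p _ d = (lower p _ d).conjTranspose
      rw [← Matrix.conjTranspose_inj, raise_conjTranspose, Matrix.conjTranspose_conjTranspose]
      rfl
  · cases σ
    · change raise p _ d = (lower p _ d).conjTranspose
      rw [← Matrix.conjTranspose_inj, raise_conjTranspose, Matrix.conjTranspose_conjTranspose]
      rfl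
    · exact (raise_conjTranspose p _ d).symm

/-! ### Adjoints of R-matrices and of dressed holonomies -/

section Adjoint

variable {A : Type} [Ring A] [Algebra ℂ A] {r : A → A → Prop} {p : Level} {σ : Sector} {d : ℕ}
  {S S' T T' : GenImages A}

lemma rhoLeg_adjoint (h : StarRel r) (p : Level) (σ : Sector) (d : ℕ) :
    genRel (matRel r) (rhoLeg p σ d A) (rhoLeg p σ.swap d A) := by
  obtain ⟨h1, h2, h3, h4⟩ := rho_adjoint p σ d
  refine ⟨?_, ?_, ?_, ?_⟩
  · change matRel r (cmat A _) (cmat A (rho p σ.swap d).K)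
    rw [h1]; exact h.cmat _
  · change matRel r (cmat A _) (cmat A (rho p σ.swap d).Kinv)
    rw [h2]; exact h.cmat _
  · change matRel r (cmat A _) (cmat A (rho p σ.swap d).X)
    rw [h3]; exact h.cmat _
  · change matRel r (cmat A _) (cmat A (rho p σ.swap d).Y)
    rw [h4]; exact h.cmat _

lemma scalarLeg_adjoint (h : StarRel r) (hT : genRel r T T') (n : Type) [Fintype n]
    [DecidableEq n] : genRel (matRel r) (scalarLeg n T) (scalarLeg n T') :=
  ⟨h.scalar hT.1, h.scalar hT.2.1, h.scalar hT.2.2.1, h.scalar hT.2.2.2⟩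

lemma X_mul_K (hT : Rels (p.Q σ) T) : T.X * T.K = (p.Q σ)⁻¹ • T.e := by
  rw [GenImages.e, hT.K_X, smul_smul, inv_mul_cancel₀ (p.Q_ne_zero σ), one_smul]

lemma Y_mul_Kinv (hT : Rels (p.Q σ) T) : T.Y * T.Kinv = (p.Q σ)⁻¹ • T.f := by
  rw [GenImages.f, hT.Kinv_Y (p.generic σ), smul_smul, inv_mul_cancel₀ (p.Q_ne_zero σ), one_smul]

/-- The adjoint of a universal R-matrix of one sector is the inverse of that of the other one. -/
lemma RUniv_adjoint {B : Type} [Ring B] [Algebra ℂ B] {r : B → B → Prop} (h : StarRel r)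
    {S S' T T' : GenImages B} {θ θ' θi : B}
    (hp : Pair (p.Q σ) S T θ) (hp' : Pair (p.Q σ.swap) S' T' θ')
    (hS : genRel r S S') (hT : genRel r T T') (hθ : r θ θi) (hθi : θi * θ' = 1) :
    r (RUniv (p.Q σ) S T θ) (Ring.inverse (RUniv (p.Q σ.swap) S' T' θ')) := by
  set t := (p.Q σ.swap)⁻¹ ^ 2 with ht
  have ht0 : t ≠ 0 := pow_ne_zero _ (inv_ne_zero (p.Q_ne_zero _))
  -- Taking adjoints reverses K X and K⁻¹ Y; restoring their order costs 𝐪̃⁻¹ in each leg,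
  -- altogether the parameter t of the exponential of the other sector.
  have hx : r (S.e * T.f) (t • (S'.e * T'.f)) := by
    have := h.mul (h.mul hS.1 hS.2.2.1) (h.mul hT.2.1 hT.2.2.2)
    rw [X_mul_K hp'.relS, Y_mul_Kinv hp'.relT, smul_mul_smul_comm, ← pow_two,
      ← hp'.comm.e_f.eq] at this
    exact this
  have hnil : IsNilpotent (t • (S'.e * T'.f)) := hp'.nilST.smul t
  have hq := h.qexp ((p.Q σ)⁻¹ ^ 2) hx hp.nilST hnil
  -- Conjugation also inverts the parameter, so the adjoint of the exponential is `qexp t⁻¹ (t •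
  -- x)`, precisely the inverse exponential.
  have hconj : conj ((p.Q σ)⁻¹ ^ 2) = t⁻¹ := by
    rw [map_pow, map_inv₀, p.conj_Q, inv_inv, ht, inv_pow, inv_inv]
  rw [hconj] at hq
  have hR := hp'.isUnit_RUniv (p.generic _)
  have hinv : QLorentz.qexp t⁻¹ (t • (S'.e * T'.f)) * θi =
      Ring.inverse (RUniv (p.Q σ.swap) S' T' θ') := by
    have e1 := qexp_mul_qexp_inv (p.generic σ.swap).inv_sq hp'.nilST
    have hu := isUnit_qexp (p.generic σ.swap).inv_sq hp'.nilST
    have e2 : QLorentz.qexp t⁻¹ (t • (S'.e * T'.f)) * QLorentz.qexp t (S'.e * T'.f) = 1 :=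
      hu.mul_left_cancel (by rw [← mul_assoc, e1, one_mul, mul_one])
    rw [← mul_one (_ * θi), ← Ring.mul_inverse_cancel _ hR, ← mul_assoc]
    nth_rewrite 1 [RUniv]
    rw [mul_assoc _ θi, ← mul_assoc θi, hθi, one_mul, e2, one_mul]
  rw [RUniv, ← hinv]
  exact h.mul hθ hq

/-- The adjoint of 𝒦^{2m} is 𝒦̃^{2m}, whereas the tilded Cartan element uses 𝒦̃^{-2m}; the two are
inverse. -/
lemma cartan_adjoint (h : StarRel r) (hT' : Rels (p.Q σ.swap) T') (hT : genRel r T T') :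
    ∃ θ, matRel r (cartan σ d T) θ ∧ θ * cartan σ.swap d T' = 1 := by
  refine ⟨Matrix.diagonal fun i => T'.kpow (σ.sgn * wt d i), fun i j => ?_, ?_⟩
  · rw [cartan]
    by_cases hij : i = j
    · subst hij
      simpa using h.kpow hT _
    · simpa [Matrix.diagonal_apply, hij, Ne.symm hij] using h.zero
  · rw [cartan, Matrix.diagonal_mul_diagonal, ← Matrix.diagonal_one]
    congr 1
    funext i
    rw [← hT'.kpow_add, Sector.sgn_swap, neg_mul, add_neg_cancel, kpow_zero]

lemma RMat_adjoint (h : StarRel r) (hr : Rels (p.Q σ) T) (hr' : Rels (p.Q σ.swap) T')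
    (hT : genRel r T T') :
    matRel r (RMat p σ d T) (Ring.inverse (RMat p σ.swap d T')) := by
  obtain ⟨θ, h1, h2⟩ := cartan_adjoint (d := d) h hr' hT
  rw [RMat_eq, RMat_eq]
  exact RUniv_adjoint (h.matrix _) (pair_cartan p σ d hr) (pair_cartan p σ.swap d hr')
    (rhoLeg_adjoint h p σ d) (scalarLeg_adjoint h hT _) h1 h2

lemma RMat'_adjoint (h : StarRel r) (hr : Rels (p.Q σ) T) (hr' : Rels (p.Q σ.swap) T')
    (hT : genRel r T T') :
    matRel r (RMat' p σ d T) (Ring.inverse (RMat' p σ.swap d T')) := by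
  obtain ⟨θ, h1, h2⟩ := cartan_adjoint (d := d) h hr' hT
  rw [RMat'_eq, RMat'_eq]
  exact RUniv_adjoint (h.matrix _) (pair_cartan p σ d hr).symm (pair_cartan p σ.swap d hr').symm
    (scalarLeg_adjoint h hT _) (rhoLeg_adjoint h p σ d) h1 h2

lemma inverse_mul_rev {R : Type} [Ring R] {a b : R} (ha : IsUnit a) (hb : IsUnit b) :
    Ring.inverse b * Ring.inverse a = Ring.inverse (a * b) := by
  obtain ⟨u, rfl⟩ := ha
  obtain ⟨v, rfl⟩ := hb
  rw [← Units.val_mul, Ring.inverse_unit, Ring.inverse_unit, Ring.inverse_unit, mul_inv_rev,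
    Units.val_mul]

lemma isUnit_loopMat (hr : Rels (p.Q σ) T) (d : ℕ) : IsUnit (loopMat p σ d T) :=
  (isUnit_RMat' p σ d hr).mul (isUnit_RMat p σ d hr)

lemma loopMat_adjoint (h : StarRel r) (hr : Rels (p.Q σ) T) (hr' : Rels (p.Q σ.swap) T')
    (hT : genRel r T T') :
    matRel r (loopMat p σ d T) (Ring.inverse (loopMat p σ.swap d T')) := by
  rw [loopMat, loopMat, ← inverse_mul_rev (isUnit_RMat' p _ d hr') (isUnit_RMat p _ d hr')]
  exact (h.matrix _).mul (RMat'_adjoint h hr hr' hT) (RMat_adjoint h hr hr' hT)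

/-- The adjoint of a dressed holonomy is the inverse of that of the other sector. -/
lemma dressedMat_adjoint (h : StarRel r) (hS : Rels (p.Q σ) S) (hS' : Rels (p.Q σ.swap) S')
    (hT : Rels (p.Q σ) T) (hT' : Rels (p.Q σ.swap) T') (hrS : genRel r S S')
    (hrT : genRel r T T') :
    matRel r (dressedMat p σ d S T) (Ring.inverse (dressedMat p σ.swap d S' T')) := by
  have u1 := isUnit_RMat' p σ.swap d hS'
  have u2 := isUnit_loopMat hT' d
  -- For the inverse dressing the adjoint relation is read backwards, from the other sector to this
  -- one.
  have h3 : matRel r (Ring.inverse (RMat' p σ d S)) (RMat' p σ.swap d S') := by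
    have := RMat'_adjoint (p := p) (σ := σ.swap) (d := d) h.flip hS'
      (by rwa [Sector.swap_swap]) (T' := S) hrS
    rw [Sector.swap_swap] at this
    exact fun i j => this j i
  have h4 : Ring.inverse (Ring.inverse (RMat' p σ.swap d S')) = RMat' p σ.swap d S' := by
    obtain ⟨u, hu⟩ := u1
    rw [← hu, Ring.inverse_unit, Ring.inverse_unit, inv_inv]
  rw [dressedMat, dressedMat, ← inverse_mul_rev (u1.mul u2) u1.ringInverse,
    ← inverse_mul_rev u1 u2, h4]
  exact (h.matrix _).mul ((h.matrix _).mul (RMat'_adjoint h hS hS' hrS)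
    (loopMat_adjoint h hT hT' hrT)) h3

/-- The finite-dimensional instance of the adjoint theorem, with conjugate transposition as the
adjoint. It makes the defining relations of the two sectors compatible with the star. -/
lemma RFin_conjTranspose (p : Level) (σ : Sector) (d e : ℕ) :
    (RFin p σ d e).conjTranspose = (RFin p σ.swap d e)⁻¹ := by
  have h := RMat_adjoint (d := d) (conjTranspose_starRel (Fin (e + 1))) (rho_rels p σ e)
    (rho_rels p σ.swap e) (rho_adjoint p σ e)
  have e1 : (RFin p σ d e).conjTranspose = Matrix.compAlgEquiv _ _ ℂ ℂ
      (Ring.inverse (RMat p σ.swap d (rho p σ.swap e))) := by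
    ext ⟨i, j⟩ ⟨k, l⟩
    exact (congrFun (congrFun (h k i) j) l).symm
  refine (Matrix.inv_eq_left_inv ?_).symm
  have e2 : RFin p σ.swap d e = Matrix.compAlgEquiv _ _ ℂ ℂ (RMat p σ.swap d (rho p σ.swap e)) := rfl
  rw [e1, e2, ← map_mul, Ring.inverse_mul_cancel _ (isUnit_RMat p _ d (rho_rels p _ e)), map_one]

/-! ### Conjugation of the Clebsch–Gordan maps -/

lemma rhoTensor_adjoint (p : Level) (σ : Sector) (d e : ℕ) :
    genRel (fun M M' => M' = M.conjTranspose) (rhoTensor p σ d e) (rhoTensor p σ.swap d e) := by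
  have hS := rho_adjoint p σ d
  have hT := rho_adjoint p σ e
  rw [rhoTensor_eq, rhoTensor_eq]
  have key : ∀ (M : Matrix (Fin (d + 1)) (Fin (d + 1)) ℂ) (M' : Matrix (Fin (e + 1)) (Fin (e + 1)) ℂ),
      Commute (kronLeft ℂ _ (Fin (e + 1)) M) (kronRight ℂ (Fin (d + 1)) _ M') :=
    fun M M' => commute_kronLeft_kronRight fun _ _ _ _ => Commute.all _ _
  have h1 : ∀ M, ((rho p σ.swap e).map (kronRight ℂ (Fin (d + 1)) _)).All
      (Commute (kronLeft ℂ _ (Fin (e + 1)) M)) := fun M =>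
    All.map (All.of_forall (fun M' => key M M') _)
  have hc : ((rho p σ.swap d).map (kronLeft ℂ _ (Fin (e + 1)))).Comm
      ((rho p σ.swap e).map (kronRight ℂ (Fin (d + 1)) _)) :=
    All.map (All.of_forall (fun M => h1 M) _)
  have eL : ∀ {M M' : Matrix (Fin (d + 1)) (Fin (d + 1)) ℂ}, M' = M.conjTranspose →
      kronLeft ℂ _ (Fin (e + 1)) M' = (kronLeft ℂ _ (Fin (e + 1)) M).conjTranspose := by
    rintro M _ rfl
    rw [kronLeft_apply, kronLeft_apply, Matrix.conjTranspose_kronecker, Matrix.conjTranspose_one]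
  have eR : ∀ {M M' : Matrix (Fin (e + 1)) (Fin (e + 1)) ℂ}, M' = M.conjTranspose →
      kronRight ℂ (Fin (d + 1)) _ M' = (kronRight ℂ (Fin (d + 1)) _ M).conjTranspose := by
    rintro M _ rfl
    rw [kronRight_apply, kronRight_apply, Matrix.conjTranspose_kronecker, Matrix.conjTranspose_one]
  exact (conjTranspose_starRel _).comul ⟨eL hS.1, eL hS.2.1, eL hS.2.2.1, eL hS.2.2.2⟩
    ⟨eR hT.1, eR hT.2.1, eR hT.2.2.1, eR hT.2.2.2⟩ hc

/-- The intertwining property is required only of C1; completeness and orthogonality transfer it to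
C2. -/
lemma CGMaps.C2_mul {p : Level} {σ : Sector} {d e : ℕ} (C : CGMaps p σ d e) (t)
    {x : Matrix (Fin (d + 1) × Fin (e + 1)) (Fin (d + 1) × Fin (e + 1)) ℂ}
    {y : ∀ d : ℕ, Matrix (Fin (d + 1)) (Fin (d + 1)) ℂ}
    (h : ∀ t, C.C1 t * y (d + e - 2 * t) = x * C.C1 t) :
    C.C2 t * x = y (d + e - 2 * t) * C.C2 t := by
  have e1 : C.C2 t * x = ∑ s, C.C2 t * (C.C1 s * y (d + e - 2 * s) * C.C2 s) := by
    have e2 : ∀ s, C.C1 s * y (d + e - 2 * s) * C.C2 s = x * (C.C1 s * C.C2 s) := fun s => by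
      rw [h, Matrix.mul_assoc]
    rw [← Matrix.mul_sum]
    simp only [e2]
    rw [← Matrix.mul_sum, C.C1_C2, Matrix.mul_one]
  rw [e1, Finset.sum_eq_single t]
  · rw [← Matrix.mul_assoc, ← Matrix.mul_assoc, C.C2_C1, Matrix.one_mul]
  · intro s _ hs
    rw [← Matrix.mul_assoc, ← Matrix.mul_assoc, C.C2_C1_ne t s hs.symm, Matrix.zero_mul,
      Matrix.zero_mul]
  · simp

/-- The adjoints of Clebsch–Gordan maps are Clebsch–Gordan maps of the other sector. -/
def CGMaps.star {p : Level} {σ : Sector} {d e : ℕ} (C : CGMaps p σ d e) : CGMaps p σ.swap d e where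
  C1 t := (C.C2 t).conjTranspose
  C2 t := (C.C1 t).conjTranspose
  C2_C1 t := by rw [← Matrix.conjTranspose_mul, C.C2_C1, Matrix.conjTranspose_one]
  C2_C1_ne t t' h := by
    rw [← Matrix.conjTranspose_mul, C.C2_C1_ne t' t h.symm, Matrix.conjTranspose_zero]
  C1_C2 := by
    simp only [← Matrix.conjTranspose_mul]
    rw [← Matrix.conjTranspose_sum, C.C1_C2, Matrix.conjTranspose_one]
  C1_K t := by
    rw [(rho_adjoint p σ _).1, (rhoTensor_adjoint p σ d e).1, ← Matrix.conjTranspose_mul,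
      ← Matrix.conjTranspose_mul, C.C2_mul t (y := fun d => (rho p σ d).K) C.C1_K]
  C1_X t := by
    rw [(rho_adjoint p σ _).2.2.1, (rhoTensor_adjoint p σ d e).2.2.1, ← Matrix.conjTranspose_mul,
      ← Matrix.conjTranspose_mul, C.C2_mul t (y := fun d => (rho p σ d).X) C.C1_X]
  C1_Y t := by
    rw [(rho_adjoint p σ _).2.2.2, (rhoTensor_adjoint p σ d e).2.2.2, ← Matrix.conjTranspose_mul,
      ← Matrix.conjTranspose_mul, C.C2_mul t (y := fun d => (rho p σ d).Y) C.C1_Y]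

end Adjoint

/-! ### The complex-conjugate opposite algebra -/

/-- The opposite algebra, with the complex-conjugate scalar multiplication. -/
def ConjOp (B : Type) : Type := Bᵐᵒᵖ

section ConjOp

variable {B : Type} [Ring B] [Algebra ℂ B]

instance : Ring (ConjOp B) := inferInstanceAs (Ring Bᵐᵒᵖ)

instance : Algebra ℂ (ConjOp B) :=
  RingHom.toAlgebra' ((algebraMap ℂ Bᵐᵒᵖ).comp (starRingEnd ℂ))
    (fun c x => Algebra.commutes (R := ℂ) (A := Bᵐᵒᵖ) (conj c) x)

/-- The tautological antilinear anti-isomorphism. -/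
def toC (a : B) : ConjOp B := MulOpposite.op a

/-- The inverse of `toC`. -/
def ofC (x : ConjOp B) : B := MulOpposite.unop x

lemma toC_zero : toC (0 : B) = 0 := rfl
lemma toC_one : toC (1 : B) = 1 := rfl
lemma toC_add (a b : B) : toC (a + b) = toC a + toC b := rfl
lemma toC_sub (a b : B) : toC (a - b) = toC a - toC b := rfl
lemma toC_mul (a b : B) : toC (a * b) = toC b * toC a := rfl
lemma ofC_add (a b : ConjOp B) : ofC (a + b) = ofC a + ofC b := rfl
lemma ofC_mul (a b : ConjOp B) : ofC (a * b) = ofC b * ofC a := rfl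
lemma ofC_one : ofC (1 : ConjOp B) = 1 := rfl

lemma toC_algebraMap (c : ℂ) : toC (algebraMap ℂ B c) = algebraMap ℂ (ConjOp B) (conj c) := by
  change MulOpposite.op (algebraMap ℂ B c) = MulOpposite.op (algebraMap ℂ B (conj (conj c)))
  rw [Complex.conj_conj]

lemma toC_smul (c : ℂ) (a : B) : toC (c • a) = conj c • toC a := by
  rw [Algebra.smul_def, Algebra.smul_def, toC_mul, toC_algebraMap, Algebra.commutes]

lemma ofC_smul (c : ℂ) (a : ConjOp B) : ofC (c • a) = conj c • ofC a := by
  have := toC_smul (B := B) (conj c) (ofC a)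
  rw [Complex.conj_conj] at this
  exact (congrArg ofC this).symm

lemma toC_sum {ι : Type} (s : Finset ι) (f : ι → B) : toC (∑ i ∈ s, f i) = ∑ i ∈ s, toC (f i) := by
  classical
  induction s using Finset.induction_on with
  | empty => rfl
  | insert i s hi ih => rw [Finset.sum_insert hi, Finset.sum_insert hi, toC_add, ih]

lemma commute_toC {a b : B} (h : Commute a b) : Commute (toC a) (toC b) := by
  rw [Commute, SemiconjBy, ← toC_mul, ← toC_mul, h.eq]

/-- The conjugate transpose of a matrix, with entries in the conjugate opposite algebra. -/
def sharp {n n' : Type} (P : Matrix n n' B) : Matrix n' n (ConjOp B) :=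
  Matrix.of fun j i => toC (P i j)

variable {n n' n'' : Type}

lemma sharp_mul [Fintype n'] (P : Matrix n n' B) (P' : Matrix n' n'' B) :
    sharp (P * P') = sharp P' * sharp P := by
  ext i j
  simp only [sharp, Matrix.of_apply, Matrix.mul_apply, toC_sum, toC_mul]

lemma sharp_add (P P' : Matrix n n' B) : sharp (P + P') = sharp P + sharp P' := rfl

lemma sharp_sum {ι : Type} (s : Finset ι) (P : ι → Matrix n n' B) :
    sharp (∑ i ∈ s, P i) = ∑ i ∈ s, sharp (P i) := by
  ext i j
  simp only [sharp, Matrix.of_apply, Matrix.sum_apply, toC_sum]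

lemma sharp_one [DecidableEq n] : sharp (1 : Matrix n n B) = 1 := by
  ext i j
  by_cases h : i = j
  · subst h
    simp [sharp, toC_one]
  · simp [sharp, Matrix.one_apply, h, Ne.symm h, toC_zero]

lemma sharp_cmat (M : Matrix n n' ℂ) : sharp (cmat B M) = cmat (ConjOp B) M.conjTranspose := by
  ext i j
  exact toC_algebraMap _

lemma sharp_kron_one [DecidableEq n'] (P : Matrix n n B) :
    sharp (P ⊗ₖ (1 : Matrix n' n' B)) = sharp P ⊗ₖ 1 := by
  ext ⟨a, b⟩ ⟨c, e⟩
  by_cases h : b = e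
  · simp [sharp, Matrix.kroneckerMap_apply, h]
  · simp [sharp, Matrix.kroneckerMap_apply, Matrix.one_apply, h, Ne.symm h, toC_zero]

lemma sharp_one_kron [DecidableEq n'] (P : Matrix n n B) :
    sharp ((1 : Matrix n' n' B) ⊗ₖ P) = 1 ⊗ₖ sharp P := by
  ext ⟨a, b⟩ ⟨c, e⟩
  by_cases h : a = c
  · simp [sharp, Matrix.kroneckerMap_apply, h]
  · simp [sharp, Matrix.kroneckerMap_apply, Matrix.one_apply, h, Ne.symm h, toC_zero]

lemma sharp_scalarHom [Fintype n] [DecidableEq n] (a : B) :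
    sharp (scalarHom B n a) = scalarHom (ConjOp B) n (toC a) := by
  ext i j
  by_cases h : i = j
  · simp [sharp, h, scalarHom_apply]
  · simp [sharp, Matrix.diagonal_apply, h, Ne.symm h, toC_zero, scalarHom_apply]

end ConjOp

/-! ### The images of the holonomies under the `*`-structure -/

section GraphStar

variable {B : Type} [Ring B] [Algebra ℂ B] {p : Level} {σ : Sector}

lemma RFin_inv_conjTranspose (p : Level) (σ : Sector) (d e : ℕ) :
    (RFin p σ d e)⁻¹.conjTranspose = RFin p σ.swap d e := by
  rw [Matrix.conjTranspose_nonsing_inv, RFin_conjTranspose, Matrix.nonsing_inv_nonsing_inv _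
    ((Matrix.isUnit_iff_isUnit_det _).mp (isUnit_RFin p _ d e))]

/-- Conjugate transposition reverses the four factors and sends R⁻¹ and R of one sector to R and R⁻¹
of the other, exchanging the two orderings of the exchange relation. -/
lemma loopProd_sharp {d e : ℕ} (P : Matrix (Fin (d + 1)) (Fin (d + 1)) B)
    (P' : Matrix (Fin (e + 1)) (Fin (e + 1)) B) :
    loopProd p σ d e (sharp P) (sharp P') = sharp (loopProdExch p σ.swap d e P P') := by
  have h1 : (RFin p σ d e)⁻¹ = (RFin p σ.swap d e).conjTranspose := by
    rw [RFin_conjTranspose, Sector.swap_swap]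
  have h2 : RFin p σ d e = (RFin p σ.swap d e)⁻¹.conjTranspose := by
    rw [RFin_inv_conjTranspose, Sector.swap_swap]
  rw [loopProd, loopProdExch, h1, h2, sharp_mul, sharp_mul, sharp_mul, sharp_cmat, sharp_cmat, sharp_kron_one, sharp_one_kron]
  simp only [Matrix.mul_assoc]

lemma loopProdExch_sharp {d e : ℕ} (P : Matrix (Fin (d + 1)) (Fin (d + 1)) B)
    (P' : Matrix (Fin (e + 1)) (Fin (e + 1)) B) :
    loopProdExch p σ d e (sharp P) (sharp P') = sharp (loopProd p σ.swap d e P P') := by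
  have h1 : (RFin p σ d e)⁻¹ = (RFin p σ.swap d e).conjTranspose := by
    rw [RFin_conjTranspose, Sector.swap_swap]
  have h2 : RFin p σ d e = (RFin p σ.swap d e)⁻¹.conjTranspose := by
    rw [RFin_inv_conjTranspose, Sector.swap_swap]
  rw [loopProd, loopProdExch, h1, h2, sharp_mul, sharp_mul, sharp_mul, sharp_cmat, sharp_cmat, sharp_kron_one, sharp_one_kron]
  simp only [Matrix.mul_assoc]

lemma cgSum_sharp {d e : ℕ} (C : CGMaps p σ d e)
    (P : ∀ d : ℕ, Matrix (Fin (d + 1)) (Fin (d + 1)) B) :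
    cgSum C (fun d => sharp (P d)) = sharp (cgSum C.star P) := by
  rw [cgSum, cgSum, sharp_sum]
  refine Finset.sum_congr rfl fun t _ => ?_
  rw [sharp_mul, sharp_mul, sharp_cmat, sharp_cmat, ← Matrix.mul_assoc]
  simp [CGMaps.star]

lemma kron_one_mul_inverse {d e : ℕ} {M : Matrix (Fin (d + 1)) (Fin (d + 1)) B} (hM : IsUnit M) :
    (Ring.inverse M ⊗ₖ (1 : Matrix (Fin (e + 1)) (Fin (e + 1)) B)) * (M ⊗ₖ 1) = 1 ∧
      (M ⊗ₖ (1 : Matrix (Fin (e + 1)) (Fin (e + 1)) B)) * (Ring.inverse M ⊗ₖ 1) = 1 := by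
  rw [← kronLeft_apply, ← kronLeft_apply, ← map_mul, ← map_mul, Ring.inverse_mul_cancel _ hM,
    Ring.mul_inverse_cancel _ hM, map_one]
  exact ⟨rfl, rfl⟩

lemma one_kron_mul_inverse {d e : ℕ} {M : Matrix (Fin (e + 1)) (Fin (e + 1)) B} (hM : IsUnit M) :
    ((1 : Matrix (Fin (d + 1)) (Fin (d + 1)) B) ⊗ₖ Ring.inverse M) * (1 ⊗ₖ M) = 1 ∧
      ((1 : Matrix (Fin (d + 1)) (Fin (d + 1)) B) ⊗ₖ M) * (1 ⊗ₖ Ring.inverse M) = 1 := by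
  rw [← kronRight_apply, ← kronRight_apply, ← map_mul, ← map_mul, Ring.inverse_mul_cancel _ hM,
    Ring.mul_inverse_cancel _ hM, map_one]
  exact ⟨rfl, rfl⟩

lemma mul_cancel_middle {n₁ : Type} [Fintype n₁] [DecidableEq n₁]
    {a a' b b' c c' d d' : Matrix n₁ n₁ B} (ha : a * a' = 1) (hb : b * b' = 1) (hc : c * c' = 1)
    (hd : d * d' = 1) : a * b * c * d * (d' * c' * b' * a') = 1 := by
  simp only [mul_assoc]
  rw [← mul_assoc d, hd, one_mul, ← mul_assoc c, hc, one_mul, ← mul_assoc b, hb, one_mul, ha]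

lemma loopProdExch_inverse_mul {d e : ℕ} {M : Matrix (Fin (d + 1)) (Fin (d + 1)) B}
    {M' : Matrix (Fin (e + 1)) (Fin (e + 1)) B} (hM : IsUnit M) (hM' : IsUnit M') :
    loopProdExch p σ d e (Ring.inverse M) (Ring.inverse M') * loopProd p σ d e M M' = 1 := by
  have := mul_cancel_middle (one_kron_mul_inverse (d := d) hM').1
    (cmat_RFin_inv_mul p σ d e (A := B)) (kron_one_mul_inverse (e := e) hM).1
    (cmat_RFin_mul_inv p σ d e)
  rwa [loopProdExch, loopProd]

lemma loopProdExch_mul_loopProd_inverse {d e : ℕ} {M : Matrix (Fin (d + 1)) (Fin (d + 1)) B}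
    {M' : Matrix (Fin (e + 1)) (Fin (e + 1)) B} (hM : IsUnit M) (hM' : IsUnit M') :
    loopProdExch p σ d e M M' * loopProd p σ d e (Ring.inverse M) (Ring.inverse M') = 1 := by
  have := mul_cancel_middle (one_kron_mul_inverse (d := d) hM').2
    (cmat_RFin_inv_mul p σ d e (A := B)) (kron_one_mul_inverse (e := e) hM).2
    (cmat_RFin_mul_inv p σ d e)
  rwa [loopProdExch, loopProd]

lemma cgSum_mul_cgSum {d e : ℕ} (C : CGMaps p σ d e)
    {M M' : ∀ d : ℕ, Matrix (Fin (d + 1)) (Fin (d + 1)) B} (h : ∀ d, M d * M' d = 1) :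
    cgSum C M * cgSum C M' = 1 := by
  have e1 : ∀ t, cmat B (C.C1 t) * M (d + e - 2 * t) * cmat B (C.C2 t) * cgSum C M' =
      cmat B (C.C1 t * C.C2 t) := by
    intro t
    rw [Matrix.mul_assoc, C.C2_mul_cgSum, Matrix.mul_assoc, ← Matrix.mul_assoc (M _), h,
      Matrix.one_mul, cmat_mul]
  rw [cgSum, Finset.sum_mul]
  simp only [e1]
  have := congrArg (cmatHom B _) C.C1_C2
  rwa [map_sum, map_one] at this

/-- Matrices that satisfy the relations of the graph algebra. -/
def GraphHolds (p : Level) (σ : Sector) {m : ℕ}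
    (M : Fin m → ∀ d : ℕ, Matrix (Fin (d + 1)) (Fin (d + 1)) B) : Prop :=
  ∀ x y, GraphRel p σ M x y → x = y

namespace GraphHolds

variable {m : ℕ} {M : Fin m → ∀ d : ℕ, Matrix (Fin (d + 1)) (Fin (d + 1)) B}

lemma one (h : GraphHolds p σ M) (ν : Fin m) : M ν 0 = 1 := by
  ext i j
  exact h _ _ (GraphRel.one ν i j)

lemma product (h : GraphHolds p σ M) (ν : Fin m) (d e : ℕ) (C : CGMaps p σ d e) :
    loopProd p σ d e (M ν d) (M ν e) = cgSum C (M ν) := by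
  ext a c
  exact h _ _ (GraphRel.product ν d e C a c)

lemma exchange (h : GraphHolds p σ M) {ν μ : Fin m} (hνμ : ν < μ) (d e : ℕ) :
    loopProd p σ d e (M ν d) (M μ e) = loopProdExch p σ d e (M ν d) (M μ e) := by
  ext a c
  exact h _ _ (GraphRel.exchange ν μ hνμ d e a c)

lemma isUnit (h : GraphHolds p σ M) (ν : Fin m) (d : ℕ) : IsUnit (M ν d) :=
  isUnit_holonomy (h.one ν) (h.product ν) d

/-- Invert the relations of the other sector and apply the conjugate transpose: each operation
interchanges the two orderings of the product, so together they reproduce the relations of this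
sector. -/
lemma sharp_inverse (h : GraphHolds p σ.swap M) :
    GraphHolds p σ fun ν d => sharp (Ring.inverse (M ν d)) := by
  intro x y hxy
  cases hxy with
  | one ν i j => rw [h.one, Ring.inverse_one, sharp_one]
  | product ν d e C a c =>
    rw [loopProd_sharp, cgSum_sharp C fun d => Ring.inverse (M ν d)]
    have h1 := loopProdExch_inverse_mul (p := p) (σ := σ.swap) (h.isUnit ν d) (h.isUnit ν e)
    have h2 := cgSum_mul_cgSum C.star (M := M ν) (M' := fun d => Ring.inverse (M ν d))
      fun d => Ring.mul_inverse_cancel _ (h.isUnit ν d)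
    rw [← h.product ν d e C.star] at h2
    rw [left_inv_eq_right_inv h1 h2]
  | exchange ν μ hνμ d e a c =>
    rw [loopProd_sharp, loopProdExch_sharp]
    have h1 := loopProdExch_inverse_mul (p := p) (σ := σ.swap) (h.isUnit ν d) (h.isUnit μ e)
    have h2 := loopProdExch_mul_loopProd_inverse (p := p) (σ := σ.swap) (h.isUnit ν d)
      (h.isUnit μ e)
    rw [← h.exchange hνμ] at h2
    rw [left_inv_eq_right_inv h1 h2]

end GraphHolds

end GraphStar

/-! ### The relations of the quantum group and of the semidirect product -/

section ExtStar

variable {B : Type} [Ring B] [Algebra ℂ B] {p : Level} {σ : Sector} {m : ℕ}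

/-- Elements that satisfy the relations of the quantum group. -/
def UHolds (p : Level) (σ : Sector) (g : UGen → B) : Prop := ∀ x y, URel p σ g x y → x = y

/-- Reversing products is compensated by the conjugate of 𝐪̃ being 𝐪⁻¹. In the commutator of E and F
both sides change sign. -/
lemma UHolds.sharp {g : UGen → B} (h : UHolds p σ.swap g) : UHolds p σ fun x => toC (g x) := by
  have hc : conj (p.Q σ.swap) = (p.Q σ)⁻¹ := by rw [p.conj_Q, Sector.swap_swap]
  have h0 := p.Q_ne_zero σ
  intro x y hxy
  cases hxy with
  | K_Kinv => rw [← toC_mul, h _ _ .Kinv_K, toC_one]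
  | Kinv_K => rw [← toC_mul, h _ _ .K_Kinv, toC_one]
  | K_E =>
    have := congrArg toC (h _ _ .K_E)
    rw [toC_smul, map_pow, hc, toC_mul, toC_mul] at this
    rw [this, smul_smul, ← mul_pow, mul_inv_cancel₀ h0, one_pow, one_smul]
  | K_F =>
    have := congrArg toC (h _ _ .K_F)
    rw [toC_smul, map_pow, map_inv₀, hc, inv_inv, toC_mul, toC_mul] at this
    rw [this, smul_smul, ← mul_pow, inv_mul_cancel₀ h0, one_pow, one_smul]
  | E_F =>
    have := congrArg toC (h _ _ .E_F)
    rw [toC_smul, map_inv₀, map_sub, map_inv₀, hc, inv_inv, toC_sub, toC_sub, toC_mul, toC_mul]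
      at this
    rw [← neg_sub (toC (g .F) * toC (g .E)), this, ← neg_sub (p.Q σ), inv_neg, neg_smul, neg_neg]

/-- The element `∑ ρ(ξ⁽¹⁾) ⊗ ξ⁽²⁾` for a generator `ξ`. -/
def covMat (p : Level) (σ : Sector) (d : ℕ) (g : UGen → B) :
    UGen → Matrix (Fin (d + 1)) (Fin (d + 1)) B :=
  let r := (rho p σ d).u σ
  fun
  | .E => cmat B (r .E) * scalarHom B _ (g .K) + scalarHom B _ (g .E)
  | .F => cmat B (r .F) + cmat B (r .Kinv) * scalarHom B _ (g .F)
  | .K => cmat B (r .K) * scalarHom B _ (g .K)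
  | .Kinv => cmat B (r .Kinv) * scalarHom B _ (g .Kinv)

/-- Reversing the order of the two tensor legs is harmless because they commute. -/
lemma sharp_covMat (d : ℕ) (g : UGen → B) (x : UGen) :
    sharp (covMat p σ.swap d g x) = covMat p σ d (fun x => toC (g x)) x := by
  have h : ∀ x, ((rho p σ.swap d).u σ.swap x).conjTranspose = (rho p σ d).u σ x := fun x => by
    rw [(conjTranspose_starRel (Fin (d + 1))).u (rho_adjoint p σ d) x (σ := σ),
      Matrix.conjTranspose_conjTranspose]
  cases x <;>
  simp only [covMat, sharp_add, sharp_mul, sharp_cmat, sharp_scalarHom, h] <;>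
  simp only [(commute_scalarHom_cmatHom _ _).eq, ← cmatHom_apply]

lemma rho_u_K_Kinv (p : Level) (σ : Sector) (d : ℕ) :
    (rho p σ d).u σ .K * (rho p σ d).u σ .Kinv = 1 := by
  have := rho_rels p σ d
  have h : (rho p σ d).K * (rho p σ d).K * ((rho p σ d).Kinv * (rho p σ d).Kinv) = 1 := by
    rw [mul_assoc, ← mul_assoc _ (rho p σ d).Kinv, this.K_Kinv, one_mul, this.K_Kinv]
  cases σ <;> exact h

lemma rho_u_Kinv_K (p : Level) (σ : Sector) (d : ℕ) :
    (rho p σ d).u σ .Kinv * (rho p σ d).u σ .K = 1 :=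
  mul_eq_one_comm.mp (rho_u_K_Kinv p σ d)

/-- Elements that satisfy the multiplication rules of the semidirect product. -/
def CrossHolds (p : Level) (σ : Sector)
    (M : Fin m → ∀ d : ℕ, Matrix (Fin (d + 1)) (Fin (d + 1)) B) (g : UGen → B) : Prop :=
  ∀ x y, CrossRel p σ M g x y → x = y

variable {M : Fin m → ∀ d : ℕ, Matrix (Fin (d + 1)) (Fin (d + 1)) B} {g : UGen → B}

/-- The rules of the semidirect product say that M commutes with the images of (ρ ⊗ id)Δ(ξ). In this
form, covariance passes to inverses and conjugate transposes at once; `CrossHolds.of_commute` is the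
converse. -/
lemma CrossHolds.commute (hg : UHolds p σ g) (h : CrossHolds p σ M g) (ν : Fin m) (d : ℕ)
    (x : UGen) : Commute (M ν d) (covMat p σ d g x) := by
  have c1 : cmat B ((rho p σ d).u σ .K) * cmat B ((rho p σ d).u σ .Kinv) = 1 := by
    rw [← cmat_mul, rho_u_K_Kinv, cmat_one]
  have c2 : cmat B ((rho p σ d).u σ .Kinv) * cmat B ((rho p σ d).u σ .K) = 1 := by
    rw [← cmat_mul, rho_u_Kinv_K, cmat_one]
  have hs : ∀ (a : B) X, scalarHom B _ a * cmat B X = cmat B X * scalarHom B (Fin (d + 1)) a :=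
    fun a X => (commute_scalarHom_cmatHom X a).eq
  have hE : scalarHom B _ (g .E) * M ν d = gaugeAct p σ d (M ν d) .E * scalarHom B _ (g .K) +
      M ν d * scalarHom B _ (g .E) := by
    ext i j
    simpa [scalarHom_apply] using h _ _ (.E ν d i j)
  have hF : scalarHom B _ (g .F) * M ν d = gaugeAct p σ d (M ν d) .F +
      gaugeAct p σ d (M ν d) .Kinv * scalarHom B _ (g .F) := by
    ext i j
    simpa [scalarHom_apply] using h _ _ (.F ν d i j)
  have hK : scalarHom B _ (g .K) * M ν d = gaugeAct p σ d (M ν d) .K * scalarHom B _ (g .K) := by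
    ext i j
    simpa [scalarHom_apply] using h _ _ (.K ν d i j)
  have hKi : scalarHom B _ (g .Kinv) * M ν d =
      gaugeAct p σ d (M ν d) .Kinv * scalarHom B _ (g .Kinv) := by
    ext i j
    simpa [scalarHom_apply] using h _ _ (.Kinv ν d i j)
  simp only [gaugeAct, neg_mul, cmat_mul, ← cmatHom_apply, map_neg, map_mul] at hE hF hK hKi c1 c2 hs
  rw [Commute, SemiconjBy]
  cases x <;> simp only [covMat, ← cmatHom_apply]
  · rw [mul_add, add_mul, mul_assoc (cmatHom B _ _), hK, hE]
    simp only [add_mul, mul_assoc, neg_mul]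
    abel
  · rw [mul_add, add_mul, mul_assoc (cmatHom B _ _) (scalarHom B _ _), hF]
    simp only [mul_add, mul_neg, ← mul_assoc]
    simp only [c2, one_mul]
    abel
  · rw [mul_assoc (cmatHom B _ _) (scalarHom B _ _), hK]
    simp only [← mul_assoc]
    simp only [c1, one_mul]
  · rw [mul_assoc (cmatHom B _ _) (scalarHom B _ _), hKi]
    simp only [← mul_assoc]
    simp only [c2, one_mul]

lemma CrossHolds.of_commute (h : ∀ ν d x, Commute (M ν d) (covMat p σ d g x)) :
    CrossHolds p σ M g := by
  have c1 : ∀ d, cmatHom B _ ((rho p σ d).u σ .K) * cmatHom B _ ((rho p σ d).u σ .Kinv) = 1 :=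
    fun d => by rw [← map_mul, rho_u_K_Kinv, map_one]
  have c2 : ∀ d, cmatHom B _ ((rho p σ d).u σ .Kinv) * cmatHom B _ ((rho p σ d).u σ .K) = 1 :=
    fun d => by rw [← map_mul, rho_u_Kinv_K, map_one]
  have hK : ∀ ν d, scalarHom B _ (g .K) * M ν d =
      gaugeAct p σ d (M ν d) .K * scalarHom B _ (g .K) := by
    intro ν d
    have := (h ν d .K).eq
    simp only [covMat, ← cmatHom_apply, gaugeAct] at this ⊢
    rw [mul_assoc, mul_assoc, this, ← mul_assoc, ← mul_assoc, c2, one_mul]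
  have hKi : ∀ ν d, scalarHom B _ (g .Kinv) * M ν d =
      gaugeAct p σ d (M ν d) .Kinv * scalarHom B _ (g .Kinv) := by
    intro ν d
    have := (h ν d .Kinv).eq
    simp only [covMat, ← cmatHom_apply, gaugeAct] at this ⊢
    rw [mul_assoc, mul_assoc, this, ← mul_assoc, ← mul_assoc, c1, one_mul]
  have hE : ∀ ν d, scalarHom B _ (g .E) * M ν d =
      gaugeAct p σ d (M ν d) .E * scalarHom B _ (g .K) + M ν d * scalarHom B _ (g .E) := by
    intro ν d
    have h1 := (h ν d .E).eq
    have h2 := hK ν d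
    simp only [covMat, ← cmatHom_apply, gaugeAct, map_neg, map_mul] at h1 h2 ⊢
    rw [mul_add, add_mul, mul_assoc (cmatHom B _ _), h2] at h1
    rw [← add_right_inj, ← h1]
    simp only [add_mul, mul_assoc, neg_mul]
    abel
  have hF : ∀ ν d, scalarHom B _ (g .F) * M ν d =
      gaugeAct p σ d (M ν d) .F + gaugeAct p σ d (M ν d) .Kinv * scalarHom B _ (g .F) := by
    intro ν d
    have h1 := congrArg (cmatHom B _ ((rho p σ d).u σ .K) * ·) (h ν d .F).eq
    simp only [covMat, ← cmatHom_apply, gaugeAct, map_neg, map_mul] at h1 ⊢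
    rw [mul_add, add_mul, mul_add, mul_add, mul_assoc (cmatHom B _ _) (scalarHom B _ _),
      ← mul_assoc (cmatHom B _ _) (cmatHom B _ _) (scalarHom B _ _ * _), c1, one_mul] at h1
    rw [← add_right_inj, ← h1]
    simp only [mul_assoc, neg_mul]
    abel
  intro x y hxy
  cases hxy with
  | E ν d i j => simpa [scalarHom_apply] using congrFun (congrFun (hE ν d) i) j
  | F ν d i j => simpa [scalarHom_apply] using congrFun (congrFun (hF ν d) i) j
  | K ν d i j => simpa [scalarHom_apply] using congrFun (congrFun (hK ν d) i) j
  | Kinv ν d i j => simpa [scalarHom_apply] using congrFun (congrFun (hKi ν d) i) j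

lemma commute_inverse {R : Type} [Ring R] {a b : R} (ha : IsUnit a) (h : Commute a b) :
    Commute (Ring.inverse a) b := by
  obtain ⟨u, rfl⟩ := ha
  rw [Ring.inverse_unit]
  exact h.units_inv_left

lemma CrossHolds.sharp_inverse {M : Fin m → ∀ d : ℕ, Matrix (Fin (d + 1)) (Fin (d + 1)) B}
    {g : UGen → B} (hM : ∀ ν d, IsUnit (M ν d)) (hg : UHolds p σ.swap g)
    (h : CrossHolds p σ.swap M g) :
    CrossHolds p σ (fun ν d => sharp (Ring.inverse (M ν d))) (fun x => toC (g x)) := by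
  refine CrossHolds.of_commute fun ν d x => ?_
  rw [← sharp_covMat, Commute, SemiconjBy, ← sharp_mul, ← sharp_mul,
    (commute_inverse (hM ν d) (h.commute hg ν d x)).eq]

end ExtStar

/-! ### Tensor products of two algebras given by generators and relations -/

section TensorQuot

variable {X : Type} {r₁ r₂ : FreeAlgebra ℂ X → FreeAlgebra ℂ X → Prop}

variable (r₁ r₂) in
/-- The generators of the first factor. -/
def tensorGenL (x : X) : RingQuot r₁ ⊗[ℂ] RingQuot r₂ :=
  Algebra.TensorProduct.includeLeft (S := ℂ) (RingQuot.mkAlgHom ℂ r₁ (FreeAlgebra.ι ℂ x))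

variable (r₁ r₂) in
/-- The generators of the second factor. -/
def tensorGenR (x : X) : RingQuot r₁ ⊗[ℂ] RingQuot r₂ :=
  Algebra.TensorProduct.includeRight (RingQuot.mkAlgHom ℂ r₂ (FreeAlgebra.ι ℂ x))

/-- A property of images that defines a subalgebra need only be checked on generators. -/
lemma ringQuot_induction {C : Type} [Semiring C] [Algebra ℂ C] (f : RingQuot r₁ →ₐ[ℂ] C)
    (S : Subalgebra ℂ C) (h : ∀ x, f (RingQuot.mkAlgHom ℂ r₁ (FreeAlgebra.ι ℂ x)) ∈ S)
    (a : RingQuot r₁) : f a ∈ S := by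
  obtain ⟨a, rfl⟩ := RingQuot.mkAlgHom_surjective ℂ r₁ a
  induction a with
  | grade0 c => rw [AlgHom.commutes, AlgHom.commutes]; exact S.algebraMap_mem c
  | grade1 x => exact h x
  | mul a b ha hb => rw [map_mul, map_mul]; exact S.mul_mem ha hb
  | add a b ha hb => rw [map_add, map_add]; exact S.add_mem ha hb

lemma tensorQuot_induction (S : Subalgebra ℂ (RingQuot r₁ ⊗[ℂ] RingQuot r₂))
    (h₁ : ∀ x, tensorGenL r₁ r₂ x ∈ S) (h₂ : ∀ x, tensorGenR r₁ r₂ x ∈ S)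
    (a : RingQuot r₁ ⊗[ℂ] RingQuot r₂) : a ∈ S := by
  induction a using TensorProduct.induction_on with
  | zero => exact S.zero_mem
  | add a b ha hb => exact S.add_mem ha hb
  | tmul a b =>
    have : a ⊗ₜ[ℂ] b = Algebra.TensorProduct.includeLeft (S := ℂ) a *
        Algebra.TensorProduct.includeRight b := by simp
    rw [this]
    exact S.mul_mem (ringQuot_induction _ S h₁ a)
      (ringQuot_induction _ S h₂ b)

variable {C : Type} [Ring C] [Algebra ℂ C]

/-- The centralizer is a subalgebra, so commutation extends from the generators in one argument at a
time. -/
lemma commute_ringQuot_lift (v₁ v₂ : X → C)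
    (h₁ : ∀ x y, r₁ x y → FreeAlgebra.lift ℂ v₁ x = FreeAlgebra.lift ℂ v₁ y)
    (h₂ : ∀ x y, r₂ x y → FreeAlgebra.lift ℂ v₂ x = FreeAlgebra.lift ℂ v₂ y)
    (hc : ∀ x y, Commute (v₁ x) (v₂ y)) (a : RingQuot r₁) (b : RingQuot r₂) :
    Commute (RingQuot.liftAlgHom ℂ ⟨FreeAlgebra.lift ℂ v₁, fun {x y} => h₁ x y⟩ a)
      (RingQuot.liftAlgHom ℂ ⟨FreeAlgebra.lift ℂ v₂, fun {x y} => h₂ x y⟩ b) := by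
  have key : ∀ x b, Commute (v₁ x) (RingQuot.liftAlgHom ℂ
      ⟨FreeAlgebra.lift ℂ v₂, fun {x y} => h₂ x y⟩ b) := fun x b =>
    (Subalgebra.mem_centralizer_iff ℂ).mp (ringQuot_induction _
      (Subalgebra.centralizer ℂ {v₁ x}) (fun y => (Subalgebra.mem_centralizer_iff ℂ).mpr (by
        rintro _ rfl
        rw [RingQuot.liftAlgHom_mkAlgHom_apply, FreeAlgebra.lift_ι_apply]
        exact (hc x y).eq)) b) _ rfl
  have := (Subalgebra.mem_centralizer_iff ℂ).mp (ringQuot_induction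
    (RingQuot.liftAlgHom ℂ ⟨FreeAlgebra.lift ℂ v₁, fun {x y} => h₁ x y⟩)
      (Subalgebra.centralizer ℂ {RingQuot.liftAlgHom ℂ
      ⟨FreeAlgebra.lift ℂ v₂, fun {x y} => h₂ x y⟩ b})
      (fun x => (Subalgebra.mem_centralizer_iff ℂ).mpr (by
        rintro _ rfl
        rw [RingQuot.liftAlgHom_mkAlgHom_apply, FreeAlgebra.lift_ι_apply]
        exact (key x b).symm.eq)) a) _ rfl
  exact this.symm

/-- A pair of commuting families that satisfy the relations defines a homomorphism. -/
def tensorQuotLift (v₁ v₂ : X → C)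
    (h₁ : ∀ x y, r₁ x y → FreeAlgebra.lift ℂ v₁ x = FreeAlgebra.lift ℂ v₁ y)
    (h₂ : ∀ x y, r₂ x y → FreeAlgebra.lift ℂ v₂ x = FreeAlgebra.lift ℂ v₂ y)
    (hc : ∀ x y, Commute (v₁ x) (v₂ y)) : RingQuot r₁ ⊗[ℂ] RingQuot r₂ →ₐ[ℂ] C :=
  Algebra.TensorProduct.lift
    (RingQuot.liftAlgHom ℂ ⟨FreeAlgebra.lift ℂ v₁, fun {x y} => h₁ x y⟩)
    (RingQuot.liftAlgHom ℂ ⟨FreeAlgebra.lift ℂ v₂, fun {x y} => h₂ x y⟩)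
    (commute_ringQuot_lift v₁ v₂ h₁ h₂ hc)

variable (v₁ v₂ : X → C)
    (h₁ : ∀ x y, r₁ x y → FreeAlgebra.lift ℂ v₁ x = FreeAlgebra.lift ℂ v₁ y)
    (h₂ : ∀ x y, r₂ x y → FreeAlgebra.lift ℂ v₂ x = FreeAlgebra.lift ℂ v₂ y)
    (hc : ∀ x y, Commute (v₁ x) (v₂ y))

@[simp] lemma tensorQuotLift_genL (x : X) :
    tensorQuotLift v₁ v₂ h₁ h₂ hc (tensorGenL r₁ r₂ x) = v₁ x := by
  rw [tensorQuotLift, tensorGenL, Algebra.TensorProduct.includeLeft_apply,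
    Algebra.TensorProduct.lift_tmul, map_one, mul_one, RingQuot.liftAlgHom_mkAlgHom_apply,
    FreeAlgebra.lift_ι_apply]

@[simp] lemma tensorQuotLift_genR (x : X) :
    tensorQuotLift v₁ v₂ h₁ h₂ hc (tensorGenR r₁ r₂ x) = v₂ x := by
  rw [tensorQuotLift, tensorGenR, Algebra.TensorProduct.includeRight_apply,
    Algebra.TensorProduct.lift_tmul, map_one, one_mul, RingQuot.liftAlgHom_mkAlgHom_apply,
    FreeAlgebra.lift_ι_apply]

lemma commute_tensorGen (x y : X) : Commute (tensorGenL r₁ r₂ x) (tensorGenR r₁ r₂ y) := by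
  simp [tensorGenL, tensorGenR, Commute, SemiconjBy]

end TensorQuot

/-! ### Star structures from homomorphisms to the conjugate opposite algebra -/

section StarOf

variable {B : Type} [Ring B] [Algebra ℂ B]

/-- The antilinear antimultiplicative map defined by a homomorphism to `ConjOp B`. -/
def starOf (φ : B →ₐ[ℂ] ConjOp B) (a : B) : B := ofC (φ a)

lemma starOf_add (φ : B →ₐ[ℂ] ConjOp B) (x y : B) : starOf φ (x + y) = starOf φ x + starOf φ y := by
  rw [starOf, map_add, ofC_add]; rfl

lemma starOf_mul (φ : B →ₐ[ℂ] ConjOp B) (x y : B) : starOf φ (x * y) = starOf φ y * starOf φ x := by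
  rw [starOf, map_mul, ofC_mul]; rfl

lemma starOf_smul (φ : B →ₐ[ℂ] ConjOp B) (c : ℂ) (x : B) :
    starOf φ (c • x) = conj c • starOf φ x := by
  rw [starOf, map_smul, ofC_smul]; rfl

lemma starOf_one (φ : B →ₐ[ℂ] ConjOp B) : starOf φ 1 = 1 := by
  rw [starOf, map_one, ofC_one]

/-- The fixed points of the square of `starOf φ`. -/
def starOfFixed (φ : B →ₐ[ℂ] ConjOp B) : Subalgebra ℂ B where
  carrier := {a | starOf φ (starOf φ a) = a}
  mul_mem' {a b} ha hb := by
    rw [Set.mem_setOf_eq] at *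
    rw [starOf_mul, starOf_mul, ha, hb]
  add_mem' {a b} ha hb := by
    rw [Set.mem_setOf_eq] at *
    rw [starOf_add, starOf_add, ha, hb]
  algebraMap_mem' c := by
    rw [Set.mem_setOf_eq, Algebra.algebraMap_eq_smul_one, starOf_smul, starOf_one, starOf_smul,
      starOf_one, Complex.conj_conj]

lemma isStar_starOf {φ : B →ₐ[ℂ] ConjOp B} (h : ∀ a, a ∈ starOfFixed φ) : IsStar (starOf φ) where
  add := starOf_add φ
  smul := starOf_smul φ
  mul := starOf_mul φ
  invol := h

/-- The conjugate transpose with respect to `starOf φ`. -/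
def matStar (φ : B →ₐ[ℂ] ConjOp B) {n : Type} (P : Matrix n n B) : Matrix n n B :=
  Matrix.of fun j i => starOf φ (P i j)

lemma matStar_mul (φ : B →ₐ[ℂ] ConjOp B) {n : Type} [Fintype n] (P P' : Matrix n n B) :
    matStar φ (P * P') = matStar φ P' * matStar φ P := by
  have hs : ∀ (s : Finset n) (f : n → B), starOf φ (∑ i ∈ s, f i) = ∑ i ∈ s, starOf φ (f i) := by
    intro s f
    exact map_sum (⟨⟨starOf φ, by rw [starOf, map_zero]; rfl⟩, starOf_add φ⟩ : B →+ B) f s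
  ext i j
  simp only [matStar, Matrix.of_apply, Matrix.mul_apply, hs, starOf_mul]

lemma matStar_one (φ : B →ₐ[ℂ] ConjOp B) {n : Type} [DecidableEq n] :
    matStar φ (1 : Matrix n n B) = 1 := by
  have h0 : starOf φ 0 = 0 := by rw [starOf, map_zero]; rfl
  ext i j
  by_cases h : i = j
  · subst h
    simp [matStar, starOf_one]
  · simp [matStar, Matrix.one_apply, h, Ne.symm h, h0]

lemma matStar_inverse (φ : B →ₐ[ℂ] ConjOp B) {n : Type} [Fintype n] [DecidableEq n]
    {P P' : Matrix n n B} (hP : IsUnit P) (h : matStar φ P = Ring.inverse P') (hP' : IsUnit P') :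
    matStar φ (Ring.inverse P) = P' := by
  have h1 : matStar φ (Ring.inverse P) * Ring.inverse P' = 1 := by
    rw [← h, ← matStar_mul, Ring.mul_inverse_cancel _ hP, matStar_one]
  rw [← mul_one (matStar φ _), ← Ring.inverse_mul_cancel _ hP', ← mul_assoc, h1, one_mul]

/-- The elements whose image under `starOf φ` is the adjoint. -/
def adjointSubalgebra (p : Level) {m : ℕ} (D : B →ₐ[ℂ] Module.End ℂ (Dom p m))
    (φ : B →ₐ[ℂ] ConjOp B)
    (h : StarRel fun P P' : Module.End ℂ (Dom p m) => ∀ f g, ip p (P f) g = ip p f (P' g)) :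
    Subalgebra ℂ B where
  carrier := {a | ∀ f g, ip p (D a f) g = ip p f (D (starOf φ a) g)}
  mul_mem' {a b} ha hb := by
    rw [Set.mem_setOf_eq, starOf_mul, map_mul, map_mul]
    exact h.mul ha hb
  add_mem' {a b} ha hb := by
    rw [Set.mem_setOf_eq, starOf_add, map_add, map_add]
    exact h.add ha hb
  algebraMap_mem' c := by
    rw [Set.mem_setOf_eq, Algebra.algebraMap_eq_smul_one, starOf_smul, starOf_one, map_smul,
      map_smul, map_one]
    exact h.smul c h.one

/-- The elements that leave `EvenDom` invariant. -/
def evenSubalgebra (p : Level) {m : ℕ} (D : B →ₐ[ℂ] Module.End ℂ (Dom p m)) : Subalgebra ℂ B where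
  carrier := {a | ∀ f ∈ EvenDom p m, D a f ∈ EvenDom p m}
  mul_mem' {a b} ha hb f hf := by
    rw [map_mul]
    exact ha _ (hb _ hf)
  add_mem' {a b} ha hb f hf := by
    rw [map_add]
    exact (EvenDom p m).add_mem (ha _ hf) (hb _ hf)
  algebraMap_mem' c f hf := by
    rw [AlgHom.commutes]
    exact (EvenDom p m).smul_mem c hf

end StarOf

/-! ### The star structures of the graph algebra and of the extended graph algebra -/

section Naturality

variable {A B : Type} [Ring A] [Algebra ℂ A] [Ring B] [Algebra ℂ B]

lemma map_gaugeAct (f : A →ₐ[ℂ] B) (p : Level) (σ : Sector) (d : ℕ)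
    (M : Matrix (Fin (d + 1)) (Fin (d + 1)) A) (x : UGen) :
    (gaugeAct p σ d M x).map f = gaugeAct p σ d (M.map f) x := by
  cases x <;> simp only [gaugeAct, Matrix.map_mul, map_cmat, Matrix.map_add _ (map_add f)]

lemma CrossRel.map (f : A →ₐ[ℂ] B) {p : Level} {σ : Sector} {m : ℕ}
    {M : Fin m → ∀ d : ℕ, Matrix (Fin (d + 1)) (Fin (d + 1)) A} {g : UGen → A} {x y : A}
    (h : CrossRel p σ M g x y) :
    CrossRel p σ (fun ν d => (M ν d).map f) (fun t => f (g t)) (f x) (f y) := by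
  have hg : ∀ ν d x i j, f (gaugeAct p σ d (M ν d) x i j) =
      gaugeAct p σ d ((M ν d).map f) x i j := fun ν d x i j => by
    rw [← map_gaugeAct]; rfl
  cases h with
  | E ν d i j =>
    rw [map_mul, map_add, map_mul, map_mul, hg]
    exact CrossRel.E (M := fun ν d => (M ν d).map f) (g := fun t => f (g t)) ν d i j
  | F ν d i j =>
    rw [map_mul, map_add, map_mul, hg, hg]
    exact CrossRel.F (M := fun ν d => (M ν d).map f) (g := fun t => f (g t)) ν d i j
  | K ν d i j =>
    rw [map_mul, map_mul, hg]
    exact CrossRel.K (M := fun ν d => (M ν d).map f) (g := fun t => f (g t)) ν d i j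
  | Kinv ν d i j =>
    rw [map_mul, map_mul, hg]
    exact CrossRel.Kinv (M := fun ν d => (M ν d).map f) (g := fun t => f (g t)) ν d i j

/-- The images of the free generators of the graph algebra. -/
def graphVal {m : ℕ} (M : Fin m → ∀ d : ℕ, Matrix (Fin (d + 1)) (Fin (d + 1)) B)
    (x : GraphGen m) : B :=
  M x.hole x.d x.row x.col

/-- The images of the free generators of the extended graph algebra. -/
def extVal {m : ℕ} (M : Fin m → ∀ d : ℕ, Matrix (Fin (d + 1)) (Fin (d + 1)) B) (g : UGen → B) :
    GraphGen m ⊕ UGen → B :=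
  Sum.elim (graphVal M) g

variable {p : Level} {σ : Sector} {m : ℕ}
  {M : Fin m → ∀ d : ℕ, Matrix (Fin (d + 1)) (Fin (d + 1)) B} {g : UGen → B}

lemma graphVal_rel (h : GraphHolds p σ M) (x y : FreeAlgebra ℂ (GraphGen m))
    (hxy : GraphRel p σ (freeM m) x y) :
    FreeAlgebra.lift ℂ (graphVal M) x = FreeAlgebra.lift ℂ (graphVal M) y := by
  have := GraphRel.map (FreeAlgebra.lift ℂ (graphVal M)) hxy
  have hM : (fun ν d => (freeM m ν d).map (FreeAlgebra.lift ℂ (graphVal M))) = M := by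
    funext ν d
    ext i j
    simp [freeM, graphVal]
  rw [hM] at this
  exact h _ _ this

lemma extVal_rel (h : GraphHolds p σ M) (hg : UHolds p σ g) (hc : CrossHolds p σ M g)
    (x y : FreeAlgebra ℂ (GraphGen m ⊕ UGen))
    (hxy : ExtRel p σ (freeExtM m) (fun x => FreeAlgebra.ι ℂ (Sum.inr x)) x y) :
    FreeAlgebra.lift ℂ (extVal M g) x = FreeAlgebra.lift ℂ (extVal M g) y := by
  have hM : (fun ν d => (freeExtM m ν d).map (FreeAlgebra.lift ℂ (extVal M g))) = M := by
    funext ν d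
    ext i j
    simp [freeExtM, extVal, graphVal]
  have hG : (fun x => FreeAlgebra.lift ℂ (extVal M g) (FreeAlgebra.ι ℂ (Sum.inr x))) = g := by
    funext x
    simp [extVal]
  cases hxy with
  | graph hxy =>
    have := GraphRel.map (FreeAlgebra.lift ℂ (extVal M g)) hxy
    rw [hM] at this
    exact h _ _ this
  | u hxy =>
    have := URel.map (FreeAlgebra.lift ℂ (extVal M g)) hxy
    rw [hG] at this
    exact hg _ _ this
  | cross hxy =>
    have := CrossRel.map (FreeAlgebra.lift ℂ (extVal M g)) hxy
    rw [hM, hG] at this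
    exact hc _ _ this

end Naturality

lemma Sector.ne_swap (σ : Sector) : σ ≠ σ.swap := by cases σ <;> simp [Sector.swap]

lemma commute_inverse_entry {B n : Type} [Ring B] [Algebra ℂ B] [Fintype n] [DecidableEq n]
    {P : Matrix n n B} (hP : IsUnit P) {a : B} (ha : ∀ i j, Commute a (P i j)) (i j) :
    Commute a (Ring.inverse P i j) :=
  commute_apply_of_commute_scalarHom (commute_inverse hP (commute_scalarHom ha).symm).symm i j

lemma commute_inverse_apply {B n n' : Type} [Ring B] [Algebra ℂ B] [Fintype n] [DecidableEq n]
    [Fintype n'] [DecidableEq n'] {P : Matrix n n B} {P' : Matrix n' n' B} (hP : IsUnit P)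
    (hP' : IsUnit P') (h : ∀ i j k l, Commute (P i j) (P' k l)) (i j k l) :
    Commute (Ring.inverse P i j) (Ring.inverse P' k l) :=
  commute_inverse_entry hP'
    (fun k l => (commute_inverse_entry hP (fun i j => (h i j k l).symm) i j).symm) k l

/-! ### Relations transported along homomorphisms -/

section OfMap

variable {A B : Type} [Ring A] [Algebra ℂ A] [Ring B] [Algebra ℂ B] {p : Level} {σ : Sector}
  {m : ℕ} {M : Fin m → ∀ d : ℕ, Matrix (Fin (d + 1)) (Fin (d + 1)) A} {g : UGen → A}

lemma GraphHolds.of_map (f : A →ₐ[ℂ] B) (h : ∀ x y, GraphRel p σ M x y → f x = f y) :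
    GraphHolds p σ fun ν d => (M ν d).map f := by
  intro x y hxy
  cases hxy with
  | one ν i j =>
    have := h _ _ (GraphRel.one ν i j)
    rw [← Matrix.map_apply (M := (1 : Matrix (Fin (0 + 1)) (Fin (0 + 1)) A)) (f := f),
      Matrix.map_one f (map_zero f) (map_one f)] at this
    exact this
  | product ν d e C a c =>
    rw [← map_loopProd, ← map_cgSum]
    exact h _ _ (GraphRel.product ν d e C a c)
  | exchange ν μ hνμ d e a c =>
    rw [← map_loopProd, ← map_loopProdExch]
    exact h _ _ (GraphRel.exchange ν μ hνμ d e a c)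

lemma UHolds.of_map (f : A →ₐ[ℂ] B) (h : ∀ x y, URel p σ g x y → f x = f y) :
    UHolds p σ fun x => f (g x) := by
  intro x y hxy
  cases hxy with
  | K_Kinv => simpa using h _ _ URel.K_Kinv
  | Kinv_K => simpa using h _ _ URel.Kinv_K
  | K_E => simpa using h _ _ URel.K_E
  | K_F => simpa using h _ _ URel.K_F
  | E_F => simpa using h _ _ URel.E_F

lemma CrossHolds.of_map (f : A →ₐ[ℂ] B) (h : ∀ x y, CrossRel p σ M g x y → f x = f y) :
    CrossHolds p σ (fun ν d => (M ν d).map f) fun x => f (g x) := by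
  intro x y hxy
  cases hxy with
  | E ν d i j => simpa [← map_gaugeAct] using h _ _ (CrossRel.E ν d i j)
  | F ν d i j => simpa [← map_gaugeAct] using h _ _ (CrossRel.F ν d i j)
  | K ν d i j => simpa [← map_gaugeAct] using h _ _ (CrossRel.K ν d i j)
  | Kinv ν d i j => simpa [← map_gaugeAct] using h _ _ (CrossRel.Kinv ν d i j)

end OfMap

/-! ### Star structures on algebras generated by holonomies -/

section AbstractStar

variable {B : Type} [Ring B] [Algebra ℂ B] {p : Level} {m : ℕ}
  {M : ∀ (_ : Sector) (_ : Fin m) (d : ℕ), Matrix (Fin (d + 1)) (Fin (d + 1)) B}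
  {φ : B →ₐ[ℂ] ConjOp B}

lemma commute_sharp_inverse (hM : ∀ σ ν d, IsUnit (M σ ν d))
    (hc : ∀ σ ν μ d e i j k l, Commute (M σ ν d i j) (M (Sector.swap σ) μ e k l))
    (σ : Sector) (ν μ : Fin m) (d e : ℕ) (i j k l) :
    Commute (sharp (Ring.inverse (M σ ν d)) i j)
      (sharp (Ring.inverse (M σ.swap μ e)) k l) :=
  commute_toC (commute_inverse_apply (hM _ _ _) (hM _ _ _)
    (fun i j k l => hc σ ν μ d e i j k l) j i l k)

lemma starOf_holonomy
    (hφ : ∀ σ ν d i j, φ (M σ ν d i j) = sharp (Ring.inverse (M (Sector.swap σ) ν d)) i j)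
    (σ : Sector) (ν : Fin m) (d : ℕ) (i j) :
    starOf φ (M σ ν d i j) = Ring.inverse (M σ.swap ν d) j i :=
  congrArg ofC (hφ σ ν d i j)

lemma isHolonomyStar_starOf (hM : ∀ σ ν d, IsUnit (M σ ν d))
    (hφ : ∀ σ ν d i j, φ (M σ ν d i j) = sharp (Ring.inverse (M (Sector.swap σ) ν d)) i j) :
    IsHolonomyStar M (starOf φ) := by
  intro σ ν d
  have : (Matrix.of fun j i => starOf φ (M σ ν d i j)) = Ring.inverse (M σ.swap ν d) := by
    ext j i
    exact starOf_holonomy hφ σ ν d i j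
  rw [this]
  exact ⟨Ring.inverse_mul_cancel _ (hM _ ν d), Ring.mul_inverse_cancel _ (hM _ ν d)⟩

/-- The first star gives the inverse of the tilded holonomy; by antimultiplicativity the star of
that inverse is inverse to the inverse of the original one. -/
lemma holonomy_mem_starOfFixed (hM : ∀ σ ν d, IsUnit (M σ ν d))
    (hφ : ∀ σ ν d i j, φ (M σ ν d i j) = sharp (Ring.inverse (M (Sector.swap σ) ν d)) i j)
    (σ : Sector) (ν : Fin m) (d : ℕ) (i j) : M σ ν d i j ∈ starOfFixed φ := by
  have := matStar_inverse φ (P := M σ.swap ν d) (P' := M σ ν d) (hM _ ν d) (by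
      ext j i
      rw [matStar, Matrix.of_apply, starOf_holonomy hφ, Sector.swap_swap]) (hM _ ν d)
  have h := congrFun (congrFun this i) j
  rw [matStar, Matrix.of_apply, ← starOf_holonomy hφ] at h
  exact h

lemma map_inverse_apply {C : Type} [Ring C] [Algebra ℂ C] (D : B →ₐ[ℂ] C) {n : Type} [Fintype n]
    [DecidableEq n] {P : Matrix n n B} (hP : IsUnit P) (i j) :
    D (Ring.inverse P i j) = Ring.inverse (P.map D) i j := by
  have h : D.mapMatrix (Ring.inverse P) = Ring.inverse (D.mapMatrix P) := by
    have h1 : D.mapMatrix (Ring.inverse P) * D.mapMatrix P = 1 := by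
      rw [← map_mul, Ring.inverse_mul_cancel _ hP, map_one]
    rw [← mul_one (D.mapMatrix (Ring.inverse P)),
      ← Ring.mul_inverse_cancel _ (hP.map D.mapMatrix), ← mul_assoc, h1, one_mul]
  exact congrFun (congrFun h i) j

/-- Representations preserve matrix inverses, so the abstract inverse in the star is represented by
the inverse operator matrix, which is the adjoint. -/
lemma holonomy_mem_adjointSubalgebra {n : ℕ} (hM : ∀ σ ν d, IsUnit (M σ ν d))
    (hφ : ∀ σ ν d i j, φ (M σ ν d i j) = sharp (Ring.inverse (M (Sector.swap σ) ν d)) i j)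
    {D : B →ₐ[ℂ] Module.End ℂ (Dom p n)}
    (h : StarRel fun P P' : Module.End ℂ (Dom p n) => ∀ f g, ip p (P f) g = ip p f (P' g))
    {T : ∀ (_ : Sector) (_ : Fin m) (d : ℕ),
      Matrix (Fin (d + 1)) (Fin (d + 1)) (Module.End ℂ (Dom p n))}
    (hD : ∀ σ ν d i j, D (M σ ν d i j) = T σ ν d i j)
    (hT : ∀ σ ν d, matRel (fun P P' : Module.End ℂ (Dom p n) => ∀ f g, ip p (P f) g = ip p f (P' g))
      (T σ ν d) (Ring.inverse (T (Sector.swap σ) ν d)))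
    (σ : Sector) (ν : Fin m) (d : ℕ) (i j) : M σ ν d i j ∈ adjointSubalgebra p D φ h := by
  change ∀ f g, ip p (D _ f) g = ip p f (D (starOf φ _) g)
  have h1 : (M σ.swap ν d).map D = T σ.swap ν d :=
    Matrix.ext fun i j => hD σ.swap ν d i j
  have h2 : D (starOf φ (M σ ν d i j)) = Ring.inverse (T σ.swap ν d) j i := by
    rw [starOf_holonomy hφ, ← h1]
    exact map_inverse_apply (C := Module.End ℂ (Dom p n)) D (hM _ _ _) j i
  have h3 := hT σ ν d i j
  rw [← h2, ← hD] at h3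
  exact h3

/-- The star structure of an algebra with the universal property of the graph algebra. -/
theorem exists_graphStar (hG : ∀ σ, GraphHolds p σ (M σ))
    (hc : ∀ σ ν μ d e i j k l, Commute (M σ ν d i j) (M (Sector.swap σ) μ e k l))
    (hgen : ∀ S : Subalgebra ℂ B, (∀ σ ν d i j, M σ ν d i j ∈ S) → ∀ a, a ∈ S)
    (huniv : ∀ N : ∀ (_ : Sector) (_ : Fin m) (d : ℕ),
      Matrix (Fin (d + 1)) (Fin (d + 1)) (ConjOp B), (∀ σ, GraphHolds p σ (N σ)) →
      (∀ σ ν μ d e i j k l, Commute (N σ ν d i j) (N (Sector.swap σ) μ e k l)) →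
      ∃ φ : B →ₐ[ℂ] ConjOp B, ∀ σ ν d i j, φ (M σ ν d i j) = N σ ν d i j) :
    ∃ s : B → B, IsStar s ∧ IsHolonomyStar M s ∧
      ∀ {n : ℕ} (D : B →ₐ[ℂ] Module.End ℂ (Dom p n))
        (T : ∀ (_ : Sector) (_ : Fin m) (d : ℕ),
          Matrix (Fin (d + 1)) (Fin (d + 1)) (Module.End ℂ (Dom p n))),
        (StarRel fun P P' : Module.End ℂ (Dom p n) => ∀ f g, ip p (P f) g = ip p f (P' g)) →
        (∀ σ ν d i j, D (M σ ν d i j) = T σ ν d i j) →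
        (∀ σ ν d, matRel (fun P P' : Module.End ℂ (Dom p n) =>
          ∀ f g, ip p (P f) g = ip p f (P' g)) (T σ ν d) (Ring.inverse (T (Sector.swap σ) ν d))) →
        IsStarRep p D s := by
  have hM : ∀ σ ν d, IsUnit (M σ ν d) := fun σ => (hG σ).isUnit
  -- The candidate star on generators, regarded as a homomorphism into the conjugate opposite
  -- algebra: transposed inverses of the holonomies of the other sector.
  obtain ⟨φ, hφ⟩ := huniv (fun σ ν d => sharp (Ring.inverse (M σ.swap ν d)))
    (fun σ => (hG σ.swap).sharp_inverse) fun σ => commute_sharp_inverse hM hc σ.swap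
  exact ⟨starOf φ, isStar_starOf (hgen _ (holonomy_mem_starOfFixed hM hφ)),
    isHolonomyStar_starOf hM hφ, fun D T h hD hT =>
      hgen _ (holonomy_mem_adjointSubalgebra hM hφ h hD hT)⟩

/-- The star structure of an algebra with the universal property of the extended graph algebra. -/
theorem exists_extStar {γ : Sector → UGen → B} (hG : ∀ σ, GraphHolds p σ (M σ))
    (hU : ∀ σ, UHolds p σ (γ σ)) (hC : ∀ σ, CrossHolds p σ (M σ) (γ σ))
    (hc : ∀ σ ν μ d e i j k l, Commute (M σ ν d i j) (M (Sector.swap σ) μ e k l))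
    (hc' : ∀ σ ν d i j x, Commute (M σ ν d i j) (γ (Sector.swap σ) x))
    (hc'' : ∀ σ x y, Commute (γ σ x) (γ (Sector.swap σ) y))
    (hgen : ∀ S : Subalgebra ℂ B, (∀ σ ν d i j, M σ ν d i j ∈ S) → (∀ σ x, γ σ x ∈ S) →
      ∀ a, a ∈ S)
    (huniv : ∀ (N : ∀ (_ : Sector) (_ : Fin m) (d : ℕ),
      Matrix (Fin (d + 1)) (Fin (d + 1)) (ConjOp B)) (δ : Sector → UGen → ConjOp B),
      (∀ σ, GraphHolds p σ (N σ)) → (∀ σ, UHolds p σ (δ σ)) →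
      (∀ σ, CrossHolds p σ (N σ) (δ σ)) →
      (∀ σ ν μ d e i j k l, Commute (N σ ν d i j) (N (Sector.swap σ) μ e k l)) →
      (∀ σ ν d i j x, Commute (N σ ν d i j) (δ (Sector.swap σ) x)) →
      (∀ σ x y, Commute (δ σ x) (δ (Sector.swap σ) y)) →
      ∃ φ : B →ₐ[ℂ] ConjOp B, (∀ σ ν d i j, φ (M σ ν d i j) = N σ ν d i j) ∧
        ∀ σ x, φ (γ σ x) = δ σ x) :
    ∃ s : B → B, IsStar s ∧ IsHolonomyStar M s ∧ (∀ σ x, s (γ σ x) = γ (Sector.swap σ) x) ∧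
      ∀ {n : ℕ} (D : B →ₐ[ℂ] Module.End ℂ (Dom p n))
        (T : ∀ (_ : Sector) (_ : Fin m) (d : ℕ),
          Matrix (Fin (d + 1)) (Fin (d + 1)) (Module.End ℂ (Dom p n))),
        (StarRel fun P P' : Module.End ℂ (Dom p n) => ∀ f g, ip p (P f) g = ip p f (P' g)) →
        (∀ σ ν d i j, D (M σ ν d i j) = T σ ν d i j) →
        (∀ σ ν d, matRel (fun P P' : Module.End ℂ (Dom p n) =>
          ∀ f g, ip p (P f) g = ip p f (P' g)) (T σ ν d) (Ring.inverse (T (Sector.swap σ) ν d))) →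
        (∀ σ x f g, ip p (D (γ σ x) f) g = ip p f (D (γ (Sector.swap σ) x) g)) →
        IsStarRep p D s := by
  have hM : ∀ σ ν d, IsUnit (M σ ν d) := fun σ => (hG σ).isUnit
  -- As for the graph algebra, with the generators of the quantum group exchanged between the
  -- sectors.
  obtain ⟨φ, hφ, hφg⟩ := huniv (fun σ ν d => sharp (Ring.inverse (M σ.swap ν d)))
    (fun σ x => toC (γ σ.swap x))
    (fun σ => (hG σ.swap).sharp_inverse) (fun σ => (hU σ.swap).sharp)
    (fun σ => (hC σ.swap).sharp_inverse (hM _) (hU _))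
    (fun σ => commute_sharp_inverse hM hc σ.swap)
    (fun σ ν d i j x => (commute_toC (commute_inverse_entry (hM σ.swap ν d)
      (fun i j => (hc' σ.swap ν d i j x).symm) j i)).symm)
    fun σ x y => commute_toC (hc'' σ.swap x y)
  have hs : ∀ σ x, starOf φ (γ σ x) = γ σ.swap x := fun σ x => congrArg ofC (hφg σ x)
  refine ⟨starOf φ, isStar_starOf (hgen _ (holonomy_mem_starOfFixed hM hφ) fun σ x => ?_),
    isHolonomyStar_starOf hM hφ, hs, fun D T h hD hT hγ =>
      hgen (adjointSubalgebra p D φ h) (holonomy_mem_adjointSubalgebra hM hφ h hD hT)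
        fun σ x => ?_⟩
  · change starOf φ (starOf φ _) = _
    rw [hs, hs, Sector.swap_swap]
  · change ∀ f g, ip p (D _ f) g = ip p f (D (starOf φ _) g)
    rw [hs]
    exact hγ σ x

end AbstractStar

/-! ### The star structure of the graph algebra -/

namespace GraphAlg

variable (p : Level) (m : ℕ)

lemma graphHolds (σ : Sector) : GraphHolds p σ (GraphAlg.M p m σ) := by
  cases σ
  · have key : ∀ x y, GraphRel p .holo (freeM m) x y →
        ((Algebra.TensorProduct.includeLeft (S := ℂ)).comp (Graph.mk p .holo m) :
          _ →ₐ[ℂ] GraphAlg p m) x =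
        ((Algebra.TensorProduct.includeLeft (S := ℂ)).comp (Graph.mk p .holo m) :
          _ →ₐ[ℂ] GraphAlg p m) y :=
      fun x y h => congrArg (Algebra.TensorProduct.includeLeft (S := ℂ))
        (RingQuot.mkAlgHom_rel ℂ h)
    exact GraphHolds.of_map (B := GraphAlg p m) (M := freeM m)
      ((Algebra.TensorProduct.includeLeft (S := ℂ)).comp (Graph.mk p .holo m) : _ →ₐ[ℂ] GraphAlg p m) key
  · have key : ∀ x y, GraphRel p .anti (freeM m) x y →
        (Algebra.TensorProduct.includeRight.comp (Graph.mk p .anti m) :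
          _ →ₐ[ℂ] GraphAlg p m) x =
        (Algebra.TensorProduct.includeRight.comp (Graph.mk p .anti m) :
          _ →ₐ[ℂ] GraphAlg p m) y :=
      fun x y h => congrArg Algebra.TensorProduct.includeRight (RingQuot.mkAlgHom_rel ℂ h)
    exact GraphHolds.of_map (B := GraphAlg p m) (M := freeM m)
      (Algebra.TensorProduct.includeRight.comp (Graph.mk p .anti m) : _ →ₐ[ℂ] GraphAlg p m) key

lemma commute_M (σ : Sector) (ν μ : Fin m) (d e : ℕ) (i j k l) :
    Commute (GraphAlg.M p m σ ν d i j) (GraphAlg.M p m σ.swap μ e k l) := by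
  have h : ∀ x y : GraphGen m, Commute
      (tensorGenL (GraphRel p .holo (freeM m)) (GraphRel p .anti (freeM m)) x)
      (tensorGenR (GraphRel p .holo (freeM m)) (GraphRel p .anti (freeM m)) y) := commute_tensorGen
  cases σ
  · exact h ⟨ν, d, i, j⟩ ⟨μ, e, k, l⟩
  · exact (h ⟨μ, e, k, l⟩ ⟨ν, d, i, j⟩).symm

variable {p m}

lemma mem_of_M {S : Subalgebra ℂ (GraphAlg p m)} (h : ∀ σ ν d i j, GraphAlg.M p m σ ν d i j ∈ S)
    (a : GraphAlg p m) : a ∈ S :=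
  tensorQuot_induction S (fun x => h .holo x.hole x.d x.row x.col)
    (fun x => h .anti x.hole x.d x.row x.col) a

section Lift

variable {C : Type} [Ring C] [Algebra ℂ C]
  (N : ∀ (_ : Sector) (_ : Fin m) (d : ℕ), Matrix (Fin (d + 1)) (Fin (d + 1)) C)
  (hG : ∀ σ, GraphHolds p σ (N σ))
  (h1 : ∀ σ ν μ d e i j k l, Commute (N σ ν d i j) (N (Sector.swap σ) μ e k l))

/-- The universal property of the graph algebra. -/
def lift : GraphAlg p m →ₐ[ℂ] C :=
  tensorQuotLift (graphVal (N .holo)) (graphVal (N .anti))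
    (graphVal_rel (hG _)) (graphVal_rel (hG _)) fun _ _ => h1 .holo _ _ _ _ _ _ _ _

lemma lift_M (σ : Sector) (ν : Fin m) (d : ℕ) (i j) :
    lift N hG h1 (GraphAlg.M p m σ ν d i j) = N σ ν d i j := by
  cases σ
  · exact tensorQuotLift_genL _ _ _ _ _ (⟨ν, d, i, j⟩ : GraphGen m)
  · exact tensorQuotLift_genR _ _ _ _ _ (⟨ν, d, i, j⟩ : GraphGen m)

end Lift

variable (p m)

lemma exists_star : ∃ s : GraphAlg p m → GraphAlg p m,
    IsStar s ∧ IsHolonomyStar (GraphAlg.M p m) s ∧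
      ∀ {n : ℕ} (D : GraphAlg p m →ₐ[ℂ] Module.End ℂ (Dom p n))
        (T : ∀ (_ : Sector) (_ : Fin m) (d : ℕ),
          Matrix (Fin (d + 1)) (Fin (d + 1)) (Module.End ℂ (Dom p n))),
        (StarRel fun P P' : Module.End ℂ (Dom p n) => ∀ f g, ip p (P f) g = ip p f (P' g)) →
        (∀ σ ν d i j, D (GraphAlg.M p m σ ν d i j) = T σ ν d i j) →
        (∀ σ ν d, matRel (fun P P' : Module.End ℂ (Dom p n) =>
          ∀ f g, ip p (P f) g = ip p f (P' g)) (T σ ν d) (Ring.inverse (T (Sector.swap σ) ν d))) →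
        IsStarRep p D s :=
  exists_graphStar (graphHolds p m) (commute_M p m) (fun _ => mem_of_M)
    fun N hG h1 => ⟨lift N hG h1, lift_M N hG h1⟩

end GraphAlg

/-! ### The star structure of the extended graph algebra -/

namespace ExtAlg

variable (p : Level) (m : ℕ)

lemma extHolds (σ : Sector) : GraphHolds p σ (ExtAlg.M p m σ) ∧ UHolds p σ (ExtAlg.g p m σ) ∧
    CrossHolds p σ (ExtAlg.M p m σ) (ExtAlg.g p m σ) := by
  cases σ
  · have key : ∀ x y, ExtRel p .holo (freeExtM m)
        (fun x => FreeAlgebra.ι ℂ (Sum.inr x) : UGen → FreeAlgebra ℂ (GraphGen m ⊕ UGen)) x y →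
        ((Algebra.TensorProduct.includeLeft (S := ℂ)).comp (Ext.mk p .holo m) :
          _ →ₐ[ℂ] ExtAlg p m) x =
        ((Algebra.TensorProduct.includeLeft (S := ℂ)).comp (Ext.mk p .holo m) :
          _ →ₐ[ℂ] ExtAlg p m) y :=
      fun x y h => congrArg (Algebra.TensorProduct.includeLeft (S := ℂ))
        (RingQuot.mkAlgHom_rel ℂ h)
    exact ⟨GraphHolds.of_map (B := ExtAlg p m) (M := freeExtM m) _ fun x y h => key x y (.graph h),
      UHolds.of_map (B := ExtAlg p m) (g := fun x => FreeAlgebra.ι ℂ (Sum.inr x)) _ fun x y h => key x y (.u h),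
      CrossHolds.of_map (B := ExtAlg p m) (M := freeExtM m) (g := fun x => FreeAlgebra.ι ℂ (Sum.inr x)) _
        fun x y h => key x y (.cross h)⟩
  · have key : ∀ x y, ExtRel p .anti (freeExtM m)
        (fun x => FreeAlgebra.ι ℂ (Sum.inr x) : UGen → FreeAlgebra ℂ (GraphGen m ⊕ UGen)) x y →
        (Algebra.TensorProduct.includeRight.comp (Ext.mk p .anti m) :
          _ →ₐ[ℂ] ExtAlg p m) x =
        (Algebra.TensorProduct.includeRight.comp (Ext.mk p .anti m) :
          _ →ₐ[ℂ] ExtAlg p m) y :=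
      fun x y h => congrArg Algebra.TensorProduct.includeRight (RingQuot.mkAlgHom_rel ℂ h)
    exact ⟨GraphHolds.of_map (B := ExtAlg p m) (M := freeExtM m) _ fun x y h => key x y (.graph h),
      UHolds.of_map (B := ExtAlg p m) (g := fun x => FreeAlgebra.ι ℂ (Sum.inr x)) _ fun x y h => key x y (.u h),
      CrossHolds.of_map (B := ExtAlg p m) (M := freeExtM m) (g := fun x => FreeAlgebra.ι ℂ (Sum.inr x)) _
        fun x y h => key x y (.cross h)⟩

lemma commute_gen (x y : GraphGen m ⊕ UGen) : Commute
    (tensorGenL (ExtRel p .holo (freeExtM m) fun x => FreeAlgebra.ι ℂ (Sum.inr x))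
      (ExtRel p .anti (freeExtM m) fun x => FreeAlgebra.ι ℂ (Sum.inr x)) x)
    (tensorGenR (ExtRel p .holo (freeExtM m) fun x => FreeAlgebra.ι ℂ (Sum.inr x))
      (ExtRel p .anti (freeExtM m) fun x => FreeAlgebra.ι ℂ (Sum.inr x)) y) :=
  commute_tensorGen x y

lemma commute_M (σ : Sector) (ν μ : Fin m) (d e : ℕ) (i j k l) :
    Commute (ExtAlg.M p m σ ν d i j) (ExtAlg.M p m σ.swap μ e k l) := by
  cases σ
  · exact commute_gen p m (.inl ⟨ν, d, i, j⟩) (.inl ⟨μ, e, k, l⟩)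
  · exact (commute_gen p m (.inl ⟨μ, e, k, l⟩) (.inl ⟨ν, d, i, j⟩)).symm

lemma commute_M_g (σ : Sector) (ν : Fin m) (d : ℕ) (i j) (x : UGen) :
    Commute (ExtAlg.M p m σ ν d i j) (ExtAlg.g p m σ.swap x) := by
  cases σ
  · exact commute_gen p m (.inl ⟨ν, d, i, j⟩) (.inr x)
  · exact (commute_gen p m (.inr x) (.inl ⟨ν, d, i, j⟩)).symm

lemma commute_g_g (σ : Sector) (x y : UGen) :
    Commute (ExtAlg.g p m σ x) (ExtAlg.g p m σ.swap y) := by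
  cases σ
  · exact commute_gen p m (.inr x) (.inr y)
  · exact (commute_gen p m (.inr y) (.inr x)).symm

variable {p m}

lemma mem_of_M_g {S : Subalgebra ℂ (ExtAlg p m)}
    (h : ∀ σ ν d i j, ExtAlg.M p m σ ν d i j ∈ S) (hg : ∀ σ x, ExtAlg.g p m σ x ∈ S)
    (a : ExtAlg p m) : a ∈ S :=
  tensorQuot_induction S
    (fun x => match x with
      | .inl x => h .holo x.hole x.d x.row x.col
      | .inr x => hg .holo x)
    (fun x => match x with
      | .inl x => h .anti x.hole x.d x.row x.col
      | .inr x => hg .anti x) a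

section Lift

variable {C : Type} [Ring C] [Algebra ℂ C]
  (N : ∀ (_ : Sector) (_ : Fin m) (d : ℕ), Matrix (Fin (d + 1)) (Fin (d + 1)) C)
  (γ : Sector → UGen → C)
  (hG : ∀ σ, GraphHolds p σ (N σ)) (hU : ∀ σ, UHolds p σ (γ σ))
  (hC : ∀ σ, CrossHolds p σ (N σ) (γ σ))
  (h1 : ∀ σ ν μ d e i j k l, Commute (N σ ν d i j) (N (Sector.swap σ) μ e k l))
  (h2 : ∀ σ ν d i j x, Commute (N σ ν d i j) (γ (Sector.swap σ) x))
  (h3 : ∀ σ x y, Commute (γ σ x) (γ (Sector.swap σ) y))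

/-- The universal property of the extended graph algebra. -/
def lift : ExtAlg p m →ₐ[ℂ] C :=
  tensorQuotLift (extVal (N .holo) (γ .holo)) (extVal (N .anti) (γ .anti))
    (extVal_rel (hG _) (hU _) (hC _)) (extVal_rel (hG _) (hU _) (hC _))
    fun x y => match x, y with
      | .inl _, .inl _ => h1 .holo _ _ _ _ _ _ _ _
      | .inl _, .inr _ => h2 .holo _ _ _ _ _
      | .inr _, .inl _ => (h2 .anti _ _ _ _ _).symm
      | .inr _, .inr _ => h3 .holo _ _

lemma lift_genL (x : GraphGen m ⊕ UGen) : lift N γ hG hU hC h1 h2 h3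
    (tensorGenL (ExtRel p .holo (freeExtM m) fun x => FreeAlgebra.ι ℂ (Sum.inr x))
      (ExtRel p .anti (freeExtM m) fun x => FreeAlgebra.ι ℂ (Sum.inr x)) x) =
    extVal (N .holo) (γ .holo) x :=
  tensorQuotLift_genL _ _ _ _ _ x

lemma lift_genR (x : GraphGen m ⊕ UGen) : lift N γ hG hU hC h1 h2 h3
    (tensorGenR (ExtRel p .holo (freeExtM m) fun x => FreeAlgebra.ι ℂ (Sum.inr x))
      (ExtRel p .anti (freeExtM m) fun x => FreeAlgebra.ι ℂ (Sum.inr x)) x) =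
    extVal (N .anti) (γ .anti) x :=
  tensorQuotLift_genR _ _ _ _ _ x

lemma lift_M (σ : Sector) (ν : Fin m) (d : ℕ) (i j) :
    lift N γ hG hU hC h1 h2 h3 (ExtAlg.M p m σ ν d i j) = N σ ν d i j := by
  cases σ
  · exact lift_genL N γ hG hU hC h1 h2 h3 (.inl ⟨ν, d, i, j⟩)
  · exact lift_genR N γ hG hU hC h1 h2 h3 (.inl ⟨ν, d, i, j⟩)

lemma lift_g (σ : Sector) (x : UGen) :
    lift N γ hG hU hC h1 h2 h3 (ExtAlg.g p m σ x) = γ σ x := by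
  cases σ
  · exact lift_genL N γ hG hU hC h1 h2 h3 (.inr x)
  · exact lift_genR N γ hG hU hC h1 h2 h3 (.inr x)

end Lift

variable (p m)

lemma exists_star : ∃ s : ExtAlg p m → ExtAlg p m,
    IsStar s ∧ IsHolonomyStar (ExtAlg.M p m) s ∧
      (∀ σ x, s (ExtAlg.g p m σ x) = ExtAlg.g p m (Sector.swap σ) x) ∧
      ∀ {n : ℕ} (D : ExtAlg p m →ₐ[ℂ] Module.End ℂ (Dom p n))
        (T : ∀ (_ : Sector) (_ : Fin m) (d : ℕ),
          Matrix (Fin (d + 1)) (Fin (d + 1)) (Module.End ℂ (Dom p n))),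
        (StarRel fun P P' : Module.End ℂ (Dom p n) => ∀ f g, ip p (P f) g = ip p f (P' g)) →
        (∀ σ ν d i j, D (ExtAlg.M p m σ ν d i j) = T σ ν d i j) →
        (∀ σ ν d, matRel (fun P P' : Module.End ℂ (Dom p n) =>
          ∀ f g, ip p (P f) g = ip p f (P' g)) (T σ ν d) (Ring.inverse (T (Sector.swap σ) ν d))) →
        (∀ σ x f g, ip p (D (ExtAlg.g p m σ x) f) g =
          ip p f (D (ExtAlg.g p m (Sector.swap σ) x) g)) →
        IsStarRep p D s :=
  exists_extStar (fun σ => (extHolds p m σ).1) (fun σ => (extHolds p m σ).2.1)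
    (fun σ => (extHolds p m σ).2.2) (commute_M p m) (commute_M_g p m) (commute_g_g p m)
    (fun _ => mem_of_M_g) fun N δ hG hU hC h1 h2 h3 =>
      ⟨lift N δ hG hU hC h1 h2 h3, lift_M N δ hG hU hC h1 h2 h3, lift_g N δ hG hU hC h1 h2 h3⟩

end ExtAlg

/-! ### The generators of the quantum group -/

section UGenerators

variable {A : Type} [Ring A] [Algebra ℂ A] {p : Level} {σ : Sector} {S T : GenImages A}

lemma Rels.u_holds (hT : Rels (p.Q σ) T) : UHolds p σ (T.u σ) := by
  have hX : T.K * T.K * T.X = p.Q σ ^ 2 • (T.X * (T.K * T.K)) := by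
    rw [mul_assoc, hT.K_X, mul_smul_comm, ← mul_assoc, hT.K_X, smul_mul_assoc, smul_smul,
      mul_assoc, pow_two]
  have hY : T.K * T.K * T.Y = (p.Q σ)⁻¹ ^ 2 • (T.Y * (T.K * T.K)) := by
    rw [mul_assoc, hT.K_Y, mul_smul_comm, ← mul_assoc, hT.K_Y, smul_mul_assoc, smul_smul,
      mul_assoc, pow_two]
  have h1 : T.K * T.K * (T.Kinv * T.Kinv) = 1 := by
    rw [mul_assoc, ← mul_assoc T.K T.Kinv, hT.K_Kinv, one_mul, hT.K_Kinv]
  have h2 : T.Kinv * T.Kinv * (T.K * T.K) = 1 := by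
    rw [mul_assoc, ← mul_assoc T.Kinv T.K, hT.Kinv_K, one_mul, hT.Kinv_K]
  have cK : T.K * T.Kinv = T.Kinv * T.K := by rw [hT.K_Kinv, hT.Kinv_K]
  have h0 := p.Q_sub_inv_ne_zero σ
  have hXY : T.X * T.Y - T.Y * T.X =
      (p.Q σ - (p.Q σ)⁻¹)⁻¹ • (T.K * T.K - T.Kinv * T.Kinv) := by
    rw [← hT.X_Y, smul_smul, inv_mul_cancel₀ h0, one_smul]
  have hQ := p.Q_ne_zero σ
  have cYX : T.K * (T.Y * T.X) = T.Y * T.X * T.K := by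
    rw [← mul_assoc, hT.K_Y, smul_mul_assoc, mul_assoc, hT.K_X, mul_smul_comm, smul_smul,
      inv_mul_cancel₀ hQ, one_smul, mul_assoc]
  have cXY : T.K * (T.X * T.Y) = T.X * T.Y * T.K := by
    rw [← mul_assoc, hT.K_X, smul_mul_assoc, mul_assoc, hT.K_Y, mul_smul_comm, smul_smul,
      mul_inv_cancel₀ hQ, one_smul, mul_assoc]
  intro x y hxy
  cases hxy with
  | K_Kinv => cases σ <;> exact h1
  | Kinv_K => cases σ <;> exact h2
  | K_E =>
    cases σ <;> simp only [GenImages.u]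
    · rw [← mul_assoc, hX, smul_mul_assoc]
      simp only [mul_assoc]
    · rw [← mul_assoc, mul_assoc T.K T.K T.K, mul_assoc T.K (T.K * T.K), hX, mul_smul_comm]
      simp only [mul_assoc]
  | K_F =>
    have e1 : T.K * T.K * T.Kinv = T.Kinv * (T.K * T.K) := by
      rw [mul_assoc, cK, ← mul_assoc, cK, mul_assoc]
    cases σ <;> simp only [GenImages.u]
    · rw [← mul_assoc, e1, mul_assoc, hY, mul_smul_comm]
      simp only [mul_assoc]
    · rw [← mul_assoc, hY, smul_mul_assoc, mul_assoc T.Y, e1]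
      simp only [mul_assoc]
  | E_F =>
    cases σ <;> simp only [GenImages.u]
    · rw [← hXY, mul_assoc T.X, ← mul_assoc T.K, hT.K_Kinv, one_mul, mul_assoc, ← mul_assoc T.Y,
        ← cYX, ← mul_assoc, hT.Kinv_K, one_mul]
    · rw [← hXY, mul_assoc T.Y, ← mul_assoc T.Kinv, hT.Kinv_K, one_mul, ← mul_assoc, mul_assoc T.K,
        cXY, mul_assoc (T.X * T.Y), hT.K_Kinv, mul_one]

lemma u_map {B : Type} [Ring B] [Algebra ℂ B] (f : A →ₐ[ℂ] B) (T : GenImages A) (x : UGen) :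
    (T.map f).u σ x = f (T.u σ x) := by
  cases σ <;> cases x <;> simp [GenImages.u, GenImages.map]

lemma All.u {a : A} (h : T.All (Commute a)) (x : UGen) : Commute a (T.u σ x) := by
  obtain ⟨h1, h2, h3, h4⟩ := h
  cases σ <;> cases x <;> simp only [GenImages.u]
  exacts [h3.mul_right h1, h2.mul_right h4, h1.mul_right h1, h2.mul_right h2,
    h1.mul_right h3, h4.mul_right h2, h1.mul_right h1, h2.mul_right h2]

lemma comm_u {σ' : Sector} (h : S.Comm T) (x y : UGen) : Commute (S.u σ x) (T.u σ' y) :=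
  All.u (All.imp (fun _ h => (All.u h x).symm) h.symm) y

/-- The coproduct of 𝒦, 𝒳, 𝒴 induces the stated coproduct of E, F, K; the different orderings in the
two sectors lead to the same formulas. -/
lemma u_comul (hS : Rels (p.Q σ) S) (hT : Rels (p.Q σ) T) (h : S.Comm T) :
    (S.comul T).u σ .E = S.u σ .E * T.u σ .K + T.u σ .E ∧
    (S.comul T).u σ .F = S.u σ .F + S.u σ .Kinv * T.u σ .F ∧
    (S.comul T).u σ .K = S.u σ .K * T.u σ .K ∧
    (S.comul T).u σ .Kinv = S.u σ .Kinv * T.u σ .Kinv := by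
  obtain ⟨⟨hKK, hKk, hKX, hKY⟩, ⟨hkK, hkk, hkX, hkY⟩, ⟨hXK, hXk, hXX, hXY⟩, ⟨hYK, hYk, hYX, hYY⟩⟩ := h
  have aKK : S.K * T.K * (S.K * T.K) = S.K * S.K * (T.K * T.K) := hKK.symm.mul_mul_mul_comm ..
  have akk : S.Kinv * T.Kinv * (S.Kinv * T.Kinv) = S.Kinv * S.Kinv * (T.Kinv * T.Kinv) :=
    hkk.symm.mul_mul_mul_comm ..
  have aXK : S.X * T.K * (S.K * T.K) = S.X * S.K * (T.K * T.K) := hKK.symm.mul_mul_mul_comm ..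
  have akX : S.Kinv * T.X * (S.K * T.K) = S.Kinv * S.K * (T.X * T.K) :=
    hKX.symm.mul_mul_mul_comm ..
  have aKX : S.K * T.K * (S.X * T.K) = S.K * S.X * (T.K * T.K) := hXK.symm.mul_mul_mul_comm ..
  have aKk : S.K * T.K * (S.Kinv * T.X) = S.K * S.Kinv * (T.K * T.X) :=
    hkK.symm.mul_mul_mul_comm ..
  have bY : S.Kinv * T.Kinv * (S.Y * T.K) = S.Kinv * S.Y * (T.Kinv * T.K) :=
    hYk.symm.mul_mul_mul_comm ..
  have bk : S.Kinv * T.Kinv * (S.Kinv * T.Y) = S.Kinv * S.Kinv * (T.Kinv * T.Y) :=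
    hkk.symm.mul_mul_mul_comm ..
  have cY : S.Y * T.K * (S.Kinv * T.Kinv) = S.Y * S.Kinv * (T.K * T.Kinv) :=
    hkK.symm.mul_mul_mul_comm ..
  have ck : S.Kinv * T.Y * (S.Kinv * T.Kinv) = S.Kinv * S.Kinv * (T.Y * T.Kinv) :=
    hkY.symm.mul_mul_mul_comm ..
  cases σ <;> simp only [GenImages.u, GenImages.comul, mul_add, add_mul]
  · exact ⟨by rw [aXK, akX, hS.Kinv_K, one_mul], by rw [bY, bk, hT.Kinv_K, mul_one], aKK, akk⟩
  · exact ⟨by rw [aKX, aKk, hS.K_Kinv, one_mul], by rw [cY, ck, hT.K_Kinv, mul_one], aKK, akk⟩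

lemma covMat_eq (hT : Rels (p.Q σ) T) (d : ℕ) (x : UGen) :
    covMat p σ d (T.u σ) x = ((rhoLeg p σ d A).comul (scalarLeg _ T)).u σ x := by
  obtain ⟨h1, h2, h3, h4⟩ := u_comul (p := p) (σ := σ) ((rho_rels p σ d).map (cmatHom A _))
    (hT.map (scalarHom A (Fin (d + 1)))) (rhoLeg_comm_scalarLeg ..)
  cases x
  · exact (h1.trans (by rw [u_map, u_map, u_map]; rfl)).symm
  · exact (h2.trans (by rw [u_map, u_map, u_map]; rfl)).symm
  · exact (h3.trans (by rw [u_map, u_map]; rfl)).symm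
  · exact (h4.trans (by rw [u_map, u_map]; rfl)).symm

end UGenerators

/-! ### The representations of the graph algebra and of the extended graph algebra -/

section Representation

variable (p : Level) {m : ℕ} (lam : Fin m → ℂ)

lemma graphHolds_dressedOp (σ : Sector) : GraphHolds p σ (dressedOp p σ lam) :=
  fun _ _ h => graphRel_dressedOp p σ lam h

/-- The semidirect product rules are the gauge covariance of the dressed operators under all the
factors. -/
lemma crossHolds_dressedOp (σ : Sector) :
    CrossHolds p σ (dressedOp p σ lam) ((tensorOps p σ lam m).u σ) :=
  CrossHolds.of_commute fun ν d x => by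
    rw [covMat_eq (tensorOps_rels p σ lam m le_rfl)]
    exact All.u (dressedOp_gauge p σ lam ν d m ν.isLt le_rfl) x

/-- The representation of the extended graph algebra. -/
def extRep : ExtAlg p m →ₐ[ℂ] Module.End ℂ (Dom p m) :=
  ExtAlg.lift (C := Module.End ℂ (Dom p m)) (fun σ => dressedOp p σ lam)
    (fun σ => (tensorOps p σ lam m).u σ)
    (graphHolds_dressedOp p lam) (fun σ => (tensorOps_rels p σ lam m le_rfl).u_holds)
    (crossHolds_dressedOp p lam)
    (fun σ ν μ d e i j k l => commute_dressedOp_dressedOp p σ.ne_swap lam μ ν d e i j k l)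
    (fun σ ν d i j x => All.u (tensorOps_commute p σ.swap lam m le_rfl fun κ _ =>
      siteOps_comm_dressedOp p lam κ ν _ d i j (Or.inr σ.ne_swap)) x)
    (fun σ x y => (comm_u (tensorOps_comm_tensorOps p σ.ne_swap lam m m le_rfl le_rfl) x y))

lemma extRep_M (σ : Sector) (ν : Fin m) (d : ℕ) (i j) :
    extRep p lam (ExtAlg.M p m σ ν d i j) = dressedOp p σ lam ν d i j :=
  ExtAlg.lift_M ..

lemma extRep_g (σ : Sector) (x : UGen) :
    extRep p lam (ExtAlg.g p m σ x) = (tensorOps p σ lam m).u σ x :=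
  ExtAlg.lift_g ..

lemma toExt_M (σ : Sector) (ν : Fin m) (d : ℕ) (i j) :
    GraphAlg.toExt p m (GraphAlg.M p m σ ν d i j) = ExtAlg.M p m σ ν d i j := by
  have h : ∀ σ, Graph.toExt p σ m (Graph.mk p σ m (freeM m ν d i j)) =
      Ext.mk p σ m (freeExtM m ν d i j) := fun σ => by
    rw [Graph.toExt, Graph.mk]
    refine (RingQuot.liftAlgHom_mkAlgHom_apply ..).trans ?_
    simp [freeM, freeExtM]
  cases σ
  · change GraphAlg.toExt p m (_ ⊗ₜ[ℂ] 1) = _ ⊗ₜ[ℂ] 1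
    rw [← h, GraphAlg.toExt, Algebra.TensorProduct.map_tmul, map_one]
  · change GraphAlg.toExt p m (1 ⊗ₜ[ℂ] _) = 1 ⊗ₜ[ℂ] _
    rw [← h, GraphAlg.toExt, Algebra.TensorProduct.map_tmul, map_one]

end Representation

/-! ### Contour shifts -/

section Contour

variable {m : ℕ}

/-- A real vector as a complex vector. -/
def cvec (μ : Fin m → ℝ) : Fin m → ℂ := fun ν => (μ ν : ℂ)

lemma continuous_cvec : Continuous (cvec (m := m)) := by
  unfold cvec
  fun_prop

lemma cvec_add_single (μ : Fin m → ℝ) (ν : Fin m) (x : ℝ) (z : ℂ) :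
    cvec (μ + Pi.single ν x) + Pi.single ν z = cvec μ + Pi.single ν (x + z : ℂ) := by
  funext κ
  by_cases h : κ = ν
  · subst h
    simp [cvec, add_assoc]
  · simp [cvec, h]

/-- The integral over `ℝ^m` is invariant under complex translations. -/
theorem integral_add_single {H : (Fin m → ℂ) → ℂ} (hc : Continuous H) (ν : Fin m)
    (hd : ∀ μ : Fin m → ℝ, Differentiable ℂ fun ζ : ℂ => H (cvec μ + Pi.single ν ζ))
    (hb : ∀ B : ℝ, ∃ C : ℝ≥0, ∀ t : ℝ, |t| ≤ B →
      ∫⁻ μ : Fin m → ℝ, ‖H (cvec μ + Pi.single ν (t * Complex.I))‖ₑ ≤ C) (τ : ℂ) :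
    ∫ μ, H (cvec μ + Pi.single ν τ) = ∫ μ, H (cvec μ) := by
  set Φ : ℝ → ℂ := fun t => ∫ μ, H (cvec μ + Pi.single ν (t * Complex.I)) with hΦ
  -- Real translations leave the integral unchanged, so only the imaginary part of the shift
  -- matters.
  have hshift : ∀ x t : ℝ, ∫ μ, H (cvec μ + Pi.single ν (x + t * Complex.I)) = Φ t := by
    intro x t
    rw [hΦ]
    simp only [← cvec_add_single]
    exact MeasureTheory.integral_add_right_eq_self (μ := MeasureTheory.volume)
      (fun μ => H (cvec μ + Pi.single ν (t * Complex.I))) (Pi.single ν x)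
  have hlshift : ∀ x t : ℝ, ∫⁻ μ, ‖H (cvec μ + Pi.single ν (x + t * Complex.I))‖ₑ =
      ∫⁻ μ, ‖H (cvec μ + Pi.single ν (t * Complex.I))‖ₑ := by
    intro x t
    simp only [← cvec_add_single]
    exact MeasureTheory.lintegral_add_right_eq_self (μ := MeasureTheory.volume)
      (fun μ => ‖H (cvec μ + Pi.single ν (t * Complex.I))‖ₑ) (Pi.single ν x)
  have hcont : ∀ u v : ℝ → ℝ, Continuous u → Continuous v → Continuous fun q : ℝ × (Fin m → ℝ) =>
      H (cvec q.2 + Pi.single ν ((u q.1 : ℂ) + v q.1 * Complex.I)) := by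
    intro u v hu hv
    refine hc.comp ((continuous_cvec.comp continuous_snd).add ?_)
    refine (continuous_single ν).comp ?_
    fun_prop
  -- Fubini on a side of the rectangle; the bound `hb` is uniform over the bounded range of
  -- imaginary parts.
  have hswap : ∀ u v : ℝ → ℝ, Continuous u → Continuous v → ∀ a b : ℝ,
      ∫ μ, ∫ r in a..b, H (cvec μ + Pi.single ν ((u r : ℂ) + v r * Complex.I)) =
        ∫ r in a..b, Φ (v r) ∧
      MeasureTheory.Integrable
        fun μ => ∫ r in a..b, H (cvec μ + Pi.single ν ((u r : ℂ) + v r * Complex.I)) := by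
    intro u v hu hv a b
    obtain ⟨B, hB⟩ : ∃ B, ∀ r ∈ Set.uIcc a b, |v r| ≤ B := by
      obtain ⟨B, hB⟩ := (isCompact_uIcc (a := a) (b := b)).exists_bound_of_continuousOn
        hv.continuousOn
      exact ⟨B, hB⟩
    obtain ⟨C, hC⟩ := hb B
    have hint : MeasureTheory.Integrable (Function.uncurry fun (r : ℝ) (μ : Fin m → ℝ) =>
        H (cvec μ + Pi.single ν ((u r : ℂ) + v r * Complex.I)))
        ((MeasureTheory.volume.restrict (Set.uIoc a b)).prod MeasureTheory.volume) := by
      have hm : Continuous (Function.uncurry fun (r : ℝ) (μ : Fin m → ℝ) =>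
        H (cvec μ + Pi.single ν ((u r : ℂ) + v r * Complex.I))) := hcont u v hu hv
      refine ⟨hm.aestronglyMeasurable, ?_⟩
      rw [MeasureTheory.hasFiniteIntegral_iff_enorm,
        MeasureTheory.lintegral_prod _ hm.enorm.measurable.aemeasurable]
      calc _ ≤ ∫⁻ r in Set.uIoc a b, (C : ℝ≥0∞) := by
            refine MeasureTheory.setLIntegral_mono measurable_const fun r hr => ?_
            simp only [Function.uncurry]
            rw [hlshift]
            exact hC _ (hB r (Set.uIoc_subset_uIcc hr))
        _ < ⊤ := by
            rw [MeasureTheory.setLIntegral_const]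
            exact ENNReal.mul_lt_top ENNReal.coe_lt_top (by simp [Set.uIoc])
    refine ⟨?_, ?_⟩
    · rw [← MeasureTheory.intervalIntegral_integral_swap hint]
      simp only [hshift]
    · have := hint.swap.integral_prod_left
      simp only [intervalIntegral.intervalIntegral_eq_integral_uIoc]
      exact this.smul _
  -- Apply Cauchy's theorem to a rectangle of width 1 over every μ and integrate over μ. The
  -- vertical sides cancel because their integrals differ by a real translation, and each horizontal
  -- side yields Φ averaged over an interval of length 1. No pointwise decay is needed.
  have key : Φ 0 = Φ τ.im := by
    have hrect : ∀ μ : Fin m → ℝ,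
        (∫ x in (0 : ℝ)..1, H (cvec μ + Pi.single ν ((x : ℂ) + (0 : ℝ) * Complex.I))) -
        (∫ x in (0 : ℝ)..1, H (cvec μ + Pi.single ν ((x : ℂ) + τ.im * Complex.I))) +
        Complex.I • (∫ y in (0 : ℝ)..τ.im, H (cvec μ + Pi.single ν (((1 : ℝ) : ℂ) + y * Complex.I))) -
        Complex.I • (∫ y in (0 : ℝ)..τ.im,
          H (cvec μ + Pi.single ν (((0 : ℝ) : ℂ) + y * Complex.I))) = 0 := by
      intro μ
      have := Complex.integral_boundary_rect_eq_zero_of_differentiableOn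
        (fun ζ : ℂ => H (cvec μ + Pi.single ν ζ)) 0 (1 + τ.im * Complex.I)
        (hd μ).differentiableOn
      simpa using this
    obtain ⟨e1, i1⟩ := hswap (fun x => x) (fun _ => 0) continuous_id continuous_const 0 1
    obtain ⟨e2, i2⟩ := hswap (fun x => x) (fun _ => τ.im) continuous_id continuous_const 0 1
    obtain ⟨e3, i3⟩ := hswap (fun _ => 1) (fun y => y) continuous_const continuous_id 0 τ.im
    obtain ⟨e4, i4⟩ := hswap (fun _ => 0) (fun y => y) continuous_const continuous_id 0 τ.im
    have h0 := MeasureTheory.integral_congr_ae (μ := MeasureTheory.volume)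
      (Filter.Eventually.of_forall hrect)
    have h1 := MeasureTheory.integral_sub' ((i1.sub i2).add (i3.smul Complex.I))
      (i4.smul Complex.I)
    rw [MeasureTheory.integral_add' (i1.sub i2) (i3.smul Complex.I),
      MeasureTheory.integral_sub' i1 i2] at h1
    have h2 := h1.symm.trans h0
    simp only [Pi.smul_apply, MeasureTheory.integral_smul, e1, e2, e3, e4] at h2
    simp at h2
    exact sub_eq_zero.mp h2
  have hτ := hshift τ.re τ.im
  rw [Complex.re_add_im] at hτ
  rw [hτ, ← key, hΦ]
  simp

end Contour

/-! ### The inner product on the common domain -/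

section InnerProduct

variable {p : Level} {m : ℕ}

/-- Being formally adjoint on the common domain. -/
def Adj (p : Level) {m : ℕ} (P P' : Module.End ℂ (Dom p m)) : Prop :=
  ∀ f g, ip p (P f) g = ip p f (P' g)

lemma Dom.continuous (f : Dom p m) (s) : Continuous fun z => f.1 z s := (f.2 s).1.continuous

lemma Dom.lintegral_sq_le (f : Dom p m) (s) (ν : Fin m) (B : ℝ) : ∃ C : ℝ≥0, ∀ t : ℝ, |t| ≤ B →
    ∫⁻ μ : Fin m → ℝ, ‖f.1 (cvec μ + Pi.single ν (t * Complex.I)) s‖ₑ ^ 2 ≤ C := by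
  obtain ⟨C, hC⟩ := (f.2 s).2 0 B
  refine ⟨C, fun t ht => ?_⟩
  convert! hC (Pi.single ν t) (fun κ => ?_) using 4 with μ
  · simp only [weighted, Pi.zero_apply, Complex.ofReal_zero, zero_mul, Finset.sum_const_zero,
      Complex.exp_zero, one_mul]
    refine congrArg (fun z => ‖f.1 z s‖ₑ) ?_
    funext κ
    by_cases h : κ = ν
    · subst h; simp [cvec]
    · simp [cvec, h]
  · by_cases h : κ = ν
    · subst h; simpa using ht
    · simpa [h] using (abs_nonneg t).trans ht

lemma Dom.lintegral_sq_lt_top (f : Dom p m) (s) :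
    ∫⁻ μ : Fin m → ℝ, ‖f.1 (cvec μ) s‖ₑ ^ 2 < ⊤ := by
  obtain ⟨C, hC⟩ := (f.2 s).2 0 0
  refine lt_of_le_of_lt ?_ (ENNReal.coe_lt_top (r := C))
  convert! hC 0 (fun κ => by simp) using 4 with μ
  simp [weighted]
  rfl

lemma enorm_mul_le_sq (x y : ℂ) : ‖x * y‖ₑ ≤ ‖x‖ₑ ^ 2 + ‖y‖ₑ ^ 2 := by
  have h : ‖x * y‖₊ ≤ ‖x‖₊ ^ 2 + ‖y‖₊ ^ 2 := by
    rw [← NNReal.coe_le_coe]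
    push_cast
    rw [norm_mul]
    nlinarith [norm_nonneg x, norm_nonneg y, sq_nonneg (‖x‖ - ‖y‖)]
  simp only [enorm_eq_nnnorm]
  exact_mod_cast h

lemma enorm_conj (x : ℂ) : ‖conj x‖ₑ = ‖x‖ₑ := by
  simp [enorm_eq_nnnorm]

/-- The inner product is additive only because these integrals converge; the integral of a
non-integrable function would be 0. -/
lemma Dom.integrable_conj_mul (f g : Dom p m) (s s') :
    MeasureTheory.Integrable fun μ : Fin m → ℝ => conj (f.1 (cvec μ) s) * g.1 (cvec μ) s' := by
  have h1 : Continuous fun μ : Fin m → ℝ => f.1 (cvec μ) s := (Dom.continuous f s).comp continuous_cvec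
  have h2 : Continuous fun μ : Fin m → ℝ => g.1 (cvec μ) s' :=
    (Dom.continuous g s').comp continuous_cvec
  refine ⟨((Complex.continuous_conj.comp h1).mul h2).aestronglyMeasurable, ?_⟩
  rw [MeasureTheory.hasFiniteIntegral_iff_enorm]
  calc _ ≤ ∫⁻ μ : Fin m → ℝ, (‖f.1 (cvec μ) s‖ₑ ^ 2 + ‖g.1 (cvec μ) s'‖ₑ ^ 2) :=
        MeasureTheory.lintegral_mono fun μ => by
          have := enorm_mul_le_sq (conj (f.1 (cvec μ) s)) (g.1 (cvec μ) s')
          rwa [enorm_conj] at this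
    _ < ⊤ := by
        rw [MeasureTheory.lintegral_add_left (h1.enorm.measurable.pow_const 2)]
        exact ENNReal.add_lt_top.mpr ⟨Dom.lintegral_sq_lt_top f s, Dom.lintegral_sq_lt_top g s'⟩

lemma ip_add_left (f f' g : Dom p m) : ip p (f + f') g = ip p f g + ip p f' g := by
  rw [ip, ip, ip, ← Finset.sum_add_distrib]
  refine Finset.sum_congr rfl fun s _ => ?_
  refine Eq.trans ?_ (MeasureTheory.integral_add (Dom.integrable_conj_mul f g s s) (Dom.integrable_conj_mul f' g s s))
  refine MeasureTheory.integral_congr_ae (Filter.Eventually.of_forall fun μ => ?_)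
  simp [cvec, add_mul]

lemma ip_add_right (f g g' : Dom p m) : ip p f (g + g') = ip p f g + ip p f g' := by
  rw [ip, ip, ip, ← Finset.sum_add_distrib]
  refine Finset.sum_congr rfl fun s _ => ?_
  refine Eq.trans ?_ (MeasureTheory.integral_add (Dom.integrable_conj_mul f g s s) (Dom.integrable_conj_mul f g' s s))
  refine MeasureTheory.integral_congr_ae (Filter.Eventually.of_forall fun μ => ?_)
  simp [cvec, mul_add]

lemma ip_smul_left (c : ℂ) (f g : Dom p m) : ip p (c • f) g = conj c * ip p f g := by
  rw [ip, ip, Finset.mul_sum]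
  refine Finset.sum_congr rfl fun s _ => ?_
  rw [← MeasureTheory.integral_const_mul]
  refine MeasureTheory.integral_congr_ae (Filter.Eventually.of_forall fun μ => ?_)
  simp [mul_assoc]

lemma ip_smul_right (c : ℂ) (f g : Dom p m) : ip p f (c • g) = c * ip p f g := by
  rw [ip, ip, Finset.mul_sum]
  refine Finset.sum_congr rfl fun s _ => ?_
  rw [← MeasureTheory.integral_const_mul]
  refine MeasureTheory.integral_congr_ae (Filter.Eventually.of_forall fun μ => ?_)
  simp [mul_left_comm]

lemma adj_starRel (p : Level) (m : ℕ) :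
    StarRel (Adj p : Module.End ℂ (Dom p m) → Module.End ℂ (Dom p m) → Prop) where
  zero f g := by
    have h1 := ip_smul_left (p := p) 0 f g
    have h2 := ip_smul_right (p := p) 0 f g
    rw [LinearMap.zero_apply, LinearMap.zero_apply]
    simp only [zero_smul, map_zero, zero_mul] at h1 h2
    rw [h1, h2]
  one f g := rfl
  add ha hb f g := by
    rw [LinearMap.add_apply, LinearMap.add_apply, ip_add_left, ip_add_right, ha, hb]
  smul c a a' ha f g := by
    rw [LinearMap.smul_apply, LinearMap.smul_apply, ip_smul_left, ip_smul_right, ha]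
  mul ha hb f g := by
    rw [Module.End.mul_apply, Module.End.mul_apply, ha, hb]

/-! ### The adjoints of the elementary operators -/

lemma adj_multOp (ν : Fin m) (c : ℂ) (l : ℤ) :
    Adj p (multOp p ν c l) (multOp p ν (conj c) (-l)) := by
  intro f g
  rw [ip, ip]
  refine Finset.sum_congr rfl fun s _ => ?_
  refine MeasureTheory.integral_congr_ae (Filter.Eventually.of_forall fun μ => ?_)
  simp only [multOp_apply, map_mul, ← Complex.exp_conj]
  rw [mul_assoc, mul_left_comm, ← mul_assoc, mul_comm (conj _), ← mul_assoc,
    mul_comm (conj (f.1 _ _))]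
  congr 3
  generalize (s ν).val = n
  simp [map_ofNat]
  ring

lemma differentiable_conj_conj {F : ℂ → ℂ} (h : Differentiable ℂ F) :
    Differentiable ℂ fun ζ => conj (F (conj ζ)) := fun ζ => by
  have := (h (conj ζ)).conj_conj
  rwa [Complex.conj_conj] at this

/-- The integrand extends from real points to the holomorphic function conj(f(z̄)) g(z), to which
the contour shift applies. -/
lemma integral_conj_mul_shift (f g : Dom p m) (s) (ν : Fin m) (τ : ℂ) :
    ∫ μ : Fin m → ℝ, conj (f.1 (cvec μ + Pi.single ν τ) s) *
      g.1 (cvec μ + Pi.single ν (conj τ)) s =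
    ∫ μ : Fin m → ℝ, conj (f.1 (cvec μ) s) * g.1 (cvec μ) s := by
  set H : (Fin m → ℂ) → ℂ := fun z => conj (f.1 (fun κ => conj (z κ)) s) * g.1 z s with hH
  have hc : ∀ (μ : Fin m → ℝ) (ζ : ℂ), H (cvec μ + Pi.single ν ζ) =
      conj (f.1 (cvec μ + Pi.single ν (conj ζ)) s) * g.1 (cvec μ + Pi.single ν ζ) s := by
    intro μ ζ
    have : (fun κ => conj ((cvec μ + (Pi.single ν ζ : Fin m → ℂ)) κ)) = cvec μ + Pi.single ν (conj ζ) := by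
      funext κ
      by_cases h : κ = ν
      · subst h; simp [cvec]
      · simp [cvec, h]
    rw [hH]
    simp only [this]
  have hline : ∀ (f : Dom p m) (μ : Fin m → ℝ),
      Differentiable ℂ fun ζ : ℂ => f.1 (cvec μ + Pi.single ν ζ) s := by
    intro f μ
    refine (f.2 s).1.comp ((differentiable_const _).add ?_)
    exact (ContinuousLinearMap.single ℂ (fun _ : Fin m => ℂ) ν).differentiable
  -- Shifting by τ̄ makes the argument of f shift by τ, since it enters through a conjugate.
  have := integral_add_single (H := H) ?_ ν (fun μ => ?_) (fun B => ?_) (conj τ)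
  · have h0 : ∀ μ : Fin m → ℝ, H (cvec μ) = conj (f.1 (cvec μ) s) * g.1 (cvec μ) s := by
      intro μ
      simpa using hc μ 0
    simpa only [hc, h0, Complex.conj_conj] using this
  · refine (Complex.continuous_conj.comp ((Dom.continuous f s).comp ?_)).mul (Dom.continuous g s)
    fun_prop
  · simp only [hc]
    exact (differentiable_conj_conj (hline f μ)).mul (hline g μ)
  · obtain ⟨C, hC⟩ := Dom.lintegral_sq_le f s ν B
    obtain ⟨D, hD⟩ := Dom.lintegral_sq_le g s ν B
    refine ⟨C + D, fun t ht => ?_⟩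
    have hm : Measurable fun μ : Fin m → ℝ =>
        ‖f.1 (cvec μ + Pi.single ν (((-t : ℝ) : ℂ) * Complex.I)) s‖ₑ ^ 2 := by
      refine Measurable.pow_const (Continuous.measurable ?_) 2
      exact ((Dom.continuous f s).comp (continuous_cvec.add continuous_const)).enorm
    calc _ ≤ ∫⁻ μ : Fin m → ℝ,
          (‖f.1 (cvec μ + Pi.single ν (((-t : ℝ) : ℂ) * Complex.I)) s‖ₑ ^ 2 +
            ‖g.1 (cvec μ + Pi.single ν (t * Complex.I)) s‖ₑ ^ 2) :=
          MeasureTheory.lintegral_mono fun μ => by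
            dsimp only
            rw [hc]
            refine (enorm_mul_le_sq _ _).trans_eq ?_
            rw [enorm_conj]
            congr 5
            simp
      _ ≤ _ := by
          rw [MeasureTheory.lintegral_add_left hm, ENNReal.coe_add]
          exact add_le_add (hC _ (by rwa [abs_neg])) (hD t ht)

/-- The sum over ℤ/k is reindexed by the discrete shift, and the contour shift treats the complex
one. -/
lemma adj_shiftOp (ν : Fin m) (τ : ℂ) (n : ZMod p.k) :
    Adj p (shiftOp p ν τ n) (shiftOp p ν (-conj τ) (-n)) := by
  intro f g
  rw [ip, ip]
  refine Fintype.sum_equiv (Equiv.addRight (Pi.single ν n)) _ _ fun s => ?_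
  have := integral_conj_mul_shift f (shiftOp p ν (-conj τ) (-n) g) (s + Pi.single ν n) ν τ
  refine Eq.trans ?_ this
  refine MeasureTheory.integral_congr_ae (Filter.Eventually.of_forall fun μ => ?_)
  simp only [shiftOp_apply, Pi.single_neg, add_neg_cancel_right]
  rfl

variable (p)

lemma adj_xPow (σ : Sector) (ν : Fin m) (α : ℤ) :
    Adj p (xPow p σ ν α) (xPow p σ.swap ν α) := by
  have h := adj_shiftOp (p := p) ν (α * (Complex.I * p.bPar σ)) ((-σ.sgn * α : ℤ) : ZMod p.k)
  have e1 : -conj ((α : ℂ) * (Complex.I * p.bPar σ)) = α * (Complex.I * p.bPar σ.swap) := by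
    rw [map_mul, map_mul, Complex.conj_I, p.conj_bPar]
    simp
  rw [e1] at h
  rw [xPow, xPow, Sector.sgn_swap]
  convert! h using 2
  push_cast
  ring

lemma adj_yPow (σ : Sector) (ν : Fin m) (β : ℤ) :
    Adj p (yPow p σ ν β) (yPow p σ.swap ν β) := by
  have h := adj_multOp (p := p) ν (β * (2 * Real.pi * Complex.I / p.k * (-Complex.I * p.bPar σ)))
    (-σ.sgn * β)
  rw [yPow, yPow, Sector.sgn_swap]
  convert! h using 2
  · simp [p.conj_bPar, map_ofNat]
    ring
  · ring

lemma adj_xOp (σ : Sector) (ν : Fin m) (α β : ℤ) :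
    Adj p (xOp p σ ν α β) (xOp p σ.swap ν α β) := by
  have h := (adj_starRel p m).smul (p.q σ ^ (-(α * β)))
    ((adj_starRel p m).mul (adj_xPow p σ ν α) (adj_yPow p σ ν β))
  rw [xOp, xOp]
  convert! h using 1
  -- Weyl ordering is symmetric under reversal: the reordering factor q̃^{2αβ} turns the prefactor
  -- q̃^{-αβ} into q̃^{αβ}, the conjugate of q^{-αβ}.
  rw [xPow_mul_yPow, smul_smul, map_zpow₀, p.conj_q, inv_zpow', ← zpow_add₀ (p.q_ne_zero _)]
  congr 2
  ring

/-- The common prefactor of 𝒳 and 𝒴 conjugates to the tilded one, and λ̄ in the tilded sector is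
what conjugation requires; no restriction on λ results. -/
lemma siteOps_adjoint (σ : Sector) (ν : Fin m) (lam : ℂ) :
    genRel (Adj p) (siteOps p σ ν lam) (siteOps p σ.swap ν lam) := by
  have hS := adj_starRel p m
  have hc : conj (-Complex.I / (p.Q σ - (p.Q σ)⁻¹)) =
      -Complex.I / (p.Q σ.swap - (p.Q σ.swap)⁻¹) := by
    rw [map_div₀, map_neg, Complex.conj_I, map_sub, map_inv₀, p.conj_Q, inv_inv, neg_neg,
      ← neg_sub (p.Q σ.swap), div_neg, neg_div]
  refine ⟨adj_xOp p σ ν _ _, adj_xOp p σ ν _ _, ?_, ?_⟩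
  · have hl := hS.add (hS.add (hS.smul
        ((match σ with | .holo => lam | .anti => conj lam) +
          (match σ with | .holo => lam | .anti => conj lam)⁻¹)
        (adj_xOp p σ ν 1 (-1))) (adj_xOp p σ ν 3 (-1))) (adj_xOp p σ ν (-1) (-1))
    have h := hS.smul (-Complex.I / (p.Q σ - (p.Q σ)⁻¹)) hl
    rw [hc] at h
    cases σ
    · simpa [siteOps, Sector.swap] using h
    · simpa [siteOps, Sector.swap] using h
  · have h := hS.smul (-Complex.I / (p.Q σ - (p.Q σ)⁻¹)) (adj_xOp p σ ν (-1) 1)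
    rwa [hc] at h

lemma tensorOps_adjoint (σ : Sector) (lam : Fin m → ℂ) (n : ℕ) (hn : n ≤ m) :
    genRel (Adj p) (tensorOps p σ lam n) (tensorOps p σ.swap lam n) := by
  induction n with
  | zero =>
    rw [tensorOps_zero, tensorOps_zero]
    exact (adj_starRel p m).counit
  | succ n ih =>
    rw [tensorOps_succ p σ lam n (by omega), tensorOps_succ p σ.swap lam n (by omega)]
    exact (adj_starRel p m).comul (ih (by omega)) (siteOps_adjoint p σ _ _)
      (tensorOps_comm_siteOps p σ.swap σ.swap lam n (by omega) _ _ (Or.inl le_rfl))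

lemma dressedOp_adjoint (σ : Sector) (lam : Fin m → ℂ) (ν : Fin m) (d : ℕ) :
    matRel (Adj p) (dressedOp p σ lam ν d) (Ring.inverse (dressedOp p σ.swap lam ν d)) :=
  dressedMat_adjoint (adj_starRel p m) (tensorOps_rels p σ lam ν ν.isLt.le)
    (tensorOps_rels p σ.swap lam ν ν.isLt.le) (siteOps_rels p σ ν (lam ν))
    (siteOps_rels p σ.swap ν (lam ν)) (tensorOps_adjoint p σ lam ν ν.isLt.le)
    (siteOps_adjoint p σ ν (lam ν))

end InnerProduct

/-! ### Elements that commute up to a sign -/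

section Graded

variable {A : Type} [Ring A] [Algebra ℂ A] {p : Level} {σ : Sector} {S T : GenImages A} {Γ a b : A}
  {ε ε' : ℂ}

/-- Commutation with `Γ` up to the factor `ε`. -/
def Graded (Γ : A) (ε : ℂ) (a : A) : Prop := Γ * a = ε • (a * Γ)

lemma Graded.mul (ha : Graded Γ ε a) (hb : Graded Γ ε' b) : Graded Γ (ε * ε') (a * b) := by
  rw [Graded, ← mul_assoc, ha, smul_mul_assoc, mul_assoc, hb, mul_smul_comm, smul_smul, mul_assoc]

lemma Graded.one : Graded Γ 1 (1 : A) := by simp [Graded]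

lemma Graded.zero : Graded Γ ε (0 : A) := by simp [Graded]

lemma Graded.add (ha : Graded Γ ε a) (hb : Graded Γ ε b) : Graded Γ ε (a + b) := by
  rw [Graded, mul_add, ha, hb, add_mul, smul_add]

lemma Graded.smul (c : ℂ) (ha : Graded Γ ε a) : Graded Γ ε (c • a) := by
  rw [Graded, mul_smul_comm, ha, smul_mul_assoc, smul_comm]

lemma Graded.sum {ι : Type} (s : Finset ι) {f : ι → A} (h : ∀ i ∈ s, Graded Γ ε (f i)) :
    Graded Γ ε (∑ i ∈ s, f i) := by
  rw [Graded, Finset.mul_sum, Finset.sum_mul, Finset.smul_sum]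
  exact Finset.sum_congr rfl h

lemma Graded.pow (ha : Graded Γ ε a) (n : ℕ) : Graded Γ (ε ^ n) (a ^ n) := by
  induction n with
  | zero => simpa using Graded.one
  | succ n ih => rw [pow_succ, pow_succ]; exact ih.mul ha

lemma Graded.commute (h : Graded Γ 1 a) : Commute Γ a := by
  rw [Graded, one_smul] at h
  exact h

lemma Graded.all_comul (hS : S.All (Graded Γ ε)) (hT : T.All (Graded Γ ε')) :
    (S.comul T).All (Graded Γ (ε * ε')) :=
  ⟨hS.1.mul hT.1, hS.2.1.mul hT.2.1, (hS.2.2.1.mul hT.1).add (hS.2.1.mul hT.2.2.1),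
    (hS.2.2.2.mul hT.1).add (hS.2.1.mul hT.2.2.2)⟩

lemma Graded.commute_u (hε : ε * ε = 1) (hT : T.All (Graded Γ ε)) (x : UGen) :
    Commute Γ (T.u σ x) := by
  obtain ⟨h1, h2, h3, h4⟩ := hT
  have key : ∀ {a b : A}, Graded Γ ε a → Graded Γ ε b → Commute Γ (a * b) := fun ha hb =>
    Graded.commute (by rw [← hε]; exact ha.mul hb)
  cases σ <;> cases x <;> simp only [GenImages.u]
  exacts [key h3 h1, key h2 h4, key h1 h1, key h2 h2, key h1 h3, key h4 h2, key h1 h1, key h2 h2]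

lemma pow_eq_pow_of_mod_two (hε : ε * ε = 1) {a b : ℕ} (h : a % 2 = b % 2) : ε ^ a = ε ^ b := by
  rcases mul_self_eq_one_iff.mp hε with rfl | rfl
  · simp
  · rw [neg_one_pow_eq_pow_mod_two, h, ← neg_one_pow_eq_pow_mod_two]

lemma Graded.kpow (hε : ε * ε = 1) (hT : T.All (Graded Γ ε)) {n : ℤ} {d : ℕ}
    (h : n.natAbs % 2 = d % 2) : Graded Γ (ε ^ d) (T.kpow n) := by
  rw [← pow_eq_pow_of_mod_two hε h, GenImages.kpow]
  split_ifs with hn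
  · convert! hT.1.pow n.toNat using 2
    omega
  · convert! hT.2.1.pow (-n).toNat using 2
    omega

lemma sgn_mul_wt_natAbs (σ : Sector) (d : ℕ) (i : Fin (d + 1)) :
    (σ.sgn * wt d i).natAbs % 2 = d % 2 := by
  have := i.isLt
  cases σ <;> simp only [Sector.sgn, wt] <;> omega

/-- The products K⁻¹Y are even, and the Cartan exponents all have the parity of d. -/
lemma Graded.RMat_apply (hε : ε * ε = 1) (hT : T.All (Graded Γ ε)) (d : ℕ) (i j) :
    Graded Γ (ε ^ d) (RMat p σ d T i j) := by
  rw [RMat, cartan, Matrix.diagonal_mul, Matrix.sum_apply, ← mul_one (ε ^ d)]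
  refine (Graded.kpow hε hT (sgn_mul_wt_natAbs σ d i)).mul (Graded.sum _ fun n _ => ?_)
  have := ((hT.2.1.mul hT.2.2.2).pow n).smul
    (expCoef p σ n * (((rho p σ d).K * (rho p σ d).X) ^ n) i j)
  rwa [hε, one_pow] at this

lemma Graded.RMat'_apply (hε : ε * ε = 1) (hT : T.All (Graded Γ ε)) (d : ℕ) (i j) :
    Graded Γ (ε ^ d) (RMat' p σ d T i j) := by
  rw [RMat', cartan, Matrix.diagonal_mul, Matrix.sum_apply, ← mul_one (ε ^ d)]
  refine (Graded.kpow hε hT (sgn_mul_wt_natAbs σ d i)).mul (Graded.sum _ fun n _ => ?_)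
  have := ((hT.1.mul hT.2.2.1).pow n).smul
    (expCoef p σ n * (((rho p σ d).Kinv * (rho p σ d).Y) ^ n) i j)
  rwa [hε, one_pow] at this

lemma Graded.matrix {n : Type} [Fintype n] [DecidableEq n] {M : Matrix n n A}
    (h : ∀ i j, Graded Γ ε (M i j)) : Graded (scalarHom A n Γ) ε M := by
  ext i j
  rw [scalarHom_apply, Matrix.diagonal_mul, Matrix.smul_apply, Matrix.mul_diagonal]
  exact h i j

lemma Graded.inverse (hε : ε * ε = 1) (hu : IsUnit a) (h : Graded Γ ε a) :
    Graded Γ ε (Ring.inverse a) := by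
  have h1 : Ring.inverse a * Γ * (a * Ring.inverse a) =
      ε • (Ring.inverse a * a * (Γ * Ring.inverse a)) := by
    rw [mul_assoc, ← mul_assoc Γ, h, smul_mul_assoc, mul_smul_comm]
    simp only [mul_assoc]
  rw [Ring.mul_inverse_cancel _ hu, Ring.inverse_mul_cancel _ hu, mul_one, one_mul] at h1
  rw [Graded, h1, smul_smul, hε, one_smul]

/-- The loop contains two R-matrices, and the dressing occurs together with its inverse, so every
sign appears squared. -/
lemma Graded.dressedMat (hε : ε * ε = 1) (hε' : ε' * ε' = 1) (hrS : Rels (p.Q σ) S)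
    (hS : S.All (Graded Γ ε)) (hT : T.All (Graded Γ ε')) (d : ℕ) (i j) :
    Commute Γ (dressedMat p σ d S T i j) := by
  have e1 : ∀ {ε : ℂ}, ε * ε = 1 → ε ^ d * ε ^ d = 1 := fun h => by
    rw [← mul_pow, h, one_pow]
  have hS' := Graded.matrix (Graded.RMat'_apply (p := p) (σ := σ) hε hS d)
  have hl := (Graded.matrix (Graded.RMat'_apply (p := p) (σ := σ) hε' hT d)).mul
    (Graded.matrix (Graded.RMat_apply (p := p) (σ := σ) hε' hT d))
  have := (hS'.mul hl).mul (hS'.inverse (e1 hε) (isUnit_RMat' p σ d hrS))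
  rw [e1 hε', mul_one, e1 hε] at this
  exact commute_apply_of_commute_scalarHom this.commute i j

end Graded

/-! ### Invariance of the even subspace -/

section Even

variable (p : Level) {m : ℕ}

/-- Multiplication by `(-1)^{s_κ}`. -/
def parity (κ : Fin m) : Module.End ℂ (Dom p m) := multOp p κ 0 p.N

lemma even_iff_even_val (x : ZMod p.k) : Even x ↔ Even x.val := by
  constructor
  · rintro ⟨r, rfl⟩
    rw [ZMod.val_add, Nat.even_iff, Nat.mod_mod_of_dvd _ (Dvd.intro _ rfl : 2 ∣ p.k)]
    omega
  · rintro ⟨r, hr⟩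
    exact ⟨(r : ZMod p.k), by rw [← Nat.cast_add, ← hr, ZMod.natCast_zmod_val]⟩

lemma exp_parity (n : ℤ) :
    Complex.exp (2 * Real.pi * Complex.I / p.k * p.N * n) = (-1) ^ n := by
  have hN : (p.N : ℂ) ≠ 0 := by exact_mod_cast p.N_pos.ne'
  rw [← Complex.exp_pi_mul_I, ← Complex.exp_int_mul, Level.k]
  congr 1
  push_cast
  field_simp

/-- Vanishing at odd s_κ means being fixed by the sign (-1)^{s_κ}; this turns invariance of the
subspace into commutation of operators. -/
lemma mem_evenDom_iff (f : Dom p m) : f ∈ EvenDom p m ↔ ∀ κ, parity p κ f = f := by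
  have hp : ∀ κ z s, (parity p κ f).1 z s = (-1) ^ (s κ).val * f.1 z s := by
    intro κ z s
    have := exp_parity p (s κ).val
    rw [zpow_natCast] at this
    rw [parity, multOp_apply, ← this]
    push_cast
    rw [zero_mul, zero_add]
  constructor
  · intro hf κ
    refine Subtype.ext (funext fun z => funext fun s => ?_)
    rw [hp]
    by_cases h : Even (s κ)
    · rw [((even_iff_even_val p _).mp h).neg_one_pow, one_mul]
    · rw [hf z s ⟨κ, h⟩, mul_zero]
  · rintro h z s ⟨κ, hκ⟩
    have h1 := hp κ z s
    rw [even_iff_even_val, Nat.not_even_iff_odd] at hκ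
    rw [h κ, hκ.neg_one_pow] at h1
    have h2 : (2 : ℂ) * f.1 z s = 0 := by linear_combination h1
    simpa using h2

lemma evenDom_of_commute {P : Module.End ℂ (Dom p m)} (h : ∀ κ, Commute (parity p κ) P)
    (f : Dom p m) (hf : f ∈ EvenDom p m) : P f ∈ EvenDom p m := by
  rw [mem_evenDom_iff] at hf ⊢
  intro κ
  have := congrArg (fun A : Module.End ℂ (Dom p m) => A f) (h κ).eq
  simp only [Module.End.mul_apply] at this
  rw [this, hf κ]

/-- An odd power of 𝐱 shifts s by an odd amount and so anticommutes with the parity of its own site.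
-/
lemma graded_xOp (σ : Sector) (ν κ : Fin m) (α β : ℤ) (hα : Odd α) :
    Graded (parity p κ) (if κ = ν then -1 else 1) (xOp p σ ν α β) := by
  have hy : Commute (parity p κ) (yPow p σ ν β) := commute_multOp ..
  have hx : Graded (parity p κ) (if κ = ν then -1 else 1) (xPow p σ ν α) := by
    split_ifs with h
    · subst h
      have h1 := shiftOp_mul_multOp p κ (α * (Complex.I * p.bPar σ)) 0 (-σ.sgn * α) p.N
      have h2 : Odd (-σ.sgn * α) := by
        cases σ <;> simpa [Sector.sgn] using hα
      have h3 := exp_parity p (-σ.sgn * α)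
      rw [h2.neg_one_zpow] at h3
      rw [Graded, xPow, parity, h1]
      rw [zero_mul, zero_add]
      push_cast at h3 ⊢
      rw [h3, smul_smul]
      simp
    · rw [Graded, one_smul]
      exact (commute_shiftOp_multOp p (Ne.symm h) ..).symm
  have := (hx.mul (b := yPow p σ ν β) (ε' := 1) (by rw [Graded, one_smul]; exact hy)).smul
    (p.q σ ^ (-(α * β)))
  rwa [mul_one] at this

lemma graded_siteOps (σ : Sector) (ν κ : Fin m) (lam : ℂ) :
    (siteOps p σ ν lam).All (Graded (parity p κ) (if κ = ν then -1 else 1)) :=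
  siteOps_all p (fun _ _ => Graded.add) (fun c _ h => h.smul c) σ ν lam
    fun α β hα => graded_xOp p σ ν κ α β hα

lemma graded_tensorOps (σ : Sector) (lam : Fin m → ℂ) (κ : Fin m) (n : ℕ) (hn : n ≤ m) :
    ∃ ε : ℂ, ε * ε = 1 ∧ (tensorOps p σ lam n).All (Graded (parity p κ) ε) := by
  induction n with
  | zero =>
    rw [tensorOps_zero]
    exact ⟨1, one_mul 1, Graded.one, Graded.one, Graded.zero, Graded.zero⟩
  | succ n ih =>
    obtain ⟨ε, hε, h⟩ := ih (by omega)
    rw [tensorOps_succ p σ lam n (by omega)]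
    refine ⟨_, ?_, Graded.all_comul h (graded_siteOps p σ _ κ _)⟩
    rw [mul_mul_mul_comm, hε]
    split_ifs <;> norm_num

lemma commute_parity_dressedOp (σ : Sector) (lam : Fin m → ℂ) (κ ν : Fin m) (d : ℕ) (i j) :
    Commute (parity p κ) (dressedOp p σ lam ν d i j) := by
  obtain ⟨ε, hε, h⟩ := graded_tensorOps p σ lam κ ν ν.isLt.le
  exact Graded.dressedMat hε (by split_ifs <;> norm_num) (tensorOps_rels p σ lam ν ν.isLt.le) h
    (graded_siteOps p σ ν κ (lam ν)) d i j

lemma commute_parity_tensorOps_u (σ : Sector) (lam : Fin m → ℂ) (κ : Fin m) (x : UGen) :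
    Commute (parity p κ) ((tensorOps p σ lam m).u σ x) := by
  obtain ⟨ε, hε, h⟩ := graded_tensorOps p σ lam κ m le_rfl
  exact Graded.commute_u hε h x

lemma extRep_leavesEvenInvariant (lam : Fin m → ℂ) : LeavesEvenInvariant p (extRep p lam) := by
  intro a
  refine ExtAlg.mem_of_M_g (p := p) (m := m)
    (S := evenSubalgebra (B := ExtAlg p m) p (extRep p lam)) (fun σ ν d i j => ?_)
    (fun σ x => ?_) a
  · change ∀ f ∈ EvenDom p m, extRep p lam _ f ∈ _
    rw [extRep_M]
    exact evenDom_of_commute p fun κ => commute_parity_dressedOp p σ lam κ ν d i j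
  · change ∀ f ∈ EvenDom p m, extRep p lam _ f ∈ _
    rw [extRep_g]
    exact evenDom_of_commute p fun κ => commute_parity_tensorOps_u p σ lam κ x

end Even

/-! ### The matrix elements of `R'R` belong to the quantum group -/

section LoopMem

variable {A B : Type} [Ring A] [Algebra ℂ A] [Ring B] [Algebra ℂ B] {p : Level} {σ : Sector}
  {T : GenImages A}

lemma map_RMat (φ : A →ₐ[ℂ] B) (T : GenImages A) (d : ℕ) (i j) :
    φ (RMat p σ d T i j) = RMat p σ d (T.map φ) i j := by
  rw [RMat, RMat, cartan, cartan, Matrix.diagonal_mul, Matrix.diagonal_mul, map_mul, map_kpow,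
    Matrix.sum_apply, Matrix.sum_apply, map_sum]
  simp only [Matrix.of_apply, map_smul, map_pow, map_mul]
  rfl

lemma map_RMat' (φ : A →ₐ[ℂ] B) (T : GenImages A) (d : ℕ) (i j) :
    φ (RMat' p σ d T i j) = RMat' p σ d (T.map φ) i j := by
  rw [RMat', RMat', cartan, cartan, Matrix.diagonal_mul, Matrix.diagonal_mul, map_mul, map_kpow,
    Matrix.sum_apply, Matrix.sum_apply, map_sum]
  simp only [Matrix.of_apply, map_smul, map_pow, map_mul]
  rfl

lemma map_loopMat (φ : A →ₐ[ℂ] B) (T : GenImages A) (d : ℕ) (i j) :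
    φ (loopMat p σ d T i j) = loopMat p σ d (T.map φ) i j := by
  rw [loopMat, loopMat, Matrix.mul_apply, Matrix.mul_apply, map_sum]
  simp only [map_mul, map_RMat, map_RMat']

lemma kpow_two_mul_mem {S : Subalgebra ℂ A} (h : ∀ x, T.u σ x ∈ S) (c : ℤ) :
    T.kpow (2 * c) ∈ S := by
  have hK : T.K * T.K ∈ S := by have := h .K; cases σ <;> exact this
  have hk : T.Kinv * T.Kinv ∈ S := by have := h .Kinv; cases σ <;> exact this
  rw [GenImages.kpow]
  split_ifs with hc
  · rw [show (2 * c).toNat = 2 * c.toNat by omega, pow_mul, pow_two]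
    exact S.pow_mem hK _
  · rw [show (-(2 * c)).toNat = 2 * (-c).toNat by omega, pow_mul, pow_two]
    exact S.pow_mem hk _

lemma KX_mem (hT : Rels (p.Q σ) T) {S : Subalgebra ℂ A} (h : ∀ x, T.u σ x ∈ S) :
    T.K * T.X ∈ S := by
  have := h .E
  cases σ
  · rw [hT.K_X]
    exact S.smul_mem this _
  · exact this

lemma KinvY_mem (hT : Rels (p.Q σ) T) {S : Subalgebra ℂ A} (h : ∀ x, T.u σ x ∈ S) :
    T.Kinv * T.Y ∈ S := by
  have := h .F
  cases σ
  · exact this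
  · rw [hT.inv_comm (inv_ne_zero (p.Q_ne_zero _)) hT.K_Y]
    exact S.smul_mem this _

lemma pow_mul_kpow (hT : Rels (p.Q σ) T) (n : ℕ) (b : ℤ) :
    ∃ c : ℂ, (T.K * T.X) ^ n * T.kpow b = c • (T.kpow b * (T.K * T.X) ^ n) := by
  have hQ := p.Q_ne_zero σ
  have h1 : T.K * (T.K * T.X) = p.Q σ • (T.K * T.X * T.K) := by
    rw [hT.K_X, mul_smul_comm, smul_mul_assoc, ← mul_assoc, hT.K_X, smul_mul_assoc]
  have h2 : T.K * (T.K * T.X) ^ n = p.Q σ ^ n • ((T.K * T.X) ^ n * T.K) := by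
    induction n with
    | zero => simp
    | succ n ih =>
      rw [pow_succ, ← mul_assoc, ih, smul_mul_assoc, mul_assoc _ T.K, h1, mul_smul_comm, smul_smul,
        ← pow_succ, mul_assoc _ (T.K * T.X)]
  have h3 := hT.kpow_mul (pow_ne_zero n hQ) h2 b
  exact ⟨((p.Q σ ^ n) ^ b)⁻¹, by
    rw [h3, smul_smul, inv_mul_cancel₀ (zpow_ne_zero _ (pow_ne_zero _ hQ)), one_smul]⟩

/-- In a product of an entry of R' with one of R the two Cartan exponents add up to an even number,
and 𝒦𝒳, 𝒦⁻¹𝒴 are multiples of E, F. So R'R involves only the subalgebra generated by E, F, K and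
K⁻¹. -/
lemma loopMat_mem (hT : Rels (p.Q σ) T) {S : Subalgebra ℂ A} (h : ∀ x, T.u σ x ∈ S) (d : ℕ)
    (i j) : loopMat p σ d T i j ∈ S := by
  rw [loopMat, Matrix.mul_apply]
  refine S.sum_mem fun l _ => ?_
  rw [RMat', RMat, cartan, Matrix.diagonal_mul, Matrix.diagonal_mul, Matrix.sum_apply,
    Matrix.sum_apply, mul_assoc, ← mul_assoc (Finset.sum _ _), Finset.sum_mul, Finset.sum_mul,
    Finset.mul_sum]
  refine S.sum_mem fun n _ => ?_
  obtain ⟨c, hc⟩ := pow_mul_kpow hT n (σ.sgn * wt d l)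
  -- Weights of the same spin have the same parity: (d - 2i) + (d - 2l) = 2(d - i - l).
  obtain ⟨t, ht⟩ : ∃ t, σ.sgn * wt d i + σ.sgn * wt d l = 2 * t := by
    refine ⟨σ.sgn * (d - i - l), ?_⟩
    simp only [wt]
    ring
  rw [Matrix.of_apply, smul_mul_assoc, hc, smul_smul, smul_mul_assoc, mul_smul_comm,
    mul_assoc (T.kpow (σ.sgn * wt d l)), ← mul_assoc (T.kpow _), ← hT.kpow_add, ht]
  refine S.smul_mem (S.mul_mem (kpow_two_mul_mem h t) (S.mul_mem (S.pow_mem (KX_mem hT h) n) ?_)) _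
  refine S.sum_mem fun n _ => ?_
  exact S.smul_mem (S.pow_mem (KinvY_mem hT h) n) _

end LoopMem

/-! ### Quantum flatness -/

section Flatness

variable (p : Level) {m : ℕ} (lam : Fin m → ℂ)

/-- Each further dressed holonomy multiplies the loop of the previous factors on the left, which is
the telescoping rule `dressedMat_mul_loopMat`. -/
lemma prod_dressedOp (σ : Sector) (d n : ℕ) (hn : n ≤ m) :
    (((List.finRange m).take n).map fun ν => dressedOp p σ lam ν d).reverse.prod =
      loopMat p σ d (tensorOps p σ lam n) := by
  induction n with
  | zero => simp [tensorOps_zero, loopMat_counit]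
  | succ n ih =>
    have hnm : n < m := by omega
    rw [tensorOps_succ p σ lam n hnm, ← dressedMat_mul_loopMat (tensorOps_rels p σ lam n hnm.le)
      (siteOps_rels p σ _ _) (tensorOps_comm_siteOps p σ σ lam n hnm.le _ _ (Or.inl le_rfl)),
      ← ih hnm.le, List.take_add_one]
    simp [hnm, dressedOp_eq]

lemma extRep_M0 (σ : Sector) (d : ℕ) (i j) :
    extRep p lam (ExtAlg.M0 p m σ d i j) = loopMat p σ d (tensorOps p σ lam m) i j := by
  have h : (extRep p lam).mapMatrix (ExtAlg.M0 p m σ d) =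
      loopMat p σ d (tensorOps p σ lam m) := by
    rw [ExtAlg.M0, map_list_prod, List.map_reverse, List.map_ofFn, ← prod_dressedOp p lam σ d m le_rfl,
      List.ofFn_eq_map, List.take_of_length_le (by simp)]
    refine congrArg (fun l : List _ => l.reverse.prod) (List.map_congr_left fun ν _ => ?_)
    ext1 i j
    exact extRep_M p lam σ ν d i j
  rw [← h]
  rfl

/-- The operator and the counit of an element of the quantum group. -/
def gaugePair : UAlg p →ₐ[ℂ] Module.End ℂ (Dom p m) × ℂ :=
  ((extRep p lam).comp (UAlg.toExt p m)).prod (UAlg.counit p)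

lemma gauge_generator (σ : Sector) (x : UGen) : ∃ ξ : UAlg p,
    UAlg.toExt p m ξ = ExtAlg.g p m σ x ∧
      UAlg.counit p ξ = (GenImages.counit : GenImages ℂ).u σ x := by
  have h : ∀ σ, Uq.toExt p σ m (RingQuot.mkAlgHom ℂ _ (FreeAlgebra.ι ℂ x)) =
      Ext.mk p σ m (FreeAlgebra.ι ℂ (Sum.inr x)) := fun σ => by
    rw [Uq.toExt]
    refine (RingQuot.liftAlgHom_mkAlgHom_apply ..).trans ?_
    simp
  have h' : ∀ σ, Uq.counit p σ (RingQuot.mkAlgHom ℂ _ (FreeAlgebra.ι ℂ x)) =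
      (GenImages.counit : GenImages ℂ).u σ x := fun σ => by
    rw [Uq.counit]
    refine (RingQuot.liftAlgHom_mkAlgHom_apply ..).trans ?_
    cases σ <;> cases x <;> simp [GenImages.counit, GenImages.u]
  cases σ
  · refine ⟨RingQuot.mkAlgHom ℂ _ (FreeAlgebra.ι ℂ x) ⊗ₜ[ℂ] 1, ?_, ?_⟩
    · rw [UAlg.toExt, Algebra.TensorProduct.map_tmul, map_one, h]
      rfl
    · simp [UAlg.counit, h']
  · refine ⟨1 ⊗ₜ[ℂ] RingQuot.mkAlgHom ℂ _ (FreeAlgebra.ι ℂ x), ?_, ?_⟩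
    · rw [UAlg.toExt, Algebra.TensorProduct.map_tmul, map_one, h]
      rfl
    · simp [UAlg.counit, h']

/-- The entry of R'R must be lifted to a single element of the quantum group whose operator and
whose counit are known simultaneously. -/
lemma exists_gauge_loopMat (σ : Sector) (d : ℕ) (i j) : ∃ ξ : UAlg p,
    extRep p lam (UAlg.toExt p m ξ) = loopMat p σ d (tensorOps p σ lam m) i j ∧
      UAlg.counit p ξ = (1 : Matrix (Fin (d + 1)) (Fin (d + 1)) ℂ) i j := by
  let S := tensorOps p σ lam m
  -- Working in the product algebra, with the operator and the counit as components, performs both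
  -- evaluations at once.
  let T : GenImages (Module.End ℂ (Dom p m) × ℂ) :=
    ⟨(S.K, 1), (S.Kinv, 1), (S.X, 0), (S.Y, 0)⟩
  have hS : Rels (p.Q σ) S := tensorOps_rels p σ lam m le_rfl
  have hT : Rels (p.Q σ) T := by
    refine ⟨Prod.ext hS.K_Kinv ?_, Prod.ext hS.Kinv_K ?_, Prod.ext hS.K_X ?_, Prod.ext hS.K_Y ?_,
      Prod.ext hS.X_Y ?_⟩ <;> simp [T]
  have hmem : ∀ x, T.u σ x ∈ (gaugePair p lam).range := by
    intro x
    obtain ⟨ξ, h3, h4⟩ := gauge_generator (m := m) p σ x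
    refine ⟨ξ, Prod.ext ?_ ?_⟩
    · change extRep p lam (UAlg.toExt p m ξ) = AlgHom.fst ℂ _ _ (T.u σ x)
      rw [h3, extRep_g]
      exact u_map (AlgHom.fst ℂ _ _) T x
    · change UAlg.counit p ξ = AlgHom.snd ℂ _ _ (T.u σ x)
      rw [h4]
      exact u_map (AlgHom.snd ℂ _ _) T x
  obtain ⟨ξ, hξ⟩ : ∃ ξ, gaugePair p lam ξ = loopMat p σ d T i j := loopMat_mem hT hmem d i j
  have h1 := map_loopMat (p := p) (σ := σ) (AlgHom.fst ℂ _ _) T d i j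
  have h2 := map_loopMat (p := p) (σ := σ) (AlgHom.snd ℂ _ _) T d i j
  rw [show T.map (AlgHom.snd ℂ _ _) = GenImages.counit from rfl, loopMat_counit] at h2
  rw [← hξ] at h1 h2
  exact ⟨ξ, h1, h2⟩

lemma extRep_flat : GaugeInvariantImpliesFlat p (extRep p lam) := by
  intro W hW Ψ hΨ σ d i j f
  obtain ⟨ξ, h1, h2⟩ := exists_gauge_loopMat p lam σ d i j
  rw [← h2, ← hΨ ξ f]
  refine congrArg Ψ (Subtype.ext ?_)
  change extRep p lam (ExtAlg.M0 p m σ d i j) f = extRep p lam (UAlg.toExt p m ξ) f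
  rw [h1, extRep_M0]

end Flatness

/-! ### Uniqueness of the Fourier transform -/

section Fourier

variable {m : ℕ}

open MeasureTheory

/-- `e^{i w·v}`. -/
def wave (w v : Fin m → ℝ) : ℂ := Complex.exp ((∑ ν, w ν * v ν : ℝ) * Complex.I)

lemma continuous_wave (w : Fin m → ℝ) : Continuous (wave w) := by
  unfold wave
  fun_prop

lemma norm_wave (w v : Fin m → ℝ) : ‖wave w v‖ = 1 := Complex.norm_exp_ofReal_mul_I _

lemma conj_wave (w v : Fin m → ℝ) : conj (wave w v) = wave (-w) v := by
  rw [wave, wave, ← Complex.exp_conj, map_mul, Complex.conj_I, Complex.conj_ofReal]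
  congr 1
  simp

lemma integrable_wave_mul {h : (Fin m → ℝ) → ℂ} (hh : Integrable h) (w : Fin m → ℝ) :
    Integrable fun v => wave w v * h v :=
  hh.bdd_mul (c := 1) (continuous_wave w).aestronglyMeasurable
    (Filter.Eventually.of_forall fun v => (norm_wave w v).le)

/-- A finite measure is determined by its characteristic function. -/
lemma measure_eq_of_integral_wave {P P' : Measure (Fin m → ℝ)} [IsFiniteMeasure P]
    [IsFiniteMeasure P'] (h : ∀ w, ∫ v, wave w v ∂P = ∫ v, wave w v ∂P') : P = P' := by
  let L : (Fin m → ℝ) →ₗ[ℝ] (Fin m → ℝ) →ₗ[ℝ] ℝ :=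
    LinearMap.mk₂ ℝ (fun v w => ∑ ν, w ν * v ν)
      (fun v v' w => by simp [mul_add, Finset.sum_add_distrib])
      (fun c v w => by simp [Finset.mul_sum, mul_left_comm])
      (fun v w w' => by simp [add_mul, Finset.sum_add_distrib])
      (fun c v w => by simp [Finset.mul_sum, mul_assoc])
  refine ext_of_integral_char_eq Real.continuous_probChar Real.probChar_ne_one (L := L)
    (fun v hv h0 => hv ?_) ?_ fun w => ?_
  · funext ν
    simpa [L, Pi.single_apply] using LinearMap.congr_fun h0 (Pi.single ν 1)
  · simp only [L, LinearMap.mk₂_apply]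
    fun_prop
  · simpa [BoundedContinuousFunction.char_apply, Real.probChar_apply, L, wave] using h w

lemma ae_eq_zero_of_integral_wave_real {u : (Fin m → ℝ) → ℝ} (hu : Integrable u)
    (h : ∀ w, ∫ v, wave w v * (u v : ℂ) = 0) : u =ᵐ[volume] 0 := by
  have hfin : ∀ {u : (Fin m → ℝ) → ℝ}, Integrable u →
      ∫⁻ v, ENNReal.ofReal (u v) ≠ ⊤ := fun hu => hu.lintegral_lt_top.ne
  have hint : ∀ {u : (Fin m → ℝ) → ℝ}, Integrable u → ∀ w,
      ∫ v, wave w v ∂(volume.withDensity fun v => ENNReal.ofReal (u v)) =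
        ∫ v, wave w v * ((u v ⊔ 0 : ℝ) : ℂ) := fun {u} hu w => by
    refine (integral_withDensity_eq_integral_smul₀
      (f := fun v => (u v).toNNReal) hu.aemeasurable.real_toNNReal _).trans ?_
    refine integral_congr_ae (Filter.Eventually.of_forall fun v => ?_)
    simp [NNReal.smul_def, mul_comm]
  have i1 := isFiniteMeasure_withDensity (hfin hu)
  have i2 := isFiniteMeasure_withDensity (hfin hu.neg)
  -- The positive and negative parts of u are densities of finite measures with equal characteristic
  -- functions, so they agree almost everywhere and u vanishes.
  have hP : volume.withDensity (fun v => ENNReal.ofReal (u v)) =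
      volume.withDensity fun v => ENNReal.ofReal ((-u) v) := by
    refine measure_eq_of_integral_wave fun w => ?_
    rw [hint hu, hint hu.neg, ← sub_eq_zero, ← integral_sub, ← h w]
    · refine integral_congr_ae (Filter.Eventually.of_forall fun v => ?_)
      dsimp only
      rw [← mul_sub, ← Complex.ofReal_sub]
      congr 2
      exact posPart_sub_negPart (u v)
    · exact integrable_wave_mul hu.pos_part.ofReal w
    · exact integrable_wave_mul hu.neg.pos_part.ofReal w
  have := (withDensity_eq_iff hu.aemeasurable.ennreal_ofReal hu.neg.aemeasurable.ennreal_ofReal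
    (hfin hu)).mp hP
  filter_upwards [this] with v hv
  rw [Pi.neg_apply] at hv
  rcases le_total 0 (u v) with h0 | h0
  · rw [ENNReal.ofReal_of_nonpos (neg_nonpos.mpr h0), ENNReal.ofReal_eq_zero] at hv
    exact le_antisymm hv h0
  · rw [ENNReal.ofReal_of_nonpos h0, eq_comm, ENNReal.ofReal_eq_zero] at hv
    exact le_antisymm h0 (neg_nonpos.mp hv)

/-- An integrable function with vanishing Fourier transform vanishes almost everywhere. -/
theorem ae_eq_zero_of_integral_wave {h : (Fin m → ℝ) → ℂ} (hh : Integrable h)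
    (h0 : ∀ w, ∫ v, wave w v * h v = 0) : h =ᵐ[volume] 0 := by
  have hconj : ∀ w, ∫ v, wave w v * conj (h v) = 0 := fun w => by
    have := congrArg conj (h0 (-w))
    rw [← integral_conj, map_zero] at this
    simpa [conj_wave] using this
  have hc : Integrable fun v => conj (h v) := Complex.conjLIE.toContinuousLinearEquiv.toContinuousLinearMap.integrable_comp hh
  -- The transform of the conjugate vanishes too, by reflecting w, so real and imaginary parts can
  -- be treated separately.
  have hre := ae_eq_zero_of_integral_wave_real hh.re fun w => by
    have := congrArg (· * (2⁻¹ : ℂ)) (integral_add (integrable_wave_mul hh w) (integrable_wave_mul hc w))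
    simp only [h0, hconj, add_zero, zero_mul] at this
    rw [← this, ← integral_mul_const]
    refine integral_congr_ae (Filter.Eventually.of_forall fun v => ?_)
    simp only [RCLike.re_eq_complex_re, Complex.re_eq_add_conj]
    ring
  have him := ae_eq_zero_of_integral_wave_real hh.im fun w => by
    have := congrArg (· * (2 * Complex.I)⁻¹)
      (integral_sub (integrable_wave_mul hh w) (integrable_wave_mul hc w))
    simp only [h0, hconj, sub_zero, zero_mul] at this
    rw [← this, ← integral_mul_const]
    refine integral_congr_ae (Filter.Eventually.of_forall fun v => ?_)
    simp only [RCLike.im_eq_complex_im, Complex.im_eq_sub_conj]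
    ring
  filter_upwards [hre, him] with v h1 h2
  exact Complex.ext h1 h2

end Fourier

/-! ### Gaussian functions in the common domain -/

section Density

variable (p : Level) {m : ℕ}

open MeasureTheory

/-- `e^{-z² + i w·z}`. -/
def gaussWave (w : Fin m → ℝ) (z : Fin m → ℂ) : ℂ :=
  Complex.exp (-∑ ν, z ν ^ 2 + ∑ ν, w ν * z ν * Complex.I)

lemma gaussWave_cvec (w μ : Fin m → ℝ) :
    gaussWave w (cvec μ) = wave w μ * (Real.exp (-∑ ν, μ ν ^ 2) : ℂ) := by
  rw [gaussWave, wave, Complex.ofReal_exp, ← Complex.exp_add, add_comm]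
  congr 1
  simp [cvec, Finset.sum_mul]

/-- On a tube the Gaussian beats every exponential weight, while the imaginary part contributes only
a bounded factor. -/
lemma isDom_gaussWave (w : Fin m → ℝ) : IsDom p fun z _ => gaussWave w z := by
  intro s
  refine ⟨by unfold gaussWave; fun_prop, fun α B => ?_⟩
  -- The coefficients 2 and 2α come from squaring the modulus.
  have hI := GaussianFourier.integrable_cexp_neg_sum_mul_add (ι := Fin m) (b := fun _ => 2)
    (fun _ => by norm_num) fun ν => ((2 * α ν : ℝ) : ℂ)
  have hfin := hI.2
  rw [hasFiniteIntegral_iff_enorm] at hfin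
  -- After squaring, η contributes exp(2η² - 2wη) in each coordinate, which is bounded for |η| ≤ B
  -- by this constant.
  let A : ℝ≥0 := ⟨Real.exp (∑ ν, (2 * B ^ 2 + 2 * (|w ν| * B))), (Real.exp_pos _).le⟩
  refine ⟨(A * ∫⁻ v : Fin m → ℝ, ‖Complex.exp (-∑ ν, 2 * (v ν : ℂ) ^ 2 +
    ∑ ν, ((2 * α ν : ℝ) : ℂ) * v ν)‖ₑ).toNNReal, fun η hη => ?_⟩
  rw [ENNReal.coe_toNNReal (ENNReal.mul_lt_top ENNReal.coe_lt_top hfin).ne,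
    ← lintegral_const_mul' _ _ ENNReal.coe_ne_top]
  refine lintegral_mono fun v => ?_
  simp only [weighted, gaussWave, enorm_eq_nnnorm]
  rw [← ENNReal.coe_pow, ← ENNReal.coe_mul, ENNReal.coe_le_coe, ← NNReal.coe_le_coe]
  push_cast
  change _ ≤ Real.exp (∑ ν, (2 * B ^ 2 + 2 * (|w ν| * B))) * _
  rw [← Complex.exp_add, Complex.norm_exp, Complex.norm_exp, ← Real.exp_nat_mul, ← Real.exp_add,
    Real.exp_le_exp]
  have e : ∀ x y : ℝ, (((x : ℂ) + y * Complex.I) ^ 2).re = x ^ 2 - y ^ 2 := fun x y => by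
    simp [pow_two]
  simp only [Complex.add_re, Complex.neg_re, Complex.re_sum, e]
  rw [← Finset.sum_neg_distrib, ← Finset.sum_neg_distrib, ← Finset.sum_add_distrib,
    ← Finset.sum_add_distrib, ← Finset.sum_add_distrib, ← Finset.sum_add_distrib, Finset.mul_sum]
  refine Finset.sum_le_sum fun ν _ => ?_
  have h1 : η ν ^ 2 ≤ B ^ 2 := sq_le_sq.mpr ((hη ν).trans (le_abs_self B))
  have h2 : -(w ν * η ν) ≤ |w ν| * B := by
    calc -(w ν * η ν) ≤ |w ν * η ν| := neg_le_abs _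
      _ = |w ν| * |η ν| := abs_mul _ _
      _ ≤ |w ν| * B := by gcongr; exact hη ν
  have h3 : ((2 : ℂ) * (v ν : ℂ) ^ 2).re = 2 * v ν ^ 2 := by simp [pow_two]
  rw [h3]
  simp
  linarith

lemma IsDom.memLp {F : (Fin m → ℂ) → ℂ} (hF : IsDom p fun z _ => F z) :
    MemLp (fun μ : Fin m → ℝ => F (cvec μ)) 2 := by
  let f : Dom p m := ⟨fun z _ => F z, hF⟩
  refine ⟨((Dom.continuous f 0).comp continuous_cvec).aestronglyMeasurable, ?_⟩
  rw [eLpNorm_lt_top_iff_lintegral_rpow_enorm_lt_top two_ne_zero ENNReal.ofNat_ne_top]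
  simpa using Dom.lintegral_sq_lt_top f 0

/-- The square-integrable functions represented by elements of the common domain. -/
def entireLp (m : ℕ) : Submodule ℂ (Lp ℂ 2 (volume : Measure (Fin m → ℝ))) where
  carrier := {φ | ∃ F : (Fin m → ℂ) → ℂ, IsDom p (fun z _ => F z) ∧ φ =ᵐ[volume] fun μ => F (cvec μ)}
  zero_mem' := ⟨0, IsDom.zero p m, Lp.coeFn_zero ..⟩
  add_mem' := by
    rintro φ ψ ⟨F, hF, h⟩ ⟨G, hG, h'⟩
    refine ⟨F + G, hF.add hG, (Lp.coeFn_add φ ψ).trans ?_⟩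
    filter_upwards [h, h'] with μ h1 h2
    simp [h1, h2]
  smul_mem' := by
    rintro c φ ⟨F, hF, h⟩
    refine ⟨c • F, (Dom p m).smul_mem c hF, (Lp.coeFn_smul c φ).trans ?_⟩
    filter_upwards [h] with μ h1
    simp [h1]

lemma entireLp_dense : (entireLp p m).topologicalClosure = ⊤ := by
  rw [Submodule.topologicalClosure_eq_top_iff, Submodule.eq_bot_iff]
  intro φ hφ
  have hG := fun w : Fin m → ℝ => IsDom.memLp p (isDom_gaussWave p w)
  have hreal : (fun μ : Fin m → ℝ => (Real.exp (-∑ ν, μ ν ^ 2) : ℂ)) =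
      fun μ => gaussWave 0 (cvec μ) := by
    funext μ
    rw [gaussWave_cvec]
    simp [wave]
  have hint : Integrable fun μ : Fin m → ℝ => (Real.exp (-∑ ν, μ ν ^ 2) : ℂ) * φ μ := by
    have h0 := hG 0
    rw [← hreal] at h0
    exact h0.integrable_mul (Lp.memLp φ)
  -- Orthogonality to the Gaussian with frequency -w is the vanishing of the transform at w; the
  -- Gaussian factor never vanishes and can be divided out afterwards.
  have hz := ae_eq_zero_of_integral_wave hint fun w => by
    have h1 := (Submodule.mem_orthogonal _ _).mp hφ ((hG (-w)).toLp _)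
      ⟨_, isDom_gaussWave p (-w), (hG (-w)).coeFn_toLp⟩
    rw [L2.inner_def] at h1
    rw [← h1]
    refine integral_congr_ae ?_
    filter_upwards [(hG (-w)).coeFn_toLp] with μ hμ
    rw [hμ, gaussWave_cvec, RCLike.inner_apply, map_mul, conj_wave, Complex.conj_ofReal, neg_neg]
    ring
  refine (Lp.eq_zero_iff_ae_eq_zero).mpr ?_
  filter_upwards [hz] with μ hμ
  simpa [Real.exp_ne_zero, -Complex.ofReal_exp] using hμ

lemma exists_isDom_near {g : (Fin m → ℝ) → ℂ} (hg : MemLp g 2) {ε : ℝ≥0∞} (hε : 0 < ε) :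
    ∃ F : (Fin m → ℂ) → ℂ, IsDom p (fun z _ => F z) ∧
      eLpNorm (fun μ => F (cvec μ) - g μ) 2 < ε := by
  have h : hg.toLp g ∈ closure (entireLp p m : Set (Lp ℂ 2 (volume : Measure (Fin m → ℝ)))) := by
    rw [← Submodule.topologicalClosure_coe, entireLp_dense]
    trivial
  obtain ⟨φ, ⟨F, hF, hφ⟩, hd⟩ := EMetric.mem_closure_iff.mp h ε hε
  refine ⟨F, hF, ?_⟩
  rw [edist_comm, Lp.edist_def] at hd
  refine (eLpNorm_congr_ae ?_).trans_lt hd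
  filter_upwards [hφ, hg.coeFn_toLp] with μ h1 h2
  simp [h1, h2]

lemma evenDom_dense (m : ℕ) : EvenDomDense p m := by
  intro g hg hg0 ε hε
  choose F hF hFg using fun s => exists_isDom_near p (hg s) hε
  classical
  -- Approximate each component separately and put zero on the components with an odd label, where
  -- the target vanishes as well.
  refine ⟨⟨fun z s => if ∃ ν, ¬ Even (s ν) then 0 else F s z, fun s => ?_⟩, ?_, fun s => ?_⟩
  · by_cases hs : ∃ ν, ¬ Even (s ν)
    · have := IsDom.zero p m s
      simpa only [weighted, if_pos hs, Pi.zero_apply] using this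
    · have := hF s s
      simpa only [weighted, if_neg hs] using this
  · intro z s hs
    exact if_pos hs
  · by_cases hs : ∃ ν, ¬ Even (s ν)
    · simpa [if_pos hs, hg0 _ s hs] using hε
    · simpa only [if_neg hs] using! hFg s

end Density

/-! ### The `*`-representations -/

section Final

variable (p : Level) {m : ℕ} (lam : Fin m → ℂ)

/-- The representation of the graph algebra. -/
def graphRep : GraphAlg p m →ₐ[ℂ] Module.End ℂ (Dom p m) :=
  (extRep p lam).comp (GraphAlg.toExt p m)

lemma graphRep_M (σ : Sector) (ν : Fin m) (d : ℕ) (i j) :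
    graphRep p lam (GraphAlg.M p m σ ν d i j) = dressedOp p σ lam ν d i j := by
  rw [← extRep_M, ← toExt_M]
  rfl

lemma isGraphStarRep_graphRep :
    IsGraphStarRep p (fun σ ν d => dressedOp p σ lam ν d) (graphRep p lam) := by
  obtain ⟨s, h1, h2, h3⟩ := GraphAlg.exists_star p m
  exact ⟨graphRep_M p lam, fun a => extRep_leavesEvenInvariant p lam _, s, h1, h2,
    h3 (graphRep p lam) (fun σ => dressedOp p σ lam) (adj_starRel p m) (graphRep_M p lam)
      fun σ => dressedOp_adjoint p σ lam⟩

lemma isExtStarRep_extRep : IsExtStarRep p lam (graphRep p lam) (extRep p lam) := by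
  obtain ⟨s, h1, h2, h3, h4⟩ := ExtAlg.exists_star p m
  refine ⟨rfl, extRep_g p lam, extRep_leavesEvenInvariant p lam, s, h1, h2, h3,
    h4 (extRep p lam) (fun σ => dressedOp p σ lam) (adj_starRel p m) (extRep_M p lam)
      (fun σ => dressedOp_adjoint p σ lam) fun σ x => ?_⟩
  rw [extRep_g, extRep_g]
  exact (adj_starRel p m).u (tensorOps_adjoint p σ lam m le_rfl) x

/-- Nothing precedes the first site, so its dressing is the counit of R', the identity. -/
lemma dressedOp_first {m : ℕ} (lam : Fin m → ℂ) (σ : Sector) (ν : Fin m) (hν : ν.val = 0) (d : ℕ) :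
    dressedOp p σ lam ν d = loopOp p σ lam ν d := by
  rw [dressedOp_eq, hν, tensorOps_zero, dressedMat_counit, loopOp_eq]

end Final

end QLorentz

end

theorem mainTheorem6 (p : QLorentz.Level) :
    (∀ lam : ℂ, lam ≠ 0 →
      ∃ D : QLorentz.GraphAlg p 1 →ₐ[ℂ] Module.End ℂ (QLorentz.Dom p 1),
        QLorentz.IsGraphStarRep p (fun σ ν d => QLorentz.loopOp p σ (fun _ => lam) ν d) D) ∧
    (∀ (m : ℕ) (lam : Fin m → ℂ), 1 ≤ m → (∀ ν, lam ν ≠ 0) →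
      QLorentz.EvenDomDense p m ∧
      ∃ D₀ : QLorentz.GraphAlg p m →ₐ[ℂ] Module.End ℂ (QLorentz.Dom p m),
        QLorentz.IsGraphStarRep p (fun σ ν d => QLorentz.dressedOp p σ lam ν d) D₀ ∧
        ∃ D : QLorentz.ExtAlg p m →ₐ[ℂ] Module.End ℂ (QLorentz.Dom p m),
          QLorentz.IsExtStarRep p lam D₀ D ∧
          QLorentz.GaugeInvariantImpliesFlat p D) := by
  refine ⟨fun lam _ => ⟨QLorentz.graphRep p fun _ => lam, ?_⟩, fun m lam _ _ =>
    ⟨QLorentz.evenDom_dense p m, QLorentz.graphRep p lam, QLorentz.isGraphStarRep_graphRep p lam,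
      QLorentz.extRep p lam, QLorentz.isExtStarRep_extRep p lam, QLorentz.extRep_flat p lam⟩⟩
  have h := QLorentz.isGraphStarRep_graphRep p fun _ : Fin 1 => lam
  refine ⟨fun σ ν d i j => ?_, h.2⟩
  exact (h.1 σ ν d i j).trans
    (congrFun (congrFun (QLorentz.dressedOp_first p _ σ ν (by simp) d) i) j)
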